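/- Conventions. A \emph{multitensor} (lax monoidal structure) on a category $V$ consists of functors $E_n:V^n\to V$ ($n\ge 0$), written $E(X_1,\dots,X_n)$, a unit $u_X:X\to E_1X$ and substitutions $\sigma:E_k\bigl(E_{n_1}(X_{11},\dots),\dots,E_{n_k}(X_{k1},\dots)\bigr)\to E_{n_1+\dots+n_k}(X_{11},\dots,X_{kn_k})$, all natural, satisfying the unit and associativity axioms of a lax algebra for the free monoidal category monad. Then $E_1$ is a monad on $V$. $E$ is \emph{distributive} if each $E_n$ preserves (small) coproducts in each variable, and is a \emph{functor operad} if $u$ is invertible. $\mathcal GV$ is the category of graphs enriched in $V$, and $E\text{-}\mathrm{Cat}$ is the category of \emph{$E$-categories}: $V$-graphs $X$ with compositions $E_n(X(x_0,x_1),\dots,X(x_{n-1},x_n))\to X(x_0,x_n)$ compatible with $u$ and $\sigma$. $\Gamma E$ is the monad on $\mathcal GV$ that is the identity on objects, with $(\Gamma E)X(a,b)=\coprod_{a=x_0,\dots,x_n=b}E_n(X(x_0,x_1),\dots,X(x_{n-1},x_n))$ and with unit and multiplication induced by $u$ and $\sigma$. A \emph{lift} of $E$ is a distributive functor operad $E'$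 on the category $V^{E_1}$ of $E_1$-algebras with $E'\text{-}\mathrm{Cat}\cong E\text{-}\mathrm{Cat}$ over $\mathcal GV$. Let $\mathcal T_{\le2}$ be the free strict 2-category monad on the category $\mathcal G^2(\mathrm{Set})$ of 2-globular sets, and let $\mathcal T_{\le 2}^\times$ be the multitensor $(X_1,\dots,X_n)\mapsto\prod_i\mathcal T_{\le2}X_i$. Let $E$ be the following multitensor on $\mathcal G^2(\mathrm{Set})$. The objects of $E(X_1,\dots,X_n)$ are tuples $(x_1,\dots,x_n)$ of objects of the $X_i$; its 1-cells are the paths in the graph whose edges consist of a 1-cell of one $X_i$ and an object of each of the other $X_j$ (shuffles of paths in the $X_i$); its 2-cells $w\Rightarrow w'$, for $w,w'$ with the same source and target, are the tuples of 2-cells of the free 2-categories $\mathcal T_{\le2}X_i$ from the $i$-th projection of $w$ to the $i$-th projection of $w'$. The unit is given by the inclusions of generators, and the substitution by concatenating the nested shuffles on 1-cells and by composing in the free 2-categories on 2-cells. (This is the multitensor $E=\overline A$ corresponding to Batanin's $\mathcal T_{\le3}$-operad $A$ for Gray categories.) The \emph{Gray tensor product} $A\otimes B$ of 2-categories (in its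 invertible, ``pseudo'' version) is the tensor product representing cubical functors of two variables: families of 2-functors $F(-,b):A\to C$ and $F(a,-):B\to C$ which agree on objects, together with invertible 2-cells $\gamma_{f,g}:F(a',g)\,F(f,b)\Rightarrow F(f,b')\,F(a,g)$, for $f:a\to a'$ and $g:b\to b'$, functorial in $f$ and in $g$ and natural with respect to 2-cells in each variable. Its unit object is the terminal 2-category, its associativity isomorphism is $(a\otimes b)\otimes c\mapsto a\otimes(b\otimes c)$, and its unit isomorphisms are $a\otimes *\mapsto a$, $*\otimes a\mapsto a$. The monoidal structure is regarded as a multitensor on the category $2\text{-}\mathrm{Cat}$ of strict 2-categories and strict 2-functors, so \emph{Gray categories} are its enriched categories. Theorem. (1) There is a cartesian morphism of multitensors $E\to\mathcal T_{\le2}^\times$ (so $E$ corresponds to a $\mathcal T_{\le3}$-operad). (2) $\mathcal G^2(\mathrm{Set})^{E_1}$ is isomorphic to $2\text{-}\mathrm{Cat}$ over $\mathcal G^2(\mathrm{Set})$, by an isomorphism $K$, such that (3)--(5) hold. (3) The Gray tensor product exists. There is a monad $A$ on $\mathcal G(\mathcal G^2(\mathrm{Set}))=\mathcal G^3(\mathrm{Set})$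 whose category of algebras is isomorphic, over $\mathcal G^3(\mathrm{Set})$, to the category of Gray categories, and every such monad $A$ is $\Gamma E$ (up to isomorphism). (4) $E$ has a lift $E'$. (5) Every lift $E'$ of $E$ is, along $K$, isomorphic as a multitensor (compatibly with units and substitutions) to the Gray tensor product of 2-categories. -/

import Mathlib

universe w v u v' u'

namespace GrayLift

open CategoryTheory CategoryTheory.Limits

section FreeMonoid

variable {V : Type u} [Category.{v} V] {W : Type u'} [Category.{v'} W]

/-- Morphisms in the free (strict) monoidal category `MV` on `V`, whose objects are the finite
sequences of objects of `V`: componentwise morphisms between sequences of the same length. -/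
def MHom : List V → List V → Type v
  | [], [] => PUnit
  | [], _ :: _ => PEmpty
  | _ :: _, [] => PEmpty
  | X :: L, Y :: M => (X ⟶ Y) × MHom L M

def MHom.id : ∀ L : List V, MHom L L
  | [] => PUnit.unit
  | X :: L => (𝟙 X, MHom.id L)

def MHom.comp : ∀ {L M N : List V}, MHom L M → MHom M N → MHom L N
  | [], [], [], _, _ => PUnit.unit
  | [], _ :: _, _, f, _ => PEmpty.elim f
  | _ :: _, [], _, f, _ => PEmpty.elim f
  | _, [], _ :: _, _, g => PEmpty.elim g
  | _, _ :: _, [], _, g => PEmpty.elim g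
  | _ :: _, _ :: _, _ :: _, f, g => (f.1 ≫ g.1, MHom.comp f.2 g.2)

theorem MHom.id_comp : ∀ {L M : List V} (f : MHom L M), MHom.comp (MHom.id L) f = f
  | [], [], _ => rfl
  | [], _ :: _, f => PEmpty.elim f
  | _ :: _, [], f => PEmpty.elim f
  | _ :: _, _ :: _, f => Prod.ext (Category.id_comp f.1) (MHom.id_comp f.2)

theorem MHom.comp_id : ∀ {L M : List V} (f : MHom L M), MHom.comp f (MHom.id M) = f
  | [], [], _ => rfl
  | [], _ :: _, f => PEmpty.elim f
  | _ :: _, [], f => PEmpty.elim f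
  | _ :: _, _ :: _, f => Prod.ext (Category.comp_id f.1) (MHom.comp_id f.2)

theorem MHom.assoc : ∀ {L M N K : List V} (f : MHom L M) (g : MHom M N) (h : MHom N K),
    MHom.comp (MHom.comp f g) h = MHom.comp f (MHom.comp g h)
  | [], [], [], [], _, _, _ => rfl
  | [], _ :: _, _, _, f, _, _ => PEmpty.elim f
  | _ :: _, [], _, _, f, _, _ => PEmpty.elim f
  | _, [], _ :: _, _, _, g, _ => PEmpty.elim g
  | _, _ :: _, [], _, _, g, _ => PEmpty.elim g
  | _, _, [], _ :: _, _, _, h => PEmpty.elim h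
  | _, _, _ :: _, [], _, _, h => PEmpty.elim h
  | _ :: _, _ :: _, _ :: _, _ :: _, f, g, h =>
    Prod.ext (Category.assoc f.1 g.1 h.1) (MHom.assoc f.2 g.2 h.2)

/-- The category `MV`. -/
instance listCategory : Category.{v} (List V) where
  Hom := MHom
  id := MHom.id
  comp := MHom.comp
  id_comp := MHom.id_comp
  comp_id := MHom.comp_id
  assoc := MHom.assoc

/-- Prefix a morphism of sequences by a morphism of `V`. -/
def consHom {X Y : V} {L M : List V} (f : X ⟶ Y) (g : L ⟶ M) : (X :: L) ⟶ (Y :: M) := (f, g)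

theorem consHom_comp {X Y Z : V} {L M N : List V} (f : X ⟶ Y) (f' : Y ⟶ Z) (g : L ⟶ M)
    (g' : M ⟶ N) : consHom (f ≫ f') (g ≫ g') = consHom f g ≫ consHom f' g' := rfl

/-- Action of a functor on morphisms of sequences. -/
def mapMHom (F : V ⥤ W) : ∀ {L M : List V}, (L ⟶ M) → (L.map F.obj ⟶ M.map F.obj)
  | [], [], _ => 𝟙 []
  | [], _ :: _, f => PEmpty.elim f
  | _ :: _, [], f => PEmpty.elim f
  | _ :: _, _ :: _, f => consHom (F.map f.1) (mapMHom F f.2)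

theorem mapMHom_id (F : V ⥤ W) : ∀ L : List V, mapMHom F (𝟙 L) = 𝟙 (L.map F.obj)
  | [] => rfl
  | X :: L => Prod.ext (F.map_id X) (mapMHom_id F L)

theorem mapMHom_comp (F : V ⥤ W) : ∀ {L M N : List V} (f : L ⟶ M) (g : M ⟶ N),
    mapMHom F (f ≫ g) = mapMHom F f ≫ mapMHom F g
  | [], [], [], _, _ => rfl
  | [], _ :: _, _, f, _ => PEmpty.elim f
  | _ :: _, [], _, f, _ => PEmpty.elim f
  | _, [], _ :: _, _, g => PEmpty.elim g
  | _, _ :: _, [], _, g => PEmpty.elim g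
  | _ :: _, _ :: _, _ :: _, f, g => Prod.ext (F.map_comp f.1 g.1) (mapMHom_comp F f.2 g.2)

/-- `M` on functors. -/
def mapM (F : V ⥤ W) : List V ⥤ List W where
  obj L := L.map F.obj
  map f := mapMHom F f
  map_id := mapMHom_id F
  map_comp := mapMHom_comp F

/-- Concatenation of morphisms of sequences. -/
def appendHom : ∀ {L M L' M' : List V}, (L ⟶ M) → (L' ⟶ M') → ((L ++ L') ⟶ (M ++ M'))
  | [], [], _, _, _, g => g
  | [], _ :: _, _, _, f, _ => PEmpty.elim f
  | _ :: _, [], _, _, f, _ => PEmpty.elim f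
  | _ :: _, _ :: _, _, _, f, g => consHom f.1 (appendHom f.2 g)

/-- Concatenation `con : MMV ⟶ MV` on morphisms. -/
def flattenHom : ∀ {L M : List (List V)}, (L ⟶ M) → (L.flatten ⟶ M.flatten)
  | [], [], _ => 𝟙 []
  | [], _ :: _, f => PEmpty.elim f
  | _ :: _, [], f => PEmpty.elim f
  | _ :: _, _ :: _, f => appendHom f.1 (flattenHom f.2)

/-- Insertion of a variable object between two fixed sequences. -/
def insertHom : ∀ (L₁ : List V) {X Y : V} (_ : X ⟶ Y) (L₂ : List V),
    (L₁ ++ X :: L₂) ⟶ (L₁ ++ Y :: L₂)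
  | [], _, _, f, L₂ => consHom f (𝟙 L₂)
  | Z :: L₁, _, _, f, L₂ => consHom (𝟙 Z) (insertHom L₁ f L₂)

def insertAt (L₁ L₂ : List V) : V ⥤ List V where
  obj X := L₁ ++ X :: L₂
  map f := insertHom L₁ f L₂
  map_id X := by
    induction L₁ with
    | nil => rfl
    | cons Z L₁ ih => exact Prod.ext rfl ih
  map_comp f g := by
    induction L₁ with
    | nil => exact Prod.ext rfl (Category.comp_id (𝟙 L₂)).symm
    | cons Z L₁ ih => exact Prod.ext (Category.comp_id (𝟙 Z)).symm ih

end FreeMonoid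

/-- The components `X_i ⟶ E_1 X_i`, assembled. -/
def unitHom {V : Type u} [Category.{v} V] (E : List V ⥤ V) (η : ∀ X : V, X ⟶ E.obj [X]) :
    ∀ L : List V, L ⟶ (L.map fun X => [X]).map E.obj
  | [] => 𝟙 []
  | X :: L => consHom (η X) (unitHom E η L)

/-- The components `E_j E_k X_ijk ⟶ E_jk X_ijk` for all `i`, assembled. -/
def substHom {V : Type u} [Category.{v} V] (E : List V ⥤ V)
    (σ : ∀ (LL : List (List V)) (L : List V), LL.flatten = L →
      (E.obj (LL.map E.obj) ⟶ E.obj L)) :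
    ∀ LLL : List (List (List V)),
      (LLL.map (List.map E.obj)).map E.obj ⟶ (LLL.map List.flatten).map E.obj
  | [] => 𝟙 []
  | LL :: LLL => consHom (σ LL LL.flatten rfl) (substHom E σ LLL)

/-- A multitensor (lax monoidal structure) on `V`: a lax algebra structure for the monad `M`. -/
structure Multitensor (V : Type u) [Category.{v} V] where
  /-- the tensor products `E_n : V^n ⟶ V`, assembled into `E : MV ⟶ V` -/
  E : List V ⥤ V
  /-- the unit -/
  η : ∀ X : V, X ⟶ E.obj [X]
  /-- the substitution `E_i E_j X_ij ⟶ E_i X_i`, for `con (X_ij) = (X_i)` -/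
  σ : ∀ (LL : List (List V)) (L : List V), LL.flatten = L → (E.obj (LL.map E.obj) ⟶ E.obj L)
  η_natural : ∀ {X Y : V} (f : X ⟶ Y), η X ≫ E.map (consHom f (𝟙 [])) = f ≫ η Y
  σ_natural : ∀ {LL MM : List (List V)} (f : LL ⟶ MM),
    E.map ((mapM E).map f) ≫ σ MM MM.flatten rfl = σ LL LL.flatten rfl ≫ E.map (flattenHom f)
  unit_left : ∀ (L : List V) (h : [L].flatten = L), η (E.obj L) ≫ σ [L] L h = 𝟙 _
  unit_right : ∀ (L : List V) (h : (L.map fun X => [X]).flatten = L),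
    E.map (unitHom E η L) ≫ σ (L.map fun X => [X]) L h = 𝟙 _
  assoc : ∀ (LLL : List (List (List V))) (L : List V)
    (h₁ : (LLL.map List.flatten).flatten = L) (h₂ : LLL.flatten.flatten = L)
    (h₃ : (LLL.map (List.map E.obj)).flatten = LLL.flatten.map E.obj),
    E.map (substHom E σ LLL) ≫ σ (LLL.map List.flatten) L h₁ =
      σ (LLL.map (List.map E.obj)) (LLL.flatten.map E.obj) h₃ ≫ σ LLL.flatten L h₂

/-! ### Multitensors from adjunctions with a monoidal category -/

/-! The tensor power functors `T` and the structure maps of the multitensor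
`E (X_1, …, X_n) = Ψ (d X_1 ⊗ ⋯ ⊗ d X_n)`. -/

namespace OfAdjunction

open MonoidalCategory

variable {V : Type u} [Category.{v} V] {D : Type u'} [Category.{v'} D] [MonoidalCategory D]
  (d : V ⥤ D)

/-- The tensor product `d X_1 ⊗ (d X_2 ⊗ (⋯ ⊗ 𝟙))`. -/
def T : List V → D
  | [] => 𝟙_ D
  | X :: L => d.obj X ⊗ T L

def TMap : ∀ {L M : List V}, (L ⟶ M) → (T d L ⟶ T d M)
  | [], [], _ => 𝟙 _
  | [], _ :: _, f => PEmpty.elim f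
  | _ :: _, [], f => PEmpty.elim f
  | _ :: _, _ :: _, f => d.map f.1 ⊗ₘ TMap f.2

theorem TMap_id : ∀ L : List V, TMap d (𝟙 L) = 𝟙 (T d L)
  | [] => rfl
  | X :: L => by
    change d.map (𝟙 X) ⊗ₘ TMap d (𝟙 L) = 𝟙 (d.obj X ⊗ T d L)
    rw [TMap_id L, d.map_id, id_tensorHom_id]

theorem TMap_comp : ∀ {L M N : List V} (f : L ⟶ M) (g : M ⟶ N),
    TMap d (f ≫ g) = TMap d f ≫ TMap d g
  | [], [], [], _, _ => (Category.id_comp _).symm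
  | [], _ :: _, _, f, _ => PEmpty.elim f
  | _ :: _, [], _, f, _ => PEmpty.elim f
  | _, [], _ :: _, _, g => PEmpty.elim g
  | _, _ :: _, [], _, g => PEmpty.elim g
  | _ :: _, _ :: _, _ :: _, f, g => by
    change d.map (f.1 ≫ g.1) ⊗ₘ TMap d (f.2 ≫ g.2) =
      (d.map f.1 ⊗ₘ TMap d f.2) ≫ (d.map g.1 ⊗ₘ TMap d g.2)
    rw [TMap_comp f.2 g.2, d.map_comp, tensorHom_comp_tensorHom]

/-- The canonical map `T L ⊗ T M ⟶ T (L ++ M)`. -/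
def mu : ∀ L M : List V, T d L ⊗ T d M ⟶ T d (L ++ M)
  | [], M => (λ_ (T d M)).hom
  | X :: L, M => (α_ (d.obj X) (T d L) (T d M)).hom ≫ (d.obj X ◁ mu L M)

/-- Transport along an equality of sequences. -/
def tc {L M : List V} (h : L = M) : T d L ⟶ T d M := eqToHom (congrArg (T d) h)

theorem tc_rfl (L : List V) (h : L = L) : tc d h = 𝟙 _ := rfl

theorem tc_tc {L M N : List V} (h : L = M) (h' : M = N) : tc d h ≫ tc d h' = tc d (h.trans h') :=
  eqToHom_trans _ _

theorem tc_cons (X : V) {L M : List V} (h : L = M) :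
    d.obj X ◁ tc d h = tc d (congrArg (List.cons X) h) := by
  subst h
  exact whiskerLeft_id _ _

theorem mu_tc {L L' M M' : List V} (h : L = L') (h' : M = M') :
    (tc d h ⊗ₘ tc d h') ≫ mu d L' M' = mu d L M ≫ tc d (by rw [h, h']) := by
  subst h h'
  rw [tc_rfl, tc_rfl, tc_rfl, id_tensorHom_id, Category.id_comp, Category.comp_id]

theorem mu_natural : ∀ {L L' M M' : List V} (f : L ⟶ L') (g : M ⟶ M'),
    (TMap d f ⊗ₘ TMap d g) ≫ mu d L' M' = mu d L M ≫ TMap d (appendHom f g)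
  | [], [], M, M', f, g => by
    change (𝟙 (𝟙_ D) ⊗ₘ TMap d g) ≫ (λ_ _).hom = (λ_ _).hom ≫ TMap d g
    rw [id_tensorHom, leftUnitor_naturality]
  | [], _ :: _, _, _, f, _ => PEmpty.elim f
  | _ :: _, [], _, _, f, _ => PEmpty.elim f
  | X :: L, Y :: L', M, M', f, g => by
    change ((d.map f.1 ⊗ₘ TMap d f.2) ⊗ₘ TMap d g) ≫ (α_ _ _ _).hom ≫ (d.obj Y ◁ mu d L' M') =
      ((α_ _ _ _).hom ≫ (d.obj X ◁ mu d L M)) ≫ (d.map f.1 ⊗ₘ TMap d (appendHom f.2 g))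
    rw [associator_naturality_assoc, Category.assoc, ← id_tensorHom, ← id_tensorHom,
      tensorHom_comp_tensorHom, tensorHom_comp_tensorHom, mu_natural f.2 g, Category.comp_id,
      Category.id_comp]

theorem mu_nil : ∀ L : List V, mu d L [] ≫ tc d (List.append_nil L) = (ρ_ (T d L)).hom
  | [] => by
    change (λ_ (𝟙_ D)).hom ≫ 𝟙 _ = (ρ_ (𝟙_ D)).hom
    rw [Category.comp_id, unitors_equal]
  | X :: L => by
    refine (congrArg (mu d (X :: L) [] ≫ ·) (tc_cons d X (List.append_nil L)).symm).trans ?_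
    change ((α_ _ _ _).hom ≫ (d.obj X ◁ mu d L [])) ≫ (d.obj X ◁ tc d (List.append_nil L)) =
      (ρ_ (d.obj X ⊗ T d L)).hom
    rw [Category.assoc, ← whiskerLeft_comp, mu_nil L,
      rightUnitor_tensor_hom]
    rfl

theorem mu_assoc : ∀ L M N : List V,
    (mu d L M ▷ T d N) ≫ mu d (L ++ M) N ≫ tc d (List.append_assoc L M N) =
      (α_ _ _ _).hom ≫ (T d L ◁ mu d M N) ≫ mu d L (M ++ N)
  | [], M, N => by
    change ((λ_ (T d M)).hom ▷ T d N) ≫ mu d M N ≫ 𝟙 _ =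
      (α_ _ _ _).hom ≫ (𝟙_ D ◁ mu d M N) ≫ (λ_ _).hom
    rw [Category.comp_id, leftUnitor_naturality, leftUnitor_tensor_hom_assoc,
      Iso.hom_inv_id_assoc]
  | X :: L, M, N => by
    refine (congrArg (fun k => (mu d (X :: L) M ▷ T d N) ≫ mu d (X :: L ++ M) N ≫ k)
      (tc_cons d X (List.append_assoc L M N)).symm).trans ?_
    change (((α_ _ _ _).hom ≫ (d.obj X ◁ mu d L M)) ▷ T d N) ≫
      ((α_ _ _ _).hom ≫ (d.obj X ◁ mu d (L ++ M) N)) ≫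
        (d.obj X ◁ tc d (List.append_assoc L M N)) =
      (α_ _ _ _).hom ≫ ((d.obj X ⊗ T d L) ◁ mu d M N) ≫ (α_ _ _ _).hom ≫
        (d.obj X ◁ mu d L (M ++ N))
    rw [comp_whiskerRight]
    simp only [Category.assoc]
    rw [associator_naturality_middle_assoc, ← whiskerLeft_comp, ← whiskerLeft_comp, mu_assoc L M N]
    simp

variable {d} {Ψ : D ⥤ V} (adj : d ⊣ Ψ)

/-- The tensor product `Ψ (d X_1 ⊗ ⋯ ⊗ d X_n)`. -/
def E (_ : d ⊣ Ψ) : List V ⥤ V where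
  obj L := Ψ.obj (T d L)
  map f := Ψ.map (TMap d f)
  map_id L := by rw [TMap_id, Ψ.map_id]
  map_comp f g := by rw [TMap_comp, Ψ.map_comp]

/-- The counit `d Ψ (d X_1 ⊗ ⋯) ⟶ d X_1 ⊗ ⋯`. -/
def eps (L : List V) : d.obj ((E adj).obj L) ⟶ T d L := adj.counit.app (T d L)

theorem map_eps {L M : List V} (f : T d L ⟶ T d M) :
    d.map (X := (E adj).obj L) (Y := (E adj).obj M) (Ψ.map f) ≫ eps adj M = eps adj L ≫ f :=
  adj.counit_naturality f

/-- The canonical map `d Ψ (d X_11 ⊗ ⋯) ⊗ ⋯ ⊗ d Ψ (d X_n1 ⊗ ⋯) ⟶ d X_11 ⊗ ⋯`. -/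
def flat : ∀ LL : List (List V), T d (LL.map (E adj).obj) ⟶ T d LL.flatten
  | [] => 𝟙 _
  | L :: LL => (eps adj L ⊗ₘ flat LL) ≫ mu d L LL.flatten

theorem flat_natural : ∀ {LL MM : List (List V)} (f : LL ⟶ MM),
    TMap d (mapMHom (E adj) f) ≫ flat adj MM = flat adj LL ≫ TMap d (flattenHom f)
  | [], [], _ => rfl
  | [], _ :: _, f => PEmpty.elim f
  | _ :: _, [], f => PEmpty.elim f
  | L :: LL, M :: MM, f => by
    obtain ⟨f₁, f₂⟩ := f
    have hc : d.map (Ψ.map (TMap d f₁)) ≫ eps adj M =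
        eps adj L ≫ TMap d f₁ := adj.counit_naturality (TMap d f₁)
    change (d.map (Ψ.map (TMap d f₁)) ⊗ₘ TMap d (mapMHom (E adj) f₂)) ≫
      (eps adj M ⊗ₘ flat adj MM) ≫ mu d M MM.flatten =
      ((eps adj L ⊗ₘ flat adj LL) ≫ mu d L LL.flatten) ≫
        TMap d (appendHom f₁ (flattenHom f₂))
    have ih := flat_natural (LL := LL) (MM := MM) f₂
    refine (tensorHom_comp_tensorHom_assoc _ _ _ _ _).trans ?_
    refine (congrArg₂ (fun a b => (a ⊗ₘ b) ≫ mu d M MM.flatten) hc ih).trans ?_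
    rw [Category.assoc, ← mu_natural]
    exact (tensorHom_comp_tensorHom_assoc _ _ _ _ _).symm

theorem flat_append_aux {A B C C' F G X Y Z W : D} (ε : A ⟶ B) (m : C ⊗ F ⟶ X) (t : X ⟶ Y)
    (φ : Y ⟶ Z) (t' : Z ⟶ W) (f : C ⟶ C') (g : F ⟶ G) (m' : C' ⊗ G ⟶ W)
    (key : m ≫ t ≫ φ ≫ t' = (f ⊗ₘ g) ≫ m') :
    (α_ _ _ _).hom ≫ (A ◁ m) ≫ (A ◁ t) ≫ (ε ⊗ₘ φ) ≫ (B ◁ t') =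
      ((ε ⊗ₘ f) ⊗ₘ g) ≫ (α_ _ _ _).hom ≫ (B ◁ m') := by
  rw [associator_naturality_assoc, ← id_tensorHom, ← id_tensorHom, ← id_tensorHom, ← id_tensorHom]
  simp only [tensorHom_comp_tensorHom, Category.id_comp, Category.comp_id, key]

theorem flat_append : ∀ LL MM : List (List V),
    mu d (LL.map (E adj).obj) (MM.map (E adj).obj) ≫ tc d List.map_append.symm ≫
        flat adj (LL ++ MM) ≫ tc d List.flatten_append =
      (flat adj LL ⊗ₘ flat adj MM) ≫ mu d LL.flatten MM.flatten
  | [], MM => by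
    change (λ_ _).hom ≫ 𝟙 _ ≫ flat adj MM ≫ 𝟙 _ = (𝟙 (𝟙_ D) ⊗ₘ flat adj MM) ≫ (λ_ _).hom
    rw [id_tensorHom, leftUnitor_naturality, Category.id_comp, Category.comp_id]
  | L :: LL, MM => by
    have key := flat_append LL MM
    have e1 : tc d (List.flatten_append (L₁ := L :: LL) (L₂ := MM)) =
        tc d (congrArg (L ++ ·) (List.flatten_append (L₁ := LL) (L₂ := MM))) ≫
          tc d (List.append_assoc L LL.flatten MM.flatten).symm := (tc_tc d _ _).symm
    have e2 : mu d L (LL ++ MM).flatten ≫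
        tc d (congrArg (L ++ ·) (List.flatten_append (L₁ := LL) (L₂ := MM))) =
        (T d L ◁ tc d List.flatten_append) ≫ mu d L (LL.flatten ++ MM.flatten) := by
      rw [← mu_tc d rfl, tc_rfl, id_tensorHom]
    have e3 : (T d L ◁ mu d LL.flatten MM.flatten) ≫ mu d L (LL.flatten ++ MM.flatten) ≫
        tc d (List.append_assoc L LL.flatten MM.flatten).symm =
        (α_ _ _ _).inv ≫ (mu d L LL.flatten ▷ T d MM.flatten) ≫
          mu d (L ++ LL.flatten) MM.flatten := by
      have := mu_assoc d L LL.flatten MM.flatten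
      rw [Iso.eq_inv_comp, ← Category.assoc, ← Category.assoc, Category.assoc (α_ _ _ _).hom,
        ← this, Category.assoc, Category.assoc, tc_tc, tc_rfl, Category.comp_id]
    refine (congrArg₂ (fun a b => mu d ((L :: LL).map (E adj).obj) (MM.map (E adj).obj) ≫ a ≫
      flat adj (L :: LL ++ MM) ≫ b) (tc_cons d ((E adj).obj L)
        (List.map_append (f := (E adj).obj) (l₁ := LL) (l₂ := MM)).symm).symm e1).trans ?_
    change ((α_ _ _ _).hom ≫ (d.obj ((E adj).obj L) ◁ mu d (LL.map (E adj).obj) (MM.map (E adj).obj)))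
      ≫ (d.obj ((E adj).obj L) ◁ tc d List.map_append.symm) ≫
      ((eps adj L ⊗ₘ flat adj (LL ++ MM)) ≫ mu d L (LL ++ MM).flatten) ≫
        tc d (congrArg (L ++ ·) (List.flatten_append (L₁ := LL) (L₂ := MM))) ≫
          tc d (List.append_assoc L LL.flatten MM.flatten).symm =
      (((eps adj L ⊗ₘ flat adj LL) ≫ mu d L LL.flatten) ⊗ₘ flat adj MM) ≫
        mu d (L ++ LL.flatten) MM.flatten
    have h := flat_append_aux (eps adj L) _ _ _ _ _ _ _ key
    have h' := congrArg (· ≫ mu d L (LL.flatten ++ MM.flatten) ≫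
      tc d (List.append_assoc L LL.flatten MM.flatten).symm) h
    simp only [Category.assoc] at h' ⊢
    rw [reassoc_of% e2]
    refine h'.trans ?_
    rw [e3, Iso.hom_inv_id_assoc, ← tensorHom_id, tensorHom_comp_tensorHom_assoc,
      Category.comp_id]

/-- The unit `X ⟶ Ψ (d X) ⟶ Ψ (d X ⊗ 𝟙)`. -/
def eta (X : V) : X ⟶ (E adj).obj [X] := adj.unit.app X ≫ Ψ.map (ρ_ (d.obj X)).inv

theorem eta_eps (X : V) : d.map (eta adj X) ≫ eps adj [X] = (ρ_ (d.obj X)).inv := by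
  have h : d.map (eta adj X) = d.map (adj.unit.app X) ≫ d.map (Ψ.map (ρ_ (d.obj X)).inv) :=
    d.map_comp _ _
  have h' : d.map (Ψ.map (ρ_ (d.obj X)).inv) ≫ eps adj [X] =
    adj.counit.app (d.obj X) ≫ (ρ_ (d.obj X)).inv := adj.counit_naturality _
  refine (congrArg (· ≫ eps adj [X]) h).trans ((Category.assoc _ _ _).trans ?_)
  refine (congrArg (d.map (adj.unit.app X) ≫ ·) h').trans ?_
  exact adj.left_triangle_components_assoc X _

theorem eta_natural {X Y : V} (f : X ⟶ Y) :
    eta adj X ≫ (E adj).map (consHom f (𝟙 [])) = f ≫ eta adj Y := by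
  change (adj.unit.app X ≫ Ψ.map (ρ_ (d.obj X)).inv) ≫ Ψ.map (d.map f ⊗ₘ 𝟙 (𝟙_ D)) =
    f ≫ adj.unit.app Y ≫ Ψ.map (ρ_ (d.obj Y)).inv
  rw [Category.assoc, ← Ψ.map_comp, tensorHom_id, ← rightUnitor_inv_naturality, Ψ.map_comp,
    ← Category.assoc, ← Category.assoc]
  exact congrArg (· ≫ Ψ.map (ρ_ (d.obj Y)).inv) (adj.unit.naturality f).symm

theorem eta_sigma (L : List V) (h : [L].flatten = L) :
    eta adj ((E adj).obj L) ≫ Ψ.map (flat adj [L] ≫ tc d h) = 𝟙 _ := by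
  have h₁ : flat adj [L] ≫ tc d h = (ρ_ (d.obj ((E adj).obj L))).hom ≫ eps adj L := by
    refine (Category.assoc _ _ _).trans ((congrArg ((eps adj L ⊗ₘ 𝟙 (𝟙_ D)) ≫ ·)
      (mu_nil d L)).trans ?_)
    rw [tensorHom_id, rightUnitor_naturality]
  rw [h₁]
  change (adj.unit.app (Ψ.obj (T d L)) ≫ Ψ.map (ρ_ (d.obj (Ψ.obj (T d L)))).inv) ≫
    Ψ.map ((ρ_ (d.obj (Ψ.obj (T d L)))).hom ≫ adj.counit.app (T d L)) = 𝟙 _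
  rw [Category.assoc, ← Ψ.map_comp, Iso.inv_hom_id_assoc, adj.right_triangle_components]
  rfl

theorem T_unit_aux {A B Y Z W : D} (f : A ⟶ B) (ε : B ⟶ A ⊗ 𝟙_ D) (hf : f ≫ ε = (ρ_ A).inv)
    (g : Y ⟶ Z) (φ : Z ⟶ W) (t : W ⟶ Y) (ht : g ≫ φ ≫ t = 𝟙 _) :
    (f ⊗ₘ g) ≫ ((ε ⊗ₘ φ) ≫ (α_ A (𝟙_ D) W).hom ≫ (A ◁ (λ_ W).hom)) ≫ (A ◁ t) = 𝟙 _ := by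
  rw [triangle, Category.assoc, tensorHom_comp_tensorHom_assoc, hf, ← tensorHom_id,
    tensorHom_comp_tensorHom_assoc, ← id_tensorHom, tensorHom_comp_tensorHom]
  simp [ht]

theorem T_unit : ∀ (L : List V) (h : (L.map fun X => [X]).flatten = L),
    TMap d (unitHom (E adj) (eta adj) L) ≫ flat adj (L.map fun X => [X]) ≫ tc d h = 𝟙 _
  | [], _ => by
    change 𝟙 (𝟙_ D) ≫ 𝟙 _ ≫ 𝟙 _ = 𝟙 _
    rw [Category.comp_id, Category.comp_id]
  | X :: L, h => by
    have h₀ : (L.map fun X => [X]).flatten = L := List.tail_eq_of_cons_eq h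
    have ih := T_unit L h₀
    refine (congrArg (fun k => TMap d (unitHom (E adj) (eta adj) (X :: L)) ≫
      flat adj ((X :: L).map fun X => [X]) ≫ k) (tc_cons d X h₀).symm).trans ?_
    exact T_unit_aux _ _ (eta_eps adj X) _ _ _ ih

theorem T_assoc : ∀ (LLL : List (List (List V)))
    (h : (LLL.map List.flatten).flatten = LLL.flatten.flatten)
    (h' : (LLL.map (List.map (E adj).obj)).flatten = LLL.flatten.map (E adj).obj),
    TMap d (substHom (E adj) (fun LL _ h => Ψ.map (flat adj LL ≫ tc d h)) LLL) ≫
        flat adj (LLL.map List.flatten) ≫ tc d h =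
      flat adj (LLL.map (List.map (E adj).obj)) ≫ tc d h' ≫ flat adj LLL.flatten
  | [], _, _ => rfl
  | LL :: LLL, h, h' => by
    have h₀ : (LLL.map List.flatten).flatten = LLL.flatten.flatten := by
      rw [List.flatten_flatten]
    have h₀' : (LLL.map (List.map (E adj).obj)).flatten = LLL.flatten.map (E adj).obj :=
      List.map_flatten.symm
    have ih := T_assoc LLL h₀ h₀'
    have e1 : d.map (Ψ.map (flat adj LL ≫ tc d rfl)) ≫ eps adj LL.flatten =
        eps adj (LL.map (E adj).obj) ≫ flat adj LL := by
      refine (map_eps adj _).trans ?_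
      rw [tc_rfl, Category.comp_id]
    have e2 : tc d h = tc d (congrArg (LL.flatten ++ ·) h₀) ≫ tc d List.flatten_append.symm :=
      (tc_tc d _ _).symm
    have e3 : tc d h' = tc d (congrArg (LL.map (E adj).obj ++ ·) h₀') ≫ tc d List.map_append.symm :=
      (tc_tc d _ _).symm
    have e4 : mu d LL.flatten (LLL.map List.flatten).flatten ≫ tc d (congrArg (LL.flatten ++ ·) h₀)
        = (T d LL.flatten ◁ tc d h₀) ≫ mu d LL.flatten LLL.flatten.flatten := by
      rw [← mu_tc d rfl, tc_rfl, id_tensorHom]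
    have e5 : mu d (LL.map (E adj).obj) (LLL.map (List.map (E adj).obj)).flatten ≫
        tc d (congrArg (LL.map (E adj).obj ++ ·) h₀') =
        (T d (LL.map (E adj).obj) ◁ tc d h₀') ≫ mu d (LL.map (E adj).obj) _ := by
      rw [← mu_tc d rfl, tc_rfl, id_tensorHom]
    have e6 := flat_append adj LL LLL.flatten
    have e7 : (tc d (List.flatten_append (L₁ := LL) (L₂ := LLL.flatten))) ≫
      tc d List.flatten_append.symm = 𝟙 _ := tc_tc d _ _
    have e6' : mu d (LL.map (E adj).obj) (LLL.flatten.map (E adj).obj) ≫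
        tc d List.map_append.symm ≫ flat adj (LL ++ LLL.flatten) =
        (flat adj LL ⊗ₘ flat adj LLL.flatten) ≫ mu d LL.flatten LLL.flatten.flatten ≫
          tc d List.flatten_append.symm := by
      rw [← Category.assoc (flat adj LL ⊗ₘ _), ← e6]
      simp only [Category.assoc, e7, Category.comp_id]
    rw [e2, e3]
    change (d.map (Ψ.map (flat adj LL ≫ tc d rfl)) ⊗ₘ
        TMap d (substHom (E adj) (fun LL _ h => Ψ.map (flat adj LL ≫ tc d h)) LLL)) ≫
        ((eps adj LL.flatten ⊗ₘ flat adj (LLL.map List.flatten)) ≫ mu d LL.flatten _) ≫ _ ≫ _ =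
      ((eps adj (LL.map (E adj).obj) ⊗ₘ flat adj (LLL.map (List.map (E adj).obj))) ≫
        mu d (LL.map (E adj).obj) _) ≫ (_ ≫ _) ≫ flat adj (LL ++ LLL.flatten)
    simp only [Category.assoc]
    rw [reassoc_of% e4, reassoc_of% e5, e6']
    simp only [← id_tensorHom, tensorHom_comp_tensorHom_assoc, Category.id_comp]
    refine (tensorHom_comp_tensorHom_assoc _ _ _ _ _).trans
      ((tensorHom_comp_tensorHom_assoc _ _ _ _ _).trans ?_)
    exact congrArg (· ≫ mu d LL.flatten LLL.flatten.flatten ≫ _)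
      (congrArg₂ (· ⊗ₘ ·) ((Category.comp_id _).trans e1) ((Category.assoc _ _ _).trans ih))

end OfAdjunction

open OfAdjunction MonoidalCategory in
/-- The multitensor with `E (X_1, …, X_n) = Ψ (d X_1 ⊗ ⋯ ⊗ d X_n)` for an adjunction `d ⊣ Ψ`. Its
unit and its substitution are given by the unit and the counit of the adjunction. -/
def Multitensor.ofAdjunction {V : Type u} [Category.{v} V] {D : Type u'} [Category.{v'} D]
    [MonoidalCategory D] {d : V ⥤ D} {Ψ : D ⥤ V} (adj : d ⊣ Ψ) : Multitensor V where
  E := OfAdjunction.E adj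
  η := eta adj
  σ LL _ h := Ψ.map (flat adj LL ≫ tc d h)
  η_natural := eta_natural adj
  σ_natural f := by
    rw [tc_rfl, tc_rfl, Category.comp_id, Category.comp_id]
    refine (Ψ.map_comp _ _).symm.trans ((congrArg Ψ.map (flat_natural adj f)).trans ?_)
    exact Ψ.map_comp _ _
  unit_left L h := eta_sigma adj L h
  unit_right L h :=
    (Ψ.map_comp _ _).symm.trans ((congrArg Ψ.map (T_unit adj L h)).trans (Ψ.map_id _))
  assoc LLL L h₁ h₂ h₃ := by
    subst h₂
    refine (Ψ.map_comp _ _).symm.trans ((congrArg Ψ.map (T_assoc adj LLL h₁ h₃)).trans ?_)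
    rw [tc_rfl, Category.comp_id, ← Category.assoc]
    exact Ψ.map_comp _ _

namespace Multitensor

variable {V : Type u} [Category.{v} V]

/-- The unary part of a multitensor: the monad `(E_1, u, σ)`. -/
def unary (F : Multitensor V) : Monad V where
  obj X := F.E.obj [X]
  map f := F.E.map (consHom f (𝟙 []))
  map_id X := F.E.map_id [X]
  map_comp f g := by
    rw [← F.E.map_comp, ← consHom_comp, Category.comp_id]
  η := { app := F.η, naturality := fun _ _ f => (F.η_natural f).symm }
  μ :=
    { app := fun X => F.σ [[X]] [X] rfl
      naturality := fun X Y f =>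
        F.σ_natural (LL := [[X]]) (MM := [[Y]]) (consHom (consHom f (𝟙 [])) (𝟙 [])) }
  assoc X := F.assoc [[[X]]] [X] rfl rfl rfl
  left_unit X := F.unit_left [X] rfl
  right_unit X := F.unit_right [X] rfl

/-- A multitensor is a functor operad when its unary part is (isomorphic, via the unit, to) the
identity monad. -/
def IsFunctorOperad (F : Multitensor V) : Prop := ∀ X : V, IsIso (F.η X)

/-- A multitensor is distributive when every `E_n` preserves (small) coproducts in each variable. -/
def IsDistributive (F : Multitensor V) : Prop :=
  ∀ (L₁ L₂ : List V) (J : Type w),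
    Nonempty (PreservesColimitsOfShape (Discrete J) (insertAt L₁ L₂ ⋙ F.E))

end Multitensor

/-- Assemble a family of morphisms `F (K X_1, …, K X_n) ⟶ K (E (X_1, …, X_n))`. -/
def alongHom {V : Type u} [Category.{v} V] {W : Type u'} [Category.{v'} W] (K : V ⥤ W)
    (E : List V ⥤ V) (F : List W ⥤ W)
    (θ : ∀ L : List V, F.obj (L.map K.obj) ⟶ K.obj (E.obj L)) :
    ∀ LL : List (List V),
      (LL.map (List.map K.obj)).map F.obj ⟶ (LL.map E.obj).map K.obj
  | [] => 𝟙 []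
  | L :: LL => consHom (θ L) (alongHom K E F θ LL)

/-- An isomorphism of multitensors lying over a functor `K : V ⥤ W`: natural isomorphisms
`F (K X_1, …, K X_n) ≅ K (E (X_1, …, X_n))` compatible with units and substitutions. When `K` is
an isomorphism of categories, it identifies `E` with `F` transported along `K`. -/
structure MultitensorIsoOver {V : Type u} [Category.{v} V] {W : Type u'} [Category.{v'} W]
    (K : V ⥤ W) (E : Multitensor V) (F : Multitensor W) where
  θ : ∀ L : List V, F.E.obj (L.map K.obj) ≅ K.obj (E.E.obj L)
  natural : ∀ {L M : List V} (f : L ⟶ M),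
    F.E.map ((mapM K).map f) ≫ (θ M).hom = (θ L).hom ≫ K.map (E.E.map f)
  unit : ∀ X : V, F.η (K.obj X) ≫ (θ [X]).hom = K.map (E.η X)
  subst : ∀ (LL : List (List V)) (L : List V) (h : LL.flatten = L)
    (h' : (LL.map (List.map K.obj)).flatten = L.map K.obj),
    F.σ (LL.map (List.map K.obj)) (L.map K.obj) h' ≫ (θ L).hom =
      F.E.map (alongHom K E.E F.E (fun L => (θ L).hom) LL) ≫ (θ (LL.map E.E.obj)).hom ≫
        K.map (E.σ LL L h)

/-- An isomorphism between two categories over a third one. -/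
structure IsoOver {A : Type*} [Category A] {B : Type*} [Category B] {C : Type*} [Category C]
    (U : A ⥤ C) (U' : B ⥤ C) where
  functor : A ⥤ B
  inverse : B ⥤ A
  functor_inverse : functor ⋙ inverse = 𝟭 A
  inverse_functor : inverse ⋙ functor = 𝟭 B
  comp_forget : functor ⋙ U' = U

/-! ### Enriched graphs and enriched categories -/

/-- A graph enriched in `V`. -/
structure EGraph (V : Type u) where
  obj : Type w
  hom : obj → obj → V

/-- A morphism of `V`-graphs. -/
@[ext] structure EGraph.Hom {V : Type u} [Category.{v} V] (X Y : EGraph.{w} V) where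
  obj : X.obj → Y.obj
  hom : ∀ a b, X.hom a b ⟶ Y.hom (obj a) (obj b)

/-- The category `𝒢V` of `V`-graphs. -/
instance EGraph.category {V : Type u} [Category.{v} V] : Category.{max w v} (EGraph.{w} V) where
  Hom := EGraph.Hom
  id X := ⟨id, fun _ _ => 𝟙 _⟩
  comp f g := ⟨fun a => g.obj (f.obj a), fun a b => f.hom a b ≫ g.hom _ _⟩
  id_comp f := EGraph.Hom.ext rfl (heq_of_eq (funext fun _ => funext fun _ => Category.id_comp _))
  comp_id f := EGraph.Hom.ext rfl (heq_of_eq (funext fun _ => funext fun _ => Category.comp_id _))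
  assoc f g h :=
    EGraph.Hom.ext rfl (heq_of_eq (funext fun _ => funext fun _ => Category.assoc _ _ _))

/-- `𝒢` on functors. -/
def EGraph.mapFunctor {V : Type u} [Category.{v} V] {W : Type u'} [Category.{v'} W] (K : V ⥤ W) :
    EGraph.{w} V ⥤ EGraph.{w} W where
  obj X := ⟨X.obj, fun a b => K.obj (X.hom a b)⟩
  map f := ⟨f.obj, fun a b => K.map (f.hom a b)⟩
  map_id X := EGraph.Hom.ext rfl (heq_of_eq (funext fun _ => funext fun _ => K.map_id _))
  map_comp f g := EGraph.Hom.ext rfl (heq_of_eq (funext fun _ => funext fun _ => K.map_comp _ _))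

/-- Sequences `(x_0, …, x_n)` of elements of `S` (`n ≥ 0`) with given first and last element. -/
inductive Chain (S : Type w) : S → S → Type w
  | nil (a : S) : Chain S a a
  | cons (a : S) {b c : S} (p : Chain S b c) : Chain S a c

/-- Composable sequences of sequences. -/
inductive Chain₂ (S : Type w) : S → S → Type w
  | nil (a : S) : Chain₂ S a a
  | cons {a b c : S} (p : Chain S a b) (P : Chain₂ S b c) : Chain₂ S a c

namespace Chain

variable {S : Type w} {T : Type w}

/-- The sequence `(a, b)`. -/
def single (a b : S) : Chain S a b := cons a (nil b)

def append : ∀ {a b c : S}, Chain S a b → Chain S b c → Chain S a c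
  | _, _, _, nil _, q => q
  | _, _, _, cons a p, q => cons a (append p q)

def map (f : S → T) : ∀ {a b : S}, Chain S a b → Chain T (f a) (f b)
  | _, _, nil a => nil (f a)
  | _, _, cons a p => cons (f a) (map f p)

theorem map_id : ∀ {a b : S} (p : Chain S a b), p.map (fun x => x) = p
  | _, _, nil _ => rfl
  | _, _, cons a p => congrArg (cons a) (map_id p)

end Chain

namespace Chain₂

variable {S : Type w}

/-- The sequence of the endpoints of the constituents. -/
def outer : ∀ {a b : S}, Chain₂ S a b → Chain S a b
  | _, _, nil a => Chain.nil a
  | _, _, cons (a := a) _ P => Chain.cons a (outer P)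

/-- The concatenated sequence. -/
def flatten : ∀ {a b : S}, Chain₂ S a b → Chain S a b
  | _, _, nil a => Chain.nil a
  | _, _, cons p P => p.append (flatten P)

end Chain₂

namespace EGraph

variable {V : Type u} [Category.{v} V]

/-- The sequence of homs `X(x_{i-1}, x_i)` along a sequence `(x_0, …, x_n)`. -/
def homs (X : EGraph.{w} V) : ∀ {a b : X.obj}, Chain X.obj a b → List V
  | _, _, .nil _ => []
  | _, _, .cons a (b := b) p => X.hom a b :: X.homs p

/-- The sequence of sequences of homs along a nested sequence. -/
def homs₂ (X : EGraph.{w} V) : ∀ {a b : X.obj}, Chain₂ X.obj a b → List (List V)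
  | _, _, .nil _ => []
  | _, _, .cons p P => X.homs p :: X.homs₂ P

theorem homs_append (X : EGraph.{w} V) : ∀ {a b c : X.obj} (p : Chain X.obj a b)
    (q : Chain X.obj b c), X.homs (p.append q) = X.homs p ++ X.homs q
  | _, _, _, .nil _, _ => rfl
  | _, _, _, .cons a (b := b) p, q => congrArg (X.hom a b :: ·) (X.homs_append p q)

theorem flatten_homs₂ (X : EGraph.{w} V) : ∀ {a b : X.obj} (P : Chain₂ X.obj a b),
    (X.homs₂ P).flatten = X.homs P.flatten
  | _, _, .nil _ => rfl
  | _, _, .cons p P => by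
    rw [Chain₂.flatten, homs_append, homs₂, List.flatten_cons, flatten_homs₂ X P]

/-- The action of a morphism of graphs on homs along a sequence. -/
def homsMap {X Y : EGraph.{w} V} (f : X ⟶ Y) : ∀ {a b : X.obj} (p : Chain X.obj a b),
    X.homs p ⟶ Y.homs (p.map f.obj)
  | _, _, .nil _ => 𝟙 []
  | _, _, .cons a (b := b) p => consHom (f.hom a b) (homsMap f p)

end EGraph

/-- Assemble the composition maps along the constituents of a nested sequence. -/
def compHom {V : Type u} [Category.{v} V] (E : List V ⥤ V) (X : EGraph.{w} V)
    (κ : ∀ {a b : X.obj} (p : Chain X.obj a b), E.obj (X.homs p) ⟶ X.hom a b) :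
    ∀ {a b : X.obj} (P : Chain₂ X.obj a b), (X.homs₂ P).map E.obj ⟶ X.homs P.outer
  | _, _, .nil _ => 𝟙 []
  | _, _, .cons p P => consHom (κ p) (compHom E X κ P)

/-- A category enriched in the multitensor `F`. -/
structure ECat {V : Type u} [Category.{v} V] (F : Multitensor V) where
  graph : EGraph.{w} V
  /-- the composition maps -/
  κ : ∀ {a b : graph.obj} (p : Chain graph.obj a b), F.E.obj (graph.homs p) ⟶ graph.hom a b
  unit : ∀ a b : graph.obj, F.η (graph.hom a b) ≫ κ (Chain.single a b) = 𝟙 _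
  assoc : ∀ {a b : graph.obj} (P : Chain₂ graph.obj a b),
    F.E.map (compHom F.E graph κ P) ≫ κ P.outer =
      F.σ (graph.homs₂ P) (graph.homs P.flatten) (graph.flatten_homs₂ P) ≫ κ P.flatten

/-- An `F`-functor. -/
@[ext] structure ECat.Hom {V : Type u} [Category.{v} V] {F : Multitensor V}
    (X Y : ECat.{w} F) where
  map : X.graph ⟶ Y.graph
  map_κ : ∀ {a b : X.graph.obj} (p : Chain X.graph.obj a b),
    F.E.map (EGraph.homsMap map p) ≫ Y.κ (p.map map.obj) = X.κ p ≫ map.hom a b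

namespace EGraph

variable {V : Type u} [Category.{v} V]

theorem homsMap_id (X : EGraph.{w} V) : ∀ {a b : X.obj} (p : Chain X.obj a b),
    (⟨p.map (𝟙 X : X ⟶ X).obj, homsMap (𝟙 X) p⟩ : Σ q : Chain X.obj a b, X.homs p ⟶ X.homs q) =
      ⟨p, 𝟙 _⟩
  | _, _, .nil _ => rfl
  | _, _, .cons a (b := b) (c := c) p =>
    congrArg (fun s : (Σ q : Chain X.obj b c, X.homs p ⟶ X.homs q) =>
      (⟨Chain.cons a s.1, consHom (𝟙 (X.hom a b)) s.2⟩ :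
        Σ q : Chain X.obj a c, X.homs (Chain.cons a p) ⟶ X.homs q)) (homsMap_id X p)

theorem homsMap_comp {X Y Z : EGraph.{w} V} (f : X ⟶ Y) (g : Y ⟶ Z) :
    ∀ {a b : X.obj} (p : Chain X.obj a b),
    (⟨p.map (f ≫ g).obj, homsMap (f ≫ g) p⟩ :
      Σ q : Chain Z.obj (g.obj (f.obj a)) (g.obj (f.obj b)), X.homs p ⟶ Z.homs q) =
      ⟨(p.map f.obj).map g.obj, homsMap f p ≫ homsMap g (p.map f.obj)⟩
  | _, _, .nil _ => rfl
  | _, _, .cons a (b := b) (c := c) p =>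
    congrArg (fun s : (Σ q : Chain Z.obj (g.obj (f.obj b)) (g.obj (f.obj c)),
        X.homs p ⟶ Z.homs q) =>
      (⟨Chain.cons (g.obj (f.obj a)) s.1, consHom (f.hom a b ≫ g.hom _ _) s.2⟩ :
        Σ q : Chain Z.obj (g.obj (f.obj a)) (g.obj (f.obj c)),
          X.homs (Chain.cons a p) ⟶ Z.homs q)) (homsMap_comp f g p)

end EGraph

namespace ECat

variable {V : Type u} [Category.{v} V] {F : Multitensor V}

/-- The category `F-Cat`. -/
instance category : Category.{max w v} (ECat.{w} F) where
  Hom := ECat.Hom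
  id X :=
    { map := 𝟙 X.graph
      map_κ := fun {a b} p => by
        have h := congrArg (fun s : (Σ q : Chain X.graph.obj a b,
          X.graph.homs p ⟶ X.graph.homs q) => F.E.map s.2 ≫ X.κ s.1) (X.graph.homsMap_id p)
        refine h.trans ?_
        change F.E.map (𝟙 _) ≫ X.κ p = X.κ p ≫ 𝟙 _
        rw [F.E.map_id, Category.id_comp, Category.comp_id] }
  comp {X Y Z} f g :=
    { map := f.map ≫ g.map
      map_κ := fun {a b} p => by
        have h := congrArg (fun s : (Σ q : Chain Z.graph.obj (g.map.obj (f.map.obj a))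
            (g.map.obj (f.map.obj b)), X.graph.homs p ⟶ Z.graph.homs q) => F.E.map s.2 ≫ Z.κ s.1)
          (EGraph.homsMap_comp f.map g.map p)
        refine h.trans ?_
        change F.E.map (_ ≫ _) ≫ Z.κ _ = X.κ p ≫ (f.map.hom a b ≫ g.map.hom _ _)
        rw [F.E.map_comp, Category.assoc, g.map_κ, ← Category.assoc, f.map_κ, Category.assoc] }
  id_comp f := ECat.Hom.ext (Category.id_comp f.map)
  comp_id f := ECat.Hom.ext (Category.comp_id f.map)
  assoc f g h := ECat.Hom.ext (Category.assoc f.map g.map h.map)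

/-- The forgetful functor `F-Cat ⥤ 𝒢V`. -/
def forget (F : Multitensor V) : ECat.{w} F ⥤ EGraph.{w} V where
  obj X := X.graph
  map f := f.map

end ECat

/-- `E'` is a lift of `E`: a distributive functor operad on the category of algebras of the unary
part of `E`, with the same enriched categories over `𝒢V`. -/
structure IsLift {V : Type u} [Category.{v} V] (F : Multitensor V)
    (F' : Multitensor F.unary.Algebra) : Prop where
  functorOperad : F'.IsFunctorOperad
  distributive : F'.IsDistributive.{w}
  iso : Nonempty (IsoOver
    (ECat.forget.{w} F' ⋙ EGraph.mapFunctor.{w} F.unary.forget) (ECat.forget.{w} F))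

/-- Assemble the maps `E_i X(x_{i-1}, x_i) ⟶ A X(x_0, x_n)`. -/
def injHom {V : Type u} [Category.{v} V] (E : List V ⥤ V) {X Y : EGraph.{w} V} (f : X.obj → Y.obj)
    (ι : ∀ {a b : X.obj} (p : Chain X.obj a b), E.obj (X.homs p) ⟶ Y.hom (f a) (f b)) :
    ∀ {a b : X.obj} (P : Chain₂ X.obj a b), (X.homs₂ P).map E.obj ⟶ Y.homs (P.outer.map f)
  | _, _, .nil _ => 𝟙 []
  | _, _, .cons p P => consHom (ι p) (injHom E f ι P)

/-- The monad `A` on `𝒢V` is the monad `ΓE`: it is the identity on objects (the unit being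
bijective on objects), one has `A X (a, b) = ∐_{a = x_0, …, x_n = b} E_i X(x_{i-1}, x_i)` with
the evident functoriality, the unit of `A` is given by the unit of `E`, and the multiplication of
`A` is given by the substitution of `E`. -/
structure GammaPresentation {V : Type u} [Category.{v} V] (F : Multitensor V)
    (A : Monad (EGraph.{w} V)) where
  bijective : ∀ X : EGraph.{w} V, Function.Bijective (A.η.app X).obj
  ι : ∀ (X : EGraph.{w} V) {a b : X.obj} (p : Chain X.obj a b),
    F.E.obj (X.homs p) ⟶ (A.obj X).hom ((A.η.app X).obj a) ((A.η.app X).obj b)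
  isColimit : ∀ (X : EGraph.{w} V) (a b : X.obj),
    Nonempty (IsColimit (Cofan.mk _ fun p : Chain X.obj a b => ι X p))
  natural : ∀ {X Y : EGraph.{w} V} (f : X ⟶ Y) {a b : X.obj} (p : Chain X.obj a b)
    (h : (A.obj Y).hom ((A.map f).obj ((A.η.app X).obj a)) ((A.map f).obj ((A.η.app X).obj b)) =
      (A.obj Y).hom ((A.η.app Y).obj (f.obj a)) ((A.η.app Y).obj (f.obj b))),
    F.E.map (EGraph.homsMap f p) ≫ ι Y (p.map f.obj) = ι X p ≫ (A.map f).hom _ _ ≫ eqToHom h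
  unit : ∀ (X : EGraph.{w} V) (a b : X.obj),
    F.η (X.hom a b) ≫ ι X (Chain.single a b) = (A.η.app X).hom a b
  mult : ∀ (X : EGraph.{w} V) {a b : X.obj} (P : Chain₂ X.obj a b)
    (h : (A.obj X).hom ((A.μ.app X).obj ((A.η.app (A.obj X)).obj ((A.η.app X).obj a)))
        ((A.μ.app X).obj ((A.η.app (A.obj X)).obj ((A.η.app X).obj b))) =
      (A.obj X).hom ((A.η.app X).obj a) ((A.η.app X).obj b)),
    F.E.map (injHom F.E (A.η.app X).obj (fun p => ι X p) P) ≫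
        ι (A.obj X) (P.outer.map (A.η.app X).obj) ≫ (A.μ.app X).hom _ _ ≫ eqToHom h =
      F.σ (X.homs₂ P) (X.homs P.flatten) (X.flatten_homs₂ P) ≫ ι X P.flatten

/-! ### Strict 2-categories -/

/-- A (one-sorted in each dimension) category structure with set of objects `O`, set of morphisms
`M`, source `s` and target `t`. Composites are written in diagrammatic order. -/
@[ext] structure CatOn {O M : Type u} (s t : M → O) where
  id : O → M
  comp : ∀ f g : M, t f = s g → M
  s_id : ∀ a, s (id a) = a
  t_id : ∀ a, t (id a) = a
  s_comp : ∀ f g h, s (comp f g h) = s f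
  t_comp : ∀ f g h, t (comp f g h) = t g
  id_comp : ∀ f h, comp (id (s f)) f h = f
  comp_id : ∀ f h, comp f (id (t f)) h = f
  assoc : ∀ f g k h₁ h₂ h₃ h₄, comp (comp f g h₁) k h₂ = comp f (comp g k h₃) h₄

/-- A 2-globular set. -/
structure Glob2 where
  C0 : Type u
  C1 : Type u
  C2 : Type u
  s0 : C1 → C0
  t0 : C1 → C0
  s1 : C2 → C1
  t1 : C2 → C1
  ss : ∀ x, s0 (s1 x) = s0 (t1 x)
  tt : ∀ x, t0 (s1 x) = t0 (t1 x)

@[ext] structure Glob2.Hom (X Y : Glob2.{u}) where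
  f0 : X.C0 → Y.C0
  f1 : X.C1 → Y.C1
  f2 : X.C2 → Y.C2
  s0 : ∀ x, Y.s0 (f1 x) = f0 (X.s0 x)
  t0 : ∀ x, Y.t0 (f1 x) = f0 (X.t0 x)
  s1 : ∀ x, Y.s1 (f2 x) = f1 (X.s1 x)
  t1 : ∀ x, Y.t1 (f2 x) = f1 (X.t1 x)

/-- The category `𝒢²(Set)` of 2-globular sets. -/
instance Glob2.category : LargeCategory Glob2.{u} where
  Hom := Glob2.Hom
  id X := ⟨fun x => x, fun x => x, fun x => x, fun _ => rfl, fun _ => rfl, fun _ => rfl,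
    fun _ => rfl⟩
  comp f g := ⟨fun x => g.f0 (f.f0 x), fun x => g.f1 (f.f1 x), fun x => g.f2 (f.f2 x),
    fun x => by rw [g.s0, f.s0], fun x => by rw [g.t0, f.t0], fun x => by rw [g.s1, f.s1],
    fun x => by rw [g.t1, f.t1]⟩

/-- A strict 2-category: a 2-globular set with composition of 1-cells, vertical composition and
horizontal composition of 2-cells, satisfying the usual axioms. -/
structure TwoCat extends Glob2.{u} where
  cat1 : CatOn s0 t0
  catV : CatOn s1 t1
  catH : CatOn (fun x => s0 (s1 x)) (fun x => t0 (s1 x))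
  catH_id : ∀ a, catH.id a = catV.id (cat1.id a)
  s1_hcomp : ∀ x y h, s1 (catH.comp x y h) = cat1.comp (s1 x) (s1 y) h
  t1_hcomp : ∀ x y h h', t1 (catH.comp x y h) = cat1.comp (t1 x) (t1 y) h'
  hcomp_id : ∀ f g h h', catH.comp (catV.id f) (catV.id g) h' = catV.id (cat1.comp f g h)
  interchange : ∀ x x' y y' hx hy h h₁ h₂ h',
    catH.comp (catV.comp x x' hx) (catV.comp y y' hy) h =
      catV.comp (catH.comp x y h₁) (catH.comp x' y' h₂) h'

/-- A strict 2-functor. -/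
structure TwoCat.Hom (A B : TwoCat.{u}) where
  toHom : A.toGlob2 ⟶ B.toGlob2
  map_id : ∀ a, toHom.f1 (A.cat1.id a) = B.cat1.id (toHom.f0 a)
  map_comp : ∀ f g h h', toHom.f1 (A.cat1.comp f g h) = B.cat1.comp (toHom.f1 f) (toHom.f1 g) h'
  map_vid : ∀ f, toHom.f2 (A.catV.id f) = B.catV.id (toHom.f1 f)
  map_vcomp : ∀ x y h h',
    toHom.f2 (A.catV.comp x y h) = B.catV.comp (toHom.f2 x) (toHom.f2 y) h'
  map_hcomp : ∀ x y h h',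
    toHom.f2 (A.catH.comp x y h) = B.catH.comp (toHom.f2 x) (toHom.f2 y) h'

theorem TwoCat.Hom.ext' {A B : TwoCat.{u}} {F G : TwoCat.Hom A B} (h : F.toHom = G.toHom) :
    F = G := by
  cases F; cases G; cases h; rfl

/-- The category `2-Cat` of 2-categories and 2-functors. -/
instance TwoCat.category : LargeCategory TwoCat.{u} where
  Hom := TwoCat.Hom
  id A := ⟨𝟙 A.toGlob2, fun _ => rfl, fun _ _ _ _ => rfl, fun _ => rfl, fun _ _ _ _ => rfl,
    fun _ _ _ _ => rfl⟩
  comp {A B C} F G :=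
    { toHom := F.toHom ≫ G.toHom
      map_id := fun a => (congrArg G.toHom.f1 (F.map_id a)).trans (G.map_id _)
      map_comp := fun f g h h' =>
        (congrArg G.toHom.f1 (F.map_comp f g h (by rw [F.toHom.t0, F.toHom.s0, h]))).trans
          (G.map_comp _ _ _ _)
      map_vid := fun f => (congrArg G.toHom.f2 (F.map_vid f)).trans (G.map_vid _)
      map_vcomp := fun x y h h' =>
        (congrArg G.toHom.f2 (F.map_vcomp x y h (by rw [F.toHom.t1, F.toHom.s1, h]))).trans
          (G.map_vcomp _ _ _ _)
      map_hcomp := fun x y h h' =>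
        (congrArg G.toHom.f2 (F.map_hcomp x y h (by
          rw [F.toHom.s1, F.toHom.s1, F.toHom.t0, F.toHom.s0, h]))).trans
          (G.map_hcomp _ _ _ _) }
  id_comp _ := rfl
  comp_id _ := rfl
  assoc _ _ _ := rfl

/-- The underlying 2-globular set of a 2-category. -/
def TwoCat.forget : TwoCat.{u} ⥤ Glob2.{u} where
  obj A := A.toGlob2
  map F := F.toHom

/-! ### Free categories and free 2-categories -/

/-- A directed graph. -/
structure Gph where
  V : Type u
  E : Type u
  s : E → V
  t : E → V

/-- The edges in a list are composable, leading from one given vertex to another. -/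
def Gph.IsWalk (G : Gph.{u}) : G.V → List G.E → G.V → Prop
  | a, [], b => a = b
  | a, e :: l, b => G.s e = a ∧ G.IsWalk (G.t e) l b

theorem Gph.IsWalk.append {G : Gph.{u}} : ∀ {a b c : G.V} {l m : List G.E},
    G.IsWalk a l b → G.IsWalk b m c → G.IsWalk a (l ++ m) c
  | _, _, _, [], _, h, h' => by cases h; exact h'
  | _, _, _, _ :: _, _, h, h' => ⟨h.1, h.2.append h'⟩

theorem Gph.IsWalk.flatMap {G K : Gph.{u}} (f : G.V → K.V) (g : G.E → List K.E)
    (hg : ∀ e, K.IsWalk (f (G.s e)) (g e) (f (G.t e))) : ∀ {a b : G.V} {l : List G.E},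
    G.IsWalk a l b → K.IsWalk (f a) (l.flatMap g) (f b)
  | _, _, [], h => congrArg f h
  | _, _, e :: l, h => by
    rw [List.flatMap_cons, ← h.1]
    exact (hg e).append (h.2.flatMap f g hg)

theorem Gph.IsWalk.map {G K : Gph.{u}} (f : G.V → K.V) (g : G.E → K.E)
    (hs : ∀ e, K.s (g e) = f (G.s e)) (ht : ∀ e, K.t (g e) = f (G.t e)) :
    ∀ {a b : G.V} {l : List G.E}, G.IsWalk a l b → K.IsWalk (f a) (l.map g) (f b)
  | _, _, [], h => congrArg f h
  | _, _, e :: l, h => ⟨by rw [hs, h.1], by rw [ht]; exact h.2.map f g hs ht⟩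

/-- A walk in a graph: a morphism of the free category on it. -/
@[ext] structure Walk (G : Gph.{u}) where
  src : G.V
  tgt : G.V
  edges : List G.E
  valid : G.IsWalk src edges tgt

namespace Walk

variable {G K : Gph.{u}}

def nil (a : G.V) : Walk G := ⟨a, a, [], rfl⟩

def single (e : G.E) : Walk G := ⟨G.s e, G.t e, [e], rfl, rfl⟩

def append (p q : Walk G) (h : p.tgt = q.src) : Walk G :=
  ⟨p.src, q.tgt, p.edges ++ q.edges, p.valid.append (h ▸ q.valid)⟩

/-- The free category on a graph. -/
def catOn (G : Gph.{u}) : CatOn (Walk.src (G := G)) (Walk.tgt (G := G)) where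
  id := nil
  comp := append
  s_id _ := rfl
  t_id _ := rfl
  s_comp _ _ _ := rfl
  t_comp _ _ _ := rfl
  id_comp _ _ := rfl
  comp_id p _ := Walk.ext rfl rfl (List.append_nil _)
  assoc _ _ _ _ _ _ _ := Walk.ext rfl rfl (List.append_assoc _ _ _)

def map (f : G.V → K.V) (g : G.E → K.E)
    (hs : ∀ e, K.s (g e) = f (G.s e)) (ht : ∀ e, K.t (g e) = f (G.t e)) (p : Walk G) : Walk K :=
  ⟨f p.src, f p.tgt, p.edges.map g, p.valid.map f g hs ht⟩

/-- Recursion for properties of walks. -/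
theorem induction {P : Walk G → Prop} (hnil : ∀ a, P (Walk.nil a))
    (hcons : ∀ (e : G.E) (p : Walk G) (h : G.t e = p.src), P p →
      P ((Walk.single e).append p h)) (p : Walk G) : P p := by
  obtain ⟨a, b, l, h⟩ := p
  induction l generalizing a with
  | nil => cases h; exact hnil _
  | cons e l ih =>
    obtain ⟨rfl, h⟩ := h
    exact hcons e ⟨_, _, l, h⟩ rfl (ih _ h)

/-- Substitution of walks for the edges of a walk. -/
def bind (f : G.V → K.V) (g : G.E → Walk K)
    (hs : ∀ e, (g e).src = f (G.s e)) (ht : ∀ e, (g e).tgt = f (G.t e)) (p : Walk G) : Walk K :=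
  ⟨f p.src, f p.tgt, p.edges.flatMap fun e => (g e).edges,
    p.valid.flatMap f _ fun e => hs e ▸ ht e ▸ (g e).valid⟩

end Walk

namespace CatOn

variable {O M : Type u} {s t : M → O} (c : CatOn s t)

theorem comp_congr {f f' g g' : M} (hf : f = f') (hg : g = g') (h : t f = s g) (h' : t f' = s g') :
    c.comp f g h = c.comp f' g' h' := by subst hf hg; rfl

variable {G : Gph.{u}} (f : G.V → O) (g : G.E → M)
  (hs : ∀ e, s (g e) = f (G.s e)) (ht : ∀ e, t (g e) = f (G.t e))

/-- Composition of a list of morphisms. -/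
def evalAux : ∀ (a : G.V) (l : List G.E) (b : G.V), G.IsWalk a l b →
    {x : M // s x = f a ∧ t x = f b}
  | a, [], b, h => ⟨c.id (f a), c.s_id _, (c.t_id _).trans (congrArg f h)⟩
  | a, e :: l, b, h =>
    ⟨c.comp (g e) (evalAux (G.t e) l b h.2).1 (by rw [ht, (evalAux (G.t e) l b h.2).2.1]),
      by rw [c.s_comp, hs, h.1], by rw [c.t_comp, (evalAux (G.t e) l b h.2).2.2]⟩

/-- The composite, in a category, of (the image of) a walk. -/
def eval (p : Walk G) : M := (c.evalAux f g hs ht p.src p.edges p.tgt p.valid).1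

theorem s_eval (p : Walk G) : s (c.eval f g hs ht p) = f p.src :=
  (c.evalAux f g hs ht p.src p.edges p.tgt p.valid).2.1

theorem t_eval (p : Walk G) : t (c.eval f g hs ht p) = f p.tgt :=
  (c.evalAux f g hs ht p.src p.edges p.tgt p.valid).2.2

theorem eval_nil (a : G.V) : c.eval f g hs ht (Walk.nil a) = c.id (f a) := rfl

theorem eval_single (e : G.E) : c.eval f g hs ht (Walk.single e) = g e := by
  have h : t (g e) = s (c.id (t (g e))) := (c.s_id _).symm
  exact (c.comp_congr rfl (congrArg c.id (ht e).symm) _ h).trans (c.comp_id (g e) h)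

theorem eval_cons (e : G.E) (p : Walk G) (h : G.t e = p.src) (h') :
    c.eval f g hs ht ((Walk.single e).append p h) = c.comp (g e) (c.eval f g hs ht p) h' := by
  obtain ⟨a, b, l, hp⟩ := p
  cases h
  rfl

theorem eval_append (p q : Walk G) (h : p.tgt = q.src) (h') :
    c.eval f g hs ht (p.append q h) = c.comp (c.eval f g hs ht p) (c.eval f g hs ht q) h' := by
  induction p using Walk.induction with
  | hnil a =>
    have h₁ : t (c.id (s (c.eval f g hs ht q))) = s (c.eval f g hs ht q) := c.t_id _
    refine Eq.trans ?_ (c.comp_congr (congrArg c.id ?_) rfl h₁ h')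
    · rw [c.id_comp]
      cases h
      rfl
    · rw [c.s_eval]; exact congrArg f h.symm
  | hcons e p hp ih =>
    have h₁ : t (c.eval f g hs ht p) = s (c.eval f g hs ht q) := by
      rw [c.t_eval, c.s_eval]; exact congrArg f h
    have h₂ : t (g e) = s (c.eval f g hs ht p) := by rw [c.s_eval, ht, hp]
    have h₃ : t (c.comp (g e) (c.eval f g hs ht p) h₂) = s (c.eval f g hs ht q) := by
      rw [c.t_comp, h₁]
    have h₄ : t (g e) = s (c.comp (c.eval f g hs ht p) (c.eval f g hs ht q) h₁) := by
      rw [c.s_comp, h₂]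
    have e1 : (((Walk.single e).append p hp).append q h) = (Walk.single e).append (p.append q h) hp :=
      rfl
    rw [e1, c.eval_cons f g hs ht e (p.append q h) hp (by rw [c.s_eval, ht]; exact congrArg f hp),
      c.comp_congr rfl (ih h h₁) _ h₄, ← c.assoc _ _ _ h₂ h₃]
    exact c.comp_congr (c.eval_cons f g hs ht e p hp h₂).symm rfl _ _

/-- A map of walks into a category that respects identities and composition is determined by its
values on edges. -/
theorem eval_unique (φ : Walk G → M) (hnil : ∀ a, φ (Walk.nil a) = c.id (f a))
    (happ : ∀ p q h h', φ (p.append q h) = c.comp (φ p) (φ q) h')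
    (hs' : ∀ p, s (φ p) = f p.src) (hsing : ∀ e, φ (Walk.single e) = g e) (p : Walk G) :
    φ p = c.eval f g hs ht p := by
  induction p using Walk.induction with
  | hnil a => exact hnil a
  | hcons e p hp ih =>
    have h₁ : t (φ (Walk.single e)) = s (φ p) := by rw [hsing, ht, hs', hp]
    have h₂ : t (g e) = s (c.eval f g hs ht p) := by rw [c.s_eval, ht, hp]
    rw [happ _ _ hp h₁, c.eval_cons f g hs ht e p hp h₂]
    exact c.comp_congr (hsing e) ih _ _

theorem eval_congr {f' : G.V → O} {g' : G.E → M} (hf : f = f') (hg : g = g')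
    (hs' : ∀ e, s (g' e) = f' (G.s e)) (ht' : ∀ e, t (g' e) = f' (G.t e)) (p : Walk G) :
    c.eval f g hs ht p = c.eval f' g' hs' ht' p := by subst hf hg; rfl

/-- Functors preserve the composites of walks. -/
theorem map_eval {O' M' : Type u} {s' t' : M' → O'} (c' : CatOn s' t') (F : O → O') (F₁ : M → M')
    (Fs : ∀ x, s' (F₁ x) = F (s x))
    (Fid : ∀ a, F₁ (c.id a) = c'.id (F a))
    (Fcomp : ∀ x y h h', F₁ (c.comp x y h) = c'.comp (F₁ x) (F₁ y) h') (p : Walk G) (hs' ht') :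
    F₁ (c.eval f g hs ht p) = c'.eval (fun a => F (f a)) (fun e => F₁ (g e)) hs' ht' p := by
  refine c'.eval_unique (fun a => F (f a)) (fun e => F₁ (g e)) hs' ht'
    (fun p => F₁ (c.eval f g hs ht p)) (fun a => Fid _) ?_ ?_ ?_ p
  · intro p q h h'
    have h₁ : t (c.eval f g hs ht p) = s (c.eval f g hs ht q) := by
      rw [c.t_eval, c.s_eval, h]
    simp only [c.eval_append f g hs ht p q h h₁]
    exact Fcomp _ _ _ _
  · intro p
    simp only [Fs, c.s_eval]
  · intro e
    simp only [c.eval_single]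

theorem eval_bind {K : Gph.{u}} (k : K.V → G.V) (l : K.E → Walk G)
    (ks : ∀ e, (l e).src = k (K.s e)) (kt : ∀ e, (l e).tgt = k (K.t e)) (p : Walk K) (hs' ht') :
    c.eval f g hs ht (p.bind k l ks kt) =
      c.eval (fun a => f (k a)) (fun e => c.eval f g hs ht (l e)) hs' ht' p := by
  refine c.eval_unique _ _ hs' ht' (fun p => c.eval f g hs ht (p.bind k l ks kt)) (fun a => rfl)
    ?_ ?_ ?_ p
  · intro p q h h'
    rw [← c.eval_append f g hs ht (p.bind k l ks kt) (q.bind k l ks kt) (congrArg k h) h']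
    congr 1
    exact Walk.ext rfl rfl List.flatMap_append
  · intro p
    exact c.s_eval _ _ _ _ _
  · intro e
    congr 1
    exact Walk.ext (ks e).symm (kt e).symm (by simp [Walk.bind, Walk.single])

theorem eval_map {K : Gph.{u}} (k : K.V → G.V) (l : K.E → G.E)
    (ks : ∀ e, G.s (l e) = k (K.s e)) (kt : ∀ e, G.t (l e) = k (K.t e)) (p : Walk K) (hs' ht') :
    c.eval f g hs ht (p.map k l ks kt) =
      c.eval (fun a => f (k a)) (fun e => g (l e)) hs' ht' p := by
  refine c.eval_unique _ _ hs' ht' (fun p => c.eval f g hs ht (p.map k l ks kt)) (fun a => rfl)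
    ?_ ?_ ?_ p
  · intro p q h h'
    rw [← c.eval_append f g hs ht (p.map k l ks kt) (q.map k l ks kt) (congrArg k h) h']
    congr 1
    exact Walk.ext rfl rfl List.map_append
  · intro p
    exact c.s_eval _ _ _ _ _
  · intro e
    refine Eq.trans ?_ (c.eval_single f g hs ht (l e))
    congr 1
    exact Walk.ext (ks e).symm (kt e).symm rfl

end CatOn

/-! #### The free 2-category on a 2-globular set -/

namespace Glob2

/-- Objects and 1-cells. -/
abbrev trunc (X : Glob2.{u}) : Gph.{u} := ⟨X.C0, X.C1, X.s0, X.t0⟩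

/-- 1-cells and 2-cells. -/
abbrev vert (X : Glob2.{u}) : Gph.{u} := ⟨X.C1, X.C2, X.s1, X.t1⟩

theorem isWalk_vert (X : Glob2.{u}) : ∀ {f g : X.C1} {l : List X.C2}, X.vert.IsWalk f l g →
    X.s0 f = X.s0 g ∧ X.t0 f = X.t0 g
  | _, _, [], h => by cases h; exact ⟨rfl, rfl⟩
  | _, _, x :: _, h => by
    obtain ⟨h₁, h₂⟩ := h
    have := X.isWalk_vert h₂
    cases h₁
    exact ⟨(X.ss x).trans this.1, (X.tt x).trans this.2⟩

/-- Objects, and columns of vertically composable 2-cells. -/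
abbrev hor (X : Glob2.{u}) : Gph.{u} :=
  ⟨X.C0, Walk X.vert, fun c => X.s0 c.src, fun c => X.t0 c.src⟩

/-- Vertical composition of matching columns, one column at a time. -/
def zipCols {G : Gph.{u}} : ∀ l m : List (Walk G), l.map Walk.tgt = m.map Walk.src → List (Walk G)
  | [], [], _ => []
  | [], _ :: _, h => absurd h (by simp)
  | _ :: _, [], h => absurd h (by simp)
  | c :: l, d :: m, h => c.append d (List.cons.inj h).1 :: zipCols l m (List.cons.inj h).2

section zip

variable {G : Gph.{u}}

theorem map_src_zipCols : ∀ (l m : List (Walk G)) (h), (zipCols l m h).map Walk.src = l.map Walk.src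
  | [], [], _ => rfl
  | [], _ :: _, h => absurd h (by simp)
  | _ :: _, [], h => absurd h (by simp)
  | _ :: l, _ :: m, h => congrArg (_ :: ·) (map_src_zipCols l m (List.cons.inj h).2)

theorem map_tgt_zipCols : ∀ (l m : List (Walk G)) (h), (zipCols l m h).map Walk.tgt = m.map Walk.tgt
  | [], [], _ => rfl
  | [], _ :: _, h => absurd h (by simp)
  | _ :: _, [], h => absurd h (by simp)
  | _ :: l, _ :: m, h => congrArg (_ :: ·) (map_tgt_zipCols l m (List.cons.inj h).2)

theorem zipCols_nil_left : ∀ (l : List (Walk G)) (h),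
    zipCols ((l.map Walk.src).map Walk.nil) l h = l
  | [], _ => rfl
  | _ :: l, h => congrArg (_ :: ·) (zipCols_nil_left l (List.cons.inj h).2)

theorem zipCols_nil_right : ∀ (l : List (Walk G)) (h),
    zipCols l ((l.map Walk.tgt).map Walk.nil) h = l
  | [], _ => rfl
  | c :: l, h => congrArg₂ List.cons (Walk.ext rfl rfl (List.append_nil _))
      (zipCols_nil_right l (List.cons.inj h).2)

theorem zipCols_assoc : ∀ (l m n : List (Walk G)) (h₁ h₂ h₃ h₄),
    zipCols (zipCols l m h₁) n h₂ = zipCols l (zipCols m n h₃) h₄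
  | [], [], [], _, _, _, _ => rfl
  | [], _ :: _, _, h, _, _, _ => absurd h (by simp)
  | _ :: _, [], _, h, _, _, _ => absurd h (by simp)
  | _, [], _ :: _, _, _, h, _ => absurd h (by simp)
  | _, _ :: _, [], _, _, h, _ => absurd h (by simp)
  | _ :: l, _ :: m, _ :: n, h₁, h₂, h₃, h₄ =>
    congrArg₂ List.cons (Walk.ext rfl rfl (List.append_assoc _ _ _))
      (zipCols_assoc l m n (List.cons.inj h₁).2 (List.cons.inj h₂).2 (List.cons.inj h₃).2
        (List.cons.inj h₄).2)

theorem zipCols_append : ∀ (l m l' m' : List (Walk G)) (h h' h''),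
    zipCols (l ++ l') (m ++ m') h = zipCols l m h' ++ zipCols l' m' h''
  | [], [], _, _, _, _, _ => rfl
  | [], _ :: _, _, _, _, h, _ => absurd h (by simp)
  | _ :: _, [], _, _, _, h, _ => absurd h (by simp)
  | _ :: l, _ :: m, l', m', h, h', h'' =>
    congrArg (_ :: ·) (zipCols_append l m l' m' (List.cons.inj h).2 (List.cons.inj h').2 h'')

end zip

theorem isWalk_src (X : Glob2.{u}) : ∀ {a b : X.C0} {l : List (Walk X.vert)},
    X.hor.IsWalk a l b ↔ X.trunc.IsWalk a (l.map Walk.src) b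
  | _, _, [] => Iff.rfl
  | _, _, _ :: _ => and_congr Iff.rfl X.isWalk_src

theorem isWalk_tgt (X : Glob2.{u}) : ∀ {a b : X.C0} {l : List (Walk X.vert)},
    X.hor.IsWalk a l b ↔ X.trunc.IsWalk a (l.map Walk.tgt) b
  | _, _, [] => Iff.rfl
  | a, b, c :: l => by
    have h := X.isWalk_vert c.valid
    change (X.s0 c.src = a ∧ X.hor.IsWalk (X.t0 c.src) l b) ↔
      (X.s0 c.tgt = a ∧ X.trunc.IsWalk (X.t0 c.tgt) (l.map Walk.tgt) b)
    rw [h.1, h.2, X.isWalk_tgt]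

def freeS1 (X : Glob2.{u}) (p : Walk X.hor) : Walk X.trunc :=
  ⟨p.src, p.tgt, p.edges.map Walk.src, X.isWalk_src.1 p.valid⟩

def freeT1 (X : Glob2.{u}) (p : Walk X.hor) : Walk X.trunc :=
  ⟨p.src, p.tgt, p.edges.map Walk.tgt, X.isWalk_tgt.1 p.valid⟩

theorem map_src_nil {G : Gph.{u}} (l : List G.V) :
    (l.map (Walk.nil (G := G))).map Walk.src = l := by
  rw [List.map_map]; exact List.map_id l

theorem map_tgt_nil {G : Gph.{u}} (l : List G.V) :
    (l.map (Walk.nil (G := G))).map Walk.tgt = l := by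
  rw [List.map_map]; exact List.map_id l

def freeId2 (X : Glob2.{u}) (p : Walk X.trunc) : Walk X.hor :=
  ⟨p.src, p.tgt, (p.edges.map (Walk.nil (G := X.vert)) : List (Walk X.vert)),
    X.isWalk_src.2 ((map_src_nil (G := X.vert) p.edges).symm ▸ p.valid)⟩

def freeVcomp (X : Glob2.{u}) (p q : Walk X.hor) (h : X.freeT1 p = X.freeS1 q) : Walk X.hor :=
  ⟨p.src, q.tgt, (zipCols (G := X.vert) p.edges q.edges (congrArg Walk.edges h)),
    X.isWalk_src.2 ((map_src_zipCols (G := X.vert) p.edges q.edges (congrArg Walk.edges h)).symm ▸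
      (congrArg (Walk.tgt (G := X.trunc)) h : p.tgt = q.tgt) ▸ X.isWalk_src.1 p.valid)⟩

/-- The 2-globular set of paths of 1-cells, and of pasting diagrams: horizontally composable
sequences of columns of vertically composable 2-cells. -/
def freeGlob (X : Glob2.{u}) : Glob2.{u} where
  C0 := X.C0
  C1 := Walk X.trunc
  C2 := Walk X.hor
  s0 := Walk.src
  t0 := Walk.tgt
  s1 := X.freeS1
  t1 := X.freeT1
  ss _ := rfl
  tt _ := rfl

/-- The free strict 2-category on a 2-globular set. -/
def free (X : Glob2.{u}) : TwoCat.{u} where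
  toGlob2 := X.freeGlob
  cat1 := Walk.catOn X.trunc
  catV :=
    { id := X.freeId2
      comp := X.freeVcomp
      s_id := fun p => Walk.ext rfl rfl (map_src_nil (G := X.vert) p.edges)
      t_id := fun p => Walk.ext rfl rfl (map_tgt_nil (G := X.vert) p.edges)
      s_comp := fun p q h => Walk.ext rfl (congrArg (Walk.tgt (G := X.trunc)) h).symm
        (map_src_zipCols (G := X.vert) _ _ _)
      t_comp := fun p q h => Walk.ext (congrArg (Walk.src (G := X.trunc)) h :) rfl
        (map_tgt_zipCols (G := X.vert) _ _ _)
      id_comp := fun p _ => Walk.ext rfl rfl (zipCols_nil_left (G := X.vert) _ _)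
      comp_id := fun p _ => Walk.ext rfl rfl (zipCols_nil_right (G := X.vert) _ _)
      assoc := fun p q r _ _ _ _ => Walk.ext rfl rfl (zipCols_assoc (G := X.vert) _ _ _ _ _ _ _) }
  catH := Walk.catOn X.hor
  catH_id _ := rfl
  s1_hcomp _ _ _ := Walk.ext rfl rfl List.map_append
  t1_hcomp _ _ _ _ := Walk.ext rfl rfl List.map_append
  hcomp_id _ _ _ _ := Walk.ext rfl rfl List.map_append.symm
  interchange x x' y y' hx hy _ _ _ _ :=
    Walk.ext rfl rfl (zipCols_append (G := X.vert) x.edges x'.edges y.edges y'.edges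
      (by rw [List.map_append, List.map_append]
          exact congrArg₂ _ (congrArg Walk.edges hx) (congrArg Walk.edges hy))
      (congrArg Walk.edges hx) (congrArg Walk.edges hy)).symm

/-- The inclusion of generators. -/
def unit (X : Glob2.{u}) : X ⟶ X.freeGlob where
  f0 := fun a => a
  f1 := Walk.single (G := X.trunc)
  f2 := fun x => Walk.single (G := X.hor) (Walk.single (G := X.vert) x)
  s0 _ := rfl
  t0 _ := rfl
  s1 _ := rfl
  t1 x := Walk.ext (X.ss x) (X.tt x) rfl

section lift

variable {X : Glob2.{u}} {A : TwoCat.{u}} (F : X ⟶ A.toGlob2)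

def liftV : Walk X.vert → A.C2 := A.catV.eval (G := X.vert) F.f1 F.f2 F.s1 F.t1

theorem s1_liftV (c : Walk X.vert) : A.s1 (liftV F c) = F.f1 c.src := A.catV.s_eval _ _ _ _ _

theorem t1_liftV (c : Walk X.vert) : A.t1 (liftV F c) = F.f1 c.tgt := A.catV.t_eval _ _ _ _ _

def lift1 : Walk X.trunc → A.C1 := A.cat1.eval (G := X.trunc) F.f0 F.f1 F.s0 F.t0

theorem s0_liftV (c : Walk X.vert) : A.s0 (A.s1 (liftV F c)) = F.f0 (X.s0 c.src) :=
  (congrArg A.s0 (s1_liftV F c)).trans (F.s0 _)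

theorem t0_liftV (c : Walk X.vert) : A.t0 (A.s1 (liftV F c)) = F.f0 (X.t0 c.src) :=
  (congrArg A.t0 (s1_liftV F c)).trans (F.t0 _)

def lift2 : Walk X.hor → A.C2 :=
  A.catH.eval (G := X.hor) F.f0 (liftV F) (s0_liftV F) (t0_liftV F)

theorem s0_lift2 (p : Walk X.hor) : A.s0 (A.s1 (lift2 F p)) = F.f0 p.src :=
  A.catH.s_eval (G := X.hor) F.f0 (liftV F) (s0_liftV F) (t0_liftV F) p

theorem s1_lift2 (p : Walk X.hor) : A.s1 (lift2 F p) = lift1 F (X.freeS1 p) := by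
  have hs : ∀ c : Walk X.vert, A.s0 (A.s1 (liftV F c)) = F.f0 (X.hor.s c) := s0_liftV F
  have ht : ∀ c : Walk X.vert, A.t0 (A.s1 (liftV F c)) = F.f0 (X.hor.t c) := t0_liftV F
  refine (A.catH.map_eval (G := X.hor) F.f0 (liftV F) (s0_liftV F) (t0_liftV F) A.cat1
    (fun a => a) A.s1 (fun _ => rfl) (fun a => ?_) (fun x y h _ => A.s1_hcomp x y h) p hs ht).trans ?_
  · rw [A.catH_id, A.catV.s_id]
  · have hs' : ∀ c : Walk X.vert, A.s0 (F.f1 c.src) = F.f0 (X.s0 c.src) := fun c => F.s0 _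
    have ht' : ∀ c : Walk X.vert, A.t0 (F.f1 c.src) = F.f0 (X.t0 c.src) := fun c => F.t0 _
    refine Eq.trans ?_ (A.cat1.eval_map (G := X.trunc) (K := X.hor) F.f0 F.f1 F.s0 F.t0
      (fun a => a) Walk.src (fun _ => rfl) (fun _ => rfl) p hs' ht').symm
    exact A.cat1.eval_congr (G := X.hor) _ _ hs ht rfl (funext fun c => s1_liftV F c) hs' ht' p

theorem t1_lift2 (p : Walk X.hor) : A.t1 (lift2 F p) = lift1 F (X.freeT1 p) := by
  have hs : ∀ c : Walk X.vert, A.s0 (A.t1 (liftV F c)) = F.f0 (X.hor.s c) :=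
    fun c => (A.ss _).symm.trans (s0_liftV F c)
  have ht : ∀ c : Walk X.vert, A.t0 (A.t1 (liftV F c)) = F.f0 (X.hor.t c) :=
    fun c => (A.tt _).symm.trans (t0_liftV F c)
  refine (A.catH.map_eval (G := X.hor) F.f0 (liftV F) (s0_liftV F) (t0_liftV F) A.cat1
    (fun a => a) A.t1 (fun _ => (A.ss _).symm) (fun a => ?_) (fun x y h h' => A.t1_hcomp x y h h')
    p hs ht).trans ?_
  · rw [A.catH_id, A.catV.t_id]
  · have hs₁ : ∀ c : Walk X.vert, X.s0 c.tgt = X.s0 c.src := fun c => (X.isWalk_vert c.valid).1.symm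
    have ht₁ : ∀ c : Walk X.vert, X.t0 c.tgt = X.t0 c.src := fun c => (X.isWalk_vert c.valid).2.symm
    have hs' : ∀ c : Walk X.vert, A.s0 (F.f1 c.tgt) = F.f0 (X.s0 c.src) :=
      fun c => (F.s0 _).trans (congrArg F.f0 (hs₁ c))
    have ht' : ∀ c : Walk X.vert, A.t0 (F.f1 c.tgt) = F.f0 (X.t0 c.src) :=
      fun c => (F.t0 _).trans (congrArg F.f0 (ht₁ c))
    refine Eq.trans ?_ (A.cat1.eval_map (G := X.trunc) (K := X.hor) F.f0 F.f1 F.s0 F.t0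
      (fun a => a) Walk.tgt hs₁ ht₁ p hs' ht').symm
    exact A.cat1.eval_congr (G := X.hor) _ _ hs ht rfl (funext fun c => t1_liftV F c) hs' ht' p

theorem lift2_id (p : Walk X.trunc) : lift2 F (X.freeId2 p) = A.catV.id (lift1 F p) := by
  induction p using Walk.induction with
  | hnil a => exact A.catH_id _
  | hcons e p h ih =>
    have h₁ : A.t0 (F.f1 e) = A.s0 (lift1 F p) := by
      rw [lift1, A.cat1.s_eval]; exact (F.t0 e).trans (congrArg F.f0 h)
    have h₂ : A.t0 (A.s1 (A.catV.id (F.f1 e))) = A.s0 (A.s1 (A.catV.id (lift1 F p))) := by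
      rw [A.catV.s_id, A.catV.s_id, h₁]
    have h₃ : A.t0 (A.s1 (liftV F (Walk.nil (G := X.vert) e))) =
        A.s0 (A.s1 (lift2 F (X.freeId2 p))) := by
      rw [ih]; exact h₂
    refine (A.catH.eval_cons (G := X.hor) F.f0 (liftV F) (s0_liftV F) (t0_liftV F)
      (Walk.nil (G := X.vert) e) (X.freeId2 p) h h₃).trans ?_
    refine (A.catH.comp_congr rfl ih _ h₂).trans ((A.hcomp_id _ _ h₁ h₂).trans ?_)
    exact congrArg A.catV.id (A.cat1.eval_cons F.f0 F.f1 F.s0 F.t0 e p h h₁).symm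

theorem lift2_vcomp : ∀ (l m : List (Walk X.vert)) (hlm : l.map Walk.tgt = m.map Walk.src)
    (a b : X.C0) (hl : X.hor.IsWalk a l b) (hm : X.hor.IsWalk a m b)
    (hz : X.hor.IsWalk a (zipCols (G := X.vert) l m hlm) b)
    (h : A.t1 (lift2 F ⟨a, b, l, hl⟩) = A.s1 (lift2 F ⟨a, b, m, hm⟩)),
    lift2 F ⟨a, b, zipCols (G := X.vert) l m hlm, hz⟩ =
      A.catV.comp (lift2 F ⟨a, b, l, hl⟩) (lift2 F ⟨a, b, m, hm⟩) h
  | [], [], _, a, b, hl, hm, hz, h => by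
    have h₀ : lift2 F ⟨a, b, [], hl⟩ = A.catV.id (A.cat1.id (F.f0 a)) := A.catH_id _
    have h₁ : A.t1 (A.catV.id (A.cat1.id (F.f0 a))) =
        A.s1 (A.catV.id (A.cat1.id (F.f0 a))) := by rw [A.catV.t_id, A.catV.s_id]
    refine h₀.trans (Eq.trans ?_ (A.catV.comp_congr h₀ h₀ h h₁).symm)
    have h₂ : A.t1 (A.catV.id (A.s1 (A.catV.id (A.cat1.id (F.f0 a))))) =
        A.s1 (A.catV.id (A.cat1.id (F.f0 a))) := A.catV.t_id _
    refine (A.catV.id_comp _ h₂).symm.trans (A.catV.comp_congr ?_ rfl _ _)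
    rw [A.catV.s_id]
  | [], _ :: _, hlm, _, _, _, _, _, _ => absurd hlm (by simp)
  | _ :: _, [], hlm, _, _, _, _, _, _ => absurd hlm (by simp)
  | c :: l, d :: m, hlm, a, b, hl, hm, hz, h => by
    have hcd : c.tgt = d.src := (List.cons.inj hlm).1
    have hlm' : l.map Walk.tgt = m.map Walk.src := (List.cons.inj hlm).2
    have hdc : X.t0 d.src = X.t0 c.src := by
      rw [← hcd]; exact (X.isWalk_vert c.valid).2.symm
    have hm' : X.hor.IsWalk (X.t0 c.src) m b := hdc ▸ hm.2
    have e₁ : A.t0 (A.s1 (liftV F c)) = A.s0 (A.s1 (lift2 F ⟨X.t0 c.src, b, l, hl.2⟩)) := by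
      rw [t0_liftV]; exact (s0_lift2 F ⟨X.t0 c.src, b, l, hl.2⟩).symm
    have e₂ : A.t0 (A.s1 (liftV F d)) = A.s0 (A.s1 (lift2 F ⟨X.t0 c.src, b, m, hm'⟩)) := by
      rw [t0_liftV, hdc]; exact (s0_lift2 F ⟨X.t0 c.src, b, m, hm'⟩).symm
    have e₃ : A.t0 (A.s1 (liftV F (c.append d hcd))) =
        A.s0 (A.s1 (lift2 F ⟨X.t0 c.src, b, zipCols (G := X.vert) l m hlm', hz.2⟩)) := by
      rw [t0_liftV]; exact (s0_lift2 F ⟨X.t0 c.src, b, zipCols (G := X.vert) l m hlm', hz.2⟩).symm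
    have e₄ : A.t1 (lift2 F ⟨X.t0 c.src, b, l, hl.2⟩) =
        A.s1 (lift2 F ⟨X.t0 c.src, b, m, hm'⟩) := by
      rw [t1_lift2, s1_lift2]
      exact congrArg _ (Walk.ext rfl rfl hlm')
    have e₅ : A.t1 (liftV F c) = A.s1 (liftV F d) := by rw [t1_liftV, s1_liftV, hcd]
    have hc : lift2 F ⟨a, b, c :: l, hl⟩ = A.catH.comp (liftV F c) _ e₁ := by
      cases hl.1
      exact A.catH.eval_cons (G := X.hor) F.f0 (liftV F) (s0_liftV F) (t0_liftV F) c
        ⟨X.t0 c.src, b, l, hl.2⟩ rfl e₁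
    have hd : lift2 F ⟨a, b, d :: m, hm⟩ = A.catH.comp (liftV F d) _ e₂ := by
      cases hm.1
      exact A.catH.eval_cons (G := X.hor) F.f0 (liftV F) (s0_liftV F) (t0_liftV F) d
        ⟨X.t0 c.src, b, m, hm'⟩ hdc e₂
    have hz' : lift2 F ⟨a, b, zipCols (G := X.vert) (c :: l) (d :: m) hlm, hz⟩ =
        A.catH.comp (liftV F (c.append d hcd)) _ e₃ := by
      cases hz.1
      exact A.catH.eval_cons (G := X.hor) F.f0 (liftV F) (s0_liftV F) (t0_liftV F)
        (c.append d hcd) ⟨X.t0 c.src, b, zipCols (G := X.vert) l m hlm', hz.2⟩ rfl e₃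
    have hV : liftV F (c.append d hcd) = A.catV.comp (liftV F c) (liftV F d) e₅ :=
      A.catV.eval_append (G := X.vert) _ _ _ _ c d hcd e₅
    have ih := lift2_vcomp l m hlm' (X.t0 c.src) b hl.2 hm' hz.2 e₄
    have e₆ : A.t0 (A.s1 (A.catV.comp (liftV F c) (liftV F d) e₅)) = A.s0 (A.s1 (A.catV.comp
        (lift2 F ⟨X.t0 c.src, b, l, hl.2⟩) (lift2 F ⟨X.t0 c.src, b, m, hm'⟩) e₄)) := by
      rw [A.catV.s_comp, A.catV.s_comp, e₁]
    have e₇ : A.t1 (A.catH.comp (liftV F c) _ e₁) = A.s1 (A.catH.comp (liftV F d) _ e₂) := by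
      rw [← hc, ← hd, h]
    rw [hz', A.catV.comp_congr hc hd h e₇, ← A.interchange _ _ _ _ e₅ e₄ e₆]
    exact A.catH.comp_congr hV ih _ _

/-- The extension of a map of 2-globular sets to a 2-functor on the free 2-category. -/
def lift : X.free ⟶ A where
  toHom :=
    { f0 := F.f0
      f1 := lift1 F
      f2 := lift2 F
      s0 := A.cat1.s_eval _ _ _ _
      t0 := A.cat1.t_eval _ _ _ _
      s1 := s1_lift2 F
      t1 := t1_lift2 F }
  map_id _ := rfl
  map_comp p q h h' := A.cat1.eval_append (G := X.trunc) _ _ _ _ p q h h'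
  map_vid := lift2_id F
  map_vcomp := by
    rintro ⟨a, b, l, hl⟩ ⟨a', b', m, hm⟩ h h'
    have ha : a = a' := congrArg (Walk.src (G := X.trunc)) h
    have hb : b = b' := congrArg (Walk.tgt (G := X.trunc)) h
    subst ha hb
    exact lift2_vcomp F l m _ a b hl hm _ h'
  map_hcomp p q h h' := A.catH.eval_append (G := X.hor) _ _ _ _ p q h h'

theorem unit_lift : X.unit ≫ (lift F).toHom = F := by
  refine Glob2.Hom.ext rfl (funext fun e => A.cat1.eval_single (G := X.trunc) _ _ _ _ e)
    (funext fun x => ?_)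
  exact (A.catH.eval_single (G := X.hor) _ _ _ _ _).trans
    (A.catV.eval_single (G := X.vert) _ _ _ _ x)

end lift

theorem lift_unit {X : Glob2.{u}} {A : TwoCat.{u}} (H : X.free ⟶ A) :
    lift (X.unit ≫ H.toHom) = H := by
  have hV : ∀ c : Walk X.vert, H.toHom.f2 (Walk.single (G := X.hor) c) =
      liftV (X.unit ≫ H.toHom) c := by
    refine A.catV.eval_unique (G := X.vert) _ _ _ _
      (fun c => H.toHom.f2 (Walk.single (G := X.hor) c)) ?_ ?_ ?_ ?_
    · intro f
      exact H.map_vid (Walk.single (G := X.trunc) f)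
    · intro p q h h'
      have h₁ : X.free.t1 (Walk.single (G := X.hor) p) = X.free.s1 (Walk.single (G := X.hor) q) := by
        have hp := X.isWalk_vert p.valid
        refine Walk.ext ?_ ?_ (congrArg (fun x => [x]) h)
        · exact hp.1.trans (congrArg X.s0 h)
        · exact hp.2.trans (congrArg X.t0 h)
      refine Eq.trans (congrArg H.toHom.f2 ?_) (H.map_vcomp _ _ h₁ h')
      refine Walk.ext rfl ?_ rfl
      exact (X.isWalk_vert p.valid).2.trans (congrArg X.t0 h)
    · intro p
      refine (H.toHom.s1 _).trans (congrArg H.toHom.f1 ?_)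
      exact Walk.ext rfl rfl rfl
    · intro e
      rfl
  refine TwoCat.Hom.ext' (Glob2.Hom.ext rfl (funext fun p => ?_) (funext fun p => ?_))
  · exact (A.cat1.eval_unique (G := X.trunc) _ _ _ _ H.toHom.f1 H.map_id H.map_comp H.toHom.s0
      (fun _ => rfl) p).symm
  · refine (A.catH.eval_unique (G := X.hor) _ _ _ _ H.toHom.f2
      (fun a => ?_) H.map_hcomp (fun p => ?_) hV p).symm
    · refine (H.map_vid (Walk.nil (G := X.trunc) a)).trans ?_
      rw [A.catH_id]
      exact congrArg A.catV.id (H.map_id a)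
    · refine (congrArg A.s0 (H.toHom.s1 p)).trans (H.toHom.s0 _)

theorem free_hom_ext {X : Glob2.{u}} {A : TwoCat.{u}} {H K : X.free ⟶ A}
    (h : X.unit ≫ H.toHom = X.unit ≫ K.toHom) : H = K := by
  rw [← lift_unit H, h, lift_unit]

theorem lift_comp {X : Glob2.{u}} {A B : TwoCat.{u}} (F : X ⟶ A.toGlob2) (H : A ⟶ B) :
    lift F ≫ H = lift (F ≫ H.toHom) :=
  free_hom_ext ((Category.assoc X.unit (lift F).toHom H.toHom).symm.trans
    ((congrArg (· ≫ H.toHom) (unit_lift F)).trans (unit_lift (F ≫ H.toHom)).symm))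

/-- The free 2-category functor on morphisms. -/
def freeMap {X Y : Glob2.{u}} (f : X ⟶ Y) : X.free ⟶ Y.free := lift (A := Y.free) (f ≫ Y.unit)

theorem freeMap_lift {X Y : Glob2.{u}} {A : TwoCat.{u}} (f : X ⟶ Y) (F : Y ⟶ A.toGlob2) :
    freeMap f ≫ lift F = lift (f ≫ F) :=
  (lift_comp (A := Y.free) (f ≫ Y.unit) (lift F)).trans
    (congrArg lift ((Category.assoc f Y.unit (lift F).toHom).trans
      (congrArg (f ≫ ·) (unit_lift F))))

end Glob2

/-! ### Locally fully faithful 2-categories over a 2-category -/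

/-- A graph `G` with a map to the underlying graph of a 2-category `A`. -/
structure GData where
  G : Gph.{u}
  A : TwoCat.{u}
  φ0 : G.V → A.C0
  φ1 : G.E → A.C1
  hs : ∀ e, A.s0 (φ1 e) = φ0 (G.s e)
  ht : ∀ e, A.t0 (φ1 e) = φ0 (G.t e)

/-- The composite in `A` of a walk in `G`. -/
def GData.eval (D : GData.{u}) : Walk D.G → D.A.C1 := D.A.cat1.eval D.φ0 D.φ1 D.hs D.ht

/-- A morphism `(G, A) ⟶ (G', A')`: a functor between the free categories on `G` and `G'` and
a 2-functor `A ⟶ A'`, compatible with each other. -/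
@[ext] structure GData.Hom (D D' : GData.{u}) where
  f0 : D.G.V → D'.G.V
  f1 : D.G.E → Walk D'.G
  src : ∀ e, (f1 e).src = f0 (D.G.s e)
  tgt : ∀ e, (f1 e).tgt = f0 (D.G.t e)
  H : D.A ⟶ D'.A
  h0 : ∀ v, D'.φ0 (f0 v) = H.toHom.f0 (D.φ0 v)
  h1 : ∀ e, D'.eval (f1 e) = H.toHom.f1 (D.φ1 e)

def GData.Hom.walk {D D' : GData.{u}} (F : GData.Hom D D') : Walk D.G → Walk D'.G :=
  Walk.bind F.f0 F.f1 F.src F.tgt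

theorem TwoCat.Hom.map_eval {A B : TwoCat.{u}} (H : A ⟶ B) {G : Gph.{u}} (f : G.V → A.C0)
    (g : G.E → A.C1) (hs ht hs' ht') (p : Walk G) :
    H.toHom.f1 (A.cat1.eval f g hs ht p) =
      B.cat1.eval (fun a => H.toHom.f0 (f a)) (fun e => H.toHom.f1 (g e)) hs' ht' p :=
  A.cat1.map_eval f g hs ht B.cat1 H.toHom.f0 H.toHom.f1 H.toHom.s0 H.map_id H.map_comp p hs' ht'

theorem GData.Hom.eval_walk {D D' : GData.{u}} (F : GData.Hom D D') (p : Walk D.G) :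
    D'.eval (F.walk p) = F.H.toHom.f1 (D.eval p) := by
  have hs : ∀ e, D'.A.s0 (D'.eval (F.f1 e)) = D'.φ0 (F.f0 (D.G.s e)) := fun e => by
    rw [GData.eval, D'.A.cat1.s_eval, F.src]
  have ht : ∀ e, D'.A.t0 (D'.eval (F.f1 e)) = D'.φ0 (F.f0 (D.G.t e)) := fun e => by
    rw [GData.eval, D'.A.cat1.t_eval, F.tgt]
  have hs' : ∀ e, D'.A.s0 (F.H.toHom.f1 (D.φ1 e)) = F.H.toHom.f0 (D.φ0 (D.G.s e)) := fun e => by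
    rw [F.H.toHom.s0, D.hs]
  have ht' : ∀ e, D'.A.t0 (F.H.toHom.f1 (D.φ1 e)) = F.H.toHom.f0 (D.φ0 (D.G.t e)) := fun e => by
    rw [F.H.toHom.t0, D.ht]
  refine (D'.A.cat1.eval_bind D'.φ0 D'.φ1 D'.hs D'.ht F.f0 F.f1 F.src F.tgt p hs ht).trans ?_
  refine Eq.trans ?_ (F.H.map_eval D.φ0 D.φ1 D.hs D.ht hs' ht' p).symm
  exact D'.A.cat1.eval_congr _ _ hs ht (funext F.h0) (funext F.h1) hs' ht' p

theorem GData.eval_single (D : GData.{u}) (e : D.G.E) : D.eval (Walk.single e) = D.φ1 e :=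
  D.A.cat1.eval_single _ _ _ _ e

theorem Walk.bind_single {G K : Gph.{u}} (f : G.V → K.V) (g : G.E → Walk K)
    (hs : ∀ e, (g e).src = f (G.s e)) (ht : ∀ e, (g e).tgt = f (G.t e)) (e : G.E) :
    (Walk.single e).bind f g hs ht = g e :=
  Walk.ext (hs e).symm (ht e).symm (by simp [Walk.bind, Walk.single])

instance GData.category : Category.{u} GData.{u} where
  Hom := GData.Hom
  id D := ⟨fun v => v, Walk.single, fun _ => rfl, fun _ => rfl, 𝟙 D.A, fun _ => rfl, D.eval_single⟩
  comp F K :=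
    { f0 := fun v => K.f0 (F.f0 v)
      f1 := fun e => K.walk (F.f1 e)
      src := fun e => congrArg K.f0 (F.src e)
      tgt := fun e => congrArg K.f0 (F.tgt e)
      H := F.H ≫ K.H
      h0 := fun v => (K.h0 _).trans (congrArg K.H.toHom.f0 (F.h0 v))
      h1 := fun e => (K.eval_walk _).trans (congrArg K.H.toHom.f1 (F.h1 e)) }
  id_comp F := GData.Hom.ext rfl
    (funext fun e => Walk.bind_single F.f0 F.f1 F.src F.tgt e) rfl
  comp_id F := GData.Hom.ext rfl (funext fun e => Walk.ext rfl rfl (by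
    change List.flatMap (fun e => [e]) _ = _
    simp)) rfl
  assoc F K L := GData.Hom.ext rfl (funext fun e => Walk.ext rfl rfl (List.flatMap_assoc)) rfl

namespace GData

/-- A 2-cell from a walk to a parallel walk: a 2-cell of `A` between their composites. -/
@[ext] structure Cell (D : GData.{u}) where
  src : Walk D.G
  tgt : Walk D.G
  cell : D.A.C2
  src_src : src.src = tgt.src
  tgt_tgt : src.tgt = tgt.tgt
  hs : D.A.s1 cell = D.eval src
  ht : D.A.t1 cell = D.eval tgt

/-- The 2-globular set with vertices of `G` as objects, walks in `G` as 1-cells, and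
2-cells of `A` between the composites of parallel walks as 2-cells. -/
def cells : GData.{u} ⥤ Glob2.{u} where
  obj D :=
    { C0 := D.G.V
      C1 := Walk D.G
      C2 := D.Cell
      s0 := Walk.src
      t0 := Walk.tgt
      s1 := Cell.src
      t1 := Cell.tgt
      ss := Cell.src_src
      tt := Cell.tgt_tgt }
  map F :=
    { f0 := F.f0
      f1 := F.walk
      f2 := fun x => ⟨F.walk x.src, F.walk x.tgt, F.H.toHom.f2 x.cell, congrArg F.f0 x.src_src,
        congrArg F.f0 x.tgt_tgt, by rw [F.H.toHom.s1, x.hs, F.eval_walk],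
        by rw [F.H.toHom.t1, x.ht, F.eval_walk]⟩
      s0 := fun _ => rfl
      t0 := fun _ => rfl
      s1 := fun _ => rfl
      t1 := fun _ => rfl }
  map_id D := by
    have h : ∀ p : Walk D.G, (𝟙 D : GData.Hom D D).walk p = p := fun p =>
      Walk.ext rfl rfl (by change List.flatMap (fun e => [e]) _ = _; simp)
    exact Glob2.Hom.ext rfl (funext h) (funext fun x => Cell.ext (h _) (h _) rfl)
  map_comp F K := by
    have h : ∀ p, (F ≫ K : GData.Hom _ _).walk p = K.walk (F.walk p) := fun p =>
      Walk.ext rfl rfl List.flatMap_assoc.symm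
    exact Glob2.Hom.ext rfl (funext h) (funext fun x => Cell.ext (h _) (h _) rfl)

/-- The projection to the underlying 2-globular set of `A`. -/
def proj (D : GData.{u}) : cells.obj D ⟶ D.A.toGlob2 where
  f0 := D.φ0
  f1 := D.eval
  f2 := Cell.cell
  s0 := D.A.cat1.s_eval _ _ _ _
  t0 := D.A.cat1.t_eval _ _ _ _
  s1 x := x.hs
  t1 x := x.ht

/-- The graph of objects and 1-cells of `X`, mapped to the free 2-category on `X`. -/
def gen : Glob2.{u} ⥤ GData.{u} where
  obj X :=
    { G := X.trunc
      A := X.free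
      φ0 := fun a => a
      φ1 := Walk.single
      hs := fun _ => rfl
      ht := fun _ => rfl }
  map {X Y} f :=
    { f0 := f.f0
      f1 := fun e => Walk.single (G := Y.trunc) (f.f1 e)
      src := f.s0
      tgt := f.t0
      H := Glob2.freeMap f
      h0 := fun _ => rfl
      h1 := fun e => ((Walk.catOn Y.trunc).eval_single _ _ _ _ _).trans
        (congrFun (congrArg Glob2.Hom.f1 (Glob2.unit_lift (A := Y.free) (f ≫ Y.unit))) e).symm }
  map_id X := GData.Hom.ext rfl rfl (Glob2.lift_unit (𝟙 X.free))
  map_comp {X Y Z} f g := GData.Hom.ext rfl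
    (funext fun e => (Walk.bind_single (G := Y.trunc) (K := Z.trunc) g.f0
      (fun e => Walk.single (G := Z.trunc) (g.f1 e)) g.s0 g.t0 (f.f1 e)).symm)
    (Glob2.freeMap_lift (A := Z.free) f (g ≫ Z.unit)).symm

/-- A map to the 2-globular set of cells, as a morphism of `GData`. -/
def transpose {X : Glob2.{u}} {D : GData.{u}} (F : X ⟶ cells.obj D) : gen.obj X ⟶ D where
  f0 := F.f0
  f1 := F.f1
  src := F.s0
  tgt := F.t0
  H := Glob2.lift (F ≫ D.proj)
  h0 _ := rfl
  h1 e := (congrFun (congrArg Glob2.Hom.f1 (Glob2.unit_lift (F ≫ D.proj))) e).symm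

/-- The inverse of `transpose`. -/
def transposeInv {X : Glob2.{u}} {D : GData.{u}} (F : gen.obj X ⟶ D) : X ⟶ cells.obj D where
  f0 := F.f0
  f1 := F.f1
  f2 := fun x => ⟨F.f1 (X.s1 x), F.f1 (X.t1 x), F.H.toHom.f2 (X.unit.f2 x),
    (F.src _).trans ((congrArg F.f0 (X.ss x)).trans (F.src _).symm),
    (F.tgt _).trans ((congrArg F.f0 (X.tt x)).trans (F.tgt _).symm),
    (F.H.toHom.s1 _).trans (F.h1 (X.s1 x)).symm,
    (F.H.toHom.t1 _).trans ((congrArg F.H.toHom.f1 (X.unit.t1 x)).trans (F.h1 (X.t1 x)).symm)⟩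
  s0 := F.src
  t0 := F.tgt
  s1 := fun _ => rfl
  t1 := fun _ => rfl

theorem transposeInv_proj {X : Glob2.{u}} {D : GData.{u}} (F : gen.obj X ⟶ D) :
    transposeInv F ≫ D.proj = X.unit ≫ F.H.toHom :=
  Glob2.Hom.ext (funext F.h0) (funext F.h1) rfl

/-- The adjunction between the two constructions. -/
def adj : gen.{u} ⊣ cells.{u} :=
  Adjunction.mkOfHomEquiv
    { homEquiv := fun X D =>
        { toFun := transposeInv
          invFun := transpose
          left_inv := fun F => GData.Hom.ext rfl rfl
            ((congrArg Glob2.lift (transposeInv_proj F)).trans (Glob2.lift_unit F.H))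
          right_inv := fun F => Glob2.Hom.ext rfl rfl (funext fun x => Cell.ext (F.s1 x).symm
            (F.t1 x).symm (congrFun (congrArg Glob2.Hom.f2 (Glob2.unit_lift (F ≫ D.proj))) x)) }
      homEquiv_naturality_left_symm := fun {X Y D} f g => GData.Hom.ext rfl
        (funext fun e => (Walk.bind_single (G := Y.trunc) (K := D.G) g.f0 g.f1 g.s0 g.t0
          (f.f1 e)).symm) (Glob2.freeMap_lift f (g ≫ D.proj)).symm
      homEquiv_naturality_right := fun f g => Glob2.Hom.ext rfl rfl
        (funext fun x => Cell.ext rfl rfl rfl) }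

end GData

/-! ### Words in several variables -/

/-- The terminal 2-category. -/
def TwoCat.one : TwoCat.{u} where
  C0 := PUnit
  C1 := PUnit
  C2 := PUnit
  s0 _ := ⟨⟩
  t0 _ := ⟨⟩
  s1 _ := ⟨⟩
  t1 _ := ⟨⟩
  ss _ := rfl
  tt _ := rfl
  cat1 := ⟨fun _ => ⟨⟩, fun _ _ _ => ⟨⟩, fun _ => rfl, fun _ => rfl, fun _ _ _ => rfl,
    fun _ _ _ => rfl, fun _ _ => rfl, fun _ _ => rfl, fun _ _ _ _ _ _ _ => rfl⟩
  catV := ⟨fun _ => ⟨⟩, fun _ _ _ => ⟨⟩, fun _ => rfl, fun _ => rfl, fun _ _ _ => rfl,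
    fun _ _ _ => rfl, fun _ _ => rfl, fun _ _ => rfl, fun _ _ _ _ _ _ _ => rfl⟩
  catH := ⟨fun _ => ⟨⟩, fun _ _ _ => ⟨⟩, fun _ => rfl, fun _ => rfl, fun _ _ _ => rfl,
    fun _ _ _ => rfl, fun _ _ => rfl, fun _ _ => rfl, fun _ _ _ _ _ _ _ => rfl⟩
  catH_id _ := rfl
  s1_hcomp _ _ _ := rfl
  t1_hcomp _ _ _ _ := rfl
  hcomp_id _ _ _ _ := rfl
  interchange _ _ _ _ _ _ _ _ _ _ := rfl

/-- The product of two categories. -/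
def CatOn.prod {O M O' M' : Type u} {s t : M → O} {s' t' : M' → O'} (c : CatOn s t)
    (c' : CatOn s' t') : CatOn (fun x : M × M' => (s x.1, s' x.2)) (fun x => (t x.1, t' x.2)) where
  id a := (c.id a.1, c'.id a.2)
  comp f g h := (c.comp f.1 g.1 (congrArg Prod.fst h), c'.comp f.2 g.2 (congrArg Prod.snd h))
  s_id _ := Prod.ext (c.s_id _) (c'.s_id _)
  t_id _ := Prod.ext (c.t_id _) (c'.t_id _)
  s_comp _ _ _ := Prod.ext (c.s_comp _ _ _) (c'.s_comp _ _ _)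
  t_comp _ _ _ := Prod.ext (c.t_comp _ _ _) (c'.t_comp _ _ _)
  id_comp _ _ := Prod.ext (c.id_comp _ _) (c'.id_comp _ _)
  comp_id _ _ := Prod.ext (c.comp_id _ _) (c'.comp_id _ _)
  assoc _ _ _ _ _ _ _ := Prod.ext (c.assoc _ _ _ _ _ _ _) (c'.assoc _ _ _ _ _ _ _)

/-- The product of two 2-categories. -/
def TwoCat.prod (A B : TwoCat.{u}) : TwoCat.{u} where
  C0 := A.C0 × B.C0
  C1 := A.C1 × B.C1
  C2 := A.C2 × B.C2
  s0 x := (A.s0 x.1, B.s0 x.2)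
  t0 x := (A.t0 x.1, B.t0 x.2)
  s1 x := (A.s1 x.1, B.s1 x.2)
  t1 x := (A.t1 x.1, B.t1 x.2)
  ss _ := Prod.ext (A.ss _) (B.ss _)
  tt _ := Prod.ext (A.tt _) (B.tt _)
  cat1 := A.cat1.prod B.cat1
  catV := A.catV.prod B.catV
  catH := A.catH.prod B.catH
  catH_id _ := Prod.ext (A.catH_id _) (B.catH_id _)
  s1_hcomp _ _ _ := Prod.ext (A.s1_hcomp _ _ _) (B.s1_hcomp _ _ _)
  t1_hcomp _ _ _ h' := Prod.ext (A.t1_hcomp _ _ _ (congrArg Prod.fst h'))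
    (B.t1_hcomp _ _ _ (congrArg Prod.snd h'))
  hcomp_id _ _ h _ := Prod.ext (A.hcomp_id _ _ (congrArg Prod.fst h) _)
    (B.hcomp_id _ _ (congrArg Prod.snd h) _)
  interchange _ _ _ _ hx hy _ h₁ h₂ _ :=
    Prod.ext (A.interchange _ _ _ _ (congrArg Prod.fst hx) (congrArg Prod.fst hy) _
      (congrArg Prod.fst h₁) (congrArg Prod.fst h₂) _)
      (B.interchange _ _ _ _ (congrArg Prod.snd hx) (congrArg Prod.snd hy) _
        (congrArg Prod.snd h₁) (congrArg Prod.snd h₂) _)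

/-- The product of two 2-functors. -/
def TwoCat.prodMap {A B A' B' : TwoCat.{u}} (F : A ⟶ A') (K : B ⟶ B') : A.prod B ⟶ A'.prod B' where
  toHom :=
    { f0 := fun x => (F.toHom.f0 x.1, K.toHom.f0 x.2)
      f1 := fun x => (F.toHom.f1 x.1, K.toHom.f1 x.2)
      f2 := fun x => (F.toHom.f2 x.1, K.toHom.f2 x.2)
      s0 := fun _ => Prod.ext (F.toHom.s0 _) (K.toHom.s0 _)
      t0 := fun _ => Prod.ext (F.toHom.t0 _) (K.toHom.t0 _)
      s1 := fun _ => Prod.ext (F.toHom.s1 _) (K.toHom.s1 _)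
      t1 := fun _ => Prod.ext (F.toHom.t1 _) (K.toHom.t1 _) }
  map_id _ := Prod.ext (F.map_id _) (K.map_id _)
  map_comp _ _ _ h' := Prod.ext (F.map_comp _ _ _ (congrArg Prod.fst h'))
    (K.map_comp _ _ _ (congrArg Prod.snd h'))
  map_vid _ := Prod.ext (F.map_vid _) (K.map_vid _)
  map_vcomp _ _ _ h' := Prod.ext (F.map_vcomp _ _ _ (congrArg Prod.fst h'))
    (K.map_vcomp _ _ _ (congrArg Prod.snd h'))
  map_hcomp _ _ _ h' := Prod.ext (F.map_hcomp _ _ _ (congrArg Prod.fst h'))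
    (K.map_hcomp _ _ _ (congrArg Prod.snd h'))

/-- The associator of the product of 2-categories. -/
def TwoCat.assocHom (A B C : TwoCat.{u}) : (A.prod B).prod C ⟶ A.prod (B.prod C) where
  toHom := ⟨fun x => (x.1.1, x.1.2, x.2), fun x => (x.1.1, x.1.2, x.2),
    fun x => (x.1.1, x.1.2, x.2), fun _ => rfl, fun _ => rfl, fun _ => rfl, fun _ => rfl⟩
  map_id _ := rfl
  map_comp _ _ _ _ := rfl
  map_vid _ := rfl
  map_vcomp _ _ _ _ := rfl
  map_hcomp _ _ _ _ := rfl

def TwoCat.assocInv (A B C : TwoCat.{u}) : A.prod (B.prod C) ⟶ (A.prod B).prod C where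
  toHom := ⟨fun x => ((x.1, x.2.1), x.2.2), fun x => ((x.1, x.2.1), x.2.2),
    fun x => ((x.1, x.2.1), x.2.2), fun _ => rfl, fun _ => rfl, fun _ => rfl, fun _ => rfl⟩
  map_id _ := rfl
  map_comp _ _ _ _ := rfl
  map_vid _ := rfl
  map_vcomp _ _ _ _ := rfl
  map_hcomp _ _ _ _ := rfl

def TwoCat.sndHom (A B : TwoCat.{u}) : A.prod B ⟶ B where
  toHom := ⟨Prod.snd, Prod.snd, Prod.snd, fun _ => rfl, fun _ => rfl, fun _ => rfl, fun _ => rfl⟩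
  map_id _ := rfl
  map_comp _ _ _ _ := rfl
  map_vid _ := rfl
  map_vcomp _ _ _ _ := rfl
  map_hcomp _ _ _ _ := rfl

def TwoCat.fstHom (A B : TwoCat.{u}) : A.prod B ⟶ A where
  toHom := ⟨Prod.fst, Prod.fst, Prod.fst, fun _ => rfl, fun _ => rfl, fun _ => rfl, fun _ => rfl⟩
  map_id _ := rfl
  map_comp _ _ _ _ := rfl
  map_vid _ := rfl
  map_vcomp _ _ _ _ := rfl
  map_hcomp _ _ _ _ := rfl

def TwoCat.oneProd (A : TwoCat.{u}) : A ⟶ TwoCat.one.prod A where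
  toHom := ⟨fun x => (⟨⟩, x), fun x => (⟨⟩, x), fun x => (⟨⟩, x), fun _ => rfl, fun _ => rfl,
    fun _ => rfl, fun _ => rfl⟩
  map_id _ := rfl
  map_comp _ _ _ _ := rfl
  map_vid _ := rfl
  map_vcomp _ _ _ _ := rfl
  map_hcomp _ _ _ _ := rfl

def TwoCat.prodOne (A : TwoCat.{u}) : A ⟶ A.prod TwoCat.one where
  toHom := ⟨fun x => (x, ⟨⟩), fun x => (x, ⟨⟩), fun x => (x, ⟨⟩), fun _ => rfl, fun _ => rfl,
    fun _ => rfl, fun _ => rfl⟩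
  map_id _ := rfl
  map_comp _ _ _ _ := rfl
  map_vid _ := rfl
  map_vcomp _ _ _ _ := rfl
  map_hcomp _ _ _ _ := rfl

/-- The box product of graphs: an edge is an edge in one coordinate and a vertex in the other. -/
def Gph.box (G K : Gph.{u}) : Gph.{u} where
  V := G.V × K.V
  E := (G.E × K.V) ⊕ (G.V × K.E)
  s := Sum.elim (fun e => (G.s e.1, e.2)) (fun e => (e.1, K.s e.2))
  t := Sum.elim (fun e => (G.t e.1, e.2)) (fun e => (e.1, K.t e.2))

namespace GData

/-- The box product of the graphs, mapped to the product of the 2-categories. -/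
def box (D D' : GData.{u}) : GData.{u} where
  G := D.G.box D'.G
  A := D.A.prod D'.A
  φ0 v := (D.φ0 v.1, D'.φ0 v.2)
  φ1 := Sum.elim (fun e => (D.φ1 e.1, D'.A.cat1.id (D'.φ0 e.2)))
    (fun e => (D.A.cat1.id (D.φ0 e.1), D'.φ1 e.2))
  hs := by
    rintro (e | e)
    · exact Prod.ext (D.hs _) (D'.A.cat1.s_id _)
    · exact Prod.ext (D.A.cat1.s_id _) (D'.hs _)
  ht := by
    rintro (e | e)
    · exact Prod.ext (D.ht _) (D'.A.cat1.t_id _)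
    · exact Prod.ext (D.A.cat1.t_id _) (D'.ht _)

def one : GData.{u} where
  G := ⟨PUnit, PEmpty, PEmpty.elim, PEmpty.elim⟩
  A := TwoCat.one
  φ0 v := v
  φ1 := PEmpty.elim
  hs e := e.elim
  ht e := e.elim

variable {D D' K K' : GData.{u}}

/-- A walk in the first coordinate. -/
def inl (w : D'.G.V) (p : Walk D.G) : Walk (D.box D').G :=
  p.map (K := (D.box D').G) (fun v => (v, w)) (fun e => Sum.inl (e, w)) (fun _ => rfl) (fun _ => rfl)

/-- A walk in the second coordinate. -/
def inr (v : D.G.V) (p : Walk D'.G) : Walk (D.box D').G :=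
  p.map (K := (D.box D').G) (fun w => (v, w)) (fun e => Sum.inr (v, e)) (fun _ => rfl) (fun _ => rfl)

theorem eval_inl (w : D'.G.V) (p : Walk D.G) :
    (D.box D').eval (inl w p) = (D.eval p, D'.A.cat1.id (D'.φ0 w)) := by
  have hs : ∀ e, (D.A.prod D'.A).s0 ((D.box D').φ1 (Sum.inl (e, w))) = (D.φ0 (D.G.s e), D'.φ0 w) :=
    fun e => (D.box D').hs (Sum.inl (e, w))
  have ht : ∀ e, (D.A.prod D'.A).t0 ((D.box D').φ1 (Sum.inl (e, w))) = (D.φ0 (D.G.t e), D'.φ0 w) :=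
    fun e => (D.box D').ht (Sum.inl (e, w))
  refine ((D.box D').A.cat1.eval_map (D.box D').φ0 (D.box D').φ1 (D.box D').hs (D.box D').ht
    (fun v => (v, w)) (fun e => Sum.inl (e, w)) (fun _ => rfl) (fun _ => rfl) p hs ht).trans
    ((D.box D').A.cat1.eval_unique _ _ hs ht
      (fun p => (D.eval p, D'.A.cat1.id (D'.φ0 w))) (fun _ => rfl) ?_ ?_ ?_ p).symm
  · intro p q h h'
    refine Prod.ext (D.A.cat1.eval_append _ _ _ _ p q h _) ?_
    have h₀ : D'.A.t0 (D'.A.cat1.id (D'.φ0 w)) = D'.A.s0 (D'.A.cat1.id (D'.A.t0 (D'.A.cat1.id (D'.φ0 w)))) :=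
      (D'.A.cat1.s_id _).symm
    refine (D'.A.cat1.comp_id _ h₀).symm.trans (D'.A.cat1.comp_congr rfl ?_ _ _)
    rw [D'.A.cat1.t_id]
  · intro p
    exact Prod.ext (D.A.cat1.s_eval _ _ _ _ p) (D'.A.cat1.s_id _)
  · intro e
    exact Prod.ext (D.eval_single e) rfl

theorem eval_inr (v : D.G.V) (p : Walk D'.G) :
    (D.box D').eval (inr v p) = (D.A.cat1.id (D.φ0 v), D'.eval p) := by
  have hs : ∀ e, (D.A.prod D'.A).s0 ((D.box D').φ1 (Sum.inr (v, e))) = (D.φ0 v, D'.φ0 (D'.G.s e)) :=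
    fun e => (D.box D').hs (Sum.inr (v, e))
  have ht : ∀ e, (D.A.prod D'.A).t0 ((D.box D').φ1 (Sum.inr (v, e))) = (D.φ0 v, D'.φ0 (D'.G.t e)) :=
    fun e => (D.box D').ht (Sum.inr (v, e))
  refine ((D.box D').A.cat1.eval_map (D.box D').φ0 (D.box D').φ1 (D.box D').hs (D.box D').ht
    (fun w => (v, w)) (fun e => Sum.inr (v, e)) (fun _ => rfl) (fun _ => rfl) p hs ht).trans
    ((D.box D').A.cat1.eval_unique _ _ hs ht
      (fun p => (D.A.cat1.id (D.φ0 v), D'.eval p)) (fun _ => rfl) ?_ ?_ ?_ p).symm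
  · intro p q h h'
    refine Prod.ext ?_ (D'.A.cat1.eval_append _ _ _ _ p q h _)
    have h₀ : D.A.t0 (D.A.cat1.id (D.φ0 v)) = D.A.s0 (D.A.cat1.id (D.A.t0 (D.A.cat1.id (D.φ0 v)))) :=
      (D.A.cat1.s_id _).symm
    refine (D.A.cat1.comp_id _ h₀).symm.trans (D.A.cat1.comp_congr rfl ?_ _ _)
    rw [D.A.cat1.t_id]
  · intro p
    exact Prod.ext (D.A.cat1.s_id _) (D'.A.cat1.s_eval _ _ _ _ p)
  · intro e
    exact Prod.ext rfl (D'.eval_single e)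

def boxHom (F : D ⟶ K) (F' : D' ⟶ K') : D.box D' ⟶ K.box K' where
  f0 v := (F.f0 v.1, F'.f0 v.2)
  f1 := Sum.elim (fun e => inl (F'.f0 e.2) (F.f1 e.1)) (fun e => inr (F.f0 e.1) (F'.f1 e.2))
  src := by
    rintro (e | e)
    · exact Prod.ext (F.src _) rfl
    · exact Prod.ext rfl (F'.src _)
  tgt := by
    rintro (e | e)
    · exact Prod.ext (F.tgt _) rfl
    · exact Prod.ext rfl (F'.tgt _)
  H := TwoCat.prodMap F.H F'.H
  h0 v := Prod.ext (F.h0 _) (F'.h0 _)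
  h1 := by
    rintro (e | e)
    · refine (eval_inl _ _).trans (Prod.ext (F.h1 _) ?_)
      exact (congrArg K'.A.cat1.id (F'.h0 _)).trans (F'.H.map_id _).symm
    · refine (eval_inr _ _).trans (Prod.ext ?_ (F'.h1 _))
      exact (congrArg K.A.cat1.id (F.h0 _)).trans (F.H.map_id _).symm

/-- A morphism sending edges to edges. -/
def ofGph (f : D.G.V → K.G.V) (g : D.G.E → K.G.E) (hs : ∀ e, K.G.s (g e) = f (D.G.s e))
    (ht : ∀ e, K.G.t (g e) = f (D.G.t e)) (H : D.A ⟶ K.A)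
    (h0 : ∀ v, K.φ0 (f v) = H.toHom.f0 (D.φ0 v)) (h1 : ∀ e, K.φ1 (g e) = H.toHom.f1 (D.φ1 e)) :
    D ⟶ K where
  f0 := f
  f1 e := Walk.single (g e)
  src := hs
  tgt := ht
  H := H
  h0 := h0
  h1 e := (K.eval_single _).trans (h1 e)

theorem flatMap_map_aux {α β γ δ : Type u} (f : α → β) (g : β → List γ) (h : α → List δ) (k : δ → γ)
    {l : List α} (H : ∀ a, g (f a) = (h a).map k) : (l.map f).flatMap g = (l.flatMap h).map k := by
  induction l with
  | nil => rfl
  | cons a l ih => rw [List.map_cons, List.flatMap_cons, List.flatMap_cons, List.map_append, ih, H]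

theorem walk_inl (F : D ⟶ K) (F' : D' ⟶ K') (w : D'.G.V) (p : Walk D.G) :
    (boxHom F F').walk (inl w p) = inl (F'.f0 w) (F.walk p) :=
  Walk.ext rfl rfl (by
    exact (flatMap_map_aux _ _ _ _ fun _ => rfl))

theorem walk_inr (F : D ⟶ K) (F' : D' ⟶ K') (v : D.G.V) (p : Walk D'.G) :
    (boxHom F F').walk (inr v p) = inr (F.f0 v) (F'.walk p) :=
  Walk.ext rfl rfl (by
    exact (flatMap_map_aux _ _ _ _ fun _ => rfl))

theorem boxHom_id : boxHom (𝟙 D) (𝟙 D') = 𝟙 (D.box D') :=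
  GData.Hom.ext rfl (funext (by rintro (e | e) <;> rfl)) rfl

theorem boxHom_comp {L L' : GData.{u}} (F : D ⟶ K) (F' : D' ⟶ K') (F₂ : K ⟶ L) (F₂' : K' ⟶ L') :
    boxHom (F ≫ F₂) (F' ≫ F₂') = boxHom F F' ≫ boxHom F₂ F₂' :=
  GData.Hom.ext rfl (funext (by
    rintro (e | e)
    · exact (walk_inl F₂ F₂' _ _).symm
    · exact (walk_inr F₂ F₂' _ _).symm)) rfl

def boxAssoc (D D' D'' : GData.{u}) : (D.box D').box D'' ≅ D.box (D'.box D'') where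
  hom := ofGph (D := (D.box D').box D'') (K := D.box (D'.box D''))
    (fun v => (v.1.1, v.1.2, v.2))
    (Sum.elim (fun e => Sum.elim (fun e' => Sum.inl (e'.1, e'.2, e.2))
      (fun e' => Sum.inr (e'.1, Sum.inl (e'.2, e.2))) e.1)
      (fun e => Sum.inr (e.1.1, Sum.inr (e.1.2, e.2))))
    (by rintro (⟨e | e, _⟩ | e) <;> rfl) (by rintro (⟨e | e, _⟩ | e) <;> rfl)
    (TwoCat.assocHom _ _ _) (fun _ => rfl) (by rintro (⟨e | e, _⟩ | e) <;> rfl)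
  inv := ofGph (D := D.box (D'.box D'')) (K := (D.box D').box D'')
    (fun v => ((v.1, v.2.1), v.2.2))
    (Sum.elim (fun e => Sum.inl (Sum.inl (e.1, e.2.1), e.2.2))
      (fun e => Sum.elim (fun e' => Sum.inl (Sum.inr (e.1, e'.1), e'.2))
        (fun e' => Sum.inr ((e.1, e'.1), e'.2)) e.2))
    (by rintro (e | ⟨_, e | e⟩) <;> rfl) (by rintro (e | ⟨_, e | e⟩) <;> rfl)
    (TwoCat.assocInv _ _ _) (fun _ => rfl) (by rintro (e | ⟨_, e | e⟩) <;> rfl)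
  hom_inv_id := GData.Hom.ext rfl (funext (by rintro (⟨e | e, _⟩ | e) <;> rfl)) rfl
  inv_hom_id := GData.Hom.ext rfl (funext (by rintro (e | ⟨_, e | e⟩) <;> rfl)) rfl

def boxLeft (D : GData.{u}) : one.box D ≅ D where
  hom := ofGph (D := one.box D) (K := D) (fun v => v.2)
    (Sum.elim (fun e => e.1.elim) (fun e => e.2))
    (by rintro (⟨⟨⟩, _⟩ | e); rfl) (by rintro (⟨⟨⟩, _⟩ | e); rfl)
    (TwoCat.sndHom _ _) (fun _ => rfl) (by rintro (⟨⟨⟩, _⟩ | e); rfl)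
  inv := ofGph (D := D) (K := one.box D) (fun v => (⟨⟩, v)) (fun e => Sum.inr (⟨⟩, e))
    (fun _ => rfl) (fun _ => rfl) (TwoCat.oneProd _) (fun _ => rfl) (fun _ => rfl)
  hom_inv_id := GData.Hom.ext rfl (funext (by rintro (⟨⟨⟩, _⟩ | e); rfl)) rfl
  inv_hom_id := GData.Hom.ext rfl rfl rfl

def boxRight (D : GData.{u}) : D.box one ≅ D where
  hom := ofGph (D := D.box one) (K := D) (fun v => v.1)
    (Sum.elim (fun e => e.1) (fun e => e.2.elim))
    (by rintro (e | ⟨_, ⟨⟩⟩); rfl) (by rintro (e | ⟨_, ⟨⟩⟩); rfl)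
    (TwoCat.fstHom _ _) (fun _ => rfl) (by rintro (e | ⟨_, ⟨⟩⟩); rfl)
  inv := ofGph (D := D) (K := D.box one) (fun v => (v, ⟨⟩)) (fun e => Sum.inl (e, ⟨⟩))
    (fun _ => rfl) (fun _ => rfl) (TwoCat.prodOne _) (fun _ => rfl) (fun _ => rfl)
  hom_inv_id := GData.Hom.ext rfl (funext (by rintro (e | ⟨_, ⟨⟩⟩); rfl)) rfl
  inv_hom_id := GData.Hom.ext rfl rfl rfl

theorem comp_ofGph_f1 {L : GData.{u}} (F : D ⟶ K) (F' : K ⟶ L) (g : K.G.E → L.G.E)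
    (hs : ∀ e, L.G.s (g e) = F'.f0 (K.G.s e)) (ht : ∀ e, L.G.t (g e) = F'.f0 (K.G.t e))
    (hg : ∀ e, F'.f1 e = Walk.single (g e)) (e : D.G.E) :
    (F ≫ F').f1 e = (F.f1 e).map F'.f0 g hs ht := by
  refine Walk.ext rfl rfl ?_
  change List.flatMap (fun e => (F'.f1 e).edges) (F.f1 e).edges = List.map g (F.f1 e).edges
  induction (F.f1 e).edges with
  | nil => rfl
  | cons a l ih => rw [List.flatMap_cons, ih, hg]; rfl

theorem ofGph_comp_f1 {L : GData.{u}} (F' : D ⟶ K) (F : K ⟶ L) (g : D.G.E → K.G.E)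
    (hg : ∀ e, F'.f1 e = Walk.single (g e)) (e : D.G.E) : (F' ≫ F).f1 e = F.f1 (g e) := by
  change F.walk (F'.f1 e) = _
  rw [hg]
  exact Walk.bind_single F.f0 F.f1 F.src F.tgt (g e)

theorem boxAssoc_natural {D'' K'' : GData.{u}} (f₁ : D ⟶ K) (f₂ : D' ⟶ K') (f₃ : D'' ⟶ K'') :
    boxHom (boxHom f₁ f₂) f₃ ≫ (boxAssoc K K' K'').hom =
      (boxAssoc D D' D'').hom ≫ boxHom f₁ (boxHom f₂ f₃) := by
  refine GData.Hom.ext rfl (funext fun e => ?_) rfl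
  refine (comp_ofGph_f1 _ (boxAssoc K K' K'').hom _ (by rintro (⟨e | e, _⟩ | e) <;> rfl) (by rintro (⟨e | e, _⟩ | e) <;> rfl) (fun _ => rfl) e).trans
    (Eq.trans ?_ (ofGph_comp_f1 (boxAssoc D D' D'').hom _ _ (fun _ => rfl) e).symm)
  obtain ⟨e | e, v⟩ | e := e
  · exact Walk.ext rfl rfl (by
      change List.map _ (List.map _ (List.map _ _)) = List.map _ _
      induction (f₁.f1 e.1).edges with
      | nil => rfl
      | cons a l ih => exact congrArg₂ List.cons rfl ih)
  · exact Walk.ext rfl rfl (by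
      change List.map _ (List.map _ (List.map _ _)) = List.map _ (List.map _ _)
      induction (f₂.f1 e.2).edges with
      | nil => rfl
      | cons a l ih => exact congrArg₂ List.cons rfl ih)
  · exact Walk.ext rfl rfl (by
      change List.map _ (List.map _ _) = List.map _ (List.map _ _)
      induction (f₃.f1 e.2).edges with
      | nil => rfl
      | cons a l ih => exact congrArg₂ List.cons rfl ih)

theorem boxLeft_natural (f : D ⟶ K) :
    boxHom (𝟙 one) f ≫ (boxLeft K).hom = (boxLeft D).hom ≫ f := by
  refine GData.Hom.ext rfl (funext fun e => ?_) rfl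
  obtain e | e := e
  · exact e.1.elim
  · refine (comp_ofGph_f1 _ (boxLeft K).hom _ (by rintro (⟨⟨⟩, _⟩ | e); rfl) (by rintro (⟨⟨⟩, _⟩ | e); rfl) (fun _ => rfl) _).trans
      (Eq.trans ?_ (ofGph_comp_f1 (boxLeft D).hom _ _ (fun _ => rfl) _).symm)
    exact Walk.ext rfl rfl (List.map_map.trans (List.map_id _))

theorem boxRight_natural (f : D ⟶ K) :
    boxHom f (𝟙 one) ≫ (boxRight K).hom = (boxRight D).hom ≫ f := by
  refine GData.Hom.ext rfl (funext fun e => ?_) rfl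
  obtain e | e := e
  · refine (comp_ofGph_f1 _ (boxRight K).hom _ (by rintro (e | ⟨_, ⟨⟩⟩); rfl) (by rintro (e | ⟨_, ⟨⟩⟩); rfl) (fun _ => rfl) _).trans
      (Eq.trans ?_ (ofGph_comp_f1 (boxRight D).hom _ _ (fun _ => rfl) _).symm)
    exact Walk.ext rfl rfl (List.map_map.trans (List.map_id _))
  · exact e.2.elim

instance : MonoidalCategoryStruct GData.{u} where
  tensorObj := box
  whiskerLeft D _ _ F := boxHom (𝟙 D) F
  whiskerRight F D := boxHom F (𝟙 D)
  tensorHom := boxHom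
  tensorUnit := one
  associator := boxAssoc
  leftUnitor := boxLeft
  rightUnitor := boxRight

instance : MonoidalCategory GData.{u} := MonoidalCategory.ofTensorHom
  (id_tensorHom_id := fun _ _ => boxHom_id)
  (id_tensorHom := fun _ _ _ _ => rfl)
  (tensorHom_id := fun _ _ => rfl)
  (tensorHom_comp_tensorHom := fun _ _ _ _ => (boxHom_comp _ _ _ _).symm)
  (associator_naturality := fun f₁ f₂ f₃ => boxAssoc_natural f₁ f₂ f₃)
  (leftUnitor_naturality := fun f => boxLeft_natural f)
  (rightUnitor_naturality := fun f => boxRight_natural f)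
  (pentagon := fun W X Y Z => by
    refine GData.Hom.ext rfl (funext ?_) rfl
    rintro (⟨⟨e | e, _⟩ | e, _⟩ | e) <;> rfl)
  (triangle := fun X Y => by
    refine GData.Hom.ext rfl (funext ?_) rfl
    rintro (⟨e | ⟨_, ⟨⟩⟩, _⟩ | e) <;> rfl)

end GData

/-! ### The operad for Gray categories -/

namespace TwoCat

instance : MonoidalCategoryStruct TwoCat.{u} where
  tensorObj := prod
  whiskerLeft A _ _ F := prodMap (𝟙 A) F
  whiskerRight F A := prodMap F (𝟙 A)
  tensorHom := prodMap
  tensorUnit := one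
  associator A B C := ⟨assocHom A B C, assocInv A B C, rfl, rfl⟩
  leftUnitor A := ⟨sndHom one A, oneProd A, rfl, rfl⟩
  rightUnitor A := ⟨fstHom A one, prodOne A, rfl, rfl⟩

/-- The cartesian monoidal structure on `2-Cat`. -/
instance : MonoidalCategory TwoCat.{u} := MonoidalCategory.ofTensorHom
  (id_tensorHom_id := fun _ _ => rfl)
  (id_tensorHom := fun _ _ _ _ => rfl)
  (tensorHom_id := fun _ _ => rfl)
  (tensorHom_comp_tensorHom := fun _ _ _ _ => rfl)
  (associator_naturality := fun _ _ _ => rfl)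
  (leftUnitor_naturality := fun _ => rfl)
  (rightUnitor_naturality := fun _ => rfl)
  (pentagon := fun _ _ _ _ => rfl)
  (triangle := fun _ _ => rfl)

/-- The free 2-category functor. -/
def freeFunctor : Glob2.{u} ⥤ TwoCat.{u} where
  obj := Glob2.free
  map f := Glob2.freeMap f
  map_id X := Glob2.lift_unit (𝟙 X.free)
  map_comp {X Y Z} f g := (Glob2.freeMap_lift (A := Z.free) f (g ≫ Z.unit)).symm

/-- The free 2-category functor is left adjoint to the forgetful functor. -/
def freeAdj : freeFunctor.{u} ⊣ forget.{u} :=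
  Adjunction.mkOfHomEquiv
    { homEquiv := fun X A =>
        { toFun := fun H => X.unit ≫ H.toHom
          invFun := fun F => Glob2.lift (A := A) F
          left_inv := fun H => Glob2.lift_unit H
          right_inv := fun F => Glob2.unit_lift (A := A) F }
      homEquiv_naturality_left_symm := fun {X Y A} f g =>
        (Glob2.freeMap_lift (A := A) f g).symm
      homEquiv_naturality_right := fun f g => rfl }

end TwoCat

/-- Assemble a family of morphisms `E (X_1, …, X_n) ⟶ F (X_1, …, X_n)`. -/
def betweenHom {V : Type u} [Category.{v} V] (E F : List V ⥤ V)
    (φ : ∀ L : List V, E.obj L ⟶ F.obj L) : ∀ LL : List (List V), LL.map E.obj ⟶ LL.map F.obj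
  | [] => 𝟙 []
  | L :: LL => consHom (φ L) (betweenHom E F φ LL)

/-- A cartesian morphism of multitensors. -/
structure CartesianHom {V : Type u} [Category.{v} V] (E F : Multitensor V) where
  φ : ∀ L : List V, E.E.obj L ⟶ F.E.obj L
  cartesian : ∀ {L M : List V} (f : L ⟶ M), IsPullback (φ L) (E.E.map f) (F.E.map f) (φ M)
  unit : ∀ X : V, E.η X ≫ φ [X] = F.η X
  subst : ∀ (LL : List (List V)) (L : List V) (h : LL.flatten = L),
    E.E.map (betweenHom E.E F.E φ LL) ≫ φ (LL.map F.E.obj) ≫ F.σ LL L h = E.σ LL L h ≫ φ L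

/-- The multitensor `T_{≤2}^×` on 2-globular sets, with
`T_{≤2}^× (X_1, …, X_n) = T_{≤2} X_1 × ⋯ × T_{≤2} X_n`, where `T_{≤2}` is the monad for
2-categories. Enriched categories for it are 3-categories, and a multitensor with a cartesian
morphism to it corresponds to a (normalised) `T_{≤3}`-operad. -/
def prodFree : Multitensor Glob2.{u} := Multitensor.ofAdjunction TwoCat.freeAdj

/-- The multitensor on 2-globular sets corresponding to the `T_{≤3}`-operad for Gray categories.
An object of `E (X_1, …, X_n)` is a tuple of objects of the `X_i`. A 1-cell is a shuffle of paths of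
1-cells in the `X_i`, i.e. a walk in the graph whose edges are a 1-cell in one coordinate and
an object in the others. A 2-cell between two parallel shuffles is a tuple of 2-cells of the free
2-categories on the `X_i` (i.e. of pasting diagrams) between the underlying paths: over each
pasting diagram of a 3-category there is exactly one operation of top dimension between any
two parallel lower dimensional ones. -/
def grayE : Multitensor Glob2.{u} := Multitensor.ofAdjunction GData.adj

/-! ### The Gray tensor product -/

/-- A cubical functor of two variables (a quasi-functor with invertible constraints)
`A, B ⟶ C`, the notion which the (pseudo) Gray tensor product represents: functors
`F (-, b) : A ⟶ C` and `F (a, -) : B ⟶ C` agreeing on objects, and invertible 2-cells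
`γ f g : F (f, b) ; F (a', g) ⟶ F (a, g) ; F (f, b')` for `f : a ⟶ a'` and `g : b ⟶ b'`, which are
functorial and natural in `f` and in `g`. -/
structure Cubical (A B C : TwoCat.{u}) where
  /-- `F (-, b)` -/
  left : B.C0 → (A ⟶ C)
  /-- `F (a, -)` -/
  right : A.C0 → (B ⟶ C)
  agree : ∀ a b, (left b).toHom.f0 a = (right a).toHom.f0 b
  γ : A.C1 → B.C1 → C.C2
  s1_γ : ∀ f g h, C.s1 (γ f g) =
    C.cat1.comp ((left (B.s0 g)).toHom.f1 f) ((right (A.t0 f)).toHom.f1 g) h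
  t1_γ : ∀ f g h, C.t1 (γ f g) =
    C.cat1.comp ((right (A.s0 f)).toHom.f1 g) ((left (B.t0 g)).toHom.f1 f) h
  invertible : ∀ f g, ∃ δ h h', C.catV.comp (γ f g) δ h = C.catV.id (C.s1 (γ f g)) ∧
    C.catV.comp δ (γ f g) h' = C.catV.id (C.t1 (γ f g))
  γ_id_left : ∀ a g, γ (A.cat1.id a) g = C.catV.id ((right a).toHom.f1 g)
  γ_id_right : ∀ f b, γ f (B.cat1.id b) = C.catV.id ((left b).toHom.f1 f)
  γ_comp_left : ∀ f f' g h h₁ h₂ h₃, γ (A.cat1.comp f f' h) g =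
    C.catV.comp (C.catH.comp (C.catV.id ((left (B.s0 g)).toHom.f1 f)) (γ f' g) h₁)
      (C.catH.comp (γ f g) (C.catV.id ((left (B.t0 g)).toHom.f1 f')) h₂) h₃
  γ_comp_right : ∀ f g g' h h₁ h₂ h₃, γ f (B.cat1.comp g g' h) =
    C.catV.comp (C.catH.comp (γ f g) (C.catV.id ((right (A.t0 f)).toHom.f1 g')) h₁)
      (C.catH.comp (C.catV.id ((right (A.s0 f)).toHom.f1 g)) (γ f g') h₂) h₃
  γ_natural_left : ∀ α g h₁ h₂ h₃ h₄,
    C.catV.comp (C.catH.comp ((left (B.s0 g)).toHom.f2 α)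
        (C.catV.id ((right (A.t0 (A.s1 α))).toHom.f1 g)) h₁) (γ (A.t1 α) g) h₂ =
      C.catV.comp (γ (A.s1 α) g) (C.catH.comp
        (C.catV.id ((right (A.s0 (A.s1 α))).toHom.f1 g)) ((left (B.t0 g)).toHom.f2 α) h₃) h₄
  γ_natural_right : ∀ f β h₁ h₂ h₃ h₄,
    C.catV.comp (C.catH.comp (C.catV.id ((left (B.s0 (B.s1 β))).toHom.f1 f))
        ((right (A.t0 f)).toHom.f2 β) h₁) (γ f (B.t1 β)) h₂ =
      C.catV.comp (γ f (B.s1 β)) (C.catH.comp ((right (A.s0 f)).toHom.f2 β)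
        (C.catV.id ((left (B.t0 (B.s1 β))).toHom.f1 f)) h₃) h₄

namespace Multitensor

variable {V : Type u} [Category.{v} V] (G : Multitensor V)

/-- The comparison `G (G (X, Y), Z) ⟶ G (X, Y, Z)`. -/
def assocLeft (X Y Z : V) : G.E.obj [G.E.obj [X, Y], Z] ⟶ G.E.obj [X, Y, Z] :=
  G.E.map (consHom (𝟙 (G.E.obj [X, Y])) (consHom (G.η Z) (𝟙 []))) ≫ G.σ [[X, Y], [Z]] [X, Y, Z] rfl

/-- The comparison `G (X, G (Y, Z)) ⟶ G (X, Y, Z)`. -/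
def assocRight (X Y Z : V) : G.E.obj [X, G.E.obj [Y, Z]] ⟶ G.E.obj [X, Y, Z] :=
  G.E.map (consHom (G.η X) (consHom (𝟙 (G.E.obj [Y, Z])) (𝟙 []))) ≫ G.σ [[X], [Y, Z]] [X, Y, Z] rfl

/-- The comparison `G (X, G ()) ⟶ G (X)`. -/
def unitRight (X : V) : G.E.obj [X, G.E.obj []] ⟶ G.E.obj [X] :=
  G.E.map (consHom (G.η X) (𝟙 [G.E.obj []])) ≫ G.σ [[X], []] [X] rfl

/-- The comparison `G (G (), X) ⟶ G (X)`. -/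
def unitLeft (X : V) : G.E.obj [G.E.obj [], X] ⟶ G.E.obj [X] :=
  G.E.map (consHom (𝟙 (G.E.obj [])) (consHom (G.η X) (𝟙 []))) ≫ G.σ [[], [X]] [X] rfl

end Multitensor

/-- `G` is the Gray tensor product of 2-categories, viewed as a multitensor: its substitutions and
units are invertible (so that `G` amounts to a monoidal structure), the tensor unit is terminal,
`G (A, B)` is equipped with a universal cubical functor `A, B ⟶ G (A, B)`, naturally in `A` and `B`,
and the associativity and unit isomorphisms are the standard ones:
`(a ⊗ b) ⊗ c ↦ a ⊗ (b ⊗ c)` (for cells with at most one non-object, and for the constraint 2-cells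
of any two 1-cells), `a ⊗ * ↦ a` and `* ⊗ a ↦ a`. -/
structure GrayTensor (G : Multitensor TwoCat.{u}) where
  isIso_η : ∀ A, IsIso (G.η A)
  isIso_σ : ∀ LL L h, IsIso (G.σ LL L h)
  isTerminal : Nonempty (IsTerminal (G.E.obj []))
  /-- the universal cubical functor -/
  cub : ∀ A B : TwoCat.{u}, Cubical A B (G.E.obj [A, B])
  universal : ∀ {A B C : TwoCat.{u}} (F : Cubical A B C), ∃! H : G.E.obj [A, B] ⟶ C,
    (∀ b, (cub A B).left b ≫ H = F.left b) ∧ (∀ a, (cub A B).right a ≫ H = F.right a) ∧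
      ∀ f g, H.toHom.f2 ((cub A B).γ f g) = F.γ f g
  natural_left : ∀ {A A' B B' : TwoCat.{u}} (F : A ⟶ A') (K : B ⟶ B') (b : B.C0),
    (cub A B).left b ≫ G.E.map (consHom F (consHom K (𝟙 []))) = F ≫ (cub A' B').left (K.toHom.f0 b)
  natural_right : ∀ {A A' B B' : TwoCat.{u}} (F : A ⟶ A') (K : B ⟶ B') (a : A.C0),
    (cub A B).right a ≫ G.E.map (consHom F (consHom K (𝟙 []))) =
      K ≫ (cub A' B').right (F.toHom.f0 a)
  natural_γ : ∀ {A A' B B' : TwoCat.{u}} (F : A ⟶ A') (K : B ⟶ B') (f : A.C1) (g : B.C1),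
    (G.E.map (consHom F (consHom K (𝟙 [])))).toHom.f2 ((cub A B).γ f g) =
      (cub A' B').γ (F.toHom.f1 f) (K.toHom.f1 g)
  assoc_left : ∀ (A B C : TwoCat.{u}) (b : B.C0) (c : C.C0),
    (cub A B).left b ≫ (cub (G.E.obj [A, B]) C).left c ≫ G.assocLeft A B C =
      (cub A (G.E.obj [B, C])).left (((cub B C).left c).toHom.f0 b) ≫ G.assocRight A B C
  assoc_middle : ∀ (A B C : TwoCat.{u}) (a : A.C0) (c : C.C0),
    (cub A B).right a ≫ (cub (G.E.obj [A, B]) C).left c ≫ G.assocLeft A B C =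
      (cub B C).left c ≫ (cub A (G.E.obj [B, C])).right a ≫ G.assocRight A B C
  assoc_right : ∀ (A B C : TwoCat.{u}) (a : A.C0) (b : B.C0),
    (cub (G.E.obj [A, B]) C).right (((cub A B).left b).toHom.f0 a) ≫ G.assocLeft A B C =
      (cub B C).right b ≫ (cub A (G.E.obj [B, C])).right a ≫ G.assocRight A B C
  assoc_γ_left_middle : ∀ (A B C : TwoCat.{u}) (f : A.C1) (g : B.C1) (c : C.C0),
    (G.assocLeft A B C).toHom.f2
        (((cub (G.E.obj [A, B]) C).left c).toHom.f2 ((cub A B).γ f g)) =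
      (G.assocRight A B C).toHom.f2
        ((cub A (G.E.obj [B, C])).γ f (((cub B C).left c).toHom.f1 g))
  assoc_γ_left_right : ∀ (A B C : TwoCat.{u}) (f : A.C1) (b : B.C0) (k : C.C1),
    (G.assocLeft A B C).toHom.f2
        ((cub (G.E.obj [A, B]) C).γ (((cub A B).left b).toHom.f1 f) k) =
      (G.assocRight A B C).toHom.f2
        ((cub A (G.E.obj [B, C])).γ f (((cub B C).right b).toHom.f1 k))
  assoc_γ_middle_right : ∀ (A B C : TwoCat.{u}) (a : A.C0) (g : B.C1) (k : C.C1),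
    (G.assocLeft A B C).toHom.f2
        ((cub (G.E.obj [A, B]) C).γ (((cub A B).right a).toHom.f1 g) k) =
      (G.assocRight A B C).toHom.f2
        (((cub A (G.E.obj [B, C])).right a).toHom.f2 ((cub B C).γ g k))
  unit_right : ∀ (A : TwoCat.{u}) (e : (G.E.obj []).C0),
    (cub A (G.E.obj [])).left e ≫ G.unitRight A = G.η A
  unit_left : ∀ (A : TwoCat.{u}) (e : (G.E.obj []).C0),
    (cub (G.E.obj []) A).right e ≫ G.unitLeft A = G.η A

end GrayLift

noncomputable section

namespace GrayLift

open CategoryTheory CategoryTheory.Limits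

section

notation:max A:max "♭" => CatOn.id (TwoCat.cat1 A)
notation:max A:max "♯" => CatOn.id (TwoCat.catV A)
notation:max F:max "⁰" => Glob2.Hom.f0 (TwoCat.Hom.toHom F)
notation:max F:max "¹" => Glob2.Hom.f1 (TwoCat.Hom.toHom F)
notation:max F:max "²" => Glob2.Hom.f2 (TwoCat.Hom.toHom F)

section

variable {V : Type u} [Category.{v} V] {X Y Z W : V} {f : X ⟶ Y} {g : Y ⟶ Z} {h : Z ⟶ W}

lemma assocR {k} (e : f ≫ g ≫ h = k) : (f ≫ g) ≫ h = k := (Category.assoc _ _ _).trans e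

lemma assocL {k} (e : (f ≫ g) ≫ h = k) : f ≫ g ≫ h = k := (Category.assoc _ _ _).symm.trans e

lemma slideR {k l} (e : g ≫ h = k) (e' : f ≫ k = l) : (f ≫ g) ≫ h = l := assocR ((congrArg (f ≫ ·) e).trans e')

lemma slideL {k l} (e : f ≫ g = k) (e' : k ≫ h = l) : f ≫ g ≫ h = l := assocL ((congrArg (· ≫ h) e).trans e')

end

structure Ct where
  O : Type u
  M : Type u
  s : M → O
  t : M → O
  cat : CatOn s t

namespace Ct

@[ext] structure Hom (C D : Ct.{u}) where
  f0 : C.O → D.O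
  f1 : C.M → D.M
  s : ∀ x, D.s (f1 x) = f0 (C.s x)
  t : ∀ x, D.t (f1 x) = f0 (C.t x)
  map_id : ∀ a, f1 (C.cat.id a) = D.cat.id (f0 a)
  map_comp : ∀ f g h h', f1 (C.cat.comp f g h) = D.cat.comp (f1 f) (f1 g) h'

instance category : LargeCategory Ct.{u} where
  Hom := Hom
  id C := ⟨fun x => x, fun x => x, fun _ => rfl, fun _ => rfl, fun _ => rfl, fun _ _ _ _ => rfl⟩
  comp {C D K} F G := ⟨fun x => G.f0 (F.f0 x), fun x => G.f1 (F.f1 x),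
    fun x => by rw [G.s, F.s], fun x => by rw [G.t, F.t],
    fun a => by rw [F.map_id, G.map_id],
    fun f g h h' => (congrArg G.f1 (F.map_comp f g h (by rw [F.t, F.s, h]))).trans (G.map_comp _ _ _ _)⟩
  id_comp _ := rfl
  comp_id _ := rfl
  assoc _ _ _ := rfl

lemma hom_ext {C D : Ct.{u}} {F G : C ⟶ D} (h0 : ∀ x, F.f0 x = G.f0 x) (h1 : ∀ x, F.f1 x = G.f1 x) : F = G :=
  Hom.ext (funext h0) (funext h1)

@[simp] lemma id_f0 (C : Ct.{u}) (x : C.O) : Hom.f0 (𝟙 C) x = x := rfl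
@[simp] lemma id_f1 (C : Ct.{u}) (x : C.M) : Hom.f1 (𝟙 C) x = x := rfl
@[simp] lemma comp_f0 {C D K : Ct.{u}} (F : C ⟶ D) (G : D ⟶ K) (x : C.O) :
    Hom.f0 (F ≫ G) x = G.f0 (F.f0 x) := rfl
@[simp] lemma comp_f1 {C D K : Ct.{u}} (F : C ⟶ D) (G : D ⟶ K) (x : C.M) :
    Hom.f1 (F ≫ G) x = G.f1 (F.f1 x) := rfl

def const (C : Ct.{u}) {D : Ct.{u}} (d : D.O) : C ⟶ D where
  f0 _ := d
  f1 _ := D.cat.id d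
  s _ := D.cat.s_id _
  t _ := D.cat.t_id _
  map_id _ := rfl
  map_comp _ _ _ h' := by
    have h₀ : D.t (D.cat.id (D.s (D.cat.id d))) = D.s (D.cat.id d) := D.cat.t_id _
    refine (D.cat.id_comp _ h₀).symm.trans (D.cat.comp_congr ?_ rfl _ _)
    rw [D.cat.s_id]

lemma const_comp {C D K : Ct.{u}} (d : D.O) (F : D ⟶ K) : const C d ≫ F = const C (F.f0 d) :=
  hom_ext (fun _ => rfl) (fun _ => F.map_id _)

lemma comp_const {C D K : Ct.{u}} (F : C ⟶ D) (k : K.O) : F ≫ const D k = const C k := rfl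

lemma Hom.map_eval {C D : Ct.{u}} (F : C ⟶ D) {G : Gph.{u}} (f : G.V → C.O) (g : G.E → C.M)
    (hs ht hs' ht') (p : Walk G) : F.f1 (C.cat.eval f g hs ht p) =
      D.cat.eval (fun a => F.f0 (f a)) (fun e => F.f1 (g e)) hs' ht' p :=
  C.cat.map_eval f g hs ht D.cat F.f0 F.f1 F.s F.map_id F.map_comp p hs' ht'

abbrev gbox (C D : Ct.{u}) : Gph.{u} where
  V := C.O × D.O
  E := (C.M × D.O) ⊕ (C.O × D.M)
  s := Sum.elim (fun e => (C.s e.1, e.2)) (fun e => (e.1, D.s e.2))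
  t := Sum.elim (fun e => (C.t e.1, e.2)) (fun e => (e.1, D.t e.2))

structure Sep (C D Z : Ct.{u}) where
  left : D.O → (C ⟶ Z)
  right : C.O → (D ⟶ Z)
  agree : ∀ a b, (left b).f0 a = (right a).f0 b

namespace Sep

variable {C D Z : Ct.{u}} (F : Sep C D Z)

def obj (v : C.O × D.O) : Z.O := (F.left v.2).f0 v.1

def edge : (gbox C D).E → Z.M := Sum.elim (fun e => (F.left e.2).f1 e.1) (fun e => (F.right e.1).f1 e.2)

lemma s_edge : ∀ e, Z.s (F.edge e) = F.obj ((gbox C D).s e)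
  | .inl e => (F.left e.2).s e.1
  | .inr e => ((F.right e.1).s e.2).trans (F.agree _ _).symm

lemma t_edge : ∀ e, Z.t (F.edge e) = F.obj ((gbox C D).t e)
  | .inl e => (F.left e.2).t e.1
  | .inr e => ((F.right e.1).t e.2).trans (F.agree _ _).symm

def eval (p : Walk (gbox C D)) : Z.M := Z.cat.eval F.obj F.edge F.s_edge F.t_edge p

lemma s_eval (p : Walk (gbox C D)) : Z.s (F.eval p) = F.obj p.src := Z.cat.s_eval _ _ _ _ _

lemma t_eval (p : Walk (gbox C D)) : Z.t (F.eval p) = F.obj p.tgt := Z.cat.t_eval _ _ _ _ _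

lemma eval_append (p q : Walk (gbox C D)) (h : p.tgt = q.src) (h') :
    F.eval (p.append q h) = Z.cat.comp (F.eval p) (F.eval q) h' :=
  Z.cat.eval_append _ _ _ _ p q h h'

lemma eval_single (e) : F.eval (Walk.single e) = F.edge e := Z.cat.eval_single _ _ _ _ e

lemma eval_nil (a) : F.eval (Walk.nil a) = Z.cat.id (F.obj a) := rfl

end Sep

def funnySetoid (C D : Ct.{u}) : Setoid (Walk (gbox C D)) where
  r p q := (p.src = q.src ∧ p.tgt = q.tgt) ∧ ∀ (Z : Ct.{u}) (F : Sep C D Z), F.eval p = F.eval q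
  iseqv := ⟨fun _ => ⟨⟨rfl, rfl⟩, fun _ _ => rfl⟩,
    fun h => ⟨⟨h.1.1.symm, h.1.2.symm⟩, fun Z F => (h.2 Z F).symm⟩,
    fun h k => ⟨⟨h.1.1.trans k.1.1, h.1.2.trans k.1.2⟩, fun Z F => (h.2 Z F).trans (k.2 Z F)⟩⟩

def FunnyM (C D : Ct.{u}) : Type u := Quotient (funnySetoid C D)

namespace FunnyM

variable {C D : Ct.{u}}

def mk (p : Walk (gbox C D)) : FunnyM C D := Quotient.mk (funnySetoid C D) p

lemma sound {p q : Walk (gbox C D)} (hs : p.src = q.src) (ht : p.tgt = q.tgt)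
    (h : ∀ (Z : Ct.{u}) (F : Sep C D Z), F.eval p = F.eval q) : mk p = mk q :=
  Quotient.sound (s := funnySetoid C D) ⟨⟨hs, ht⟩, h⟩

def src : FunnyM C D → C.O × D.O := Quotient.lift Walk.src fun _ _ h => h.1.1

def tgt : FunnyM C D → C.O × D.O := Quotient.lift Walk.tgt fun _ _ h => h.1.2

lemma ind {P : FunnyM C D → Prop} (h : ∀ p, P (mk p)) (x : FunnyM C D) : P x :=
  Quotient.ind (s := funnySetoid C D) h x

def out (x : FunnyM C D) : Walk (gbox C D) := Quotient.out x

lemma mk_out (x : FunnyM C D) : mk x.out = x := Quotient.out_eq x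

lemma src_out (x : FunnyM C D) : x.out.src = x.src := congrArg src x.mk_out

lemma tgt_out (x : FunnyM C D) : x.out.tgt = x.tgt := congrArg tgt x.mk_out

lemma out_mk (p : Walk (gbox C D)) : (funnySetoid C D).r (mk p).out p := Quotient.exact (mk_out (mk p))

def comp (x y : FunnyM C D) (h : x.tgt = y.src) : FunnyM C D :=
  mk (x.out.append y.out (by rw [tgt_out, src_out, h]))

lemma comp_mk (p q : Walk (gbox C D)) (h : p.tgt = q.src) : comp (mk p) (mk q) h = mk (p.append q h) := by
  have hp := out_mk p
  have hq := out_mk q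
  refine sound hp.1.1 hq.1.2 fun Z F => ?_
  rw [F.eval_append _ _ _ (by rw [F.t_eval, F.s_eval, tgt_out, src_out]; exact congrArg _ h),
    F.eval_append p q h (by rw [F.t_eval, F.s_eval, h])]
  exact Z.cat.comp_congr (hp.2 Z F) (hq.2 Z F) _ _

end FunnyM

@[reducible] def funny (C D : Ct.{u}) : Ct.{u} where
  O := C.O × D.O
  M := FunnyM C D
  s := FunnyM.src
  t := FunnyM.tgt
  cat :=
    { id := fun a => FunnyM.mk (Walk.nil a)
      comp := FunnyM.comp
      s_id := fun _ => rfl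
      t_id := fun _ => rfl
      s_comp := fun x y h => x.src_out
      t_comp := fun x y h => y.tgt_out
      id_comp := by
        intro x h
        induction x using FunnyM.ind with
        | h p => exact (FunnyM.comp_mk _ _ h).trans rfl
      comp_id := by
        intro x h
        induction x using FunnyM.ind with
        | h p => exact (FunnyM.comp_mk _ _ h).trans (congrArg FunnyM.mk ((Walk.catOn _).comp_id p h))
      assoc := by
        intro x y z h₁ h₂ h₃ h₄
        induction x using FunnyM.ind with
        | h p =>
        induction y using FunnyM.ind with
        | h q =>
        induction z using FunnyM.ind with
        | h r =>
        have e₁ := FunnyM.comp_mk p q h₁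
        have e₂ := FunnyM.comp_mk q r h₃
        have k₂ : (FunnyM.mk (p.append q h₁)).tgt = (FunnyM.mk r).src := h₃
        have k₄ : (FunnyM.mk p).tgt = (FunnyM.mk (q.append r h₃)).src := h₁
        have l : FunnyM.comp (FunnyM.comp (FunnyM.mk p) (FunnyM.mk q) h₁) (FunnyM.mk r) h₂ =
            FunnyM.comp (FunnyM.mk (p.append q h₁)) (FunnyM.mk r) k₂ := by congr 1
        have l' : FunnyM.comp (FunnyM.mk p) (FunnyM.comp (FunnyM.mk q) (FunnyM.mk r) h₃) h₄ =
            FunnyM.comp (FunnyM.mk p) (FunnyM.mk (q.append r h₃)) k₄ := by congr 1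
        rw [l, l', FunnyM.comp_mk _ _ k₂, FunnyM.comp_mk _ _ k₄]
        exact congrArg FunnyM.mk ((Walk.catOn (gbox C D)).assoc p q r h₁ h₃ h₃ h₁) }

variable {C D Z C' D' : Ct.{u}}

def inl (C : Ct.{u}) {D : Ct.{u}} (b : D.O) : C ⟶ funny C D where
  f0 a := (a, b)
  f1 f := FunnyM.mk (Walk.single (G := gbox C D) (Sum.inl (f, b)))
  s _ := rfl
  t _ := rfl
  map_id a := by
    refine FunnyM.sound (Prod.ext (C.cat.s_id a) rfl) (Prod.ext (C.cat.t_id a) rfl) fun Z F => ?_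
    rw [F.eval_single, F.eval_nil]
    exact (F.left b).map_id a
  map_comp f g h h' := by
    refine Eq.trans ?_ (FunnyM.comp_mk _ _ h').symm
    refine FunnyM.sound (Prod.ext (C.cat.s_comp f g h) rfl) (Prod.ext (C.cat.t_comp f g h) rfl) fun Z F => ?_
    have h₁ : Z.t (F.edge (Sum.inl (f, b))) = Z.s (F.edge (Sum.inl (g, b))) := by
      rw [F.t_edge, F.s_edge]; exact congrArg F.obj h'
    refine Eq.trans ?_ (F.eval_append _ _ h' (by rw [F.eval_single, F.eval_single, h₁])).symm
    refine (F.eval_single _).trans (((F.left b).map_comp f g h h₁).trans (Z.cat.comp_congr ?_ ?_ _ _))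
    · exact (F.eval_single (Sum.inl (f, b))).symm
    · exact (F.eval_single (Sum.inl (g, b))).symm

def inr {C : Ct.{u}} (D : Ct.{u}) (a : C.O) : D ⟶ funny C D where
  f0 b := (a, b)
  f1 g := FunnyM.mk (Walk.single (G := gbox C D) (Sum.inr (a, g)))
  s _ := rfl
  t _ := rfl
  map_id b := by
    refine FunnyM.sound (Prod.ext rfl (D.cat.s_id b)) (Prod.ext rfl (D.cat.t_id b)) fun Z F => ?_
    rw [F.eval_single, F.eval_nil]
    exact ((F.right a).map_id b).trans (congrArg Z.cat.id (F.agree a b).symm)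
  map_comp f g h h' := by
    refine Eq.trans ?_ (FunnyM.comp_mk _ _ h').symm
    refine FunnyM.sound (Prod.ext rfl (D.cat.s_comp f g h)) (Prod.ext rfl (D.cat.t_comp f g h)) fun Z F => ?_
    have h₁ : Z.t (F.edge (Sum.inr (a, f))) = Z.s (F.edge (Sum.inr (a, g))) := by
      rw [F.t_edge, F.s_edge]; exact congrArg F.obj h'
    refine Eq.trans ?_ (F.eval_append _ _ h' (by rw [F.eval_single, F.eval_single, h₁])).symm
    refine (F.eval_single _).trans (((F.right a).map_comp f g h h₁).trans (Z.cat.comp_congr ?_ ?_ _ _))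
    · exact (F.eval_single (Sum.inr (a, f))).symm
    · exact (F.eval_single (Sum.inr (a, g))).symm

def lift (F : Sep C D Z) : funny C D ⟶ Z where
  f0 := F.obj
  f1 := Quotient.lift (s := funnySetoid C D) F.eval fun _ _ h => h.2 Z F
  s x := by
    induction x using FunnyM.ind with
    | h p => exact F.s_eval p
  t x := by
    induction x using FunnyM.ind with
    | h p => exact F.t_eval p
  map_id _ := rfl
  map_comp x y h h' := by
    induction x using FunnyM.ind with
    | h p =>
    induction y using FunnyM.ind with
    | h q =>
    refine (congrArg (Quotient.lift (s := funnySetoid C D) F.eval fun _ _ h => h.2 Z F) (FunnyM.comp_mk p q h)).trans ?_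
    exact F.eval_append p q h h'

lemma inl_lift (F : Sep C D Z) (b : D.O) : inl C b ≫ lift F = F.left b :=
  hom_ext (fun _ => rfl) (fun f => F.eval_single (Sum.inl (f, b)))

lemma inr_lift (F : Sep C D Z) (a : C.O) : inr D a ≫ lift F = F.right a :=
  hom_ext (fun _ => F.agree _ _) (fun f => F.eval_single (Sum.inr (a, f)))

@[simp] lemma lift_inl (F : Sep C D Z) (b : D.O) (f : C.M) :
    (lift F).f1 ((inl C b).f1 f) = (F.left b).f1 f := F.eval_single (Sum.inl (f, b))

@[simp] lemma lift_inr (F : Sep C D Z) (a : C.O) (f : D.M) :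
    (lift F).f1 ((inr D a).f1 f) = (F.right a).f1 f := F.eval_single (Sum.inr (a, f))

lemma funny_induction {P : (funny C D).M → Prop} (hid : ∀ a, P ((funny C D).cat.id a))
    (hl : ∀ (f : C.M) (b : D.O) (x : (funny C D).M) (h : (funny C D).t ((inl C b).f1 f) = (funny C D).s x), P x →
      P ((funny C D).cat.comp ((inl C b).f1 f) x h))
    (hr : ∀ (a : C.O) (g : D.M) (x : (funny C D).M) (h : (funny C D).t ((inr D a).f1 g) = (funny C D).s x), P x →
      P ((funny C D).cat.comp ((inr D a).f1 g) x h)) (x : (funny C D).M) : P x := by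
  induction x using FunnyM.ind with
  | h p =>
  induction p using Walk.induction with
  | hnil a => exact hid a
  | hcons e p h ih =>
    obtain ⟨f, b⟩ | ⟨a, g⟩ := e
    · exact FunnyM.comp_mk (Walk.single (Sum.inl (f, b))) p h ▸ hl f b (FunnyM.mk p) h ih
    · exact FunnyM.comp_mk (Walk.single (Sum.inr (a, g))) p h ▸ hr a g (FunnyM.mk p) h ih

lemma funny_hom_ext {F G : funny C D ⟶ Z} (hl : ∀ b, inl C b ≫ F = inl C b ≫ G)
    (hr : ∀ a, inr D a ≫ F = inr D a ≫ G) : F = G := by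
  have h0 : ∀ x, F.f0 x = G.f0 x := fun x => congrFun (congrArg Hom.f0 (hl x.2)) x.1
  refine hom_ext h0 fun x => ?_
  induction x using funny_induction with
  | hid a => rw [F.map_id, G.map_id, h0]
  | hl f b x h ih =>
    rw [F.map_comp _ _ _ (by rw [F.t, F.s]; exact congrArg F.f0 h),
      G.map_comp _ _ _ (by rw [G.t, G.s]; exact congrArg G.f0 h)]
    exact Z.cat.comp_congr (congrFun (congrArg Hom.f1 (hl b)) f) ih _ _
  | hr a g x h ih =>
    rw [F.map_comp _ _ _ (by rw [F.t, F.s]; exact congrArg F.f0 h),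
      G.map_comp _ _ _ (by rw [G.t, G.s]; exact congrArg G.f0 h)]
    exact Z.cat.comp_congr (congrFun (congrArg Hom.f1 (hr a)) g) ih _ _

lemma funny_hom_ext' {F G : funny C D ⟶ Z} (h0 : ∀ x, F.f0 x = G.f0 x)
    (hl : ∀ b f, F.f1 ((inl C b).f1 f) = G.f1 ((inl C b).f1 f))
    (hr : ∀ a g, F.f1 ((inr D a).f1 g) = G.f1 ((inr D a).f1 g)) : F = G :=
  funny_hom_ext (fun b => hom_ext (fun _ => h0 _) (hl b)) (fun a => hom_ext (fun _ => h0 _) (hr a))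

def funnyMap (F : C ⟶ C') (G : D ⟶ D') : funny C D ⟶ funny C' D' :=
  lift ⟨fun b => F ≫ inl C' (G.f0 b), fun a => G ≫ inr D' (F.f0 a), fun _ _ => rfl⟩

@[simp] lemma funnyMap_f0 (F : C ⟶ C') (G : D ⟶ D') (x) : (funnyMap F G).f0 x = (F.f0 x.1, G.f0 x.2) := rfl

@[simp] lemma funnyMap_inl (F : C ⟶ C') (G : D ⟶ D') (b f) :
    (funnyMap F G).f1 ((inl C b).f1 f) = (inl C' (G.f0 b)).f1 (F.f1 f) := lift_inl _ _ _

@[simp] lemma funnyMap_inr (F : C ⟶ C') (G : D ⟶ D') (a g) :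
    (funnyMap F G).f1 ((inr D a).f1 g) = (inr D' (F.f0 a)).f1 (G.f1 g) := lift_inr _ _ _

def fst (C D : Ct.{u}) : funny C D ⟶ C := lift ⟨fun _ => 𝟙 C, fun a => const D a, fun _ _ => rfl⟩

def snd (C D : Ct.{u}) : funny C D ⟶ D := lift ⟨fun b => const C b, fun _ => 𝟙 D, fun _ _ => rfl⟩

@[simp] lemma fst_f0 (x) : (fst C D).f0 x = x.1 := rfl
@[simp] lemma snd_f0 (x) : (snd C D).f0 x = x.2 := rfl
@[simp] lemma fst_inl (b f) : (fst C D).f1 ((inl C b).f1 f) = f := lift_inl _ _ _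
@[simp] lemma fst_inr (a g) : (fst C D).f1 ((inr D a).f1 g) = C.cat.id a := lift_inr _ _ _
@[simp] lemma snd_inl (b f) : (snd C D).f1 ((inl C b).f1 f) = D.cat.id b := lift_inl _ _ _
@[simp] lemma snd_inr (a g) : (snd C D).f1 ((inr D a).f1 g) = g := lift_inr _ _ _

lemma funnyMap_fst (F : C ⟶ C') (G : D ⟶ D') : funnyMap F G ≫ fst C' D' = fst C D ≫ F :=
  funny_hom_ext' (fun _ => rfl) (fun b f => by simp) (fun a g => by simp [F.map_id])

lemma funnyMap_snd (F : C ⟶ C') (G : D ⟶ D') : funnyMap F G ≫ snd C' D' = snd C D ≫ G :=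
  funny_hom_ext' (fun _ => rfl) (fun b f => by simp [G.map_id]) (fun a g => by simp)

lemma funnyMap_id : funnyMap (𝟙 C) (𝟙 D) = 𝟙 (funny C D) :=
  funny_hom_ext' (fun _ => rfl) (fun b f => by simp) (fun a g => by simp)

lemma funnyMap_comp {C'' D'' : Ct.{u}} (F : C ⟶ C') (G : D ⟶ D') (F' : C' ⟶ C'')
    (G' : D' ⟶ D'') : funnyMap (F ≫ F') (G ≫ G') = funnyMap F G ≫ funnyMap F' G' :=
  funny_hom_ext' (fun _ => rfl) (fun b f => by simp) (fun a g => by simp)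

@[reducible] def one : Ct.{u} where
  O := PUnit
  M := PUnit
  s _ := ⟨⟩
  t _ := ⟨⟩
  cat := TwoCat.one.cat1

def assocHom (C D K : Ct.{u}) : funny (funny C D) K ⟶ funny C (funny D K) :=
  lift ⟨fun k => lift ⟨fun b => inl C (b, k), fun a => inl D k ≫ inr (funny D K) a,
    fun _ _ => rfl⟩, fun v => inr K v.2 ≫ inr (funny D K) v.1, fun _ _ => rfl⟩

def assocInv (C D K : Ct.{u}) : funny C (funny D K) ⟶ funny (funny C D) K :=
  lift ⟨fun v => inl C v.1 ≫ inl (funny C D) v.2, fun a => lift ⟨fun k => inr D a ≫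
    inl (funny C D) k, fun b => inr K (a, b), fun _ _ => rfl⟩, fun _ _ => rfl⟩

section

variable {K : Ct.{u}}

@[simp] lemma assocHom_f0 (x) : (assocHom C D K).f0 x = (x.1.1, x.1.2, x.2) := rfl
@[simp] lemma assocInv_f0 (x) : (assocInv C D K).f0 x = ((x.1, x.2.1), x.2.2) := rfl

@[simp] lemma assocHom_inl_inl (k b f) : (assocHom C D K).f1 ((inl _ k).f1 ((inl C b).f1 f)) =
    (inl C (b, k)).f1 f := (lift_inl _ _ _).trans (lift_inl _ _ _)
@[simp] lemma assocHom_inl_inr (k a g) : (assocHom C D K).f1 ((inl _ k).f1 ((inr D a).f1 g)) =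
    (inr _ a).f1 ((inl D k).f1 g) := (lift_inl _ _ _).trans (lift_inr _ _ _)
@[simp] lemma assocHom_inr (v g) : (assocHom C D K).f1 ((inr K v).f1 g) =
    (inr _ v.1).f1 ((inr K v.2).f1 g) := lift_inr _ _ _
@[simp] lemma assocInv_inl (v f) : (assocInv C D K).f1 ((inl C v).f1 f) =
    (inl _ v.2).f1 ((inl C v.1).f1 f) := lift_inl _ _ _
@[simp] lemma assocInv_inr_inl (a k f) : (assocInv C D K).f1 ((inr _ a).f1 ((inl D k).f1 f)) =
    (inl _ k).f1 ((inr D a).f1 f) := (lift_inr _ _ _).trans (lift_inl _ _ _)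
@[simp] lemma assocInv_inr_inr (a b f) : (assocInv C D K).f1 ((inr _ a).f1 ((inr K b).f1 f)) =
    (inr K (a, b)).f1 f := (lift_inr _ _ _).trans (lift_inr _ _ _)

end

lemma funny_hom_ext₃ {K : Ct.{u}} {F G : funny (funny C D) K ⟶ Z} (h0 : ∀ x, F.f0 x = G.f0 x)
    (h1 : ∀ k b f, F.f1 ((inl _ k).f1 ((inl C b).f1 f)) = G.f1 ((inl _ k).f1 ((inl C b).f1 f)))
    (h2 : ∀ k a f, F.f1 ((inl _ k).f1 ((inr D a).f1 f)) = G.f1 ((inl _ k).f1 ((inr D a).f1 f)))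
    (h3 : ∀ v f, F.f1 ((inr K v).f1 f) = G.f1 ((inr K v).f1 f)) : F = G :=
  funny_hom_ext (fun k => funny_hom_ext' (fun _ => h0 _) (h1 k) (h2 k))
    (fun a => hom_ext (fun _ => h0 _) (h3 a))

lemma funny_hom_ext₃' {K : Ct.{u}} {F G : funny C (funny D K) ⟶ Z} (h0 : ∀ x, F.f0 x = G.f0 x)
    (h1 : ∀ v f, F.f1 ((inl C v).f1 f) = G.f1 ((inl C v).f1 f))
    (h2 : ∀ a k f, F.f1 ((inr _ a).f1 ((inl D k).f1 f)) = G.f1 ((inr _ a).f1 ((inl D k).f1 f)))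
    (h3 : ∀ a b f, F.f1 ((inr _ a).f1 ((inr K b).f1 f)) = G.f1 ((inr _ a).f1 ((inr K b).f1 f))) :
    F = G :=
  funny_hom_ext (fun a => hom_ext (fun _ => h0 _) (h1 a))
    (fun k => funny_hom_ext' (fun _ => h0 _) (h2 k) (h3 k))

instance : MonoidalCategoryStruct Ct.{u} where
  tensorObj := funny
  whiskerLeft C _ _ F := funnyMap (𝟙 C) F
  whiskerRight F D := funnyMap F (𝟙 D)
  tensorHom := funnyMap
  tensorUnit := one
  associator C D K := ⟨assocHom C D K, assocInv C D K,
    funny_hom_ext₃ (fun _ => rfl) (by simp) (by simp) (by simp),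
    funny_hom_ext₃' (fun _ => rfl) (by simp) (by simp) (by simp)⟩
  leftUnitor C := ⟨snd one C, inr C (C := one) ⟨⟩, funny_hom_ext' (fun _ => rfl)
      (fun b f => by simp only [comp_f1, snd_inl, id_f1, Hom.map_id]; exact
        (((inl one b).map_id f).symm : _)) (fun a g => by simp),
    hom_ext (fun _ => rfl) (by simp)⟩
  rightUnitor C := ⟨fst C one, inl C (D := one) ⟨⟩, funny_hom_ext' (fun _ => rfl) (fun b f => by simp)
      (fun a g => by simp only [comp_f1, fst_inr, id_f1, Hom.map_id]; exact
        (((inr one a).map_id g).symm : _)),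
    hom_ext (fun _ => rfl) (by simp)⟩

instance : MonoidalCategory Ct.{u} := MonoidalCategory.ofTensorHom (id_tensorHom_id := fun _ _ => funnyMap_id)
  (id_tensorHom := fun _ _ _ _ => rfl)
  (tensorHom_id := fun _ _ => rfl)
  (tensorHom_comp_tensorHom := fun _ _ _ _ => (funnyMap_comp _ _ _ _).symm)
  (associator_naturality := fun f₁ f₂ f₃ => by
    change funnyMap (funnyMap f₁ f₂) f₃ ≫ assocHom _ _ _ = assocHom _ _ _ ≫ funnyMap f₁ (funnyMap f₂ f₃)
    exact funny_hom_ext₃ (fun _ => rfl) (by simp) (by simp) (by simp))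
  (leftUnitor_naturality := fun f => funnyMap_snd _ f)
  (rightUnitor_naturality := fun f => funnyMap_fst f _)
  (pentagon := fun W X Y Z => by
    change funnyMap (assocHom W X Y) (𝟙 Z) ≫ assocHom W (funny X Y) Z ≫
      funnyMap (𝟙 W) (assocHom X Y Z) = assocHom (funny W X) Y Z ≫ assocHom W X (funny Y Z)
    refine funny_hom_ext (fun k => funny_hom_ext₃ (fun _ => rfl) ?_ ?_ ?_)
      (fun a => hom_ext (fun _ => rfl) ?_) <;> simp)
  (triangle := fun X Y => by
    change assocHom X one Y ≫ funnyMap (𝟙 X) (snd one Y) = funnyMap (fst X one) (𝟙 Y)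
    refine funny_hom_ext₃ (fun _ => rfl) (by simp) (fun k a f => ?_) (by simp)
    simp [Hom.map_id]
    rfl)

end Ct

end

section

abbrev TwoCat.ct (A : TwoCat.{u}) : Ct.{u} := ⟨A.C0, A.C1, A.s0, A.t0, A.cat1⟩

abbrev TwoCat.Hom.ct {A B : TwoCat.{u}} (F : A ⟶ B) : A.ct ⟶ B.ct :=
  (⟨F⁰, F¹, F.toHom.s0, F.toHom.t0, F.map_id, F.map_comp⟩ : Ct.Hom A.ct B.ct)

structure CData where
  C : Ct.{u}
  A : TwoCat.{u}
  φ : C ⟶ A.ct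

namespace CData

structure Hom (D D' : CData.{u}) where
  f : D.C ⟶ D'.C
  H : D.A ⟶ D'.A
  comm : D.φ ≫ TwoCat.Hom.ct H = f ≫ D'.φ

lemma Hom.ext' {D D' : CData.{u}} {F G : Hom D D'} (h : F.f = G.f) (h' : F.H = G.H) : F = G := by
  cases F; cases G; cases h; cases h'; rfl

instance category : Category.{u} CData.{u} where
  Hom := Hom
  id D := ⟨𝟙 D.C, 𝟙 D.A, rfl⟩
  comp {D D' D''} F G := ⟨F.f ≫ G.f, F.H ≫ G.H, by
    have h : D.φ ≫ TwoCat.Hom.ct (F.H ≫ G.H) = (D.φ ≫ TwoCat.Hom.ct F.H) ≫ TwoCat.Hom.ct G.H := rfl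
    rw [h, F.comm, Category.assoc, G.comm, Category.assoc]⟩
  id_comp _ := rfl
  comp_id _ := rfl
  assoc _ _ _ := rfl

variable {D D' K K' : CData.{u}}

lemma hom_ext {F G : D ⟶ D'} (h : F.f = G.f) (h' : F.H = G.H) : F = G := Hom.ext' h h'

lemma Hom.comm0 (F : D ⟶ D') (x : D.C.O) : F.H⁰ (D.φ.f0 x) = D'.φ.f0 (F.f.f0 x) :=
  congrFun (congrArg Ct.Hom.f0 F.comm) x

lemma Hom.comm1 (F : D ⟶ D') (x : D.C.M) : F.H¹ (D.φ.f1 x) = D'.φ.f1 (F.f.f1 x) :=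
  congrFun (congrArg Ct.Hom.f1 F.comm) x

@[ext] structure Cell (D : CData.{u}) where
  src : D.C.M
  tgt : D.C.M
  cell : D.A.C2
  ss : D.C.s src = D.C.s tgt
  tt : D.C.t src = D.C.t tgt
  hs : D.A.s1 cell = D.φ.f1 src
  ht : D.A.t1 cell = D.φ.f1 tgt

namespace Cell

def vid (c : D.C.M) : Cell D := ⟨c, c, D.A♯ (D.φ.f1 c), rfl, rfl, D.A.catV.s_id _, D.A.catV.t_id _⟩

lemma vcompat {x y : Cell D} (h : x.tgt = y.src) : D.A.t1 x.cell = D.A.s1 y.cell := by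
  rw [x.ht, y.hs, h]

def vcomp (x y : Cell D) (h : x.tgt = y.src) : Cell D :=
  ⟨x.src, y.tgt, D.A.catV.comp x.cell y.cell (vcompat h), x.ss.trans ((congrArg D.C.s h).trans y.ss),
    x.tt.trans ((congrArg D.C.t h).trans y.tt), (D.A.catV.s_comp _ _ _).trans x.hs,
    (D.A.catV.t_comp _ _ _).trans y.ht⟩

lemma hcompat {x y : Cell D} (h : D.C.t x.src = D.C.s y.src) :
    D.A.t0 (D.A.s1 x.cell) = D.A.s0 (D.A.s1 y.cell) := by
  rw [x.hs, y.hs]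
  exact (D.φ.t _).trans ((congrArg D.φ.f0 h).trans (D.φ.s _).symm)

lemma hcompat' {x y : Cell D} (h : D.C.t x.src = D.C.s y.src) : D.C.t x.tgt = D.C.s y.tgt :=
  x.tt.symm.trans (h.trans y.ss)

def hcomp (x y : Cell D) (h : D.C.t x.src = D.C.s y.src) : Cell D :=
  ⟨D.C.cat.comp x.src y.src h, D.C.cat.comp x.tgt y.tgt (hcompat' h), D.A.catH.comp x.cell y.cell (hcompat h),
    by rw [D.C.cat.s_comp, D.C.cat.s_comp, x.ss], by rw [D.C.cat.t_comp, D.C.cat.t_comp, y.tt], by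
      have e : D.A.t0 (D.φ.f1 x.src) = D.A.s0 (D.φ.f1 y.src) := by
        have := hcompat h; rwa [x.hs, y.hs] at this
      refine (D.A.s1_hcomp _ _ _).trans (Eq.trans ?_ (D.φ.map_comp _ _ h e).symm)
      exact D.A.cat1.comp_congr x.hs y.hs _ _, by
      have e : D.A.t0 (D.φ.f1 x.tgt) = D.A.s0 (D.φ.f1 y.tgt) :=
        (D.φ.t _).trans ((congrArg D.φ.f0 (hcompat' h)).trans (D.φ.s _).symm)
      have e' : D.A.t0 (D.A.t1 x.cell) = D.A.s0 (D.A.t1 y.cell) := by rw [x.ht, y.ht]; exact e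
      refine (D.A.t1_hcomp _ _ _ e').trans (Eq.trans ?_ (D.φ.map_comp _ _ _ e).symm)
      exact D.A.cat1.comp_congr x.ht y.ht _ _⟩

end Cell

@[reducible] def cellsObj (D : CData.{u}) : TwoCat.{u} where
  C0 := D.C.O
  C1 := D.C.M
  C2 := Cell D
  s0 := D.C.s
  t0 := D.C.t
  s1 := Cell.src
  t1 := Cell.tgt
  ss := Cell.ss
  tt := Cell.tt
  cat1 := D.C.cat
  catV :=
    { id := Cell.vid
      comp := Cell.vcomp
      s_id := fun _ => rfl
      t_id := fun _ => rfl
      s_comp := fun _ _ _ => rfl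
      t_comp := fun _ _ _ => rfl
      id_comp := fun x h => Cell.ext rfl rfl (by
        have h₀ : D.A.t1 (D.A♯ (D.A.s1 x.cell)) = D.A.s1 x.cell := D.A.catV.t_id _
        exact (D.A.catV.comp_congr (congrArg _ x.hs.symm) rfl _ h₀).trans (D.A.catV.id_comp _ _))
      comp_id := fun x h => Cell.ext rfl rfl (by
        have h₀ : D.A.t1 x.cell = D.A.s1 (D.A♯ (D.A.t1 x.cell)) := (D.A.catV.s_id _).symm
        exact (D.A.catV.comp_congr rfl (congrArg _ x.ht.symm) _ h₀).trans (D.A.catV.comp_id _ _))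
      assoc := fun _ _ _ _ _ _ _ => Cell.ext rfl rfl (D.A.catV.assoc _ _ _ _ _ _ _) }
  catH :=
    { id := fun a => Cell.vid (D.C.cat.id a)
      comp := Cell.hcomp
      s_id := fun a => D.C.cat.s_id a
      t_id := fun a => D.C.cat.t_id a
      s_comp := fun _ _ _ => D.C.cat.s_comp _ _ _
      t_comp := fun _ _ _ => D.C.cat.t_comp _ _ _
      id_comp := fun x h => Cell.ext (D.C.cat.id_comp _ _) (by
          have h₀ : D.C.t (D.C.cat.id (D.C.s x.tgt)) = D.C.s x.tgt := D.C.cat.t_id _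
          exact (D.C.cat.comp_congr (congrArg _ x.ss) rfl _ h₀).trans (D.C.cat.id_comp _ _)) (by
          have h₀ : D.A.t0 (D.A.s1 (D.A.catH.id (D.A.s0 (D.A.s1 x.cell)))) =
            D.A.s0 (D.A.s1 x.cell) := D.A.catH.t_id _
          refine (D.A.catH.comp_congr ?_ rfl _ h₀).trans (D.A.catH.id_comp _ _)
          rw [D.A.catH_id, x.hs]
          exact congrArg D.A♯ ((D.φ.map_id _).trans
            (congrArg D.A♭ (D.φ.s _).symm)))
      comp_id := fun x h => Cell.ext (D.C.cat.comp_id _ _) (by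
          have h₀ : D.C.t x.tgt = D.C.s (D.C.cat.id (D.C.t x.tgt)) := (D.C.cat.s_id _).symm
          exact (D.C.cat.comp_congr rfl (congrArg _ x.tt) _ h₀).trans (D.C.cat.comp_id _ _)) (by
          have h₀ : D.A.t0 (D.A.s1 x.cell) =
            D.A.s0 (D.A.s1 (D.A.catH.id (D.A.t0 (D.A.s1 x.cell)))) := (D.A.catH.s_id _).symm
          refine (D.A.catH.comp_congr rfl ?_ _ h₀).trans (D.A.catH.comp_id _ _)
          rw [D.A.catH_id, x.hs]
          exact congrArg D.A♯ ((D.φ.map_id _).trans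
            (congrArg D.A♭ (D.φ.t _).symm)))
      assoc := fun _ _ _ _ _ _ _ => Cell.ext (D.C.cat.assoc _ _ _ _ _ _ _)
        (D.C.cat.assoc _ _ _ _ _ _ _) (D.A.catH.assoc _ _ _ _ _ _ _) }
  catH_id _ := rfl
  s1_hcomp _ _ _ := rfl
  t1_hcomp _ _ _ _ := rfl
  hcomp_id f g h h' := Cell.ext rfl rfl (by
    have e : D.A.t0 (D.φ.f1 f) = D.A.s0 (D.φ.f1 g) :=
        (D.φ.t _).trans ((congrArg D.φ.f0 h).trans (D.φ.s _).symm)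
    exact (D.A.hcomp_id _ _ e _).trans (congrArg D.A♯ (D.φ.map_comp _ _ h e).symm))
  interchange x x' y y' hx hy h h₁ h₂ h' := Cell.ext rfl rfl (D.A.interchange _ _ _ _ _ _ _ _ _ _)

def cellsMap (F : D ⟶ D') : cellsObj D ⟶ cellsObj D' where
  toHom :=
    { f0 := F.f.f0
      f1 := F.f.f1
      f2 := fun x => ⟨F.f.f1 x.src, F.f.f1 x.tgt, F.H² x.cell,
        by rw [F.f.s, F.f.s, x.ss], by rw [F.f.t, F.f.t, x.tt],
        by rw [F.H.toHom.s1, x.hs, Hom.comm1 F], by rw [F.H.toHom.t1, x.ht, Hom.comm1 F]⟩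
      s0 := F.f.s
      t0 := F.f.t
      s1 := fun _ => rfl
      t1 := fun _ => rfl }
  map_id := F.f.map_id
  map_comp := F.f.map_comp
  map_vid f := Cell.ext rfl rfl ((F.H.map_vid _).trans (congrArg _ (Hom.comm1 F f)))
  map_vcomp _ _ _ _ := Cell.ext rfl rfl (F.H.map_vcomp _ _ _ _)
  map_hcomp _ _ _ _ := Cell.ext (F.f.map_comp _ _ _ _) (F.f.map_comp _ _ _ _) (F.H.map_hcomp _ _ _ _)

@[reducible] def cells : CData.{u} ⥤ TwoCat.{u} where
  obj := cellsObj
  map F := cellsMap F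

@[reducible] def gen : TwoCat.{u} ⥤ CData.{u} where
  obj A := ⟨A.ct, A, 𝟙 _⟩
  map F := ⟨TwoCat.Hom.ct F, F, rfl⟩

def proj (D : CData.{u}) : cellsObj D ⟶ D.A where
  toHom := ⟨D.φ.f0, D.φ.f1, Cell.cell, D.φ.s, D.φ.t, Cell.hs, Cell.ht⟩
  map_id := D.φ.map_id
  map_comp := D.φ.map_comp
  map_vid _ := rfl
  map_vcomp _ _ _ _ := rfl
  map_hcomp _ _ _ _ := rfl

def transpose {A : TwoCat.{u}} {D : CData.{u}} (F : A ⟶ cellsObj D) : gen.obj A ⟶ D :=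
  ⟨TwoCat.Hom.ct F, F ≫ proj D, rfl⟩

def transposeInv {A : TwoCat.{u}} {D : CData.{u}} (F : gen.obj A ⟶ D) : A ⟶ cellsObj D where
  toHom :=
    { f0 := F.f.f0
      f1 := F.f.f1
      f2 := fun x => ⟨F.f.f1 (A.s1 x), F.f.f1 (A.t1 x), F.H² x,
        (F.f.s _).trans ((congrArg F.f.f0 (A.ss x)).trans (F.f.s _).symm),
        (F.f.t _).trans ((congrArg F.f.f0 (A.tt x)).trans (F.f.t _).symm),
        (F.H.toHom.s1 _).trans (Hom.comm1 F _), (F.H.toHom.t1 _).trans (Hom.comm1 F _)⟩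
      s0 := F.f.s
      t0 := F.f.t
      s1 := fun _ => rfl
      t1 := fun _ => rfl }
  map_id := F.f.map_id
  map_comp := F.f.map_comp
  map_vid f := Cell.ext (congrArg F.f.f1 (A.catV.s_id f)) (congrArg F.f.f1 (A.catV.t_id f))
    ((F.H.map_vid f).trans (congrArg _ (Hom.comm1 F f)))
  map_vcomp x y h _ := Cell.ext (congrArg F.f.f1 (A.catV.s_comp x y h))
    (congrArg F.f.f1 (A.catV.t_comp x y h)) (F.H.map_vcomp _ _ _ _)
  map_hcomp x y h h' := by
    have h₁ : A.t0 (A.t1 x) = A.s0 (A.t1 y) := by rw [← A.tt, ← A.ss, h]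
    refine Cell.ext ((congrArg F.f.f1 (A.s1_hcomp x y h)).trans ?_)
      ((congrArg F.f.f1 (A.t1_hcomp x y h h₁)).trans ?_) (F.H.map_hcomp _ _ _ _)
    · exact F.f.map_comp _ _ h _
    · exact F.f.map_comp _ _ h₁ _

lemma transposeInv_proj {A : TwoCat.{u}} {D : CData.{u}} (F : gen.obj A ⟶ D) :
    transposeInv F ≫ proj D = F.H :=
  TwoCat.Hom.ext' (Glob2.Hom.ext (funext fun x => (Hom.comm0 F x).symm)
    (funext fun x => (Hom.comm1 F x).symm) rfl)

def adj : gen.{u} ⊣ cells.{u} := Adjunction.mkOfHomEquiv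
    { homEquiv := fun A D =>
        { toFun := transposeInv
          invFun := transpose
          left_inv := fun F => hom_ext rfl (transposeInv_proj F)
          right_inv := fun F => TwoCat.Hom.ext' (Glob2.Hom.ext rfl rfl (funext fun x =>
            Cell.ext (F.toHom.s1 x).symm (F.toHom.t1 x).symm rfl)) }
      homEquiv_naturality_left_symm := fun f g => rfl
      homEquiv_naturality_right := fun f g => rfl }

def pair {X : Ct.{u}} {A B : TwoCat.{u}} (F : X ⟶ A.ct) (G : X ⟶ B.ct) : X ⟶ (A.prod B).ct where
  f0 x := (F.f0 x, G.f0 x)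
  f1 x := (F.f1 x, G.f1 x)
  s _ := Prod.ext (F.s _) (G.s _)
  t _ := Prod.ext (F.t _) (G.t _)
  map_id _ := Prod.ext (F.map_id _) (G.map_id _)
  map_comp _ _ _ h' := Prod.ext (F.map_comp _ _ _ (congrArg Prod.fst h'))
    (G.map_comp _ _ _ (congrArg Prod.snd h'))

@[reducible] def tensor (D D' : CData.{u}) : CData.{u} :=
  ⟨Ct.funny D.C D'.C, D.A.prod D'.A, pair (Ct.fst _ _ ≫ D.φ) (Ct.snd _ _ ≫ D'.φ)⟩

def tensorMap (F : D ⟶ K) (F' : D' ⟶ K') : tensor D D' ⟶ tensor K K' :=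
  ⟨Ct.funnyMap F.f F'.f, TwoCat.prodMap F.H F'.H, by
    have e₁ : (Ct.fst D.C D'.C ≫ D.φ) ≫ TwoCat.Hom.ct F.H = Ct.funnyMap F.f F'.f ≫ Ct.fst _ _ ≫ K.φ := by
      rw [Category.assoc, F.comm, ← Category.assoc (Ct.funnyMap F.f F'.f), Ct.funnyMap_fst, Category.assoc]
    have e₂ : (Ct.snd D.C D'.C ≫ D'.φ) ≫ TwoCat.Hom.ct F'.H = Ct.funnyMap F.f F'.f ≫ Ct.snd _ _ ≫ K'.φ := by
      rw [Category.assoc, F'.comm, ← Category.assoc (Ct.funnyMap F.f F'.f), Ct.funnyMap_snd, Category.assoc]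
    exact congrArg₂ pair e₁ e₂⟩

@[reducible] def one : CData.{u} := ⟨Ct.one, TwoCat.one, 𝟙 _⟩

open MonoidalCategory

def assocIso (D D' K : CData.{u}) : tensor (tensor D D') K ≅ tensor D (tensor D' K) where
  hom := ⟨(α_ D.C D'.C K.C).hom, TwoCat.assocHom _ _ _, Ct.funny_hom_ext₃ (fun _ => rfl) (fun k b f => by
      change _ = ((tensor D (tensor D' K)).φ.f1 ((Ct.assocHom _ _ _).f1 _))
      simp [pair, TwoCat.assocHom, Ct.Hom.map_id]
      exact Prod.ext rfl (Prod.ext (D'.φ.map_id _).symm (K.φ.map_id _).symm))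
    (fun k b f => by
      change _ = ((tensor D (tensor D' K)).φ.f1 ((Ct.assocHom _ _ _).f1 _))
      simp [pair, TwoCat.assocHom, Ct.Hom.map_id]
      rfl)
    (fun k f => by
      change _ = ((tensor D (tensor D' K)).φ.f1 ((Ct.assocHom _ _ _).f1 _))
      simp [pair, TwoCat.assocHom, Ct.Hom.map_id]
      exact Prod.ext (D.φ.map_id _) (Prod.ext (D'.φ.map_id _) rfl))⟩
  inv := ⟨(α_ D.C D'.C K.C).inv, TwoCat.assocInv _ _ _, Ct.funny_hom_ext₃' (fun _ => rfl) (fun k f => by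
      change _ = ((tensor (tensor D D') K).φ.f1 ((Ct.assocInv _ _ _).f1 _))
      simp [pair, TwoCat.assocInv, Ct.Hom.map_id]
      exact Prod.ext (Prod.ext rfl (D'.φ.map_id _)) (K.φ.map_id _))
    (fun k b f => by
      change _ = ((tensor (tensor D D') K).φ.f1 ((Ct.assocInv _ _ _).f1 _))
      simp [pair, TwoCat.assocInv, Ct.Hom.map_id]
      rfl)
    (fun k b f => by
      change _ = ((tensor (tensor D D') K).φ.f1 ((Ct.assocInv _ _ _).f1 _))
      simp [pair, TwoCat.assocInv, Ct.Hom.map_id]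
      exact Prod.ext (Prod.ext (D.φ.map_id _).symm (D'.φ.map_id _).symm) rfl)⟩
  hom_inv_id := hom_ext (α_ D.C D'.C K.C).hom_inv_id rfl
  inv_hom_id := hom_ext (α_ D.C D'.C K.C).inv_hom_id rfl

def leftIso (D : CData.{u}) : tensor one D ≅ D where
  hom := ⟨(λ_ D.C).hom, TwoCat.sndHom _ _, rfl⟩
  inv := ⟨(λ_ D.C).inv, TwoCat.oneProd _, Ct.hom_ext (fun _ => rfl) (fun f => by
    change _ = ((tensor one D).φ.f1 ((Ct.inr _ _).f1 _))
    simp [pair, TwoCat.oneProd]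
    rfl)⟩
  hom_inv_id := hom_ext (λ_ D.C).hom_inv_id rfl
  inv_hom_id := hom_ext (λ_ D.C).inv_hom_id rfl

def rightIso (D : CData.{u}) : tensor D one ≅ D where
  hom := ⟨(ρ_ D.C).hom, TwoCat.fstHom _ _, rfl⟩
  inv := ⟨(ρ_ D.C).inv, TwoCat.prodOne _, Ct.hom_ext (fun _ => rfl) (fun f => by
    change _ = ((tensor D one).φ.f1 ((Ct.inl _ _).f1 _))
    simp [pair, TwoCat.prodOne]
    rfl)⟩
  hom_inv_id := hom_ext (ρ_ D.C).hom_inv_id rfl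
  inv_hom_id := hom_ext (ρ_ D.C).inv_hom_id rfl

instance : MonoidalCategoryStruct CData.{u} where
  tensorObj := tensor
  whiskerLeft D _ _ F := tensorMap (𝟙 D) F
  whiskerRight F D := tensorMap F (𝟙 D)
  tensorHom := tensorMap
  tensorUnit := one
  associator := assocIso
  leftUnitor := leftIso
  rightUnitor := rightIso

instance : MonoidalCategory CData.{u} := MonoidalCategory.ofTensorHom
  (id_tensorHom_id := fun _ _ => hom_ext Ct.funnyMap_id rfl)
  (id_tensorHom := fun _ _ _ _ => rfl)
  (tensorHom_id := fun _ _ => rfl)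
  (tensorHom_comp_tensorHom := fun _ _ _ _ => hom_ext (Ct.funnyMap_comp _ _ _ _).symm rfl)
  (associator_naturality := fun f₁ f₂ f₃ => hom_ext (associator_naturality f₁.f f₂.f f₃.f) rfl)
  (leftUnitor_naturality := fun f => hom_ext (Ct.funnyMap_snd _ f.f) rfl)
  (rightUnitor_naturality := fun f => hom_ext (Ct.funnyMap_fst f.f _) rfl)
  (pentagon := fun W X Y Z => hom_ext (pentagon W.C X.C Y.C Z.C) rfl)
  (triangle := fun X Y => hom_ext (triangle X.C Y.C) rfl)

end CData

def grayH : Multitensor TwoCat.{u} := Multitensor.ofAdjunction CData.adj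

end

section

namespace TwoCat

variable (C : TwoCat.{u})

open Classical in
def c1 (f g : C.C1) : C.C1 := if h : C.t0 f = C.s0 g then C.cat1.comp f g h else f

open Classical in
def vc (x y : C.C2) : C.C2 := if h : C.t1 x = C.s1 y then C.catV.comp x y h else x

open Classical in
def hc (x y : C.C2) : C.C2 := if h : C.t0 (C.s1 x) = C.s0 (C.s1 y) then C.catH.comp x y h else x

abbrev i0 (a : C.C0) : C.C1 := C♭ a

abbrev i1 (f : C.C1) : C.C2 := C♯ f

variable {C}

lemma c1_eq {f g : C.C1} (h : C.t0 f = C.s0 g) : C.c1 f g = C.cat1.comp f g h := dif_pos h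

lemma vc_eq {x y : C.C2} (h : C.t1 x = C.s1 y) : C.vc x y = C.catV.comp x y h := dif_pos h

lemma hc_eq {x y : C.C2} (h : C.t0 (C.s1 x) = C.s0 (C.s1 y)) : C.hc x y = C.catH.comp x y h := dif_pos h

@[simp] lemma s0_i0 (a : C.C0) : C.s0 (C♭ a) = a := C.cat1.s_id a
@[simp] lemma t0_i0 (a : C.C0) : C.t0 (C♭ a) = a := C.cat1.t_id a
@[simp] lemma s1_i1 (a : C.C1) : C.s1 (C♯ a) = a := C.catV.s_id a
@[simp] lemma t1_i1 (a : C.C1) : C.t1 (C♯ a) = a := C.catV.t_id a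

@[simp] lemma s0_t1 (x : C.C2) : C.s0 (C.t1 x) = C.s0 (C.s1 x) := (C.ss x).symm
@[simp] lemma t0_t1 (x : C.C2) : C.t0 (C.t1 x) = C.t0 (C.s1 x) := (C.tt x).symm

@[simp] lemma s0_c1 (f g : C.C1) : C.s0 (C.c1 f g) = C.s0 f := by
  by_cases h : C.t0 f = C.s0 g
  · rw [c1_eq h]; exact C.cat1.s_comp f g h
  · rw [c1, dif_neg h]

@[simp] lemma t0_c1 {f g : C.C1} (h : C.t0 f = C.s0 g) : C.t0 (C.c1 f g) = C.t0 g := by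
  rw [c1_eq h]; exact C.cat1.t_comp f g h

@[simp] lemma s1_vc (x y : C.C2) : C.s1 (C.vc x y) = C.s1 x := by
  by_cases h : C.t1 x = C.s1 y
  · rw [vc_eq h]; exact C.catV.s_comp x y h
  · rw [vc, dif_neg h]

@[simp] lemma t1_vc {x y : C.C2} (h : C.t1 x = C.s1 y) : C.t1 (C.vc x y) = C.t1 y := by
  rw [vc_eq h]; exact C.catV.t_comp x y h

@[simp] lemma s1_hc {x y : C.C2} (h : C.t0 (C.s1 x) = C.s0 (C.s1 y)) :
    C.s1 (C.hc x y) = C.c1 (C.s1 x) (C.s1 y) := by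
  rw [hc_eq h, c1_eq h]; exact C.s1_hcomp x y h

@[simp] lemma t1_hc {x y : C.C2} (h : C.t0 (C.s1 x) = C.s0 (C.s1 y)) :
    C.t1 (C.hc x y) = C.c1 (C.t1 x) (C.t1 y) := by
  have h' : C.t0 (C.t1 x) = C.s0 (C.t1 y) := by simpa using h
  rw [hc_eq h, c1_eq h']; exact C.t1_hcomp x y h h'

@[simp] lemma s0_s1_hc (x y : C.C2) : C.s0 (C.s1 (C.hc x y)) = C.s0 (C.s1 x) := by
  by_cases h : C.t0 (C.s1 x) = C.s0 (C.s1 y)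
  · rw [s1_hc h, s0_c1]
  · rw [hc, dif_neg h]

@[simp] lemma t0_s1_hc {x y : C.C2} (h : C.t0 (C.s1 x) = C.s0 (C.s1 y)) :
    C.t0 (C.s1 (C.hc x y)) = C.t0 (C.s1 y) := by
  rw [s1_hc h, t0_c1 h]

lemma id_c1 {f : C.C1} {a : C.C0} (h : C.s0 f = a) : C.c1 (C♭ a) f = f := by
  subst h
  rw [c1_eq (C.cat1.t_id _)]
  exact C.cat1.id_comp f _

lemma c1_id {f : C.C1} {a : C.C0} (h : C.t0 f = a) : C.c1 f (C♭ a) = f := by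
  subst h
  rw [c1_eq (C.cat1.s_id _).symm]
  exact C.cat1.comp_id f _

lemma c1_assoc {f g k : C.C1} (h : C.t0 f = C.s0 g) (h' : C.t0 g = C.s0 k) :
    C.c1 (C.c1 f g) k = C.c1 f (C.c1 g k) := by
  have h₁ : C.t0 (C.c1 f g) = C.s0 k := (t0_c1 h).trans h'
  have h₂ : C.t0 f = C.s0 (C.c1 g k) := h.trans (s0_c1 g k).symm
  rw [c1_eq h₁, c1_eq h₂]
  have h₃ : C.t0 (C.cat1.comp f g h) = C.s0 k := (C.cat1.t_comp f g h).trans h'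
  have h₄ : C.t0 f = C.s0 (C.cat1.comp g k h') := h.trans (C.cat1.s_comp g k h').symm
  exact (C.cat1.comp_congr (c1_eq h) rfl _ h₃).trans ((C.cat1.assoc f g k h h₃ h' h₄).trans
    (C.cat1.comp_congr rfl (c1_eq h').symm _ _))

lemma id_vc {x : C.C2} {f : C.C1} (h : C.s1 x = f) : C.vc (C♯ f) x = x := by
  subst h
  rw [vc_eq (C.catV.t_id _)]
  exact C.catV.id_comp x _

lemma vc_id {x : C.C2} {f : C.C1} (h : C.t1 x = f) : C.vc x (C♯ f) = x := by
  subst h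
  rw [vc_eq (C.catV.s_id _).symm]
  exact C.catV.comp_id x _

lemma vc_assoc {f g k : C.C2} (h : C.t1 f = C.s1 g) (h' : C.t1 g = C.s1 k) :
    C.vc (C.vc f g) k = C.vc f (C.vc g k) := by
  have h₁ : C.t1 (C.vc f g) = C.s1 k := (t1_vc h).trans h'
  have h₂ : C.t1 f = C.s1 (C.vc g k) := h.trans (s1_vc g k).symm
  rw [vc_eq h₁, vc_eq h₂]
  have h₃ : C.t1 (C.catV.comp f g h) = C.s1 k := (C.catV.t_comp f g h).trans h'
  have h₄ : C.t1 f = C.s1 (C.catV.comp g k h') := h.trans (C.catV.s_comp g k h').symm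
  exact (C.catV.comp_congr (vc_eq h) rfl _ h₃).trans ((C.catV.assoc f g k h h₃ h' h₄).trans
    (C.catV.comp_congr rfl (vc_eq h').symm _ _))

lemma id_hc {x : C.C2} {a : C.C0} (h : C.s0 (C.s1 x) = a) : C.hc (C♯ (C♭ a)) x = x := by
  subst h
  have h₀ : C.t0 (C.s1 (C.catH.id (C.s0 (C.s1 x)))) = C.s0 (C.s1 x) := C.catH.t_id _
  rw [← C.catH_id, hc_eq h₀]
  exact C.catH.id_comp x _

lemma hc_id {x : C.C2} {a : C.C0} (h : C.t0 (C.s1 x) = a) : C.hc x (C♯ (C♭ a)) = x := by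
  subst h
  have h₀ : C.t0 (C.s1 x) = C.s0 (C.s1 (C.catH.id (C.t0 (C.s1 x)))) := (C.catH.s_id _).symm
  rw [← C.catH_id, hc_eq h₀]
  exact C.catH.comp_id x _

lemma hc_assoc {f g k : C.C2} (h : C.t0 (C.s1 f) = C.s0 (C.s1 g)) (h' : C.t0 (C.s1 g) = C.s0 (C.s1 k)) :
    C.hc (C.hc f g) k = C.hc f (C.hc g k) := by
  have h₁ : C.t0 (C.s1 (C.hc f g)) = C.s0 (C.s1 k) := by simp [h, h']
  have h₂ : C.t0 (C.s1 f) = C.s0 (C.s1 (C.hc g k)) := by simp [h, h']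
  rw [hc_eq h₁, hc_eq h₂]
  have h₃ : C.t0 (C.s1 (C.catH.comp f g h)) = C.s0 (C.s1 k) := (C.catH.t_comp f g h).trans h'
  have h₄ : C.t0 (C.s1 f) = C.s0 (C.s1 (C.catH.comp g k h')) := h.trans (C.catH.s_comp g k h').symm
  exact (C.catH.comp_congr (hc_eq h) rfl _ h₃).trans ((C.catH.assoc f g k h h₃ h' h₄).trans
    (C.catH.comp_congr rfl (hc_eq h').symm _ _))

lemma i1_hc_i1 {f g : C.C1} (h : C.t0 f = C.s0 g) : C.hc (C♯ f) (C♯ g) = C♯ (C.c1 f g) := by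
  have h' : C.t0 (C.s1 (C♯ f)) = C.s0 (C.s1 (C♯ g)) := by simpa using h
  rw [hc_eq h', c1_eq h]
  exact C.hcomp_id f g h h'

lemma interch {x x' y y' : C.C2} (hx : C.t1 x = C.s1 x') (hy : C.t1 y = C.s1 y')
    (h : C.t0 (C.s1 x) = C.s0 (C.s1 y)) :
    C.hc (C.vc x x') (C.vc y y') = C.vc (C.hc x y) (C.hc x' y') := by
  have e1 : C.t0 (C.s1 (C.vc x x')) = C.s0 (C.s1 (C.vc y y')) := by simpa using h
  have e2 : C.t0 (C.s1 x') = C.s0 (C.s1 y') := by rw [← hx, ← hy]; simpa using h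
  have e3 : C.t1 (C.hc x y) = C.s1 (C.hc x' y') := by simp [h, e2, hx, hy]
  rw [hc_eq e1, vc_eq e3]
  have e1' : C.t0 (C.s1 (C.catV.comp x x' hx)) = C.s0 (C.s1 (C.catV.comp y y' hy)) := by
    rw [← vc_eq, ← vc_eq]; exact e1
  have e3' : C.t1 (C.catH.comp x y h) = C.s1 (C.catH.comp x' y' e2) := by
    rw [← hc_eq, ← hc_eq]; exact e3
  exact (C.catH.comp_congr (vc_eq hx) (vc_eq hy) _ e1').trans
    ((C.interchange x x' y y' hx hy e1' h e2 e3').trans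
      (C.catV.comp_congr (hc_eq h).symm (hc_eq e2).symm _ _))

lemma hc_hcr {x y z : C.C2} (h : C.t0 (C.s1 x) = C.s0 (C.s1 z)) (hxy : C.t1 x = C.s1 y) :
    C.hc (C.vc x y) z = C.vc (C.hc x (C♯ (C.s1 z))) (C.hc y z) := by
  rw [← interch hxy (by simp) (by simpa using h), id_vc rfl]

variable {D : TwoCat.{u}} (F : C ⟶ D)

lemma Hom.map_c1 {f g : C.C1} (h : C.t0 f = C.s0 g) : F¹ (C.c1 f g) = D.c1 (F¹ f) (F¹ g) := by
  have h' : D.t0 (F¹ f) = D.s0 (F¹ g) := by rw [F.toHom.t0, F.toHom.s0, h]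
  rw [c1_eq h, c1_eq h']
  exact F.map_comp f g h h'

lemma Hom.map_vc {f g : C.C2} (h : C.t1 f = C.s1 g) : F² (C.vc f g) = D.vc (F² f) (F² g) := by
  have h' : D.t1 (F² f) = D.s1 (F² g) := by rw [F.toHom.t1, F.toHom.s1, h]
  rw [vc_eq h, vc_eq h']
  exact F.map_vcomp f g h h'

lemma Hom.map_hc {f g : C.C2} (h : C.t0 (C.s1 f) = C.s0 (C.s1 g)) : F² (C.hc f g) = D.hc (F² f) (F² g) := by
  have h' : D.t0 (D.s1 (F² f)) = D.s0 (D.s1 (F² g)) := by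
    rw [F.toHom.s1, F.toHom.s1, F.toHom.t0, F.toHom.s0, h]
  rw [hc_eq h, hc_eq h']
  exact F.map_hcomp f g h h'

@[simp] lemma Hom.map_i0 (a : C.C0) : F¹ (C♭ a) = D♭ (F⁰ a) := F.map_id a

@[simp] lemma Hom.map_i1 (a : C.C1) : F² (C♯ a) = D♯ (F¹ a) := F.map_vid a

lemma Hom.s0 (f : C.C1) : D.s0 (F¹ f) = F⁰ (C.s0 f) := F.toHom.s0 f
lemma Hom.t0 (f : C.C1) : D.t0 (F¹ f) = F⁰ (C.t0 f) := F.toHom.t0 f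
lemma Hom.s1 (f : C.C2) : D.s1 (F² f) = F¹ (C.s1 f) := F.toHom.s1 f
lemma Hom.t1 (f : C.C2) : D.t1 (F² f) = F¹ (C.t1 f) := F.toHom.t1 f

attribute [simp] Hom.s0 Hom.t0 Hom.s1 Hom.t1

@[simp] lemma comp_f0 {E : TwoCat.{u}} (G : D ⟶ E) (a) : (F ≫ G)⁰ a = G⁰ (F⁰ a) := rfl
@[simp] lemma comp_f1 {E : TwoCat.{u}} (G : D ⟶ E) (a) : (F ≫ G)¹ a = G¹ (F¹ a) := rfl
@[simp] lemma comp_f2 {E : TwoCat.{u}} (G : D ⟶ E) (a) : (F ≫ G)² a = G² (F² a) := rfl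

lemma hom_ext {F G : C ⟶ D} (h0 : ∀ a, F⁰ a = G⁰ a) (h1 : ∀ a, F¹ a = G¹ a) (h2 : ∀ a, F² a = G² a) : F = G :=
  Hom.ext' (Glob2.Hom.ext (funext h0) (funext h1) (funext h2))

lemma isIso_of_bijective (h0 : Function.Bijective F⁰)
    (h1 : Function.Bijective F¹) (h2 : Function.Bijective F²) : IsIso F := by
  let e0 := Equiv.ofBijective _ h0
  let e1 := Equiv.ofBijective _ h1
  let e2 := Equiv.ofBijective _ h2
  have k0 : ∀ x, F⁰ (e0.symm x) = x := e0.apply_symm_apply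
  have k1 : ∀ x, F¹ (e1.symm x) = x := e1.apply_symm_apply
  have k2 : ∀ x, F² (e2.symm x) = x := e2.apply_symm_apply
  have s0 : ∀ x, C.s0 (e1.symm x) = e0.symm (D.s0 x) := fun x => h0.1 (by
    rw [← F.toHom.s0, k0, k1])
  have t0 : ∀ x, C.t0 (e1.symm x) = e0.symm (D.t0 x) := fun x => h0.1 (by
    rw [← F.toHom.t0, k0, k1])
  have s1 : ∀ x, C.s1 (e2.symm x) = e1.symm (D.s1 x) := fun x => h1.1 (by
    rw [← F.toHom.s1, k1, k2])
  have t1 : ∀ x, C.t1 (e2.symm x) = e1.symm (D.t1 x) := fun x => h1.1 (by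
    rw [← F.toHom.t1, k1, k2])
  refine ⟨⟨⟨⟨e0.symm, e1.symm, e2.symm, s0, t0, s1, t1⟩, fun a => h1.1 ?_,
    fun f g h h' => h1.1 ?_, fun a => h2.1 ?_, fun f g h h' => h2.1 ?_, fun f g h h' => h2.1 ?_⟩,
    hom_ext e0.symm_apply_apply e1.symm_apply_apply e2.symm_apply_apply, hom_ext k0 k1 k2⟩⟩
  · rw [k1, F.map_id, k0]
  · rw [k1]
    exact (D.cat1.comp_congr (k1 f).symm (k1 g).symm _ (by rw [k1, k1, h])).trans (F.map_comp _ _ h' _).symm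
  · rw [k2, F.map_vid, k1]
  · rw [k2]
    exact (D.catV.comp_congr (k2 f).symm (k2 g).symm _ (by rw [k2, k2, h])).trans (F.map_vcomp _ _ h' _).symm
  · rw [k2]
    exact (D.catH.comp_congr (k2 f).symm (k2 g).symm _ (by rw [k2, k2, h])).trans (F.map_hcomp _ _ h' _).symm

end TwoCat

namespace CData

variable {D D' K K' : CData.{u}}

def Loc (F : D ⟶ D') : Prop :=
  IsIso F.f ∧ ∀ c c' : D.C.M, D.C.s c = D.C.s c' → D.C.t c = D.C.t c' → ∀ β : D'.A.C2,
    D'.A.s1 β = D'.φ.f1 (F.f.f1 c) → D'.A.t1 β = D'.φ.f1 (F.f.f1 c') →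
    ∃! α : D.A.C2, (D.A.s1 α = D.φ.f1 c ∧ D.A.t1 α = D.φ.f1 c') ∧ F.H² α = β

lemma bijective_f0 {C C' : Ct.{u}} (F : C ⟶ C') [IsIso F] : Function.Bijective F.f0 :=
  ⟨Function.LeftInverse.injective (g := (inv F).f0) fun x =>
    congrFun (congrArg Ct.Hom.f0 (IsIso.hom_inv_id F)) x,
   Function.RightInverse.surjective (g := (inv F).f0) fun x =>
    congrFun (congrArg Ct.Hom.f0 (IsIso.inv_hom_id F)) x⟩

lemma bijective_f1 {C C' : Ct.{u}} (F : C ⟶ C') [IsIso F] : Function.Bijective F.f1 :=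
  ⟨Function.LeftInverse.injective (g := (inv F).f1) fun x =>
    congrFun (congrArg Ct.Hom.f1 (IsIso.hom_inv_id F)) x,
   Function.RightInverse.surjective (g := (inv F).f1) fun x =>
    congrFun (congrArg Ct.Hom.f1 (IsIso.inv_hom_id F)) x⟩

lemma Loc.isIso {F : D ⟶ D'} (hF : Loc F) : IsIso (cells.map F) := by
  obtain ⟨hf, hF⟩ := hF
  have b0 := bijective_f0 F.f
  have b1 := bijective_f1 F.f
  refine TwoCat.isIso_of_bijective _ b0 b1 ⟨fun x y h => ?_, fun y => ?_⟩
  · have hs : x.src = y.src := b1.1 (congrArg Cell.src h)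
    have ht : x.tgt = y.tgt := b1.1 (congrArg Cell.tgt h)
    have hc : F.H² x.cell = F.H² y.cell := congrArg Cell.cell h
    refine Cell.ext hs ht ((hF x.src x.tgt x.ss x.tt (F.H² x.cell) ?_ ?_).unique
      ⟨⟨x.hs, x.ht⟩, rfl⟩ ⟨⟨hs ▸ y.hs, ht ▸ y.ht⟩, hc.symm⟩)
    · rw [F.H.toHom.s1, x.hs, F.comm1]
    · rw [F.H.toHom.t1, x.ht, F.comm1]
  · obtain ⟨c, hc⟩ := b1.2 y.src
    obtain ⟨c', hc'⟩ := b1.2 y.tgt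
    have ss : D.C.s c = D.C.s c' := b0.1 (by rw [← F.f.s, ← F.f.s, hc, hc', y.ss])
    have tt : D.C.t c = D.C.t c' := b0.1 (by rw [← F.f.t, ← F.f.t, hc, hc', y.tt])
    obtain ⟨α, ⟨⟨h1, h2⟩, h3⟩, -⟩ := hF c c' ss tt y.cell (by rw [hc, y.hs]) (by rw [hc', y.ht])
    exact ⟨⟨c, c', α, ss, tt, h1, h2⟩, Cell.ext hc hc' h3⟩

lemma Loc.of_isIso (F : D ⟶ D') [IsIso F] : Loc F := by
  have e1 : F.f ≫ (inv F).f = 𝟙 _ := congrArg Hom.f (IsIso.hom_inv_id F)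
  have e2 : (inv F).f ≫ F.f = 𝟙 _ := congrArg Hom.f (IsIso.inv_hom_id F)
  have e3 : F.H ≫ (inv F).H = 𝟙 _ := congrArg Hom.H (IsIso.hom_inv_id F)
  have e4 : (inv F).H ≫ F.H = 𝟙 _ := congrArg Hom.H (IsIso.inv_hom_id F)
  have e1' : ∀ x, (inv F).f.f1 (F.f.f1 x) = x := fun x => congrFun (congrArg Ct.Hom.f1 e1) x
  have e3' : ∀ x, (inv F).H² (F.H² x) = x := fun x => congrFun (congrArg (fun k => k²) e3) x
  have e4' : ∀ x, F.H² ((inv F).H² x) = x := fun x => congrFun (congrArg (fun k => k²) e4) x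
  refine ⟨⟨(inv F).f, e1, e2⟩, fun c c' hs ht β h1 h2 => ⟨(inv F).H² β, ⟨⟨?_, ?_⟩, e4' β⟩, fun α hα => ?_⟩⟩
  · rw [(inv F).H.toHom.s1, h1, (inv F).comm1, e1']
  · rw [(inv F).H.toHom.t1, h2, (inv F).comm1, e1']
  · rw [← hα.2, e3']

lemma Loc.comp {F : D ⟶ D'} {G : D' ⟶ K} (hF : Loc F) (hG : Loc G) : Loc (F ≫ G) := by
  obtain ⟨hf, hF⟩ := hF
  obtain ⟨hg, hG⟩ := hG
  refine ⟨inferInstanceAs (IsIso (F.f ≫ G.f)), fun c c' hs ht β h1 h2 => ?_⟩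
  have hs' : D'.C.s (F.f.f1 c) = D'.C.s (F.f.f1 c') := by rw [F.f.s, F.f.s, hs]
  have ht' : D'.C.t (F.f.f1 c) = D'.C.t (F.f.f1 c') := by rw [F.f.t, F.f.t, ht]
  obtain ⟨β', ⟨⟨a1, a2⟩, a3⟩, a4⟩ := hG (F.f.f1 c) (F.f.f1 c') hs' ht' β h1 h2
  obtain ⟨α, ⟨⟨b1, b2⟩, b3⟩, b4⟩ := hF c c' hs ht β' a1 a2
  refine ⟨α, ⟨⟨b1, b2⟩, (congrArg G.H² b3).trans a3⟩, fun α' ⟨⟨k1, k2⟩, k3⟩ =>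
    b4 α' ⟨⟨k1, k2⟩, a4 _ ⟨⟨?_, ?_⟩, k3⟩⟩⟩
  · rw [F.H.toHom.s1, k1, F.comm1]
  · rw [F.H.toHom.t1, k2, F.comm1]

open MonoidalCategory in
lemma Loc.tensor {F : D ⟶ D'} {G : K ⟶ K'} (hF : Loc F) (hG : Loc G) : Loc (F ⊗ₘ G) := by
  obtain ⟨hf, hF⟩ := hF
  obtain ⟨hg, hG⟩ := hG
  refine ⟨inferInstanceAs (IsIso (F.f ⊗ₘ G.f)), fun c c' hs ht β h1 h2 => ?_⟩
  have f1 : ∀ c, (Ct.fst D'.C K'.C).f1 ((Ct.funnyMap F.f G.f).f1 c) =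
      F.f.f1 ((Ct.fst D.C K.C).f1 c) := fun c =>
    congrFun (congrArg Ct.Hom.f1 (Ct.funnyMap_fst F.f G.f)) c
  have f2 : ∀ c, (Ct.snd D'.C K'.C).f1 ((Ct.funnyMap F.f G.f).f1 c) =
      G.f.f1 ((Ct.snd D.C K.C).f1 c) := fun c =>
    congrFun (congrArg Ct.Hom.f1 (Ct.funnyMap_snd F.f G.f)) c
  obtain ⟨x, ⟨⟨x1, x2⟩, x3⟩, x4⟩ := hF ((Ct.fst D.C K.C).f1 c) ((Ct.fst D.C K.C).f1 c')
    (by rw [Ct.Hom.s, Ct.Hom.s]; exact congrArg _ hs)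
    (by rw [Ct.Hom.t, Ct.Hom.t]; exact congrArg _ ht) β.1
    ((congrArg Prod.fst h1).trans (congrArg D'.φ.f1 (f1 c)))
    ((congrArg Prod.fst h2).trans (congrArg D'.φ.f1 (f1 c')))
  obtain ⟨y, ⟨⟨y1, y2⟩, y3⟩, y4⟩ := hG ((Ct.snd D.C K.C).f1 c) ((Ct.snd D.C K.C).f1 c')
    (by rw [Ct.Hom.s, Ct.Hom.s]; exact congrArg _ hs)
    (by rw [Ct.Hom.t, Ct.Hom.t]; exact congrArg _ ht) β.2
    ((congrArg Prod.snd h1).trans (congrArg K'.φ.f1 (f2 c)))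
    ((congrArg Prod.snd h2).trans (congrArg K'.φ.f1 (f2 c')))
  refine ⟨(x, y), ⟨⟨Prod.ext x1 y1, Prod.ext x2 y2⟩, Prod.ext x3 y3⟩, fun z ⟨⟨k1, k2⟩, k3⟩ =>
    Prod.ext (x4 z.1 ⟨⟨congrArg Prod.fst k1, congrArg Prod.fst k2⟩, congrArg Prod.fst k3⟩)
      (y4 z.2 ⟨⟨congrArg Prod.snd k1, congrArg Prod.snd k2⟩, congrArg Prod.snd k3⟩)⟩

lemma counit_app (D : CData.{u}) : adj.counit.app D = transpose (𝟙 (cellsObj D)) := rfl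

lemma unit_app (A : TwoCat.{u}) : adj.unit.app A = transposeInv (𝟙 (gen.obj A)) := rfl

lemma Loc.counit (D : CData.{u}) : Loc (adj.counit.app D) :=
  ⟨inferInstanceAs (IsIso (𝟙 D.C)), fun c c' hs ht β h1 h2 => ⟨⟨c, c', β, hs, ht, h1, h2⟩,
    ⟨⟨rfl, rfl⟩, rfl⟩, fun α ⟨⟨k1, k2⟩, k3⟩ => Cell.ext k1 k2 k3⟩⟩

instance isIso_unit (A : TwoCat.{u}) : IsIso (adj.unit.app A) :=
  TwoCat.isIso_of_bijective _ ⟨fun _ _ h => h, fun x => ⟨x, rfl⟩⟩ ⟨fun _ _ h => h, fun x => ⟨x, rfl⟩⟩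
    ⟨fun _ _ h => congrArg Cell.cell h, fun x => ⟨x.cell, Cell.ext x.hs x.ht rfl⟩⟩

open MonoidalCategory OfAdjunction

instance isIso_mu : ∀ L M : List TwoCat.{u}, IsIso (mu gen L M)
  | [], M => inferInstanceAs (IsIso (λ_ (T gen M)).hom)
  | X :: L, M => by
    have := isIso_mu L M
    exact inferInstanceAs (IsIso ((α_ _ _ _).hom ≫ (gen.obj X ◁ mu gen L M)))

lemma Loc.flat : ∀ LL : List (List TwoCat.{u}), Loc (OfAdjunction.flat adj LL)
  | [] => Loc.of_isIso (𝟙 _)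
  | L :: LL => ((Loc.counit _).tensor (Loc.flat LL)).comp (Loc.of_isIso (mu gen L LL.flatten))

end CData

lemma grayH_isIso_η (A : TwoCat.{u}) : IsIso (grayH.η A) :=
  @IsIso.comp_isIso _ _ _ _ _ _ _ (CData.isIso_unit A)
    (Functor.map_isIso CData.cells (MonoidalCategory.rightUnitor (CData.gen.obj A)).inv)

lemma grayH_isIso_σ (LL : List (List TwoCat.{u})) (L) (h) : IsIso (grayH.σ LL L h) := by
  subst h
  exact ((CData.Loc.flat LL).comp (CData.Loc.of_isIso (𝟙 _))).isIso

end

section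

namespace TwoCat

variable {C : TwoCat.{u}}

structure IsInv (x y : C.C2) : Prop where
  s : C.s1 y = C.t1 x
  t : C.t1 y = C.s1 x
  left : C.vc x y = C♯ (C.s1 x)
  right : C.vc y x = C♯ (C.t1 x)

lemma IsInv.symm {x y : C.C2} (h : IsInv x y) : IsInv y x :=
  ⟨h.t.symm, h.s.symm, h.right.trans (by rw [h.s]), h.left.trans (by rw [h.t])⟩

lemma IsInv.id (f : C.C1) : IsInv (C♯ f) (C♯ f) :=
  ⟨by simp, by simp, by rw [id_vc (by simp)]; simp, by rw [id_vc (by simp)]; simp⟩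

lemma IsInv.vc {x y x' y' : C.C2} (h : IsInv x y) (h' : IsInv x' y') (e : C.t1 x = C.s1 x') :
    IsInv (C.vc x x') (C.vc y' y) := by
  have a1 := h.s
  have a2 := h.t
  have b1 := h'.s
  have b2 := h'.t
  have k : C.t1 y' = C.s1 y := by rw [b2, a1, e]
  refine ⟨by rw [s1_vc, t1_vc e, b1], by rw [t1_vc k, s1_vc, a2], ?_, ?_⟩
  · rw [vc_assoc e (by rw [s1_vc, b1]), ← vc_assoc b1.symm k, h'.left, id_vc (by rw [a1, e]), h.left, s1_vc]
  · rw [vc_assoc k (by rw [s1_vc, a2]), ← vc_assoc a2 e, h.right, id_vc e.symm, h'.right, t1_vc e]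

lemma IsInv.hc {x y x' y' : C.C2} (h : IsInv x y) (h' : IsInv x' y')
    (e : C.t0 (C.s1 x) = C.s0 (C.s1 x')) : IsInv (C.hc x x') (C.hc y y') := by
  have a1 := h.s
  have a2 := h.t
  have b1 := h'.s
  have b2 := h'.t
  have k : C.t0 (C.s1 y) = C.s0 (C.s1 y') := by rw [a1, b1]; simpa using e
  refine ⟨by rw [s1_hc k, t1_hc e, a1, b1], by rw [t1_hc k, s1_hc e, a2, b2], ?_, ?_⟩
  · rw [← interch a1.symm b1.symm e, h.left, h'.left, i1_hc_i1 e, s1_hc e]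
  · rw [← interch a2 b2 k, h.right, h'.right, i1_hc_i1 (by simpa using e), t1_hc e]

lemma IsInv.cancel {x y z z' : C.C2} (h : IsInv x y) (hz : C.t1 z = C.s1 x)
    (hz' : C.t1 z' = C.s1 x) (e : C.vc z x = C.vc z' x) : z = z' := by
  have k : C.vc (C.vc z x) y = C.vc (C.vc z' x) y := congrArg (C.vc · y) e
  rwa [vc_assoc hz h.s.symm, vc_assoc hz' h.s.symm, h.left, vc_id hz, vc_id hz'] at k

lemma IsInv.unique {x y y' : C.C2} (h : IsInv x y) (h' : IsInv x y') : y = y' :=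
  h.cancel h.t h'.t (h.right.trans h'.right.symm)

lemma IsInv.map {D : TwoCat.{u}} {x y : C.C2} (h : IsInv x y) (F : C ⟶ D) : IsInv (F² x) (F² y) := by
  refine ⟨by simp [h.s], by simp [h.t], ?_, ?_⟩
  · rw [← F.map_vc h.s.symm, h.left]; simp
  · rw [← F.map_vc h.t, h.right]; simp

lemma hc_eq_vc {x y : C.C2} {f g : C.C1} (h : C.t0 (C.s1 x) = C.s0 (C.s1 y)) (hf : C.t1 x = f)
    (hg : C.s1 y = g) : C.vc (C.hc x (C♯ g)) (C.hc (C♯ f) y) = C.hc x y := by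
  subst hf hg
  rw [← interch (by simp) (by simp) (by simpa using h), vc_id rfl, id_vc rfl]

lemma hc_eq_vc' {x y : C.C2} {f g : C.C1} (h : C.t0 (C.s1 x) = C.s0 (C.s1 y)) (hf : C.s1 x = f)
    (hg : C.t1 y = g) : C.vc (C.hc (C♯ f) y) (C.hc x (C♯ g)) = C.hc x y := by
  subst hf hg
  rw [← interch (by simp) (by simp) (by simpa using h), vc_id rfl, id_vc rfl]

lemma vc_whisker_left {x y : C.C2} {f : C.C1} (h : C.t1 x = C.s1 y)
    (hf : C.t0 f = C.s0 (C.s1 x)) : C.hc (C♯ f) (C.vc x y) = C.vc (C.hc (C♯ f) x) (C.hc (C♯ f) y) := by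
  rw [← interch (by simp) h (by simpa using hf), id_vc (by simp)]

lemma vc_whisker_right {x y : C.C2} {f : C.C1} (h : C.t1 x = C.s1 y)
    (hf : C.t0 (C.s1 x) = C.s0 f) : C.hc (C.vc x y) (C♯ f) = C.vc (C.hc x (C♯ f)) (C.hc y (C♯ f)) := by
  rw [← interch h (by simp) (by simpa using hf), id_vc (by simp)]

end TwoCat

namespace Cubical

open TwoCat

variable {A B C : TwoCat.{u}} (F : Cubical A B C)

@[simp] lemma agree' (a b) : (F.left b)⁰ a = (F.right a)⁰ b := F.agree a b

lemma exists_inv (f : A.C1) (g : B.C1) : ∃ δ, IsInv (F.γ f g) δ := by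
  obtain ⟨δ, h, h', e, e'⟩ := F.invertible f g
  have k : C.t1 δ = C.s1 (F.γ f g) := h'
  exact ⟨δ, h.symm, h', (vc_eq h).trans e, (vc_eq h').trans e'⟩

def δ (f : A.C1) (g : B.C1) : C.C2 := (F.exists_inv f g).choose

lemma isInv (f : A.C1) (g : B.C1) : IsInv (F.γ f g) (F.δ f g) := (F.exists_inv f g).choose_spec

lemma cond (f : A.C1) (g : B.C1) : C.t0 ((F.left (B.s0 g))¹ f) = C.s0 ((F.right (A.t0 f))¹ g) := by simp

lemma cond' (f : A.C1) (g : B.C1) : C.t0 ((F.right (A.s0 f))¹ g) = C.s0 ((F.left (B.t0 g))¹ f) := by simp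

@[simp] lemma s1γ (f : A.C1) (g : B.C1) : C.s1 (F.γ f g) =
    C.c1 ((F.left (B.s0 g))¹ f) ((F.right (A.t0 f))¹ g) :=
  (F.s1_γ f g (F.cond f g)).trans (c1_eq _).symm

@[simp] lemma t1γ (f : A.C1) (g : B.C1) : C.t1 (F.γ f g) =
    C.c1 ((F.right (A.s0 f))¹ g) ((F.left (B.t0 g))¹ f) :=
  (F.t1_γ f g (F.cond' f g)).trans (c1_eq _).symm

@[simp] lemma s1δ (f : A.C1) (g : B.C1) : C.s1 (F.δ f g) =
    C.c1 ((F.right (A.s0 f))¹ g) ((F.left (B.t0 g))¹ f) :=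
  (F.isInv f g).s.trans (F.t1γ f g)

@[simp] lemma t1δ (f : A.C1) (g : B.C1) : C.t1 (F.δ f g) =
    C.c1 ((F.left (B.s0 g))¹ f) ((F.right (A.t0 f))¹ g) :=
  (F.isInv f g).t.trans (F.s1γ f g)

lemma δ_id_left (a g) : F.δ (A♭ a) g = C♯ ((F.right a)¹ g) :=
  (F.isInv _ g).unique (by rw [F.γ_id_left]; exact IsInv.id _)

lemma δ_id_right (f b) : F.δ f (B♭ b) = C♯ ((F.left b)¹ f) :=
  (F.isInv f _).unique (by rw [F.γ_id_right]; exact IsInv.id _)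

lemma γ_c1_left {f f' : A.C1} (g : B.C1) (h : A.t0 f = A.s0 f') : F.γ (A.c1 f f') g =
    C.vc (C.hc (C♯ ((F.left (B.s0 g))¹ f)) (F.γ f' g)) (C.hc (F.γ f g) (C♯ ((F.left (B.t0 g))¹ f'))) := by
  have h₁ : C.t0 (C.s1 (C♯ ((F.left (B.s0 g))¹ f))) = C.s0 (C.s1 (F.γ f' g)) := by
    simp [h]
  have h₂ : C.t0 (C.s1 (F.γ f g)) = C.s0 (C.s1 (C♯ ((F.left (B.t0 g))¹ f'))) := by
    simp [h]
  have h₃ : C.t1 (C.hc (C♯ ((F.left (B.s0 g))¹ f)) (F.γ f' g)) =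
      C.s1 (C.hc (F.γ f g) (C♯ ((F.left (B.t0 g))¹ f'))) := by
    simp [h, c1_assoc]
  rw [c1_eq h, vc_eq h₃]
  exact (F.γ_comp_left f f' g h h₁ h₂ (by rw [← hc_eq, ← hc_eq]; exact h₃)).trans
    (C.catV.comp_congr (hc_eq _).symm (hc_eq _).symm _ _)

lemma γ_c1_right (f : A.C1) {g g' : B.C1} (h : B.t0 g = B.s0 g') : F.γ f (B.c1 g g') =
    C.vc (C.hc (F.γ f g) (C♯ ((F.right (A.t0 f))¹ g'))) (C.hc (C♯ ((F.right (A.s0 f))¹ g)) (F.γ f g')) := by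
  have h₁ : C.t0 (C.s1 (F.γ f g)) = C.s0 (C.s1 (C♯ ((F.right (A.t0 f))¹ g'))) := by
    simp [h]
  have h₂ : C.t0 (C.s1 (C♯ ((F.right (A.s0 f))¹ g))) = C.s0 (C.s1 (F.γ f g')) := by
    simp [h]
  have h₃ : C.t1 (C.hc (F.γ f g) (C♯ ((F.right (A.t0 f))¹ g'))) =
      C.s1 (C.hc (C♯ ((F.right (A.s0 f))¹ g)) (F.γ f g')) := by
    simp [h, c1_assoc]
  rw [c1_eq h, vc_eq h₃]
  exact (F.γ_comp_right f g g' h h₁ h₂ (by rw [← hc_eq, ← hc_eq]; exact h₃)).trans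
    (C.catV.comp_congr (hc_eq _).symm (hc_eq _).symm _ _)

lemma δ_c1_left {f f' : A.C1} (g : B.C1) (h : A.t0 f = A.s0 f') : F.δ (A.c1 f f') g =
    C.vc (C.hc (F.δ f g) (C♯ ((F.left (B.t0 g))¹ f'))) (C.hc (C♯ ((F.left (B.s0 g))¹ f)) (F.δ f' g)) := by
  refine (F.isInv _ g).unique ?_
  rw [F.γ_c1_left g h]
  exact ((IsInv.id _).hc (F.isInv f' g) (by simp [h])).vc
    ((F.isInv f g).hc (IsInv.id _) (by simp [h])) (by simp [h, c1_assoc])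

lemma δ_c1_right (f : A.C1) {g g' : B.C1} (h : B.t0 g = B.s0 g') : F.δ f (B.c1 g g') =
    C.vc (C.hc (C♯ ((F.right (A.s0 f))¹ g)) (F.δ f g')) (C.hc (F.δ f g) (C♯ ((F.right (A.t0 f))¹ g'))) := by
  refine (F.isInv f _).unique ?_
  rw [F.γ_c1_right f h]
  exact ((F.isInv f g).hc (IsInv.id _) (by simp [h])).vc
    ((IsInv.id _).hc (F.isInv f g') (by simp [h])) (by simp [h, c1_assoc])

lemma γ_nat_left (α : A.C2) (g : B.C1) : C.vc (C.hc ((F.left (B.s0 g))² α)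
        (C♯ ((F.right (A.t0 (A.s1 α)))¹ g))) (F.γ (A.t1 α) g) =
      C.vc (F.γ (A.s1 α) g) (C.hc (C♯ ((F.right (A.s0 (A.s1 α)))¹ g)) ((F.left (B.t0 g))² α)) := by
  have h₁ : C.t0 (C.s1 ((F.left (B.s0 g))² α)) = C.s0 (C.s1 (C♯ ((F.right (A.t0 (A.s1 α)))¹ g))) := by simp
  have h₃ : C.t0 (C.s1 (C♯ ((F.right (A.s0 (A.s1 α)))¹ g))) = C.s0 (C.s1 ((F.left (B.t0 g))² α)) := by simp
  have h₂ : C.t1 (C.hc ((F.left (B.s0 g))² α)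
        (C♯ ((F.right (A.t0 (A.s1 α)))¹ g))) = C.s1 (F.γ (A.t1 α) g) := by simp
  have h₄ : C.t1 (F.γ (A.s1 α) g) = C.s1 (C.hc
        (C♯ ((F.right (A.s0 (A.s1 α)))¹ g)) ((F.left (B.t0 g))² α)) := by
    simp
  rw [vc_eq h₂, vc_eq h₄]
  refine (C.catV.comp_congr (hc_eq h₁) rfl _ (by rw [← hc_eq, h₂])).trans
    ((F.γ_natural_left α g h₁ _ h₃ (by rw [← hc_eq, h₄])).trans (C.catV.comp_congr rfl (hc_eq h₃).symm _ _))

lemma γ_nat_right (f : A.C1) (β : B.C2) : C.vc (C.hc (C♯ ((F.left (B.s0 (B.s1 β)))¹ f))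
        ((F.right (A.t0 f))² β)) (F.γ f (B.t1 β)) =
      C.vc (F.γ f (B.s1 β)) (C.hc ((F.right (A.s0 f))² β) (C♯ ((F.left (B.t0 (B.s1 β)))¹ f))) := by
  have h₁ : C.t0 (C.s1 (C♯ ((F.left (B.s0 (B.s1 β)))¹ f))) = C.s0 (C.s1 ((F.right (A.t0 f))² β)) := by simp
  have h₃ : C.t0 (C.s1 ((F.right (A.s0 f))² β)) = C.s0 (C.s1 (C♯ ((F.left (B.t0 (B.s1 β)))¹ f))) := by simp
  have h₂ : C.t1 (C.hc (C♯ ((F.left (B.s0 (B.s1 β)))¹ f))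
        ((F.right (A.t0 f))² β)) = C.s1 (F.γ f (B.t1 β)) := by simp
  have h₄ : C.t1 (F.γ f (B.s1 β)) = C.s1 (C.hc ((F.right (A.s0 f))² β)
        (C♯ ((F.left (B.t0 (B.s1 β)))¹ f))) := by
    simp
  rw [vc_eq h₂, vc_eq h₄]
  refine (C.catV.comp_congr (hc_eq h₁) rfl _ (by rw [← hc_eq, h₂])).trans
    ((F.γ_natural_right f β h₁ _ h₃ (by rw [← hc_eq, h₄])).trans (C.catV.comp_congr rfl (hc_eq h₃).symm _ _))

lemma γ_nat (α : A.C2) (β : B.C2) : C.vc (C.hc ((F.left (B.s0 (B.s1 β)))² α) ((F.right (A.t0 (A.s1 α)))² β))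
        (F.γ (A.t1 α) (B.t1 β)) =
      C.vc (F.γ (A.s1 α) (B.s1 β)) (C.hc ((F.right (A.s0 (A.s1 α)))² β) ((F.left (B.t0 (B.s1 β)))² α)) := by
  have h1 := F.γ_nat_right (A.t1 α) β
  have h2 := F.γ_nat_left α (B.s1 β)
  simp only [t0_t1, s0_t1] at h1
  rw [← hc_eq_vc (by simp) rfl rfl, vc_assoc (by simp) (by simp)]
  simp only [Hom.t1, Hom.s1]
  rw [h1, ← vc_assoc (by simp) (by simp), h2, vc_assoc (by simp) (by simp),
    hc_eq_vc' (by simp) (by simp) (by simp)]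

lemma δ_nat (α : A.C2) (β : B.C2) : C.vc (C.hc ((F.right (A.s0 (A.s1 α)))² β) ((F.left (B.t0 (B.s1 β)))² α))
        (F.δ (A.t1 α) (B.t1 β)) =
      C.vc (F.δ (A.s1 α) (B.s1 β)) (C.hc ((F.left (B.s0 (B.s1 β)))² α) ((F.right (A.t0 (A.s1 α)))² β)) := by
  refine (F.isInv (A.t1 α) (B.t1 β)).cancel (by simp) (by simp) ?_
  have k := (F.isInv (A.t1 α) (B.t1 β)).right
  have k' := (F.isInv (A.s1 α) (B.s1 β)).right
  rw [vc_assoc (by simp) (by simp), k, vc_assoc (by simp) (by simp), F.γ_nat,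
    ← vc_assoc (by simp) (by simp), k', vc_id (by simp), id_vc (by simp)]

end Cubical

end

section

namespace Cubical

open TwoCat

variable {A B C : TwoCat.{u}} (F : Cubical A B C)

@[ext] structure TwM where
  f : A.C1
  g : B.C1
  m : C.C1
  x : C.C2
  hs : C.s1 x = m
  ht : C.t1 x = C.c1 ((F.left (B.s0 g))¹ f) ((F.right (A.t0 f))¹ g)
  inv : ∃ y, IsInv x y

namespace TwM

variable {F}

lemma s0m (p : TwM F) : C.s0 p.m = (F.right (A.s0 p.f))⁰ (B.s0 p.g) := by
  rw [← p.hs, C.ss, p.ht]; simp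

lemma t0m (p : TwM F) : C.t0 p.m = (F.right (A.t0 p.f))⁰ (B.t0 p.g) := by
  rw [← p.hs, C.tt, p.ht]; simp

lemma s0x (p : TwM F) : C.s0 (C.s1 p.x) = (F.right (A.s0 p.f))⁰ (B.s0 p.g) := by
  rw [p.hs, s0m]

lemma t0x (p : TwM F) : C.t0 (C.s1 p.x) = (F.right (A.t0 p.f))⁰ (B.t0 p.g) := by
  rw [p.hs, t0m]

attribute [simp] s0m t0m s0x t0x

def mid (p q : TwM F) : C.C2 := C.hc (C♯ ((F.left (B.s0 p.g))¹ p.f)) (C.hc (F.δ q.f p.g)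
    (C♯ ((F.right (A.t0 q.f))¹ q.g)))

section

variable {p q : TwM F} (hA : A.t0 p.f = A.s0 q.f) (hB : B.t0 p.g = B.s0 q.g)

include hA hB

lemma s1_mid : C.s1 (mid p q) = C.t1 (C.hc p.x q.x) := by
  rw [mid, t1_hc (by simp (maxDischargeDepth := 10) [hA, hB]), p.ht, q.ht]
  simp (maxDischargeDepth := 10) [hA, hB, c1_assoc]

lemma t1_mid : C.t1 (mid p q) = C.c1 ((F.left (B.s0 p.g))¹ (A.c1 p.f q.f))
    ((F.right (A.t0 q.f))¹ (B.c1 p.g q.g)) := by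
  rw [mid, Hom.map_c1 _ hA, Hom.map_c1 _ hB]
  simp (maxDischargeDepth := 10) [hA, hB, c1_assoc]

lemma inv_mid : ∃ y, IsInv (mid p q) y :=
  ⟨_, (IsInv.id _).hc ((F.isInv q.f p.g).symm.hc (IsInv.id _) (by simp (maxDischargeDepth := 10) [hB])) (by simp (maxDischargeDepth := 10) [hA, hB])⟩

end

def comp (p q : TwM F) (hA : A.t0 p.f = A.s0 q.f) (hB : B.t0 p.g = B.s0 q.g) : TwM F where
  f := A.c1 p.f q.f
  g := B.c1 p.g q.g
  m := C.c1 p.m q.m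
  x := C.vc (C.hc p.x q.x) (mid p q)
  hs := by simp (maxDischargeDepth := 10) [hA, hB, p.hs, q.hs]
  ht := by rw [t1_vc (s1_mid hA hB).symm, t1_mid hA hB]; simp (maxDischargeDepth := 10) [hA]
  inv := by
    obtain ⟨y, hy⟩ := p.inv
    obtain ⟨y', hy'⟩ := q.inv
    obtain ⟨y'', hy''⟩ := inv_mid hA hB
    exact ⟨_, (hy.hc hy' (by simp (maxDischargeDepth := 10) [hA, hB])).vc hy'' (s1_mid hA hB).symm⟩

lemma mid_assoc {p q r : TwM F} (hA : A.t0 p.f = A.s0 q.f) (hB : B.t0 p.g = B.s0 q.g)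
    (hA' : A.t0 q.f = A.s0 r.f) (hB' : B.t0 q.g = B.s0 r.g) :
    C.vc (C.hc (mid p q) (C♯ (C.t1 r.x))) (mid (comp p q hA hB) r) =
      C.vc (C.hc (C♯ (C.t1 p.x)) (mid q r)) (mid p (comp q r hA' hB')) := by
  have e1 : mid (comp p q hA hB) r = C.vc (C.hc (C♯ ((F.left (B.s0 p.g))¹ p.f))
        (C.hc (C♯ (C.t1 (F.δ q.f p.g))) (C.hc (F.δ r.f q.g) (C♯ ((F.right (A.t0 r.f))¹ r.g)))))
      (C.hc (C♯ ((F.left (B.s0 p.g))¹ p.f)) (C.hc (C♯ ((F.left (B.s0 p.g))¹ q.f)) (C.hc (F.δ r.f p.g)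
          (C.hc (C♯ ((F.right (A.t0 r.f))¹ q.g)) (C♯ ((F.right (A.t0 r.f))¹ r.g)))))) := by
    change C.hc (C♯ ((F.left (B.s0 (B.c1 p.g q.g)))¹ (A.c1 p.f q.f)))
      (C.hc (F.δ r.f (B.c1 p.g q.g)) (C♯ ((F.right (A.t0 r.f))¹ r.g))) = _
    rw [F.δ_c1_right _ hB, Hom.map_c1 _ hA, ← i1_hc_i1 (by simp (maxDischargeDepth := 10) [hA]),
      vc_whisker_right (by simp (maxDischargeDepth := 10) [hB, hA', c1_assoc]) (by simp (maxDischargeDepth := 10) [hB, hA', hB']),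
      hc_assoc (by simp (maxDischargeDepth := 10) [hA]) (by simp (maxDischargeDepth := 10) [hB, hA', hB']),
      vc_whisker_left (by simp (maxDischargeDepth := 10) [hB, hA', hB', c1_assoc]) (by simp (maxDischargeDepth := 10) [hB, hA', hB']),
      vc_whisker_left (by simp (maxDischargeDepth := 10) [hB, hA', hB', c1_assoc]) (by simp (maxDischargeDepth := 10) [hA, hB, hA', hB'])]
    simp (maxDischargeDepth := 10) [hc_assoc, ← i1_hc_i1, hA, hA', hB, hB']
  have e2 : mid p (comp q r hA' hB') = C.vc (C.hc (C♯ ((F.left (B.s0 p.g))¹ p.f))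
        (C.hc (F.δ q.f p.g) (C.hc (C♯ (C.t1 (F.δ r.f q.g))) (C♯ ((F.right (A.t0 r.f))¹ r.g)))))
      (C.hc (C♯ ((F.left (B.s0 p.g))¹ p.f)) (C.hc (C♯ ((F.left (B.s0 p.g))¹ q.f)) (C.hc (F.δ r.f p.g)
          (C.hc (C♯ ((F.right (A.t0 r.f))¹ q.g)) (C♯ ((F.right (A.t0 r.f))¹ r.g)))))) := by
    change C.hc (C♯ ((F.left (B.s0 p.g))¹ p.f)) (C.hc (F.δ (A.c1 q.f r.f) p.g)
        (C♯ ((F.right (A.t0 (A.c1 q.f r.f)))¹ (B.c1 q.g r.g)))) = _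
    rw [F.δ_c1_left _ hA', t0_c1 hA',
      vc_whisker_right (by simp (maxDischargeDepth := 10) [hB, hA', c1_assoc]) (by simp (maxDischargeDepth := 10) [hB, hA', hB']),
      vc_whisker_left (by simp (maxDischargeDepth := 10) [hB, hA', hB', c1_assoc]) (by simp (maxDischargeDepth := 10) [hA, hB, hA', hB']), Hom.map_c1 _ hB', ← i1_hc_i1 (by simp (maxDischargeDepth := 10) [hB'])]
    simp (maxDischargeDepth := 10) [hc_assoc, ← i1_hc_i1, hA, hA', hB, hB']
  rw [e1, e2, ← vc_assoc, ← vc_assoc]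
  · congr 1
    have e3 : C.hc (mid p q) (C♯ (C.t1 r.x)) = C.hc (C♯ ((F.left (B.s0 p.g))¹ p.f)) (C.hc (F.δ q.f p.g)
          (C.hc (C♯ (C.s1 (F.δ r.f q.g))) (C♯ ((F.right (A.t0 r.f))¹ r.g)))) := by
      rw [r.ht, mid]
      simp (maxDischargeDepth := 10) [hc_assoc, ← i1_hc_i1, hA, hA', hB, hB']
    have e4 : C.hc (C♯ (C.t1 p.x)) (mid q r) =
        C.hc (C♯ ((F.left (B.s0 p.g))¹ p.f)) (C.hc (C♯ (C.s1 (F.δ q.f p.g)))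
          (C.hc (F.δ r.f q.g) (C♯ ((F.right (A.t0 r.f))¹ r.g)))) := by
      rw [p.ht, mid]
      simp (maxDischargeDepth := 10) [hc_assoc, ← i1_hc_i1, hA, hA', hB, hB']
    rw [e3, e4]
    rw [← vc_whisker_left (by simp (maxDischargeDepth := 10) [hB, hA', hB', c1_assoc]) (by simp (maxDischargeDepth := 10) [hA, hB, hA', hB']),
      ← vc_whisker_left (by simp (maxDischargeDepth := 10) [hB, hA', hB', c1_assoc]) (by simp (maxDischargeDepth := 10) [hA, hB, hA', hB']),
      i1_hc_i1 (by simp (maxDischargeDepth := 10) [hB, hB', hA']),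
      i1_hc_i1 (by simp (maxDischargeDepth := 10) [hB, hB', hA']),
      hc_eq_vc (by simp (maxDischargeDepth := 10) [hB, hB', hA']) rfl
        (by simp (maxDischargeDepth := 10) [hB, hB', hA', c1_assoc]),
      hc_eq_vc' (by simp (maxDischargeDepth := 10) [hB, hB', hA']) rfl
        (by simp (maxDischargeDepth := 10) [hB, hB', hA', c1_assoc])]
  all_goals simp (maxDischargeDepth := 10) [mid, r.ht, p.ht, hA, hA', hB, hB', c1_assoc]

end TwM

@[reducible] def tw : Ct.{u} where
  O := A.C0 × B.C0
  M := TwM F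
  s p := (A.s0 p.f, B.s0 p.g)
  t p := (A.t0 p.f, B.t0 p.g)
  cat :=
    { id := fun a => ⟨A♭ a.1, B♭ a.2, C♭ ((F.right a.1)⁰ a.2),
        C♯ (C♭ ((F.right a.1)⁰ a.2)), by simp, by simp (maxDischargeDepth := 10) [id_c1],
        _, IsInv.id _⟩
      comp := fun p q h => p.comp q (congrArg Prod.fst h) (congrArg Prod.snd h)
      s_id := fun _ => by simp
      t_id := fun _ => by simp
      s_comp := fun _ _ _ => by simp (maxDischargeDepth := 10) [TwM.comp]
      t_comp := fun p q h => by
        have hA : A.t0 p.f = A.s0 q.f := congrArg Prod.fst h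
        have hB : B.t0 p.g = B.s0 q.g := congrArg Prod.snd h
        simp (maxDischargeDepth := 10) [TwM.comp, hA, hB]
      id_comp := fun p h => by
        refine TwM.ext (id_c1 rfl) (id_c1 rfl) (id_c1 p.s0m) ?_
        have h1 := p.ht
        simp (maxDischargeDepth := 10) [TwM.comp, TwM.mid, id_hc, δ_id_right, vc_id, i1_hc_i1, h1, id_c1, c1_id]
      comp_id := fun p h => by
        refine TwM.ext (c1_id rfl) (c1_id rfl) (c1_id p.t0m) ?_
        have h1 := p.ht
        simp (maxDischargeDepth := 10) [TwM.comp, TwM.mid, hc_id, δ_id_left, vc_id, i1_hc_i1, h1, id_c1, c1_id]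
      assoc := fun p q r h₁ h₂ h₃ h₄ => by
        have hA : A.t0 p.f = A.s0 q.f := congrArg Prod.fst h₁
        have hB : B.t0 p.g = B.s0 q.g := congrArg Prod.snd h₁
        have hA' : A.t0 q.f = A.s0 r.f := congrArg Prod.fst h₃
        have hB' : B.t0 q.g = B.s0 r.g := congrArg Prod.snd h₃
        refine TwM.ext (c1_assoc hA hA') (c1_assoc hB hB') (c1_assoc ?_ ?_) ?_
        · simp (maxDischargeDepth := 10) [hA, hB]
        · simp (maxDischargeDepth := 10) [hA', hB']
        change C.vc (C.hc (C.vc (C.hc p.x q.x) (TwM.mid p q)) r.x)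
          (TwM.mid (TwM.comp p q hA hB) r) = C.vc (C.hc p.x (C.vc (C.hc q.x r.x) (TwM.mid q r)))
          (TwM.mid p (TwM.comp q r hA' hB'))
        have k1 := TwM.s1_mid hA hB
        have k2 := TwM.s1_mid hA' hB'
        have k3 := TwM.mid_assoc hA hB hA' hB'
        have k4 := TwM.s1_mid (p := TwM.comp p q hA hB) (q := r) ((t0_c1 hA).trans hA')
          ((t0_c1 hB).trans hB')
        have k5 := TwM.s1_mid (p := p) (q := TwM.comp q r hA' hB') (hA.trans (s0_c1 _ _).symm)
          (hB.trans (s0_c1 _ _).symm)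
        have d1 : C.t0 (C.s1 p.x) = C.s0 (C.s1 q.x) := by simp (maxDischargeDepth := 10) [hA, hB]
        have d2 : C.t0 (C.s1 q.x) = C.s0 (C.s1 r.x) := by simp (maxDischargeDepth := 10) [hA', hB']
        have d3 : C.t0 (C.s1 (C.hc p.x q.x)) = C.s0 (C.s1 r.x) := by
          rw [s1_hc d1, t0_c1 (by simpa using d1), d2]
        have d4 : C.t0 (C.s1 p.x) = C.s0 (C.s1 (C.hc q.x r.x)) := by
          rw [s1_hc d2, s0_c1, d1]
        have d5 : C.t0 (C.s1 (TwM.mid p q)) = C.s0 (C.t1 r.x) := by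
          rw [k1, t0_t1, d3, s0_t1]
        have d6 : C.t0 (C.t1 p.x) = C.s0 (C.s1 (TwM.mid q r)) := by
          rw [k2, s0_t1, ← d4, t0_t1]
        have j1 : C.hc (C.vc (C.hc p.x q.x) (TwM.mid p q)) r.x =
            C.vc (C.hc (C.hc p.x q.x) r.x) (C.hc (TwM.mid p q) (C♯ (C.t1 r.x))) := by
          rw [← interch k1.symm (by simp) d3, vc_id rfl]
        have j2 : C.hc p.x (C.vc (C.hc q.x r.x) (TwM.mid q r)) =
            C.vc (C.hc p.x (C.hc q.x r.x)) (C.hc (C♯ (C.t1 p.x)) (TwM.mid q r)) := by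
          rw [← interch (by simp) k2.symm d4, vc_id rfl]
        have m1 : C.t1 (C.hc (TwM.mid p q) (C♯ (C.t1 r.x))) =
            C.s1 (TwM.mid (TwM.comp p q hA hB) r) := by
          rw [k4, t1_hc (by simpa using d5)]
          change _ = C.t1 (C.hc (C.vc (C.hc p.x q.x) (TwM.mid p q)) r.x)
          rw [t1_hc (by simpa using d3), t1_vc k1.symm, t1_i1]
        have m2 : C.t1 (C.hc (C♯ (C.t1 p.x)) (TwM.mid q r)) =
            C.s1 (TwM.mid p (TwM.comp q r hA' hB')) := by
          rw [k5, t1_hc (by simpa using d6)]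
          change _ = C.t1 (C.hc p.x (C.vc (C.hc q.x r.x) (TwM.mid q r)))
          rw [t1_hc (by simpa using d4), t1_vc k2.symm, t1_i1]
        rw [j1, j2, vc_assoc ?_ m1, vc_assoc ?_ m2, k3, hc_assoc d1 d2]
        · rw [t1_hc d4, s1_hc (by simpa using d6), s1_i1, k2]
        · rw [t1_hc d3, s1_hc (by simpa using d5), s1_i1, k1] }

end Cubical

end

section

abbrev gray2 (A B : TwoCat.{u}) : TwoCat.{u} :=
  CData.cellsObj (CData.tensor (CData.gen.obj A) (CData.gen.obj B))

namespace Cubical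

open TwoCat

variable {A B C : TwoCat.{u}} (F : Cubical A B C)

def twLeft (b : B.C0) : A.ct ⟶ F.tw where
  f0 a := (a, b)
  f1 f := ⟨f, B♭ b, (F.left b)¹ f, C♯ ((F.left b)¹ f), by simp, by simp [c1_id], _, IsInv.id _⟩
  s f := by simp [tw]
  t f := by simp [tw]
  map_id a := TwM.ext rfl rfl (by simp [tw]) (by simp [tw])
  map_comp f f' h h' := by
    refine TwM.ext (c1_eq h).symm (id_c1 (by simp)).symm ?_ ?_
    · exact (congrArg _ (c1_eq h).symm).trans (Hom.map_c1 _ h)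
    · change C♯ ((F.left b)¹ (A.cat1.comp f f' h)) = C.vc (C.hc (C♯ ((F.left b)¹ f))
        (C♯ ((F.left b)¹ f'))) (TwM.mid _ _)
      rw [← c1_eq h, Hom.map_c1 _ h]
      have h' : A.t0 f = A.s0 f' := h
      simp (maxDischargeDepth := 10) [TwM.mid, δ_id_right, i1_hc_i1, h', c1_id, vc_id]

def twRight (a : A.C0) : B.ct ⟶ F.tw where
  f0 b := (a, b)
  f1 g := ⟨A♭ a, g, (F.right a)¹ g, C♯ ((F.right a)¹ g), by simp, by simp [id_c1], _, IsInv.id _⟩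
  s f := by simp [tw]
  t f := by simp [tw]
  map_id a := TwM.ext rfl rfl (by simp [tw]) (by simp [tw])
  map_comp f f' h h' := by
    refine TwM.ext (id_c1 (by simp)).symm (c1_eq h).symm ?_ ?_
    · exact (congrArg _ (c1_eq h).symm).trans (Hom.map_c1 _ h)
    · change C♯ ((F.right a)¹ (B.cat1.comp f f' h)) = C.vc (C.hc (C♯ ((F.right a)¹ f))
        (C♯ ((F.right a)¹ f'))) (TwM.mid _ _)
      rw [← c1_eq h, Hom.map_c1 _ h]
      have h' : B.t0 f = B.s0 f' := h
      simp (maxDischargeDepth := 10) [TwM.mid, δ_id_left, i1_hc_i1, h', id_hc, id_c1, vc_id]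

def twLift : Ct.funny A.ct B.ct ⟶ F.tw := Ct.lift ⟨F.twLeft, F.twRight, fun _ _ => rfl⟩

def tw1 : F.tw ⟶ A.ct where
  f0 x := x.1
  f1 p := p.f
  s _ := rfl
  t _ := rfl
  map_id _ := rfl
  map_comp p q h h' := c1_eq _

def tw2 : F.tw ⟶ B.ct where
  f0 x := x.2
  f1 p := p.g
  s _ := rfl
  t _ := rfl
  map_id _ := rfl
  map_comp p q h h' := c1_eq _

def twm : F.tw ⟶ C.ct where
  f0 x := (F.right x.1)⁰ x.2
  f1 p := p.m
  s p := p.s0m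
  t p := p.t0m
  map_id _ := rfl
  map_comp p q h h' := c1_eq _

lemma twLift_f (c) : (F.twLift.f1 c).f = (Ct.fst A.ct B.ct).f1 c := by
  have : F.twLift ≫ F.tw1 = Ct.fst A.ct B.ct := Ct.funny_hom_ext' (fun _ => rfl)
    (fun b f => by simp [twLift]; rfl) (fun a g => by simp [twLift]; rfl)
  exact congrFun (congrArg Ct.Hom.f1 this) c

lemma twLift_g (c) : (F.twLift.f1 c).g = (Ct.snd A.ct B.ct).f1 c := by
  have : F.twLift ≫ F.tw2 = Ct.snd A.ct B.ct := Ct.funny_hom_ext' (fun _ => rfl)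
    (fun b f => by simp [twLift]; rfl) (fun a g => by simp [twLift]; rfl)
  exact congrFun (congrArg Ct.Hom.f1 this) c

lemma exists_twInv (c : Ct.FunnyM A.ct B.ct) : ∃ y, IsInv (F.twLift.f1 c).x y := (F.twLift.f1 c).inv

def twInv (c : Ct.FunnyM A.ct B.ct) : C.C2 := (F.exists_twInv c).choose

lemma twInv_spec (c : Ct.FunnyM A.ct B.ct) : IsInv (F.twLift.f1 c).x (F.twInv c) :=
  (F.exists_twInv c).choose_spec

def nf (x : CData.Cell (CData.tensor (CData.gen.obj A) (CData.gen.obj B))) : C.C2 :=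
  C.hc ((F.left (x.src.src).2)² x.cell.1) ((F.right (x.src.tgt).1)² x.cell.2)

section

variable (x : CData.Cell (CData.tensor (CData.gen.obj A) (CData.gen.obj B)))

lemma hs1 : A.s1 x.cell.1 = (Ct.fst A.ct B.ct).f1 x.src := congrArg Prod.fst x.hs
lemma hs2 : B.s1 x.cell.2 = (Ct.snd A.ct B.ct).f1 x.src := congrArg Prod.snd x.hs
lemma ht1 : A.t1 x.cell.1 = (Ct.fst A.ct B.ct).f1 x.tgt := congrArg Prod.fst x.ht
lemma ht2 : B.t1 x.cell.2 = (Ct.snd A.ct B.ct).f1 x.tgt := congrArg Prod.snd x.ht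

lemma s0fst (c : Ct.FunnyM A.ct B.ct) : A.s0 ((Ct.fst A.ct B.ct).f1 c) = c.src.1 := (Ct.fst A.ct B.ct).s c
lemma t0fst (c : Ct.FunnyM A.ct B.ct) : A.t0 ((Ct.fst A.ct B.ct).f1 c) = c.tgt.1 := (Ct.fst A.ct B.ct).t c
lemma s0snd (c : Ct.FunnyM A.ct B.ct) : B.s0 ((Ct.snd A.ct B.ct).f1 c) = c.src.2 := (Ct.snd A.ct B.ct).s c
lemma t0snd (c : Ct.FunnyM A.ct B.ct) : B.t0 ((Ct.snd A.ct B.ct).f1 c) = c.tgt.2 := (Ct.snd A.ct B.ct).t c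

lemma src_tgt : x.tgt.src = x.src.src := x.ss.symm
lemma tgt_tgt : x.tgt.tgt = x.src.tgt := x.tt.symm

lemma nf_cond : C.t0 (C.s1 ((F.left (x.src.src).2)² x.cell.1)) =
    C.s0 (C.s1 ((F.right (x.src.tgt).1)² x.cell.2)) := by
  simp [hs1, hs2, s0snd, t0fst]

lemma s1_nf : C.s1 (F.nf x) = C.t1 (F.twLift.f1 x.src).x := by
  rw [nf, s1_hc (F.nf_cond x), TwM.ht, twLift_f, twLift_g, s0snd, t0fst]
  simp [hs1, hs2]

lemma t1_nf : C.t1 (F.nf x) = C.t1 (F.twLift.f1 x.tgt).x := by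
  rw [nf, t1_hc (F.nf_cond x), TwM.ht, twLift_f, twLift_g, s0snd, t0fst, src_tgt, tgt_tgt]
  simp [ht1, ht2]

def grayLift2 : C.C2 := C.vc (C.vc (F.twLift.f1 x.src).x (F.nf x)) (F.twInv x.tgt)

lemma s1_grayLift2 : C.s1 (F.grayLift2 x) = (F.twLift.f1 x.src).m := by
  rw [grayLift2, s1_vc, s1_vc, TwM.hs]

lemma conj_cond : C.t1 (C.vc (F.twLift.f1 x.src).x (F.nf x)) = C.s1 (F.twInv x.tgt) := by
  rw [t1_vc (F.s1_nf x).symm, (F.twInv_spec x.tgt).s, t1_nf]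

lemma t1_grayLift2 : C.t1 (F.grayLift2 x) = (F.twLift.f1 x.tgt).m := by
  rw [grayLift2, t1_vc (F.conj_cond x), (F.twInv_spec x.tgt).t, TwM.hs]

lemma grayLift2_vc : C.vc (F.grayLift2 x) (F.twLift.f1 x.tgt).x = C.vc (F.twLift.f1 x.src).x (F.nf x) := by
  have h := F.twInv_spec x.tgt
  rw [grayLift2, vc_assoc (F.conj_cond x) h.t, h.right, vc_id]
  rw [t1_vc (F.s1_nf x).symm, t1_nf]

lemma eq_grayLift2 (z : C.C2) (h : C.t1 z = (F.twLift.f1 x.tgt).m)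
    (e : C.vc z (F.twLift.f1 x.tgt).x = C.vc (F.twLift.f1 x.src).x (F.nf x)) :
    F.grayLift2 x = z :=
  (F.twInv_spec x.tgt).cancel (by rw [t1_grayLift2, TwM.hs]) (by rw [h, TwM.hs])
    ((F.grayLift2_vc x).trans e.symm)

end

lemma nf_vid (c : Ct.FunnyM A.ct B.ct) : F.nf ((gray2 A B)♯ c) = C♯ (C.t1 (F.twLift.f1 c).x) := by
  change C.hc ((F.left (Ct.FunnyM.src c).2)² (A♯ ((Ct.fst A.ct B.ct).f1 c)))
    ((F.right (Ct.FunnyM.tgt c).1)² (B♯ ((Ct.snd A.ct B.ct).f1 c))) = _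
  rw [TwM.ht, twLift_f, twLift_g, Hom.map_i1, Hom.map_i1, s0snd, t0fst, i1_hc_i1]
  simp [t0fst, s0snd]

lemma nf_vcomp (x y : CData.Cell (CData.tensor (CData.gen.obj A) (CData.gen.obj B))) (h : x.tgt = y.src) :
    F.nf ((gray2 A B).catV.comp x y h) = C.vc (F.nf x) (F.nf y) := by
  have e1 : A.t1 x.cell.1 = A.s1 y.cell.1 := congrArg Prod.fst (CData.Cell.vcompat h)
  have e2 : B.t1 x.cell.2 = B.s1 y.cell.2 := congrArg Prod.snd (CData.Cell.vcompat h)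
  have e3 : y.src.src = x.src.src := h ▸ src_tgt x
  have e4 : y.src.tgt = x.src.tgt := h ▸ tgt_tgt x
  change C.hc ((F.left x.src.src.2)² (A.catV.comp x.cell.1 y.cell.1 e1))
    ((F.right x.src.tgt.1)² (B.catV.comp x.cell.2 y.cell.2 e2)) = _
  rw [← vc_eq, ← vc_eq, Hom.map_vc _ e1, Hom.map_vc _ e2, nf, nf, e3, e4,
    interch (by simp [e1]) (by simp [e2]) (F.nf_cond x)]

lemma twLift_comp (c d : Ct.FunnyM A.ct B.ct) (h : c.tgt = d.src) (hA hB) :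
    F.twLift.f1 ((gray2 A B).cat1.comp c d h) = TwM.comp (F.twLift.f1 c) (F.twLift.f1 d) hA hB :=
  F.twLift.map_comp c d h (Prod.ext hA hB)

lemma middle_exchange {α β α₁ β₁ α₂ β₂ δ δ' : C.C2}
    (h1 : C.t0 (C.s1 α) = C.s0 (C.s1 α₁)) (h2 : C.t0 (C.s1 α₁) = C.s0 (C.s1 β₁))
    (h3 : C.t0 (C.s1 β₁) = C.s0 (C.s1 β)) (h4 : C.t0 (C.s1 α) = C.s0 (C.s1 β₂))
    (h5 : C.t0 (C.s1 β₂) = C.s0 (C.s1 α₂)) (h6 : C.t0 (C.s1 α₂) = C.s0 (C.s1 β))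
    (h7 : C.t1 δ = C.c1 (C.s1 α₁) (C.s1 β₁)) (h8 : C.s1 δ' = C.c1 (C.t1 β₂) (C.t1 α₂))
    (k : C.vc (C.hc β₂ α₂) δ' = C.vc δ (C.hc α₁ β₁)) :
    C.vc (C.hc (C♯ (C.s1 α)) (C.hc δ (C♯ (C.s1 β)))) (C.hc (C.hc α α₁) (C.hc β₁ β)) =
      C.vc (C.hc (C.hc α β₂) (C.hc α₂ β)) (C.hc (C♯ (C.t1 α)) (C.hc δ' (C♯ (C.t1 β))))
    := by
  have e1 : C.hc (C.hc α α₁) (C.hc β₁ β) = C.hc α (C.hc (C.hc α₁ β₁) β) := by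
    rw [hc_assoc h1 (by simp [h2]), hc_assoc h2 h3]
  have e2 : C.hc (C.hc α β₂) (C.hc α₂ β) = C.hc α (C.hc (C.hc β₂ α₂) β) := by
    rw [hc_assoc h4 (by simp [h5]), hc_assoc h5 h6]
  have u1 : C.t0 (C.s1 δ) = C.t0 (C.s1 β₁) := by rw [← t0_t1, h7, t0_c1 h2]
  have u2 : C.s0 (C.s1 δ) = C.s0 (C.s1 α₁) := by rw [← s0_t1, h7, s0_c1]
  have m1 : C.t1 δ = C.s1 (C.hc α₁ β₁) := by rw [h7, s1_hc h2]
  have m2 : C.t1 (C.hc β₂ α₂) = C.s1 δ' := by rw [h8, t1_hc h5]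
  have e3 : C.vc (C.hc δ (C♯ (C.s1 β))) (C.hc (C.hc α₁ β₁) β) = C.hc (C.vc δ (C.hc α₁ β₁)) β := by
    rw [← interch m1 (by simp) (by rw [u1, h3]; simp), id_vc rfl]
  have e4 : C.vc (C.hc (C.hc β₂ α₂) β) (C.hc δ' (C♯ (C.t1 β))) = C.hc (C.vc (C.hc β₂ α₂) δ') β := by
    rw [← interch m2 (by simp) (by simp [h5, h6]), vc_id rfl]
  rw [e1, e2, ← interch (by simp) ?_ ?_, e3, ← interch (by simp) ?_ ?_, e4, k, id_vc rfl, vc_id rfl]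
  · rw [t1_hc (by simp [h5, h6]), s1_hc (by rw [← m2]; simp [h5, h6]), m2, s1_i1]
  · simp [h4]
  · rw [t1_hc (by rw [u1, h3]; simp), s1_hc (by simp [h2, h3]), m1, t1_i1]
  · rw [s0_s1_hc, u2, s1_i1, h1]

lemma nf_hcomp (x y : CData.Cell (CData.tensor (CData.gen.obj A) (CData.gen.obj B))) (h : x.src.tgt = y.src.src) :
    C.vc (TwM.mid (F.twLift.f1 x.src) (F.twLift.f1 y.src)) (F.nf ((gray2 A B).catH.comp x y h)) =
      C.vc (C.hc (F.nf x) (F.nf y)) (TwM.mid (F.twLift.f1 x.tgt) (F.twLift.f1 y.tgt)) := by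
  have e1 : A.t0 (A.s1 x.cell.1) = A.s0 (A.s1 y.cell.1) :=
    (congrArg Prod.fst (CData.Cell.hcompat (x := x) (y := y) h) :)
  have e2 : B.t0 (B.s1 x.cell.2) = B.s0 (B.s1 y.cell.2) :=
    (congrArg Prod.snd (CData.Cell.hcompat (x := x) (y := y) h) :)
  have k1 : F.nf ((gray2 A B).catH.comp x y h) = C.hc ((F.left x.src.src.2)² (A.hc x.cell.1 y.cell.1))
        ((F.right y.src.tgt.1)² (B.hc x.cell.2 y.cell.2)) := by
    rw [hc_eq e1, hc_eq e2, nf]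
    have u1 : ((gray2 A B).catH.comp x y h).src.src = x.src.src := (gray2 A B).cat1.s_comp x.src y.src h
    have u2 : ((gray2 A B).catH.comp x y h).src.tgt = y.src.tgt := (gray2 A B).cat1.t_comp x.src y.src h
    rw [u1, u2]
    rfl
  have k2 := F.δ_nat y.cell.1 x.cell.2
  have a1 : A.s0 (A.s1 x.cell.1) = x.src.src.1 := by rw [hs1, s0fst]
  have a2 : A.t0 (A.s1 x.cell.1) = x.src.tgt.1 := by rw [hs1, t0fst]
  have a3 : A.s0 (A.s1 y.cell.1) = x.src.tgt.1 := by rw [hs1, s0fst, h]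
  have a4 : A.t0 (A.s1 y.cell.1) = y.src.tgt.1 := by rw [hs1, t0fst]
  have b1 : B.s0 (B.s1 x.cell.2) = x.src.src.2 := by rw [hs2, s0snd]
  have b2 : B.t0 (B.s1 x.cell.2) = x.src.tgt.2 := by rw [hs2, t0snd]
  have b3 : B.s0 (B.s1 y.cell.2) = x.src.tgt.2 := by rw [hs2, s0snd, h]
  have b4 : B.t0 (B.s1 y.cell.2) = y.src.tgt.2 := by rw [hs2, t0snd]
  rw [k1, nf, nf, TwM.mid, TwM.mid, Hom.map_hc _ e1, Hom.map_hc _ e2]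
  simp only [twLift_f, twLift_g, ← hs1, ← hs2, ← ht1, ← ht2, ← h, s0_t1, t0_t1, a1, a2, a3, a4, b1,
    b2, b3, b4] at k2 ⊢
  have := middle_exchange (α := (F.left x.src.src.2)² x.cell.1)
    (β := (F.right y.src.tgt.1)² y.cell.2) (by simp [a2, a3]) (by simp [a4, b1])
    (by simp [b2, b3]) (by simp [a2, b1]) (by simp [a3, b2]) (by simp [a4, b3])
    (by simp [a4, b1]) (by simp [a3, b2]) k2
  simpa only [Hom.s1, Hom.t1] using this

def grayLift : gray2 A B ⟶ C where
  toHom :=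
    { f0 := fun v => (F.right v.1)⁰ v.2
      f1 := fun c => (F.twLift.f1 c).m
      f2 := F.grayLift2
      s0 := (F.twLift ≫ F.twm).s
      t0 := (F.twLift ≫ F.twm).t
      s1 := F.s1_grayLift2
      t1 := F.t1_grayLift2 }
  map_id := (F.twLift ≫ F.twm).map_id
  map_comp := (F.twLift ≫ F.twm).map_comp
  map_vid c := by
    refine F.eq_grayLift2 _ _ (by simp; rfl) ?_
    change C.vc (C♯ (F.twLift.f1 c).m) (F.twLift.f1 c).x = C.vc (F.twLift.f1 c).x (F.nf ((gray2 A B)♯ c))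
    rw [nf_vid, id_vc (TwM.hs _)]
    exact (vc_id rfl).symm
  map_vcomp x y h h' := by
    have h'' : x.tgt = y.src := h
    have k1 := F.grayLift2_vc x
    have k2 := F.grayLift2_vc y
    have k3 := F.s1_grayLift2 y
    have k4 := F.s1_nf y
    have k5 := F.t1_nf x
    rw [← h''] at k3 k2 k4
    rw [← vc_eq h']
    refine F.eq_grayLift2 _ _ ((t1_vc h').trans (F.t1_grayLift2 y)) ?_
    change C.vc _ (F.twLift.f1 y.tgt).x = C.vc (F.twLift.f1 x.src).x _
    rw [vc_assoc h' ((F.t1_grayLift2 y).trans (TwM.hs _).symm), k2, nf_vcomp,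
      ← vc_assoc ((F.t1_grayLift2 x).trans (TwM.hs _).symm) k4.symm, k1,
      vc_assoc (F.s1_nf x).symm (k5.trans k4.symm)]
  map_hcomp x y h h' := by
    have h1 : x.src.tgt = y.src.src := h
    have h2 : x.tgt.tgt = y.tgt.src := (tgt_tgt x).trans (h1.trans (src_tgt y).symm)
    have hA : A.t0 (F.twLift.f1 x.src).f = A.s0 (F.twLift.f1 y.src).f := by
      rw [twLift_f, twLift_f, t0fst, s0fst, h1]
    have hB : B.t0 (F.twLift.f1 x.src).g = B.s0 (F.twLift.f1 y.src).g := by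
      rw [twLift_g, twLift_g, t0snd, s0snd, h1]
    have hA' : A.t0 (F.twLift.f1 x.tgt).f = A.s0 (F.twLift.f1 y.tgt).f := by
      rw [twLift_f, twLift_f, t0fst, s0fst, h2]
    have hB' : B.t0 (F.twLift.f1 x.tgt).g = B.s0 (F.twLift.f1 y.tgt).g := by
      rw [twLift_g, twLift_g, t0snd, s0snd, h2]
    have k1 := F.twLift_comp x.src y.src h1 hA hB
    have k2 := F.twLift_comp x.tgt y.tgt h2 hA' hB'
    have h'' : C.t0 (C.t1 (F.grayLift2 x)) = C.s0 (C.t1 (F.grayLift2 y)) := by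
      rw [t0_t1, s0_t1]; exact h'
    have m1 : C.t1 (F.grayLift2 x) = C.s1 (F.twLift.f1 x.tgt).x := (F.t1_grayLift2 x).trans (TwM.hs _).symm
    have m2 : C.t1 (F.grayLift2 y) = C.s1 (F.twLift.f1 y.tgt).x := (F.t1_grayLift2 y).trans (TwM.hs _).symm
    have m3 : C.t0 (C.s1 (F.twLift.f1 x.tgt).x) = C.s0 (C.s1 (F.twLift.f1 y.tgt).x) := by
      rw [← m1, ← m2, h'']
    have m4 : C.t0 (C.s1 (F.twLift.f1 x.src).x) = C.s0 (C.s1 (F.twLift.f1 y.src).x) := by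
      rw [TwM.hs, TwM.hs, ← F.s1_grayLift2 x, ← F.s1_grayLift2 y]; exact h'
    have m5 : C.t0 (C.s1 (F.nf x)) = C.s0 (C.s1 (F.nf y)) := by
      rw [F.s1_nf, F.s1_nf]; simpa using m4
    rw [← hc_eq h']
    refine F.eq_grayLift2 _ _ ?_ ?_
    · rw [t1_hc h']
      change _ = (F.twLift.f1 ((gray2 A B).cat1.comp x.tgt y.tgt h2)).m
      rw [k2, F.t1_grayLift2, F.t1_grayLift2]
      rfl
    · change C.vc _ (F.twLift.f1 ((gray2 A B).cat1.comp x.tgt y.tgt h2)).x =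
        C.vc (F.twLift.f1 ((gray2 A B).cat1.comp x.src y.src h1)).x _
      rw [k1, k2]
      change C.vc _ (C.vc (C.hc _ _) (TwM.mid _ _)) = C.vc (C.vc (C.hc _ _) (TwM.mid _ _)) _
      have k3 := F.nf_hcomp x y h1
      rw [vc_assoc (TwM.s1_mid hA hB).symm, k3, ← vc_assoc _ (TwM.s1_mid hA' hB').symm,
        ← interch m1 m2 h', ← vc_assoc, ← interch (F.s1_nf x).symm (F.s1_nf y).symm m4,
        F.grayLift2_vc, F.grayLift2_vc]
      · rw [t1_hc m4, s1_hc m5, F.s1_nf, F.s1_nf]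
      · rw [t1_hc m5, F.t1_nf, F.t1_nf, TwM.s1_mid hA' hB', t1_hc m3]
      · rw [t1_hc h', s1_hc m3, m1, m2]
      · have e1 : ((gray2 A B).catH.comp x y h).src = (gray2 A B).cat1.comp x.src y.src h1 := rfl
        rw [F.s1_nf, e1, k1]
        exact (t1_vc (TwM.s1_mid hA hB).symm).symm

end Cubical

end

section

namespace Cubical

open TwoCat

variable {A B C : TwoCat.{u}}

def ofTotal (left : B.C0 → (A ⟶ C)) (right : A.C0 → (B ⟶ C))
    (agree : ∀ a b, (left b)⁰ a = (right a)⁰ b) (γ : A.C1 → B.C1 → C.C2)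
    (hs : ∀ f g, C.s1 (γ f g) = C.c1 ((left (B.s0 g))¹ f) ((right (A.t0 f))¹ g))
    (ht : ∀ f g, C.t1 (γ f g) = C.c1 ((right (A.s0 f))¹ g) ((left (B.t0 g))¹ f))
    (inv : ∀ f g, ∃ δ, IsInv (γ f g) δ)
    (id_left : ∀ a g, γ (A♭ a) g = C♯ ((right a)¹ g))
    (id_right : ∀ f b, γ f (B♭ b) = C♯ ((left b)¹ f))
    (comp_left : ∀ f f' g, A.t0 f = A.s0 f' → γ (A.c1 f f') g = C.vc (C.hc (C♯ ((left (B.s0 g))¹ f)) (γ f' g))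
        (C.hc (γ f g) (C♯ ((left (B.t0 g))¹ f'))))
    (comp_right : ∀ f g g', B.t0 g = B.s0 g' → γ f (B.c1 g g') =
      C.vc (C.hc (γ f g) (C♯ ((right (A.t0 f))¹ g'))) (C.hc (C♯ ((right (A.s0 f))¹ g)) (γ f g')))
    (nat_left : ∀ α g, C.vc (C.hc ((left (B.s0 g))² α) (C♯ ((right (A.t0 (A.s1 α)))¹ g))) (γ (A.t1 α) g) =
      C.vc (γ (A.s1 α) g) (C.hc (C♯ ((right (A.s0 (A.s1 α)))¹ g)) ((left (B.t0 g))² α)))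
    (nat_right : ∀ f β, C.vc (C.hc (C♯ ((left (B.s0 (B.s1 β)))¹ f)) ((right (A.t0 f))² β)) (γ f (B.t1 β)) =
      C.vc (γ f (B.s1 β)) (C.hc ((right (A.s0 f))² β) (C♯ ((left (B.t0 (B.s1 β)))¹ f)))) : Cubical A B C where
  left := left
  right := right
  agree := agree
  γ := γ
  s1_γ f g h := (hs f g).trans (c1_eq h)
  t1_γ f g h := (ht f g).trans (c1_eq h)
  invertible f g := by
    obtain ⟨δ, h⟩ := inv f g
    exact ⟨δ, h.s.symm, h.t, (vc_eq _).symm.trans h.left, (vc_eq _).symm.trans h.right⟩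
  γ_id_left := id_left
  γ_id_right := id_right
  γ_comp_left f f' g h h₁ h₂ h₃ := by
    have := comp_left f f' g h
    rw [c1_eq h] at this
    rw [this, hc_eq h₁, hc_eq h₂, vc_eq]
  γ_comp_right f g g' h h₁ h₂ h₃ := by
    have := comp_right f g g' h
    rw [c1_eq h] at this
    rw [this, hc_eq h₁, hc_eq h₂, vc_eq]
  γ_natural_left α g h₁ h₂ h₃ h₄ := by
    have := nat_left α g
    rwa [hc_eq h₁, hc_eq h₃, vc_eq h₂, vc_eq h₄] at this
  γ_natural_right α g h₁ h₂ h₃ h₄ := by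
    have := nat_right α g
    rwa [hc_eq h₁, hc_eq h₃, vc_eq h₂, vc_eq h₄] at this

end Cubical

namespace TwoCat

variable {A B : TwoCat.{u}}

def prodInl (A : TwoCat.{u}) {B : TwoCat.{u}} (b : B.C0) : A ⟶ A.prod B where
  toHom := ⟨fun a => (a, b), fun f => (f, B♭ b), fun α => (α, B♯ (B♭ b)),
    fun _ => by simp [prod], fun _ => by simp [prod], fun _ => by simp [prod],
    fun _ => by simp [prod]⟩
  map_id _ := rfl
  map_comp f g h h' := Prod.ext rfl ((id_c1 (by simp)).symm.trans (c1_eq _))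
  map_vid _ := rfl
  map_vcomp f g h h' := Prod.ext rfl ((id_vc (by simp)).symm.trans (vc_eq _))
  map_hcomp f g h h' := Prod.ext rfl ((id_hc (by simp)).symm.trans (hc_eq _))

def prodInr {A : TwoCat.{u}} (B : TwoCat.{u}) (a : A.C0) : B ⟶ A.prod B where
  toHom := ⟨fun b => (a, b), fun f => (A♭ a, f), fun α => (A♯ (A♭ a), α),
    fun _ => by simp [prod], fun _ => by simp [prod], fun _ => by simp [prod],
    fun _ => by simp [prod]⟩
  map_id _ := rfl
  map_comp f g h h' := Prod.ext ((id_c1 (by simp)).symm.trans (c1_eq _)) rfl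
  map_vid _ := rfl
  map_vcomp f g h h' := Prod.ext ((id_vc (by simp)).symm.trans (vc_eq _)) rfl
  map_hcomp f g h h' := Prod.ext ((id_hc (by simp)).symm.trans (hc_eq _)) rfl

end TwoCat

section Gray2

open TwoCat

variable {A B C : TwoCat.{u}}

def grayT (A B : TwoCat.{u}) : TwoCat.{u} := gray2 A B

def grayDesc (F : Cubical A B C) : grayT A B ⟶ C := F.grayLift

def gray2Left (A : TwoCat.{u}) {B : TwoCat.{u}} (b : B.C0) : A ⟶ grayT A B :=
  CData.transposeInv (D := CData.tensor (CData.gen.obj A) (CData.gen.obj B)) (A := A)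
    ⟨Ct.inl A.ct (D := B.ct) b, prodInl A b, Ct.hom_ext (fun _ => rfl) fun f =>
      Prod.ext (Ct.fst_inl (C := A.ct) (D := B.ct) b f).symm (Ct.snd_inl (C := A.ct) (D := B.ct) b f).symm⟩

def gray2Right {A : TwoCat.{u}} (B : TwoCat.{u}) (a : A.C0) : B ⟶ grayT A B :=
  CData.transposeInv (D := CData.tensor (CData.gen.obj A) (CData.gen.obj B)) (A := B)
    ⟨Ct.inr (C := A.ct) B.ct a, prodInr B a, Ct.hom_ext (fun _ => rfl) fun f =>
      Prod.ext (Ct.fst_inr (C := A.ct) (D := B.ct) a f).symm (Ct.snd_inr (C := A.ct) (D := B.ct) a f).symm⟩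

def gray2Fst (A B : TwoCat.{u}) : grayT A B ⟶ A := CData.proj _ ≫ fstHom A B

def gray2Snd (A B : TwoCat.{u}) : grayT A B ⟶ B := CData.proj _ ≫ sndHom A B

local notation "◆" => grayT A B
local notation "◐" => gray2Fst A B
local notation "◑" => gray2Snd A B
@[simp] lemma fst_left0 (b : B.C0) (a) : ◐⁰ ((gray2Left A b)⁰ a) = a := (rfl)
@[simp] lemma snd_left0 (b : B.C0) (a) : ◑⁰ ((gray2Left A b)⁰ a) = b := (rfl)
@[simp] lemma fst_right0 (a : A.C0) (b) : ◐⁰ ((gray2Right B a)⁰ b) = a := (rfl)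
@[simp] lemma snd_right0 (a : A.C0) (b) : ◑⁰ ((gray2Right B a)⁰ b) = b := (rfl)
@[simp] lemma fst_left1 (b : B.C0) (f) : ◐¹ ((gray2Left A b)¹ f) = f := Ct.fst_inl _ _
@[simp] lemma snd_left1 (b : B.C0) (f) : ◑¹ ((gray2Left A b)¹ f) = B♭ b := Ct.snd_inl _ _
@[simp] lemma fst_right1 (a : A.C0) (f) : ◐¹ ((gray2Right B a)¹ f) = A♭ a := Ct.fst_inr _ _
@[simp] lemma snd_right1 (a : A.C0) (f) : ◑¹ ((gray2Right B a)¹ f) = f := Ct.snd_inr _ _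
@[simp] lemma fst_left2 (b : B.C0) (f) : ◐² ((gray2Left A b)² f) = f := (rfl)
@[simp] lemma snd_left2 (b : B.C0) (f) : ◑² ((gray2Left A b)² f) = B♯ (B♭ b) := (rfl)
@[simp] lemma fst_right2 (a : A.C0) (f) : ◐² ((gray2Right B a)² f) = A♯ (A♭ a) := (rfl)
@[simp] lemma snd_right2 (a : A.C0) (f) : ◑² ((gray2Right B a)² f) = f := (rfl)

@[simp] lemma gray2_agree (b : B.C0) (a : A.C0) : (gray2Left A b)⁰ a = (gray2Right B a)⁰ b := (rfl)

lemma gray2_ext {x y : ◆.C2} (hs : ◆.s1 x = ◆.s1 y) (ht : ◆.t1 x = ◆.t1 y) (h1 : ◐² x = ◐² y)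
    (h2 : ◑² x = ◑² y) : x = y :=
  CData.Cell.ext hs ht (Prod.ext h1 h2)

def gray2Iso (c c' : ◆.C1) (hs : ◆.s0 c = ◆.s0 c') (ht : ◆.t0 c = ◆.t0 c') (h1 : ◐¹ c = ◐¹ c')
    (h2 : ◑¹ c = ◑¹ c') : ◆.C2 :=
  ⟨c, c', (A♯ (◐¹ c), B♯ (◑¹ c)), hs, ht, Prod.ext (by exact s1_i1 _) (by exact s1_i1 _),
    Prod.ext (by exact (t1_i1 _).trans h1) (by exact (t1_i1 _).trans h2)⟩

section

variable {c c' : (grayT A B).C1} {hs ht h1 h2}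

@[simp] lemma s1_gray2Iso : ◆.s1 (gray2Iso c c' hs ht h1 h2) = c := (rfl)
@[simp] lemma t1_gray2Iso : ◆.t1 (gray2Iso c c' hs ht h1 h2) = c' := (rfl)
@[simp] lemma fst_gray2Iso : ◐² (gray2Iso c c' hs ht h1 h2) = A♯ (◐¹ c) := (rfl)
@[simp] lemma snd_gray2Iso : ◑² (gray2Iso c c' hs ht h1 h2) = B♯ (◑¹ c) := (rfl)

lemma gray2Iso_inv : IsInv (gray2Iso c c' hs ht h1 h2) (gray2Iso c' c hs.symm ht.symm h1.symm h2.symm) := by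
  refine ⟨rfl, rfl, gray2_ext ?_ ?_ ?_ ?_, gray2_ext ?_ ?_ ?_ ?_⟩ <;> simp [Hom.map_vc, t1_vc, h1, h2, id_vc]

end

variable (A B) in
def gray2Cub : Cubical A B ◆ := by
  refine Cubical.ofTotal (fun b => gray2Left A b) (fun a => gray2Right B a) (fun _ _ => rfl)
    (fun f g => gray2Iso (◆.c1 ((gray2Left A (B.s0 g))¹ f) ((gray2Right B (A.t0 f))¹ g))
      (◆.c1 ((gray2Right B (A.s0 f))¹ g) ((gray2Left A (B.t0 g))¹ f))
      (by simp) (by simp) (by simp [Hom.map_c1, id_c1, c1_id])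
      (by simp [Hom.map_c1, id_c1, c1_id])) ?_ ?_ ?_ ?_ ?_ ?_ ?_ ?_ ?_
  · intro f g; rfl
  · intro f g; rfl
  · exact fun f g => ⟨_, gray2Iso_inv⟩
  · intro a g
    refine gray2_ext ?_ ?_ ?_ ?_ <;> simp [Hom.map_c1, id_c1, c1_id]
  · intro f b
    refine gray2_ext ?_ ?_ ?_ ?_ <;> simp [Hom.map_c1, id_c1, c1_id]
  · intro f f' g h
    refine gray2_ext ?_ ?_ ?_ ?_ <;>
      simp (maxDischargeDepth := 10) [Hom.map_c1, id_c1, c1_id, Hom.map_vc, t1_vc, Hom.map_hc, h, c1_assoc,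
        i1_hc_i1, id_vc]
  · intro f g g' h
    refine gray2_ext ?_ ?_ ?_ ?_ <;>
      simp (maxDischargeDepth := 10) [Hom.map_c1, id_c1, c1_id, Hom.map_vc, t1_vc, Hom.map_hc, h, c1_assoc,
        i1_hc_i1, id_vc]
  · intro α g
    refine gray2_ext ?_ ?_ ?_ ?_ <;>
      simp (maxDischargeDepth := 10) [Hom.map_c1, id_c1, c1_id, Hom.map_vc, t1_vc, Hom.map_hc, c1_assoc,
        i1_hc_i1, id_vc, vc_id, hc_id, id_hc, t1_vc, t1_hc, s1_hc, hc_hcr]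
  · intro f α
    refine gray2_ext ?_ ?_ ?_ ?_ <;>
      simp (maxDischargeDepth := 10) [Hom.map_c1, id_c1, c1_id, Hom.map_vc, t1_vc, Hom.map_hc, c1_assoc,
        i1_hc_i1, id_vc, vc_id, hc_id, id_hc, t1_vc, t1_hc, s1_hc, hc_hcr]

local notation "◇" => gray2Cub A B
local notation "◖" c:max => (gray2Left A (B.s0 (◑¹ c)))¹ (◐¹ c)
local notation "◗" c:max => (gray2Right B (A.t0 (◐¹ c)))¹ (◑¹ c)
local notation "◀" c:max => (gray2Left A (B.s0 (◑¹ (Glob2.s1 _ c))))² (◐² c)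
local notation "▶" c:max => (gray2Right B (A.t0 (◐¹ (Glob2.s1 _ c))))² (◑² c)

lemma fst_γ (f : A.C1) (g : B.C1) : ◐² (◇.γ f g) = A♯ f := by
  change A♯ _ = _
  simp [Hom.map_c1, c1_id]

lemma snd_γ (f : A.C1) (g : B.C1) : ◑² (◇.γ f g) = B♯ g := by
  change B♯ _ = _
  simp [Hom.map_c1, id_c1]

variable (F : Cubical A B C)

lemma left_grayDesc (b) : ◇.left b ≫ grayDesc F = F.left b := by
  have h1 : ∀ f : A.C1, F.twLift.f1 ((Ct.inl A.ct b).f1 f) = (F.twLeft b).f1 f := fun f => Ct.lift_inl _ _ _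
  refine TwoCat.hom_ext (fun a => (F.agree a b).symm) (fun f => congrArg Cubical.TwM.m (h1 f)) fun α => ?_
  refine F.eq_grayLift2 ((gray2Left A b)² α) _ ?_ ?_
  · exact (((F.left b).toHom.t1 α).trans (congrArg Cubical.TwM.m (h1 _)).symm)
  · have e1 : ((gray2Left A b)² α).src = (Ct.inl A.ct b).f1 (A.s1 α) := rfl
    have e2 : ((gray2Left A b)² α).tgt = (Ct.inl A.ct b).f1 (A.t1 α) := rfl
    rw [e1, e2, h1, h1]
    change C.vc _ (C♯ _) = C.vc (C♯ _) (C.hc ((F.left b)² α) ((F.right (A.t0 (A.s1 α)))² (B♯ (B♭ b))))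
    rw [vc_id ((F.left b).toHom.t1 α)]
    simp (maxDischargeDepth := 10) [hc_id, id_vc]

lemma right_grayDesc (a) : ◇.right a ≫ grayDesc F = F.right a := by
  have h1 : ∀ f : B.C1, F.twLift.f1 ((Ct.inr B.ct a).f1 f) = (F.twRight a).f1 f := fun f => Ct.lift_inr _ _ _
  refine TwoCat.hom_ext (fun b => rfl) (fun f => congrArg Cubical.TwM.m (h1 f)) fun α => ?_
  refine F.eq_grayLift2 ((gray2Right B a)² α) _ ?_ ?_
  · exact (((F.right a).toHom.t1 α).trans (congrArg Cubical.TwM.m (h1 _)).symm)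
  · have e1 : ((gray2Right B a)² α).src = (Ct.inr B.ct a).f1 (B.s1 α) := rfl
    have e2 : ((gray2Right B a)² α).tgt = (Ct.inr B.ct a).f1 (B.t1 α) := rfl
    rw [e1, e2, h1, h1]
    change C.vc _ (C♯ _) = C.vc (C♯ _) (C.hc ((F.left (B.s0 (B.s1 α)))² (A♯ (A♭ a))) ((F.right a)² α))
    rw [vc_id ((F.right a).toHom.t1 α)]
    simp (maxDischargeDepth := 10) [id_hc, id_vc]

lemma γ_grayDesc (f : A.C1) (g : B.C1) : (grayDesc F)² (◇.γ f g) = F.γ f g := by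
  have h1 : ∀ b (f : A.C1), F.twLift.f1 ((Ct.inl A.ct b).f1 f) = (F.twLeft b).f1 f := fun b f =>
    Ct.lift_inl _ _ _
  have h2 : ∀ a (f : B.C1), F.twLift.f1 ((Ct.inr B.ct a).f1 f) = (F.twRight a).f1 f := fun a f =>
    Ct.lift_inr _ _ _
  have hA : A.t0 f = A.s0 (A♭ (A.t0 f)) := by simp
  have hA' : A.t0 (A♭ (A.s0 f)) = A.s0 f := by simp
  have hB : B.t0 (B♭ (B.s0 g)) = B.s0 g := by simp
  have hB' : B.t0 g = B.s0 (B♭ (B.t0 g)) := by simp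
  have e1 : F.twLift.f1 (◇.γ f g).src =
      Cubical.TwM.comp ((F.twLeft (B.s0 g)).f1 f) ((F.twRight (A.t0 f)).f1 g) hA hB := by
    refine (congrArg F.twLift.f1 (c1_eq (C := grayT A B) rfl)).trans
      ((F.twLift.map_comp _ _ rfl (Prod.ext ?_ ?_)).trans
      (F.tw.cat.comp_congr (h1 _ _) (h2 _ _) _ (Prod.ext hA hB)))
    · exact (congrArg (fun p => A.t0 p.f) (h1 _ f)).trans
        (hA.trans (congrArg (fun p => A.s0 p.f) (h2 _ g)).symm)
    · exact (congrArg (fun p => B.t0 p.g) (h1 _ f)).trans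
        (hB.trans (congrArg (fun p => B.s0 p.g) (h2 _ g)).symm)
  have e2 : F.twLift.f1 (◇.γ f g).tgt =
      Cubical.TwM.comp ((F.twRight (A.s0 f)).f1 g) ((F.twLeft (B.t0 g)).f1 f) hA' hB' := by
    refine (congrArg F.twLift.f1 (c1_eq (C := grayT A B) rfl)).trans
      ((F.twLift.map_comp _ _ rfl (Prod.ext ?_ ?_)).trans
      (F.tw.cat.comp_congr (h2 _ _) (h1 _ _) _ (Prod.ext hA' hB')))
    · exact (congrArg (fun p => A.t0 p.f) (h2 _ g)).trans
        (hA'.trans (congrArg (fun p => A.s0 p.f) (h1 _ f)).symm)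
    · exact (congrArg (fun p => B.t0 p.g) (h2 _ g)).trans
        (hB'.trans (congrArg (fun p => B.s0 p.g) (h1 _ f)).symm)
  have x1 : (Cubical.TwM.comp ((F.twLeft (B.s0 g)).f1 f) ((F.twRight (A.t0 f)).f1 g) hA hB).x =
      C♯ (C.s1 (F.γ f g)) := by
    change C.vc (C.hc (C♯ ((F.left (B.s0 g))¹ f)) (C♯ ((F.right (A.t0 f))¹ g))) (C.hc (C♯ ((F.left
        (B.s0 (B♭ (B.s0 g))))¹ f)) (C.hc (F.δ (A♭ (A.t0 f))
          (B♭ (B.s0 g))) (C♯ ((F.right (A.t0 (A♭ (A.t0 f))))¹ g)))) = _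
    simp (maxDischargeDepth := 10) [Cubical.δ_id_left, i1_hc_i1, id_c1, id_vc, id_hc]
  have x2 : (Cubical.TwM.comp ((F.twRight (A.s0 f)).f1 g) ((F.twLeft (B.t0 g)).f1 f) hA' hB').x =
      F.δ f g := by
    change C.vc (C.hc (C♯ ((F.right (A.s0 f))¹ g)) (C♯ ((F.left (B.t0 g))¹ f))) (C.hc (C♯ ((F.left (B.s0 g))¹
        (A♭ (A.s0 f)))) (C.hc (F.δ f g) (C♯ ((F.right (A.t0 f))¹ (B♭ (B.t0 g)))))) = _
    simp (maxDischargeDepth := 10) [i1_hc_i1, id_c1, id_vc, id_hc, hc_id]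
  have s3 : Ct.FunnyM.src (◇.γ f g).src = (A.s0 f, B.s0 g) :=
    (s0_c1 (C := grayT A B) _ _).trans ((gray2Left A (B.s0 g)).toHom.s0 f)
  have t3 : Ct.FunnyM.tgt (◇.γ f g).src = (A.t0 f, B.t0 g) :=
    (t0_c1 (C := grayT A B) rfl).trans ((gray2Right B (A.t0 f)).toHom.t0 g)
  have n : F.nf (◇.γ f g) = C♯ (C.s1 (F.γ f g)) := by
    have : ∀ (s t : A.C0 × B.C0) (α β), s = (A.s0 f, B.s0 g) → t = (A.t0 f, B.t0 g) → α = A♯ f → β = B♯ g →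
        C.hc ((F.left s.2)² α) ((F.right t.1)² β) = C♯ (C.s1 (F.γ f g)) := by
      rintro _ _ _ _ rfl rfl rfl rfl
      simp [i1_hc_i1]
    exact this _ _ _ _ s3 t3 (fst_γ f g) (snd_γ f g)
  refine F.eq_grayLift2 (◇.γ f g) _ ?_ ?_
  · exact (F.t1γ f g).trans (congrArg Cubical.TwM.m e2).symm
  · refine (congrArg (C.vc _) ((congrArg Cubical.TwM.x e2).trans x2)).trans
      ((F.isInv f g).left.trans (.trans ?_ (congrArg₂ C.vc ((congrArg Cubical.TwM.x e1).trans x1) n).symm))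
    simp [id_vc]

lemma _root_.GrayLift.TwoCat.IsInv.map_id {D : TwoCat.{u}} {x y : C.C2} (h : IsInv x y) (F : C ⟶ D) {f : D.C1}
    (e : F² x = D♯ f) : F² y = D♯ f :=
  (h.map F).unique (e ▸ IsInv.id f)

lemma fst_δ (f : A.C1) (g : B.C1) : ◐² (◇.δ f g) = A♯ f := (◇.isInv f g).map_id _ (fst_γ f g)

lemma snd_δ (f : A.C1) (g : B.C1) : ◑² (◇.δ f g) = B♯ g := (◇.isInv f g).map_id _ (snd_γ f g)

lemma gray2_isInv {x : ◆.C2} (h1 : ◐² x = A♯ (◐¹ (◆.s1 x))) (h2 : ◑² x = B♯ (◑¹ (◆.s1 x))) :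
    ∃ y, IsInv x y := by
  have : x = gray2Iso (◆.s1 x) (◆.t1 x) (◆.ss x) (◆.tt x)
      (by rw [← ◐.toHom.t1, h1, t1_i1]) (by rw [← ◑.toHom.t1, h2, t1_i1]) :=
    gray2_ext (by simp) (by simp) (by simp [h1]) (by simp [h2])
  rw [this]
  exact ⟨_, gray2Iso_inv⟩

lemma gray2Cub_left (b : B.C0) : ◇.left b = gray2Left A b := rfl

lemma gray2Cub_right (a : A.C0) : ◇.right a = gray2Right B a := rfl

lemma gray2_induction {P : ◆.C1 → Prop} (hid : ∀ a, P (◆♭ a))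
    (hl : ∀ b f c, ◆.t0 ((gray2Left A b)¹ f) = ◆.s0 c → P c → P (◆.c1 ((gray2Left A b)¹ f) c))
    (hr : ∀ a g c, ◆.t0 ((gray2Right B a)¹ g) = ◆.s0 c → P c →
      P (◆.c1 ((gray2Right B a)¹ g) c)) (c : ◆.C1) : P c := by
  refine Ct.funny_induction (C := A.ct) (D := B.ct) (P := P) hid (fun f b x h hx => ?_)
    (fun a g x h hx => ?_) c
  · exact (congrArg P (c1_eq (C := grayT A B) (f := (gray2Left A b)¹ f) (g := x) h)).mp (hl b f x h hx)
  · exact (congrArg P (c1_eq (C := grayT A B) (f := (gray2Right B a)¹ g) (g := x) h)).mp (hr a g x h hx)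

lemma gray2_hom_ext {H K : grayT A B ⟶ C} (hl : ∀ b, ◇.left b ≫ H = ◇.left b ≫ K)
    (hr : ∀ a, ◇.right a ≫ H = ◇.right a ≫ K)
    (hγ : ∀ f g, H² (◇.γ f g) = K² (◇.γ f g)) :
    H = K := by
  have h0 : ∀ x, H⁰ x = K⁰ x := fun x => congrFun (congrArg (fun k => k⁰) (hl x.2)) x.1
  have hc : TwoCat.Hom.ct H = TwoCat.Hom.ct K := Ct.funny_hom_ext' h0
    (fun b f => congrFun (congrArg (fun k => k¹) (hl b)) f)
    (fun a g => congrFun (congrArg (fun k => k¹) (hr a)) g)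
  have h1 : ∀ x, H¹ x = K¹ x := fun x => congrFun (congrArg Ct.Hom.f1 hc) x
  have hl2 : ∀ b α, H² ((gray2Left A b)² α) = K² ((gray2Left A b)² α) :=
    fun b α => congrFun (congrArg (fun k => k²) (hl b)) α
  have hr2 : ∀ a α, H² ((gray2Right B a)² α) = K² ((gray2Right B a)² α) :=
    fun b α => congrFun (congrArg (fun k => k²) (hr b)) α
  have hδ : ∀ f g, H² (◇.δ f g) = K² (◇.δ f g) := by
    intro f g
    refine ((◇.isInv f g).map H).unique ?_
    rw [hγ]
    exact (◇.isInv f g).map K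
  have hvc : ∀ x y, H² x = K² x → H² y = K² y → H² (◆.vc x y) = K² (◆.vc x y) := by
    intro x y hx hy
    by_cases h : ◆.t1 x = ◆.s1 y
    · rw [Hom.map_vc _ h, Hom.map_vc _ h, hx, hy]
    · rw [vc, dif_neg h, hx]
  have hhc : ∀ x y, H² x = K² x → H² y = K² y → H² (◆.hc x y) = K² (◆.hc x y) := by
    intro x y hx hy
    by_cases h : ◆.t0 (◆.s1 x) = ◆.s0 (◆.s1 y)
    · rw [Hom.map_hc _ h, Hom.map_hc _ h, hx, hy]
    · rw [TwoCat.hc, dif_neg h, hx]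
  have hi : ∀ f, H² (◆♯ f) = K² (◆♯ f) := by
    intro f
    rw [Hom.map_i1, Hom.map_i1, h1]
  have key : ∀ c : ◆.C1, ∃ x : ◆.C2, ◆.s1 x = c ∧ ◆.t1 x = ◆.c1 (◖ c) (◗ c) ∧ ◐² x = A♯ (◐¹ c) ∧
      ◑² x = B♯ (◑¹ c) ∧
      H² x = K² x := by
    intro c
    induction c using gray2_induction with
    | hid a =>
      refine ⟨◆♯ (◆♭ a), ?_, ?_, ?_, ?_, hi _⟩
      · simp
      · simp only [t1_i1, Hom.map_i0, s0_i0, t0_i0]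
        exact (id_c1 (s0_i0 _).symm).symm
      · simp
      · simp
    | hl b f c h ih =>
      obtain ⟨x, h1, h2, h3, h4, h5⟩ := ih
      have hA : A.t0 f = A.s0 (◐¹ c) := by
        rw [Hom.s0, ← h]; simp
      have hB : B.s0 (◑¹ c) = b := by
        rw [Hom.s0, ← h]; simp
      have k1 : ◐¹ (◆.c1 ((gray2Left A b)¹ f) c) = A.c1 f (◐¹ c) := by rw [Hom.map_c1 _ h]; simp
      have k2 : ◑¹ (◆.c1 ((gray2Left A b)¹ f) c) = ◑¹ c := by rw [Hom.map_c1 _ h]; simp [id_c1, hB]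
      refine ⟨◆.hc (◆♯ ((gray2Left A b)¹ f)) x, ?_, ?_, ?_, ?_, hhc _ _ (hi _) h5⟩
      · simp [h, h1]
      · rw [k1, k2, hB, Hom.map_c1 _ hA, t1_hc (by simp [h, h1]), h2, hB, t1_i1]
        simp [c1_assoc, hA, hB]
      · rw [k1, Hom.map_hc _ (by simp [h, h1]), h3]
        simp [hA, i1_hc_i1]
      · rw [k2, Hom.map_hc _ (by simp [h, h1]), h4]
        simp [hB, i1_hc_i1, id_c1]
    | hr a g c h ih =>
      obtain ⟨x, h1, h2, h3, h4, h5⟩ := ih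
      have hA : A.s0 (◐¹ c) = a := by
        rw [Hom.s0, ← h]; simp
      have hB : B.t0 g = B.s0 (◑¹ c) := by
        rw [Hom.s0, ← h]; simp
      have k1 : ◐¹ (◆.c1 ((gray2Right B a)¹ g) c) = ◐¹ c := by rw [Hom.map_c1 _ h]; simp [id_c1, hA]
      have k2 : ◑¹ (◆.c1 ((gray2Right B a)¹ g) c) = B.c1 g (◑¹ c) := by rw [Hom.map_c1 _ h]; simp
      have k3 := fst_δ (◐¹ c) g
      have k4 := snd_δ (◐¹ c) g
      have l1 : ◆.t0 (◆.s1 (◆♯ ((gray2Right B a)¹ g))) = ◆.s0 (◆.s1 x) := by rw [h1, ← h]; simp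
      have l2 : ◆.t0 (◆.s1 (◇.δ (◐¹ c) g)) = ◆.s0 (◆.s1 (◆♯ (◗ c))) := by
        simp [gray2Cub_left, gray2Cub_right, hB]
      have l3 : ◆.t1 (◆.hc (◆♯ ((gray2Right B a)¹ g)) x) = ◆.s1 (◆.hc (◇.δ (◐¹ c) g) (◆♯ (◗ c))) := by
        rw [t1_hc l1, s1_hc l2, h2]
        simp [gray2Cub_left, gray2Cub_right, hA, hB, c1_assoc]
      refine ⟨◆.vc (◆.hc (◆♯ ((gray2Right B a)¹ g)) x) (◆.hc (◇.δ (◐¹ c) g) (◆♯ (◗ c))), ?_, ?_, ?_, ?_,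
        hvc _ _ (hhc _ _ (hi _) h5) (hhc _ _ (hδ _ _) (hi _))⟩
      · simp [h, h1]
      · rw [k1, k2, t1_vc l3, t1_hc l2, Hom.map_c1 _ hB]
        simp [gray2Cub_left, gray2Cub_right, hB, c1_assoc]
      · rw [k1, Hom.map_vc _ l3, Hom.map_hc _ l1, Hom.map_hc _ l2, h3, k3]
        simp (maxDischargeDepth := 10) [hA, i1_hc_i1, id_c1, c1_id, id_vc]
      · rw [k2, Hom.map_vc _ l3, Hom.map_hc _ l1, Hom.map_hc _ l2, h4, k4]
        simp (maxDischargeDepth := 10) [hB, i1_hc_i1, id_c1, c1_id, id_vc]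
  have key' : ∀ c : ◆.C1, ∃ x y : ◆.C2, IsInv x y ∧ ◆.s1 x = c ∧ ◆.t1 x = ◆.c1 (◖ c) (◗ c) ∧
      ◐² x = A♯ (◐¹ c) ∧
      ◑² x = B♯ (◑¹ c) ∧
      H² x = K² x ∧ H² y = K² y := by
    intro c
    obtain ⟨x, h1, h2, h3, h4, h5⟩ := key c
    obtain ⟨y, hy⟩ := gray2_isInv (x := x) (by rw [h3, h1]) (by rw [h4, h1])
    refine ⟨x, y, hy, h1, h2, h3, h4, h5, (hy.map H).unique ?_⟩
    rw [h5]
    exact hy.map K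
  refine TwoCat.hom_ext h0 h1 fun z => ?_
  obtain ⟨x, x', hx, x1, x2, x3, x4, x5, x6⟩ := key' (◆.s1 z)
  obtain ⟨y, y', hy, y1, y2, y3, y4, y5, y6⟩ := key' (◆.t1 z)
  have y3' := hy.map_id _ y3
  have y4' := hy.map_id _ y4
  have l1 : ◆.t0 (◆.s1 (◀ z)) = ◆.s0 (◆.s1 (▶ z)) := by
    simp
  have l2 : ◆.t1 x = ◆.s1 (◆.hc (◀ z) (▶ z)) := by
    rw [s1_hc l1, x2]
    simp
  have l3 : ◆.t1 (◆.vc x (◆.hc (◀ z) (▶ z))) = ◆.s1 y' := by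
    rw [t1_vc l2, t1_hc l1, hy.s, y2]
    simp
  have : z = ◆.vc (◆.vc x (◆.hc (◀ z) (▶ z))) y' := by
    refine gray2_ext ?_ ?_ ?_ ?_
    · simp [x1]
    · rw [t1_vc l3, hy.t, y1]
    · rw [Hom.map_vc _ l3, Hom.map_vc _ l2, Hom.map_hc _ l1, x3, y3']
      simp (maxDischargeDepth := 10) [id_vc, vc_id, hc_id]
    · rw [Hom.map_vc _ l3, Hom.map_vc _ l2, Hom.map_hc _ l1, x4, y4']
      simp (maxDischargeDepth := 10) [id_vc, vc_id, id_hc]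
  rw [this]
  exact hvc _ _ (hvc _ _ x5 (hhc _ _ (hl2 _ _) (hr2 _ _))) y6

end Gray2

end

section

open Ct TwoCat.Hom

notation:90 A:91 " ⊠ " B:91 => CategoryTheory.Functor.obj (Multitensor.E grayH) [A, B]
notation:90 A:91 " ⊡ " B:91 => CategoryTheory.Functor.map (Multitensor.E grayH) (consHom A (consHom B (CategoryTheory.CategoryStruct.id [])))

def Cubical.map {A B C D : TwoCat.{u}} (F : Cubical A B C) (H : C ⟶ D) : Cubical A B D := by
  refine Cubical.ofTotal (fun b => F.left b ≫ H) (fun a => F.right a ≫ H)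
    (fun a b => congrArg H⁰ (F.agree a b)) (fun f g => H² (F.γ f g)) ?_ ?_ ?_ ?_ ?_
    ?_ ?_ ?_ ?_
  · intro f g
    simp [map_c1]
  · intro f g
    simp [map_c1]
  · intro f g
    exact ⟨_, (F.isInv f g).map H⟩
  · intro a g
    rw [F.γ_id_left, map_i1]; rfl
  · intro a g
    rw [F.γ_id_right, map_i1]; rfl
  · intro f f' g h
    rw [F.γ_c1_left _ h]
    simp (maxDischargeDepth := 10) [map_vc, map_hc, h, TwoCat.c1_assoc]
  · intro f g g' h
    rw [F.γ_c1_right _ h]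
    simp (maxDischargeDepth := 10) [map_vc, map_hc, h, TwoCat.c1_assoc]
  · intro α g
    have := congrArg H² (F.γ_nat_left α g)
    simpa (maxDischargeDepth := 10) [map_vc, map_hc] using this
  · intro α g
    have := congrArg H² (F.γ_nat_right α g)
    simpa (maxDischargeDepth := 10) [map_vc, map_hc] using this

def Cubical.IsUniversal {A B D : TwoCat.{u}} (U : Cubical A B D) : Prop :=
  ∀ {C : TwoCat.{u}} (F : Cubical A B C), ∃! H : D ⟶ C,
    (∀ b, U.left b ≫ H = F.left b) ∧ (∀ a, U.right a ≫ H = F.right a) ∧ ∀ f g, H² (U.γ f g) = F.γ f g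

lemma gray2_universal (A B : TwoCat.{u}) : (gray2Cub A B).IsUniversal := fun F =>
  ⟨grayDesc F, ⟨left_grayDesc F, right_grayDesc F, γ_grayDesc F⟩, fun K hK =>
    gray2_hom_ext (fun b => (hK.1 b).trans (left_grayDesc F b).symm)
      (fun a => (hK.2.1 a).trans (right_grayDesc F a).symm)
      (fun f g => (hK.2.2 f g).trans (γ_grayDesc F f g).symm)⟩

lemma Cubical.IsUniversal.map {A B D D' : TwoCat.{u}} {U : Cubical A B D} (hU : U.IsUniversal)
    (e : D ≅ D') : (U.map e.hom).IsUniversal := by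
  intro C F
  obtain ⟨H, ⟨h1, h2, h3⟩, h4⟩ := hU F
  have key : ∀ x, (e.inv ≫ H)² (e.hom² x) = H² x := fun x =>
    congrArg (fun k : D ⟶ C => k² x) (e.hom_inv_id_assoc H)
  refine ⟨e.inv ≫ H, ⟨fun b => ?_, fun a => ?_, fun f g => ?_⟩, fun K hK => ?_⟩
  · change (U.left b ≫ e.hom) ≫ e.inv ≫ H = _
    simp [h1]
  · change (U.right a ≫ e.hom) ≫ e.inv ≫ H = _
    simp [h2]
  · exact (key _).trans (h3 f g)
  · rw [Iso.eq_inv_comp]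
    exact h4 _ ⟨fun b => (Category.assoc _ _ _).symm.trans (hK.1 b),
      fun b => (Category.assoc _ _ _).symm.trans (hK.2.1 b), hK.2.2⟩

open MonoidalCategory in
def grayTIso (A B : TwoCat.{u}) : grayT A B ≅ A ⊠ B :=
  CData.cells.mapIso (whiskerLeftIso (CData.gen.obj A) (ρ_ (CData.gen.obj B)).symm)

def cubH (A B : TwoCat.{u}) : Cubical A B (A ⊠ B) := (gray2Cub A B).map (grayTIso A B).hom

section

variable {A B C : TwoCat.{u}}

lemma cubH_left_f1 (b : B.C0) (f : A.C1) : ((cubH A B).left b)¹ f =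
    (inl A.ct (D := funny B.ct one) (b, ⟨⟩)).f1 f :=
  funnyMap_inl (C := A.ct) (D := B.ct) (𝟙 A.ct) (inl B.ct (D := one) ⟨⟩) b f

lemma cubH_right_f1 (a : A.C0) (f : B.C1) : ((cubH A B).right a)¹ f =
    (inr (C := A.ct) (funny B.ct one) a).f1 ((inl B.ct (D := one) ⟨⟩).f1 f) :=
  funnyMap_inr (C := A.ct) (D := B.ct) (𝟙 A.ct) (inl B.ct (D := one) ⟨⟩) a f

lemma cubH_γ_cell (f : A.C1) (g : B.C1) : ((cubH A B).γ f g).cell = (A♯ f, (B♯ g, ⟨⟩)) :=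
  Prod.ext (fst_γ f g) (Prod.ext (snd_γ f g) rfl)

lemma cubH_γ_cell' {f : A.C1} {g : B.C1} {x y} (hx : A♯ f = x) (hy : B♯ g = y) :
    ((cubH A B).γ f g).cell = (x, (y, ⟨⟩)) :=
  hx ▸ hy ▸ cubH_γ_cell f g

lemma grayH_assocLeft_f1 (x : (funny (funny A.ct (funny B.ct one)) (funny C.ct one)).M) :
    (grayH.assocLeft A B C)¹ x = (assocHom A.ct (funny B.ct one) (funny C.ct one) ≫ funnyMap (𝟙 A.ct)
        (assocHom B.ct one (funny C.ct one) ≫ funnyMap (𝟙 B.ct) (snd one (funny C.ct one)))).f1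
      ((funnyMap (𝟙 _) (funnyMap (𝟙 (funny C.ct one)) (𝟙 one) ≫
        assocHom C.ct one one ≫ funnyMap (𝟙 C.ct) (snd one one))).f1
      ((funnyMap (𝟙 _) (funnyMap (inl C.ct (D := one) ⟨⟩) (𝟙 one))).f1 x)) := rfl

lemma grayH_assocRight_f1 (x : (funny A.ct (funny (funny B.ct (funny C.ct one)) one)).M) :
    (grayH.assocRight A B C)¹ x = (assocHom A.ct one _ ≫ funnyMap (𝟙 A.ct) (snd one _)).f1
      ((funnyMap (𝟙 _) (funnyMap (𝟙 (funny B.ct (funny C.ct one))) (𝟙 one) ≫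
        assocHom B.ct _ one ≫ funnyMap (𝟙 B.ct) (assocHom C.ct one one ≫ funnyMap (𝟙 C.ct) (snd one one)))).f1
      ((funnyMap (inl A.ct (D := one) ⟨⟩) (funnyMap (𝟙 _) (𝟙 one))).f1 x)) := rfl

lemma cells_hom_ext {X : TwoCat.{u}} {D : CData.{u}} {H K : X ⟶ CData.cellsObj D}
    (h0 : ∀ x, H⁰ x = K⁰ x) (h1 : ∀ x, H¹ x = K¹ x)
    (h2 : ∀ x, (H² x).cell = (K² x).cell) : H = K :=
  TwoCat.hom_ext h0 h1 fun x => CData.Cell.ext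
    ((H.toHom.s1 x).trans ((h1 (X.s1 x)).trans (K.toHom.s1 x).symm))
    ((H.toHom.t1 x).trans ((h1 (X.t1 x)).trans (K.toHom.t1 x).symm)) (h2 x)

lemma grayH_cell_ext {L : List TwoCat.{u}} {x y : (grayH.E.obj L).C2}
    (hs : (grayH.E.obj L).s1 x = (grayH.E.obj L).s1 y)
    (ht : (grayH.E.obj L).t1 x = (grayH.E.obj L).t1 y)
    (hc : @CData.Cell.cell (OfAdjunction.T CData.gen L) x =
      @CData.Cell.cell (OfAdjunction.T CData.gen L) y) : x = y :=
  CData.Cell.ext hs ht hc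

section Assoc

variable (A B C : TwoCat.{u})

local notation "⇚" => Multitensor.assocLeft grayH A B C
local notation "⇛" => Multitensor.assocRight grayH A B C

local notation "◁B" => funny B.ct one
local notation "◁C" => funny C.ct one
local notation "◁BC" => funny (funny B.ct ◁C) one

lemma grayH_assoc_1 (b : B.C0) (c : C.C0) (f : A.C1) :
    ⇚¹ ((inl (funny A.ct ◁B) (D := ◁C) (c, ⟨⟩)).f1 ((inl A.ct (D := ◁B) (b, ⟨⟩)).f1 f)) =
      ⇛¹ ((inl A.ct (D := ◁BC) ((b, (c, ⟨⟩)), ⟨⟩)).f1 f) :=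
  (grayH_assocLeft_f1 _).trans (.trans (by simp; rfl) (grayH_assocRight_f1 _).symm)

lemma grayH_assoc_2 (a : A.C0) (c : C.C0) (f : B.C1) : ⇚¹ ((inl (funny A.ct ◁B) (D := ◁C) (c, ⟨⟩)).f1
      ((inr (C := A.ct) ◁B a).f1 ((inl B.ct (D := one) ⟨⟩).f1 f))) = ⇛¹ ((inr (C := A.ct) ◁BC a).f1
      ((inl (funny B.ct ◁C) (D := one) ⟨⟩).f1 ((inl B.ct (D := ◁C) (c, ⟨⟩)).f1 f))) :=
  (grayH_assocLeft_f1 _).trans (.trans (by simp; rfl) (grayH_assocRight_f1 _).symm)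

lemma grayH_assoc_3 (a : A.C0) (b : B.C0) (f : C.C1) :
    ⇚¹ ((inr (C := funny A.ct ◁B) ◁C (a, (b, ⟨⟩))).f1 ((inl C.ct (D := one) ⟨⟩).f1 f)) =
      ⇛¹ ((inr (C := A.ct) ◁BC a).f1 ((inl (funny B.ct ◁C) (D := one) ⟨⟩).f1
        ((inr (C := B.ct) ◁C b).f1 ((inl C.ct (D := one) ⟨⟩).f1 f)))) :=
  (grayH_assocLeft_f1 _).trans (.trans (by simp; rfl) (grayH_assocRight_f1 _).symm)

lemma grayH_assoc_left (b : B.C0) (c : C.C0) : (cubH A B).left b ≫ (cubH (A ⊠ B) C).left c ≫ ⇚ =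
      (cubH A (B ⊠ C)).left (((cubH B C).left c)⁰ b) ≫ ⇛ := by
  refine cells_hom_ext (fun _ => rfl) (fun f => ?_) (fun _ => rfl)
  refine (congrArg ⇚¹ ((cubH_left_f1 _ _).trans (congrArg (Hom.f1 _) (cubH_left_f1 _ _)))).trans (.trans ?_
    (congrArg ⇛¹ (cubH_left_f1 _ _)).symm)
  exact grayH_assoc_1 A B C _ _ _

lemma grayH_assoc_middle (a : A.C0) (c : C.C0) : (cubH A B).right a ≫ (cubH (A ⊠ B) C).left c ≫ ⇚ =
      (cubH B C).left c ≫ (cubH A (B ⊠ C)).right a ≫ ⇛ := by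
  refine cells_hom_ext (fun _ => rfl) (fun f => ?_) (fun _ => rfl)
  refine (congrArg ⇚¹ ((cubH_left_f1 _ _).trans (congrArg (Hom.f1 _) (cubH_right_f1 _ _)))).trans (.trans ?_
    (congrArg ⇛¹ ((cubH_right_f1 _ _).trans
      (congrArg (fun x => Hom.f1 _ (Hom.f1 _ x)) (cubH_left_f1 _ _)))).symm)
  exact grayH_assoc_2 A B C _ _ _

lemma grayH_assoc_right (a : A.C0) (b : B.C0) : (cubH (A ⊠ B) C).right (((cubH A B).left b)⁰ a) ≫ ⇚ =
      (cubH B C).right b ≫ (cubH A (B ⊠ C)).right a ≫ ⇛ := by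
  refine cells_hom_ext (fun _ => rfl) (fun f => ?_) (fun _ => rfl)
  refine (congrArg ⇚¹ ((cubH_right_f1 _ _))).trans (.trans ?_ (congrArg ⇛¹ ((cubH_right_f1 _ _).trans
      (congrArg (fun x => Hom.f1 _ (Hom.f1 _ x)) (cubH_right_f1 _ _)))).symm)
  exact grayH_assoc_3 A B C _ _ _

variable {A B C}

lemma grayH_assoc_γ_left_middle (f : A.C1) (g : B.C1) (c : C.C0) : ⇚²
        (((cubH (A ⊠ B) C).left c)² ((cubH A B).γ f g)) =
      ⇛² ((cubH A (B ⊠ C)).γ f (((cubH B C).left c)¹ g)) := by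
  have h1 : ∀ b (f : A.C1), ⇚¹ (((cubH (A ⊠ B) C).left c)¹ (((cubH A B).left b)¹ f)) = _ := fun b f =>
    congrArg (fun k => k¹ f) (grayH_assoc_left A B C b c)
  have h2 : ∀ a (f : B.C1), ⇚¹ (((cubH (A ⊠ B) C).left c)¹ (((cubH A B).right a)¹ f)) = _ := fun a f =>
    congrArg (fun k => k¹ f) (grayH_assoc_middle A B C a c)
  refine grayH_cell_ext ?_ ?_ ?_
  · simp (maxDischargeDepth := 10) [map_c1, h1, h2]
  · simp (maxDischargeDepth := 10) [map_c1, h1, h2]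
  · exact (congrArg (fun z : A.C2 × B.C2 × PUnit => (z.1, (z.2.1, (C♯ (C♭ c), z.2.2))))
      (cubH_γ_cell f g)).trans (congrArg (fun z : A.C2 × (B ⊠ C).C2 × PUnit =>
      (z.1, z.2.1.cell)) (cubH_γ_cell' rfl (((cubH B C).left c).map_vid g).symm)).symm

lemma grayH_assoc_γ_left_right (f : A.C1) (b : B.C0) (k : C.C1) : ⇚²
        ((cubH (A ⊠ B) C).γ (((cubH A B).left b)¹ f) k) =
      ⇛² ((cubH A (B ⊠ C)).γ f (((cubH B C).right b)¹ k)) := by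
  have h1 : ∀ c (f : A.C1), ⇚¹ (((cubH (A ⊠ B) C).left c)¹ (((cubH A B).left b)¹ f)) = _ := fun c f =>
    congrArg (fun k => k¹ f) (grayH_assoc_left A B C b c)
  have h2 : ∀ a (f : C.C1), ⇚¹ (((cubH (A ⊠ B) C).right (((cubH A B).left b)⁰ a))¹ f) = _ := fun a f =>
    congrArg (fun k => k¹ f) (grayH_assoc_right A B C a b)
  refine grayH_cell_ext ?_ ?_ ?_
  · simp only [s1, t1, Cubical.s1γ, Cubical.t1γ, s0, t0]
    rw [map_c1 _ (by simp), map_c1 _ (by simp), h1, h2]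
    simp
  · simp only [s1, t1, Cubical.s1γ, Cubical.t1γ, s0, t0]
    rw [map_c1 _ (by simp), map_c1 _ (by simp), h1, h2]
    simp
  · exact (congrArg (fun z : (A ⊠ B).C2 × C.C2 × PUnit =>
      (z.1.cell.1, (z.1.cell.2.1, z.2))) (cubH_γ_cell' (((cubH A B).left b).map_vid f).symm rfl)).trans
      (congrArg (fun z : A.C2 × (B ⊠ C).C2 × PUnit =>
      (z.1, z.2.1.cell)) (cubH_γ_cell' rfl (((cubH B C).right b).map_vid k).symm)).symm

lemma grayH_assoc_γ_middle_right (a : A.C0) (g : B.C1) (k : C.C1) : ⇚²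
        ((cubH (A ⊠ B) C).γ (((cubH A B).right a)¹ g) k) =
      ⇛² (((cubH A (B ⊠ C)).right a)² ((cubH B C).γ g k)) := by
  have h1 : ∀ c (f : B.C1), ⇚¹ (((cubH (A ⊠ B) C).left c)¹ (((cubH A B).right a)¹ f)) = _ := fun c f =>
    congrArg (fun k => k¹ f) (grayH_assoc_middle A B C a c)
  have h2 : ∀ b (f : C.C1), ⇚¹ (((cubH (A ⊠ B) C).right (((cubH A B).right a)⁰ b))¹ f) = _ := fun b f =>
    ((congrArg (fun z => ⇚¹ (((cubH (A ⊠ B) C).right z)¹ f)) ((cubH A B).agree a b)).symm.trans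
    (congrArg (fun k => k¹ f) (grayH_assoc_right A B C a b)))
  refine grayH_cell_ext ?_ ?_ ?_
  · simp (maxDischargeDepth := 10) [map_c1, h1, h2]
  · simp (maxDischargeDepth := 10) [map_c1, h1, h2]
  · exact (congrArg (fun z : (A ⊠ B).C2 × C.C2 × PUnit =>
      (z.1.cell.1, (z.1.cell.2.1, z.2))) (cubH_γ_cell' (((cubH A B).right a).map_vid g).symm rfl)).trans
      (congrArg (fun z : B.C2 × C.C2 × PUnit => (A♯ (A♭ a), z)) (cubH_γ_cell g k)).symm

end Assoc

lemma grayH_unit_right (e : (grayH.E.obj []).C0) :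
    (cubH A (grayH.E.obj [])).left e ≫ grayH.unitRight A = grayH.η A := by
  have key : ∀ x : (funny A.ct (funny one one)).M, (grayH.unitRight A)¹ x =
      ((assocHom A.ct one one ≫ funnyMap (𝟙 A.ct) (snd one one)).f1
      ((funnyMap (𝟙 _) (funnyMap (𝟙 one) (𝟙 one) ≫ snd one one)).f1
      ((funnyMap (inl A.ct (D := one) ⟨⟩) (funnyMap (𝟙 _) (𝟙 one))).f1 x))) := fun _ => rfl
  have key' : ∀ e f, (grayH.unitRight A)¹ ((inl A.ct (D := funny one one)
      (e, ⟨⟩)).f1 f) = (inl A.ct (D := one) ⟨⟩).f1 f := fun e f =>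
    (key _).trans (by simp; rfl)
  exact cells_hom_ext (fun _ => rfl) (fun f => (congrArg (grayH.unitRight A)¹
    (cubH_left_f1 _ _)).trans (key' _ _)) (fun _ => rfl)

lemma grayH_unit_left (e : (grayH.E.obj []).C0) :
    (cubH (grayH.E.obj []) A).right e ≫ grayH.unitLeft A = grayH.η A := by
  have key : ∀ x : (funny one (funny A.ct one)).M, (grayH.unitLeft A)¹ x = ((snd one (funny A.ct one)).f1
      ((funnyMap (𝟙 _) (funnyMap (𝟙 _) (𝟙 one) ≫ assocHom A.ct one one ≫ funnyMap (𝟙 A.ct) (snd one one))).f1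
      ((funnyMap (𝟙 _) (funnyMap (inl A.ct (D := one) ⟨⟩) (𝟙 one))).f1 x))) := fun _ => rfl
  have key' : ∀ e f, (grayH.unitLeft A)¹ ((inr (C := one) (funny A.ct one)
      e).f1 ((inl A.ct (D := one) ⟨⟩).f1 f)) = (inl A.ct (D := one) ⟨⟩).f1 f := fun e f =>
    (key _).trans (by simp; rfl)
  exact cells_hom_ext (fun _ => rfl) (fun f => (congrArg (grayH.unitLeft A)¹
    (cubH_right_f1 _ _)).trans (key' _ _)) (fun _ => rfl)

section Natural

variable {A' B' : TwoCat.{u}} (F : A ⟶ A') (K : B ⟶ B')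

lemma grayH_map_inl (b f) : (F ⊡ K)¹ ((inl A.ct (D := funny B.ct one) (b, ⟨⟩)).f1 f) =
    (inl A'.ct (D := funny B'.ct one) (K⁰ b, ⟨⟩)).f1 (F¹ f) :=
  funnyMap_inl (ct F) (funnyMap (ct K) (𝟙 one)) _ _

lemma grayH_map_inr (a f) : (F ⊡ K)¹
    ((inr (C := A.ct) (funny B.ct one) a).f1 ((inl B.ct (D := one) ⟨⟩).f1 f)) =
    (inr (C := A'.ct) (funny B'.ct one) (F⁰ a)).f1 ((inl B'.ct (D := one) ⟨⟩).f1 (K¹ f)) :=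
  (funnyMap_inr (ct F) (funnyMap (ct K) (𝟙 one)) _ _).trans
    (congrArg (Hom.f1 _) (funnyMap_inl (ct K) (𝟙 one) _ _))

lemma grayH_natural_left (b : B.C0) : (cubH A B).left b ≫ F ⊡ K = F ≫ (cubH A' B').left (K⁰ b) :=
  cells_hom_ext (fun _ => rfl) (fun f => (congrArg (F ⊡ K)¹
    (cubH_left_f1 b f)).trans ((grayH_map_inl F K b f).trans (cubH_left_f1 _ _).symm))
    (fun α => Prod.ext rfl (Prod.ext ((K.map_vid _).trans (congrArg _ (K.map_id b))) rfl))

lemma grayH_natural_right (a : A.C0) : (cubH A B).right a ≫ F ⊡ K = K ≫ (cubH A' B').right (F⁰ a) :=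
  cells_hom_ext (fun _ => rfl) (fun f => (congrArg (F ⊡ K)¹
    (cubH_right_f1 a f)).trans ((grayH_map_inr F K a f).trans (cubH_right_f1 _ _).symm))
    (fun α => Prod.ext ((F.map_vid _).trans (congrArg _ (F.map_id a))) rfl)

lemma grayH_natural_γ (f : A.C1) (g : B.C1) : (F ⊡ K)² ((cubH A B).γ f g) = (cubH A' B').γ (F¹ f) (K¹ g) := by
  have h1 : ∀ b (f : A.C1), (F ⊡ K)¹ (((cubH A B).left b)¹ f) = _ := fun b f =>
    congrArg (fun k => k¹ f) (grayH_natural_left F K b)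
  have h2 : ∀ a (f : B.C1), (F ⊡ K)¹ (((cubH A B).right a)¹ f) = _ := fun a f =>
    congrArg (fun k => k¹ f) (grayH_natural_right F K a)
  refine grayH_cell_ext ?_ ?_ ?_
  · simp (maxDischargeDepth := 10) [map_c1, h1, h2]
  · simp (maxDischargeDepth := 10) [map_c1, h1, h2]
  · refine (congrArg (fun z : A.C2 × B.C2 × PUnit => (F² z.1, (K² z.2.1, z.2.2)))
      (cubH_γ_cell f g)).trans (.trans ?_ (cubH_γ_cell _ _).symm)
    exact Prod.ext (F.map_vid f) (Prod.ext (K.map_vid g) rfl)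

end Natural

lemma grayH_isTerminal : Nonempty (IsTerminal (grayH.E.obj [])) :=
  ⟨IsTerminal.ofUniqueHom (fun X => CData.transposeInv
    ⟨⟨fun _ => ⟨⟩, fun _ => ⟨⟩, fun _ => rfl, fun _ => rfl, fun _ => rfl, fun _ _ _ _ => rfl⟩,
      ⟨⟨fun _ => ⟨⟩, fun _ => ⟨⟩, fun _ => ⟨⟩, fun _ => rfl, fun _ => rfl, fun _ => rfl, fun _ => rfl⟩,
        fun _ => rfl, fun _ _ _ _ => rfl, fun _ => rfl, fun _ _ _ _ => rfl, fun _ _ _ _ => rfl⟩, rfl⟩) fun X m =>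
    cells_hom_ext (fun _ => rfl) (fun _ => rfl) fun _ => rfl⟩

def grayTensorH : GrayTensor grayH.{u} where
  isIso_η := grayH_isIso_η
  isIso_σ := grayH_isIso_σ
  isTerminal := grayH_isTerminal
  cub := cubH
  universal F := Cubical.IsUniversal.map (gray2_universal _ _) (grayTIso _ _) F
  natural_left := grayH_natural_left
  natural_right := grayH_natural_right
  natural_γ := grayH_natural_γ
  assoc_left := grayH_assoc_left
  assoc_middle := grayH_assoc_middle
  assoc_right := grayH_assoc_right
  assoc_γ_left_middle _ _ _ := grayH_assoc_γ_left_middle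
  assoc_γ_left_right _ _ _ := grayH_assoc_γ_left_right
  assoc_γ_middle_right _ _ _ := grayH_assoc_γ_middle_right
  unit_right _ := grayH_unit_right
  unit_left _ := grayH_unit_left

end

end

section

namespace TwoCat

variable (Z : TwoCat.{u})

section

variable {Z} {u v w p q p' q' p'' q'' r s r' s' : Z.C1} {X X' X'' Y Y' α β α' β' γ δ : Z.C2}

lemma sq_vcomp (hu : Z.t0 u = Z.s0 q) (hv : Z.t0 p = Z.s0 v) (hX : Z.t1 X = Z.c1 p v)
    (hX' : Z.s1 X' = Z.c1 u q') (hX't : Z.t1 X' = Z.c1 p' v) (hX'' : Z.s1 X'' = Z.c1 u q'')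
    (sα : Z.s1 α = p) (tα : Z.t1 α = p') (sβ : Z.s1 β = q) (tβ : Z.t1 β = q')
    (sα' : Z.s1 α' = p') (sβ' : Z.s1 β' = q') (tβ' : Z.t1 β' = q'')
    (hq' : Z.s0 q' = Z.s0 q) (hp' : Z.t0 p' = Z.t0 p)
    (n : Z.vc (Z.hc (Z♯ u) β) X' = Z.vc X (Z.hc α (Z♯ v)))
    (n' : Z.vc (Z.hc (Z♯ u) β') X'' = Z.vc X' (Z.hc α' (Z♯ v))) :
    Z.vc (Z.hc (Z♯ u) (Z.vc β β')) X'' = Z.vc X (Z.hc (Z.vc α α') (Z♯ v)) := by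
  have hq : Z.t0 u = Z.s0 q' := hu.trans hq'.symm
  have hp : Z.t0 p' = Z.s0 v := hp'.trans hv
  rw [vc_whisker_left (by rw [tβ, sβ']) (by rw [sβ, hu]), vc_whisker_right (by rw [tα, sα']) (by rw [sα, hv]),
    vc_assoc (by simp (maxDischargeDepth := 10) [*]) (by simp (maxDischargeDepth := 10) [*]), n',
    ← vc_assoc (by simp (maxDischargeDepth := 10) [*]) (by simp (maxDischargeDepth := 10) [*]), n,
    vc_assoc (by simp (maxDischargeDepth := 10) [*]) (by simp (maxDischargeDepth := 10) [*])]

lemma sq_hcomp (hu : Z.t0 u = Z.s0 q) (hv : Z.t0 p = Z.s0 v) (hqv : Z.t0 q = Z.t0 v)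
    (hr : Z.s0 r = Z.s0 v) (hvs : Z.t0 v = Z.s0 s) (hrw : Z.t0 r = Z.s0 w)
    (hXs : Z.s1 X = Z.c1 u q) (hX : Z.t1 X = Z.c1 p v)
    (hX' : Z.s1 X' = Z.c1 u q') (hX't : Z.t1 X' = Z.c1 p' v)
    (hYs : Z.s1 Y = Z.c1 v s) (hY : Z.t1 Y = Z.c1 r w)
    (hY' : Z.s1 Y' = Z.c1 v s') (hY't : Z.t1 Y' = Z.c1 r' w)
    (sα : Z.s1 α = p) (tα : Z.t1 α = p') (sβ : Z.s1 β = q) (tβ : Z.t1 β = q')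
    (sγ : Z.s1 γ = r) (tγ : Z.t1 γ = r') (sδ : Z.s1 δ = s) (tδ : Z.t1 δ = s')
    (hq' : Z.s0 q' = Z.s0 q) (hqt' : Z.t0 q' = Z.t0 q) (hp' : Z.t0 p' = Z.t0 p)
    (hs' : Z.s0 s' = Z.s0 s) (hrs' : Z.s0 r' = Z.s0 r) (hr' : Z.t0 r' = Z.t0 r)
    (n : Z.vc (Z.hc (Z♯ u) β) X' = Z.vc X (Z.hc α (Z♯ v)))
    (n' : Z.vc (Z.hc (Z♯ v) δ) Y' = Z.vc Y (Z.hc γ (Z♯ w))) :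
    Z.vc (Z.hc (Z♯ u) (Z.hc β δ)) (Z.vc (Z.hc X' (Z♯ s')) (Z.hc (Z♯ p') Y')) =
      Z.vc (Z.vc (Z.hc X (Z♯ s)) (Z.hc (Z♯ p) Y)) (Z.hc (Z.hc α γ) (Z♯ w)) := by
  have d1 : Z.hc (Z♯ u) (Z.hc β δ) = Z.vc (Z.hc (Z.hc (Z♯ u) β) (Z♯ s)) (Z.hc (Z♯ (Z.c1 u q')) δ) := by
    rw [hc_eq_vc (by simp (maxDischargeDepth := 10) [*]) (by simp (maxDischargeDepth := 10) [*])
      (by simp [*]), hc_assoc (by simp [*]) (by simp [*])]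
  have d2 : Z.hc (Z.hc α γ) (Z♯ w) = Z.vc (Z.hc (Z♯ p) (Z.hc γ (Z♯ w))) (Z.hc α (Z♯ (Z.c1 r' w))) := by
    rw [hc_assoc (by simp [*]) (by simp [*])]
    exact (hc_eq_vc' (by simp (maxDischargeDepth := 10) [*]) (by simp [*])
      (by simp (maxDischargeDepth := 10) [*])).symm
  have d3 : Z.vc (Z.hc (Z♯ (Z.c1 u q')) δ) (Z.hc X' (Z♯ s')) =
      Z.vc (Z.hc X' (Z♯ s)) (Z.hc (Z♯ (Z.c1 p' v)) δ) := by
    rw [hc_eq_vc (by simp (maxDischargeDepth := 10) [*]) hX't sδ,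
      hc_eq_vc' (by simp (maxDischargeDepth := 10) [*]) hX' tδ]
  have d4 : Z.vc (Z.hc (Z♯ p) Y') (Z.hc α (Z♯ (Z.c1 r' w))) =
      Z.vc (Z.hc α (Z♯ (Z.c1 v s'))) (Z.hc (Z♯ p') Y') := by
    rw [hc_eq_vc (by simp (maxDischargeDepth := 10) [*]) tα hY',
      hc_eq_vc' (by simp (maxDischargeDepth := 10) [*]) sα hY't]
  have d5 : Z.hc (Z♯ (Z.c1 p' v)) δ = Z.hc (Z♯ p') (Z.hc (Z♯ v) δ) := by
    rw [← i1_hc_i1 (by simp [*]), hc_assoc (by simp [*]) (by simp [*])]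
  have d6 : Z.vc (Z.hc (Z♯ p) Y) (Z.hc (Z♯ p) (Z.hc γ (Z♯ w))) =
      Z.vc (Z.hc (Z♯ p) (Z.hc (Z♯ v) δ)) (Z.hc (Z♯ p) Y') := by
    rw [← vc_whisker_left (by simp (maxDischargeDepth := 10) [*]) (by simp (maxDischargeDepth := 10) [*]), ← n',
      vc_whisker_left (by simp (maxDischargeDepth := 10) [*]) (by simp (maxDischargeDepth := 10) [*])]
  have d7 : Z.vc (Z.hc (Z♯ p) (Z.hc (Z♯ v) δ)) (Z.hc α (Z♯ (Z.c1 v s'))) = Z.vc (Z.hc (Z.hc α (Z♯ v)) (Z♯ s))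
        (Z.hc (Z♯ p') (Z.hc (Z♯ v) δ)) := by
    rw [hc_eq_vc' (by simp (maxDischargeDepth := 10) [*]) sα (by simp (maxDischargeDepth := 10) [*]),
      hc_assoc (by simp [*]) (by simp [*]), i1_hc_i1 hvs,
      hc_eq_vc (by simp (maxDischargeDepth := 10) [*]) tα (by simp (maxDischargeDepth := 10) [*])]
  have d8 : Z.vc (Z.hc (Z.hc (Z♯ u) β) (Z♯ s)) (Z.hc X' (Z♯ s)) =
      Z.vc (Z.hc X (Z♯ s)) (Z.hc (Z.hc α (Z♯ v)) (Z♯ s)) := by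
    rw [← vc_whisker_right (by simp (maxDischargeDepth := 10) [*]) (by simp (maxDischargeDepth := 10) [*]), n,
      vc_whisker_right (by simp (maxDischargeDepth := 10) [*]) (by simp (maxDischargeDepth := 10) [*])]
  have a1 : ∀ {a b c d e f : Z.C2}, Z.t1 a = Z.s1 b → Z.t1 b = Z.s1 c → Z.t1 c = Z.s1 d →
      Z.t1 a = Z.s1 e → Z.t1 e = Z.s1 f → Z.t1 f = Z.s1 d → Z.vc b c = Z.vc e f →
      Z.vc (Z.vc a b) (Z.vc c d) = Z.vc (Z.vc a e) (Z.vc f d) := by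
    intro a b c d e f h1 h2 h3 h4 h5 h6 h
    rw [vc_assoc h1 (by simp [h2]), ← vc_assoc h2 h3, h, vc_assoc h5 h6, ← vc_assoc h4 (by simp [h5])]
  rw [d1, d2]
  refine (a1 ?_ ?_ ?_ ?_ ?_ ?_ d3).trans ?_
  rotate_left 6
  · rw [d5, d8]
    refine Eq.trans ?_ (a1 ?_ ?_ ?_ ?_ ?_ ?_ d6).symm
    · rw [d4]
      refine a1 ?_ ?_ ?_ ?_ ?_ ?_ d7.symm
      all_goals simp (maxDischargeDepth := 10) [*, c1_assoc]
    all_goals simp (maxDischargeDepth := 10) [*, c1_assoc]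
  all_goals simp (maxDischargeDepth := 10) [*, c1_assoc]

end

@[ext] structure Sq where
  u : Z.C1
  u' : Z.C1
  p : Z.C1
  q : Z.C1
  x : Z.C2
  h1 : Z.t0 u = Z.s0 q
  h2 : Z.t0 q = Z.t0 u'
  h3 : Z.s0 p = Z.s0 u
  h4 : Z.t0 p = Z.s0 u'
  hs : Z.s1 x = Z.c1 u q
  ht : Z.t1 x = Z.c1 p u'

namespace Sq

variable {Z}

attribute [simp] h1 h2 h3 h4 hs ht

def comp (a b : Sq Z) (h : a.u' = b.u) : Sq Z where
  u := a.u
  u' := b.u'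
  p := Z.c1 a.p b.p
  q := Z.c1 a.q b.q
  x := Z.vc (Z.hc a.x (Z♯ b.q)) (Z.hc (Z♯ a.p) b.x)
  h1 := by simp
  h2 := by rw [t0_c1 (by simp [h]), b.h2]
  h3 := by simp
  h4 := by rw [t0_c1 (by simp [h]), b.h4]
  hs := by simp (maxDischargeDepth := 10) [h, c1_assoc]
  ht := by simp (maxDischargeDepth := 10) [h, c1_assoc]

def one (u : Z.C1) : Sq Z := ⟨u, u, Z♭ (Z.s0 u), Z♭ (Z.t0 u), Z♯ u, by simp, by simp, by simp, by simp,
    by simp [c1_id], by simp [id_c1]⟩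

lemma one_comp (f : Sq Z) {u : Z.C1} (h : f.u = u) : (one u).comp f h.symm = f := by
  subst h
  refine Sq.ext rfl rfl (id_c1 f.h3) (id_c1 f.h1.symm) ?_
  simp [Sq.comp, one, i1_hc_i1, id_hc, id_vc]

lemma comp_one (f : Sq Z) {u : Z.C1} (h : f.u' = u) : f.comp (one u) h = f := by
  subst h
  refine Sq.ext rfl rfl (c1_id f.h4) (c1_id f.h2) ?_
  simp [Sq.comp, one, i1_hc_i1, hc_id, vc_id]

lemma comp_assoc (f g k : Sq Z) (h₁ : f.u' = g.u) (h₃ : g.u' = k.u) :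
    (f.comp g h₁).comp k h₃ = f.comp (g.comp k h₃) h₁ := by
  have k1 := h₁
  have k2 := h₃
  refine Sq.ext rfl rfl (c1_assoc (by simp [k1]) (by simp [k2])) (c1_assoc (by simp [k1]) (by simp [k2])) ?_
  change Z.vc (Z.hc (Z.vc (Z.hc f.x (Z♯ g.q)) (Z.hc (Z♯ f.p) g.x)) (Z♯ k.q)) (Z.hc (Z♯ (Z.c1 f.p g.p)) k.x) =
    Z.vc (Z.hc f.x (Z♯ (Z.c1 g.q k.q))) (Z.hc (Z♯ f.p)
    (Z.vc (Z.hc g.x (Z♯ k.q)) (Z.hc (Z♯ g.p) k.x)))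
  rw [vc_whisker_right (by simp (maxDischargeDepth := 10) [k1, c1_assoc])
    (by simp (maxDischargeDepth := 10) [k1, k2]),
    vc_whisker_left (by simp (maxDischargeDepth := 10) [k2, c1_assoc])
    (by simp (maxDischargeDepth := 10) [k1, k2]),
    ← i1_hc_i1 (by simp [k1]), ← i1_hc_i1 (by simp [k2]),
    hc_assoc (by simp [k1]) (by simp [k2]), hc_assoc (by simp [k1]) (by simp [k2]),
    hc_assoc (by simp [k1]) (by simp [k2]),
    vc_assoc (by simp (maxDischargeDepth := 10) [k1, k2, c1_assoc])
      (by simp (maxDischargeDepth := 10) [k1, k2, c1_assoc])]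

@[ext] structure Cell (Z : TwoCat.{u}) where
  a : Sq Z
  b : Sq Z
  α : Z.C2
  β : Z.C2
  hu : a.u = b.u
  hu' : a.u' = b.u'
  sα : Z.s1 α = a.p
  tα : Z.t1 α = b.p
  sβ : Z.s1 β = a.q
  tβ : Z.t1 β = b.q
  nat : Z.vc (Z.hc (Z♯ a.u) β) b.x = Z.vc a.x (Z.hc α (Z♯ a.u'))

namespace Cell

attribute [simp] sα tα sβ tβ

def vcomp (x y : Cell Z) (h : x.b = y.a) : Cell Z where
  a := x.a
  b := y.b
  α := Z.vc x.α y.α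
  β := Z.vc x.β y.β
  hu := x.hu.trans ((congrArg Sq.u h).trans y.hu)
  hu' := x.hu'.trans ((congrArg Sq.u' h).trans y.hu')
  sα := by simp
  tα := by rw [t1_vc (by simp [h]), y.tα]
  sβ := by simp
  tβ := by rw [t1_vc (by simp [h]), y.tβ]
  nat := by
    obtain ⟨a, b, α, β, hu, hu', sα, tα, sβ, tβ, n⟩ := x
    obtain ⟨a', c, α', β', hw, hw', sα', tα', sβ', tβ', n'⟩ := y
    obtain rfl : b = a' := h
    dsimp only
    refine sq_vcomp (p' := b.p) (q' := b.q) (q'' := c.q) (X' := b.x) a.h1 a.h4 a.ht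
      (by rw [hu]; exact b.hs) (by rw [hu']; exact b.ht) (by rw [hu, hw]; exact c.hs)
      sα tα sβ tβ sα' sβ' tβ' ?_ ?_ n (by rw [hu, hu']; exact n')
    · rw [← b.h1, ← a.h1, hu]
    · rw [b.h4, a.h4, hu']

def hcomp (x y : Cell Z) (h : x.a.u' = y.a.u) : Cell Z where
  a := x.a.comp y.a h
  b := x.b.comp y.b (x.hu'.symm.trans (h.trans y.hu))
  α := Z.hc x.α y.α
  β := Z.hc x.β y.β
  hu := x.hu
  hu' := y.hu'
  sα := by simp [comp, h]
  tα := by simp [comp, h]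
  sβ := by simp [comp, h]
  tβ := by simp [comp, h]
  nat := by
    obtain ⟨a, b, α, β, hu, hu', sα, tα, sβ, tβ, n⟩ := x
    obtain ⟨a', b', γ, δ, hw, hw', sγ, tγ, sδ, tδ, n'⟩ := y
    have h : a.u' = a'.u := h
    have hX := a.ht
    have hXt := b.ht
    have hp := a.h4
    have hqv := a.h2
    have hp' := b.h4
    have hq' := b.h2
    rw [← hu'] at hXt hp' hq'
    rw [h] at hX hXt hp hqv hp' hq' n
    dsimp only [comp]
    refine sq_hcomp (u := a.u) (v := a'.u) (p := a.p) (p' := b.p) (q := a.q) (q' := b.q)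
      (r := a'.p) (r' := b'.p) (s := a'.q) (s' := b'.q) (X := a.x) (X' := b.x) (Y := a'.x)
      (Y' := b'.x) a.h1 hp hqv a'.h3 a'.h1 a'.h4 a.hs hX (by rw [hu]; exact b.hs) hXt a'.hs a'.ht
      (by rw [hw]; exact b'.hs) (by rw [hw']; exact b'.ht) sα tα sβ tβ sγ tγ sδ tδ ?_
      (hq'.trans hqv.symm) (hp'.trans hp.symm) ?_ ?_ ?_ n n'
    · rw [← b.h1, ← a.h1, hu]
    · rw [← b'.h1, ← a'.h1, hw]
    · rw [b'.h3, a'.h3, hw]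
    · rw [b'.h4, a'.h4, hw']

end Cell

end Sq

open Sq in
def cyl (Z : TwoCat.{u}) : TwoCat.{u} where
  C0 := Z.C1
  C1 := Sq Z
  C2 := Sq.Cell Z
  s0 := Sq.u
  t0 := Sq.u'
  s1 := Sq.Cell.a
  t1 := Sq.Cell.b
  ss := Sq.Cell.hu
  tt := Sq.Cell.hu'
  cat1 :=
    { id := Sq.one
      comp := Sq.comp
      s_id := fun _ => rfl
      t_id := fun _ => rfl
      s_comp := fun _ _ _ => rfl
      t_comp := fun _ _ _ => rfl
      id_comp := fun f _ => f.one_comp rfl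
      comp_id := fun f _ => f.comp_one rfl
      assoc := fun f g k h₁ _ h₃ _ => comp_assoc f g k h₁ h₃ }
  catV :=
    { id := fun a => ⟨a, a, Z♯ a.p, Z♯ a.q, rfl, rfl, by simp, by simp, by simp,
        by simp, by simp [i1_hc_i1, id_vc, vc_id]⟩
      comp := Sq.Cell.vcomp
      s_id := fun _ => rfl
      t_id := fun _ => rfl
      s_comp := fun _ _ _ => rfl
      t_comp := fun _ _ _ => rfl
      id_comp := fun f h => Sq.Cell.ext rfl rfl (id_vc f.sα) (id_vc f.sβ)
      comp_id := fun f h => Sq.Cell.ext rfl rfl (vc_id f.tα) (vc_id f.tβ)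
      assoc := fun f g k h₁ h₂ h₃ h₄ => by
        have k1 : f.b = g.a := h₁
        have k2 : g.b = k.a := h₃
        exact Sq.Cell.ext rfl rfl (vc_assoc (by simp [k1]) (by simp [k2]))
          (vc_assoc (by simp [k1]) (by simp [k2])) }
  catH :=
    { id := fun u => ⟨Sq.one u, Sq.one u, Z♯ (Z♭ (Z.s0 u)),
        Z♯ (Z♭ (Z.t0 u)), rfl, rfl, by simp [Sq.one], by simp [Sq.one], by simp [Sq.one],
        by simp [Sq.one], by simp [Sq.one, i1_hc_i1, id_vc, vc_id, id_c1, c1_id]⟩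
      comp := Sq.Cell.hcomp
      s_id := fun _ => rfl
      t_id := fun _ => rfl
      s_comp := fun _ _ _ => rfl
      t_comp := fun _ _ _ => rfl
      id_comp := fun f h => Sq.Cell.ext (f.a.one_comp rfl) (f.b.one_comp f.hu.symm)
        (id_hc (by simp)) (id_hc (by simp))
      comp_id := fun f h => Sq.Cell.ext (f.a.comp_one rfl) (f.b.comp_one f.hu'.symm)
        (hc_id (by simp)) (hc_id (by simp))
      assoc := fun f g k h₁ h₂ h₃ h₄ => by
        have k1 : f.a.u' = g.a.u := h₁
        have k2 : g.a.u' = k.a.u := h₃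
        exact Sq.Cell.ext (comp_assoc _ _ _ k1 k2) (comp_assoc _ _ _
          (f.hu'.symm.trans (k1.trans g.hu)) (g.hu'.symm.trans (k2.trans k.hu)))
          (hc_assoc (C := Z) (by simp [k1]) (by simp [k2]))
          (hc_assoc (C := Z) (by simp [k1]) (by simp [k2])) }
  catH_id _ := rfl
  s1_hcomp _ _ _ := rfl
  t1_hcomp _ _ _ _ := rfl
  hcomp_id f g h h' := by
    have k : f.u' = g.u := h
    exact Sq.Cell.ext rfl rfl (i1_hc_i1 (by simp [k])) (i1_hc_i1 (by simp [k]))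
  interchange x x' y y' hx hy h h₁ h₂ h' := by
    have k1 : x.b = x'.a := hx
    have k2 : y.b = y'.a := hy
    have k3 : x.a.u' = y.a.u := h₁
    exact Sq.Cell.ext rfl rfl (interch (by simp [k1]) (by simp [k2]) (by simp [k3]))
      (interch (by simp [k1]) (by simp [k2]) (by simp [k3]))

end TwoCat

def Cubical.sq {A B C : TwoCat.{u}} (F : Cubical A B C) (f : A.C1) (g : B.C1) : TwoCat.Sq C :=
  ⟨(F.left (B.s0 g))¹ f, (F.left (B.t0 g))¹ f, (F.right (A.s0 f))¹ g,
    (F.right (A.t0 f))¹ g, F.γ f g, by simp, by simp, by simp, by simp, by simp, by simp⟩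

lemma Cubical.sq_comp {A B C : TwoCat.{u}} (F : Cubical A B C) (f : A.C1) (g g' : B.C1)
    (h : B.t0 g = B.s0 g') (h') : F.sq f (B.c1 g g') = (F.sq f g).comp (F.sq f g') h' :=
  TwoCat.Sq.ext (congrArg (fun b => (F.left b)¹ f) (TwoCat.s0_c1 _ _))
    (congrArg (fun b => (F.left b)¹ f) (TwoCat.t0_c1 h)) (TwoCat.Hom.map_c1 _ h)
    (TwoCat.Hom.map_c1 _ h) (F.γ_c1_right f h)

def Cubical.cyl {A B C : TwoCat.{u}} (F : Cubical A B C) (f : A.C1) : B ⟶ C.cyl where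
  toHom :=
    { f0 := fun b => (F.left b)¹ f
      f1 := F.sq f
      f2 := fun β => ⟨F.sq f (B.s1 β), F.sq f (B.t1 β), (F.right (A.s0 f))² β,
        (F.right (A.t0 f))² β, congrArg (fun b => (F.left b)¹ f) (B.ss β),
        congrArg (fun b => (F.left b)¹ f) (B.tt β), by simp [Cubical.sq],
        by simp [Cubical.sq], by simp [Cubical.sq], by simp [Cubical.sq],
        F.γ_nat_right f β⟩
      s0 := fun _ => rfl
      t0 := fun _ => rfl
      s1 := fun _ => rfl
      t1 := fun _ => rfl }
  map_id a := TwoCat.Sq.ext (congrArg (fun b => (F.left b)¹ f) (TwoCat.s0_i0 _))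
    (congrArg (fun b => (F.left b)¹ f) (TwoCat.t0_i0 _))
    ((TwoCat.Hom.map_i0 _ _).trans (congrArg C♭ (by simp)))
    ((TwoCat.Hom.map_i0 _ _).trans (congrArg C♭ (by simp))) (F.γ_id_right f a)
  map_comp g g' h h' := by
    rw [← TwoCat.c1_eq h]
    exact F.sq_comp f g g' h h'
  map_vid g := TwoCat.Sq.Cell.ext (congrArg (F.sq f) (TwoCat.s1_i1 _))
    (congrArg (F.sq f) (TwoCat.t1_i1 _)) (TwoCat.Hom.map_i1 _ _) (TwoCat.Hom.map_i1 _ _)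
  map_vcomp x y h h' := by
    rw [← TwoCat.vc_eq h]
    exact TwoCat.Sq.Cell.ext (congrArg (F.sq f) (TwoCat.s1_vc _ _))
      (congrArg (F.sq f) (TwoCat.t1_vc h)) (TwoCat.Hom.map_vc (F.right _) h)
      (TwoCat.Hom.map_vc (F.right _) h)
  map_hcomp x y h h' := by
    have k : B.t0 (B.t1 x) = B.s0 (B.t1 y) := by simpa using h
    rw [← TwoCat.hc_eq h]
    exact TwoCat.Sq.Cell.ext ((congrArg (F.sq f) (TwoCat.s1_hc h)).trans (F.sq_comp f _ _ h
      (congrArg (fun b => (F.left b)¹ f) h)))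
      ((congrArg (F.sq f) (TwoCat.t1_hc h)).trans (F.sq_comp f _ _ k (congrArg (fun b => (F.left b)¹ f) k)))
      (TwoCat.Hom.map_hc (F.right _) h) (TwoCat.Hom.map_hc (F.right _) h)

end

section

section Lists

variable {V : Type u} [Category.{v} V]

lemma consHom_heq {X Y : V} (f : X ⟶ Y) {L L' M M' : List V} {g : L ⟶ M} {g' : L' ⟶ M'}
    (hL : L = L') (hM : M = M') (h : HEq g g') : HEq (consHom f g) (consHom f g') := by
  subst hL hM; cases h; rfl

lemma appendHom_nil : ∀ {L M : List V} (g : L ⟶ M), HEq (appendHom g (𝟙 [])) g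
  | [], [], _ => HEq.rfl
  | [], _ :: _, f => PEmpty.elim f
  | _ :: _, [], f => PEmpty.elim f
  | _ :: L, _ :: M, g => consHom_heq g.1 (List.append_nil L) (List.append_nil M)
      (appendHom_nil (L := L) (M := M) g.2)

instance isIso_consHom {X Y : V} (f : X ⟶ Y) {L M : List V} (g : L ⟶ M) [IsIso f] [IsIso g] :
    IsIso (consHom f g) :=
  ⟨consHom (inv f) (inv g), Prod.ext (IsIso.hom_inv_id f) (IsIso.hom_inv_id g),
    Prod.ext (IsIso.inv_hom_id f) (IsIso.inv_hom_id g)⟩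

namespace Multitensor

variable (G : Multitensor V)

lemma σ_natural' {LL MM : List (List V)} (f : LL ⟶ MM) {L M : List V} (h : LL.flatten = L)
    (h' : MM.flatten = M) (g : L ⟶ M) (hg : HEq (flattenHom f) g) :
    G.E.map ((mapM G.E).map f) ≫ G.σ MM M h' = G.σ LL L h ≫ G.E.map g := by
  subst h h'; cases hg; exact G.σ_natural f

def cn (X : V) (L : List V) : G.E.obj [X, G.E.obj L] ⟶ G.E.obj (X :: L) :=
  G.E.map (consHom (G.η X) (consHom (𝟙 (G.E.obj L)) (𝟙 []))) ≫ G.σ [[X], L] (X :: L) (by simp)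

lemma cn_natural {X Y : V} (f : X ⟶ Y) {L M : List V} (g : L ⟶ M) :
    G.E.map (consHom f (consHom (G.E.map g) (𝟙 []))) ≫ G.cn Y M = G.cn X L ≫ G.E.map (consHom f g) := by
  have h := G.σ_natural' (LL := [[X], L]) (MM := [[Y], M])
    (consHom (consHom f (𝟙 [])) (consHom g (𝟙 []))) (L := X :: L) (M := Y :: M) (by simp) (by simp)
    (consHom f g) (consHom_heq f (List.append_nil L) (List.append_nil M) (appendHom_nil g))
  refine (Category.assoc _ _ _).symm.trans (Eq.trans (Eq.trans (congrArg (· ≫ _) ?_)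
    (Category.assoc _ _ _)) ((congrArg (_ ≫ ·) h).trans (Category.assoc _ _ _).symm))
  refine (G.E.map_comp _ _).symm.trans (Eq.trans (congrArg G.E.map ?_) (G.E.map_comp _ _))
  refine Prod.ext (G.η_natural f).symm (Prod.ext ?_ rfl)
  exact (Category.comp_id _).trans (Category.id_comp _).symm

abbrev map₂ {X Y X' Y' : V} (f : X ⟶ X') (g : Y ⟶ Y') : G.E.obj [X, Y] ⟶ G.E.obj [X', Y'] :=
  G.E.map (consHom f (consHom g (𝟙 [])))

lemma map₂_comp {X Y X' Y' X'' Y'' : V} (f : X ⟶ X') (g : Y ⟶ Y') (f' : X' ⟶ X'')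
    (g' : Y' ⟶ Y'') : G.map₂ (f ≫ f') (g ≫ g') = G.map₂ f g ≫ G.map₂ f' g' :=
  G.E.map_comp (consHom f (consHom g (𝟙 []))) (consHom f' (consHom g' (𝟙 [])))

lemma isIso_cn (hη : ∀ X, IsIso (G.η X)) (hσ : ∀ LL L h, IsIso (G.σ LL L h)) (X : V) (L : List V) :
    IsIso (G.cn X L) := by
  have := hη X
  have := hσ [[X], L] (X :: L) (by simp)
  have h : IsIso (consHom (G.η X) (consHom (𝟙 (G.E.obj L)) (𝟙 []))) := inferInstance
  have : IsIso (G.E.map (consHom (G.η X) (consHom (𝟙 (G.E.obj L)) (𝟙 [])))) := inferInstance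
  exact IsIso.comp_isIso

end Multitensor

end Lists

instance grayH_isIso_cn (X : TwoCat.{u}) (L : List TwoCat.{u}) : IsIso (grayH.cn X L) :=
  grayH.isIso_cn grayH_isIso_η grayH_isIso_σ X L

section

variable {A B C A' B' : TwoCat.{u}}

def hDesc (F : Cubical A B C) : grayH.E.obj [A, B] ⟶ C := (grayTensorH.universal F).choose

lemma left_hDesc (F : Cubical A B C) (b) : (cubH A B).left b ≫ hDesc F = F.left b :=
  (grayTensorH.universal F).choose_spec.1.1 b

lemma right_hDesc (F : Cubical A B C) (a) : (cubH A B).right a ≫ hDesc F = F.right a :=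
  (grayTensorH.universal F).choose_spec.1.2.1 a

lemma γ_hDesc (F : Cubical A B C) (f g) : (hDesc F)² ((cubH A B).γ f g) = F.γ f g :=
  (grayTensorH.universal F).choose_spec.1.2.2 f g

lemma cubH_hom_ext {H K : grayH.E.obj [A, B] ⟶ C} (hl : ∀ b, (cubH A B).left b ≫ H = (cubH A B).left b ≫ K)
    (hr : ∀ a, (cubH A B).right a ≫ H = (cubH A B).right a ≫ K)
    (hγ : ∀ f g, H² ((cubH A B).γ f g) = K² ((cubH A B).γ f g)) : H = K :=
  (grayTensorH.universal ((cubH A B).map K)).unique ⟨hl, hr, hγ⟩ ⟨fun _ => rfl, fun _ => rfl, fun _ _ => rfl⟩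

lemma cubH_bijective : Function.Bijective (fun x : A.C0 × B.C0 => ((cubH A B).left x.2)⁰ x.1) := by
  have h := grayTIso A B
  refine ⟨fun x y hxy => ?_, fun z => ?_⟩
  · have := congrArg (grayTIso A B).inv⁰ hxy
    have k : ∀ z, (grayTIso A B).inv⁰ ((grayTIso A B).hom⁰ z) = z := fun z =>
      congrArg (fun F => F⁰ z) (grayTIso A B).hom_inv_id
    exact (k _).symm.trans (this.trans (k _))
  · refine ⟨(grayTIso A B).inv⁰ z, ?_⟩
    exact congrArg (fun F => F⁰ z) (grayTIso A B).inv_hom_id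

lemma cubH_induction {P : (grayH.E.obj [A, B]).C1 → Prop} (hid : ∀ a, P ((grayH.E.obj [A, B])♭ a))
    (hl : ∀ b f c, (grayH.E.obj [A, B]).t0 (((cubH A B).left b)¹ f) = (grayH.E.obj [A, B]).s0 c → P c →
      P ((grayH.E.obj [A, B]).c1 (((cubH A B).left b)¹ f) c))
    (hr : ∀ a g c, (grayH.E.obj [A, B]).t0 (((cubH A B).right a)¹ g) = (grayH.E.obj [A, B]).s0 c → P c →
      P ((grayH.E.obj [A, B]).c1 (((cubH A B).right a)¹ g) c)) (c : (grayH.E.obj [A, B]).C1) : P c := by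
  have k : ∀ z, (grayTIso A B).hom¹ ((grayTIso A B).inv¹ z) = z := fun z =>
    congrArg (fun F => F¹ z) (grayTIso A B).inv_hom_id
  rw [← k c]
  have key : ∀ z, P ((grayTIso A B).hom¹ z) := fun z => by
    induction z using gray2_induction with
    | hid a => rw [TwoCat.Hom.map_i0]; exact hid _
    | hl b f c h ih =>
      rw [TwoCat.Hom.map_c1 _ h]
      refine hl b f _ ?_ ih
      change (grayH.E.obj [A, B]).t0 ((grayTIso A B).hom¹ ((gray2Left A b)¹ f)) = _
      rw [TwoCat.Hom.t0, TwoCat.Hom.s0, h]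
    | hr b f c h ih =>
      rw [TwoCat.Hom.map_c1 _ h]
      refine hr b f _ ?_ ih
      change (grayH.E.obj [A, B]).t0 ((grayTIso A B).hom¹ ((gray2Right B b)¹ f)) = _
      rw [TwoCat.Hom.t0, TwoCat.Hom.s0, h]
  exact key _

abbrev hMap₂ (F : A ⟶ A') (K : B ⟶ B') : grayH.E.obj [A, B] ⟶ grayH.E.obj [A', B'] := grayH.map₂ F K

lemma left_hMap₂ (F : A ⟶ A') (K : B ⟶ B') (b) :
    (cubH A B).left b ≫ hMap₂ F K = F ≫ (cubH A' B').left (K⁰ b) :=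
  grayTensorH.natural_left F K b

lemma right_hMap₂ (F : A ⟶ A') (K : B ⟶ B') (a) :
    (cubH A B).right a ≫ hMap₂ F K = K ≫ (cubH A' B').right (F⁰ a) :=
  grayTensorH.natural_right F K a

lemma γ_hMap₂ (F : A ⟶ A') (K : B ⟶ B') (f g) :
    (hMap₂ F K)² ((cubH A B).γ f g) = (cubH A' B').γ (F¹ f) (K¹ g) :=
  grayTensorH.natural_γ F K f g

lemma hMap₂_comp {A'' B'' : TwoCat.{u}} (F : A ⟶ A') (K : B ⟶ B') (F' : A' ⟶ A'') (K' : B' ⟶ B'') :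
    hMap₂ (F ≫ F') (K ≫ K') = hMap₂ F K ≫ hMap₂ F' K' :=
  grayH.map₂_comp F K F' K'

lemma hMap₂_bijective {F : A ⟶ A'} {K : B ⟶ B'} (hF : Function.Bijective F⁰)
    (hK : Function.Bijective K⁰) : Function.Bijective (hMap₂ F K)⁰ := by
  have h := cubH_bijective (A := A) (B := B)
  have h' := cubH_bijective (A := A') (B := B')
  rw [← Function.Bijective.of_comp_iff _ h]
  have e : (hMap₂ F K)⁰ ∘ (fun x : A.C0 × B.C0 => ((cubH A B).left x.2)⁰ x.1) =
      (fun x : A'.C0 × B'.C0 => ((cubH A' B').left x.2)⁰ x.1) ∘ Prod.map F⁰ K⁰ :=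
    funext fun x => congrArg (fun k => k⁰ x.1) (left_hMap₂ F K x.2)
  rw [e]
  exact h'.comp (hF.prodMap hK)

lemma hMap₂_surjective {F : A ⟶ A'} {K : B ⟶ B'} (hF : Function.Bijective F⁰)
    (hK : Function.Bijective K⁰) (hF' : Function.Surjective F¹)
    (hK' : Function.Surjective K¹) : Function.Surjective (hMap₂ F K)¹ := by
  have hb := hMap₂_bijective hF hK
  intro c
  induction c using cubH_induction with
  | hid a =>
    obtain ⟨a, rfl⟩ := hb.2 a
    exact ⟨_, TwoCat.Hom.map_i0 _ a⟩
  | hl b f c h ih =>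
    obtain ⟨c, rfl⟩ := ih
    obtain ⟨b, rfl⟩ := hK.2 b
    obtain ⟨f, rfl⟩ := hF' f
    have e : (hMap₂ F K)¹ (((cubH A B).left b)¹ f) = _ := congrArg (fun k => k¹ f) (left_hMap₂ F K b)
    refine ⟨_, (TwoCat.Hom.map_c1 _ ?_).trans (congrArg (TwoCat.c1 _ · _) e)⟩
    refine hb.1 ?_
    rw [← TwoCat.Hom.t0, ← TwoCat.Hom.s0, e, ← h]
    rfl
  | hr b f c h ih =>
    obtain ⟨c, rfl⟩ := ih
    obtain ⟨b, rfl⟩ := hF.2 b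
    obtain ⟨f, rfl⟩ := hK' f
    have e : (hMap₂ F K)¹ (((cubH A B).right b)¹ f) = _ := congrArg (fun k => k¹ f) (right_hMap₂ F K b)
    refine ⟨_, (TwoCat.Hom.map_c1 _ ?_).trans (congrArg (TwoCat.c1 _ · _) e)⟩
    refine hb.1 ?_
    rw [← TwoCat.Hom.t0, ← TwoCat.Hom.s0, e, ← h]
    rfl

end

end

section

namespace TwoCat

variable {R S Y : TwoCat.{u}}

structure IsSplit (d₀ d₁ : R ⟶ S) (e : S ⟶ Y) : Prop where
  w : d₀ ≫ e = d₁ ≫ e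
  refl : ∃ r : S ⟶ R, r ≫ d₀ = 𝟙 S ∧ r ≫ d₁ = 𝟙 S
  bij : Function.Bijective e⁰
  split : ∃ (s : Y.toGlob2 ⟶ S.toGlob2) (t : S.toGlob2 ⟶ R.toGlob2), s ≫ e.toHom = 𝟙 Y.toGlob2 ∧
    t ≫ d₀.toHom = 𝟙 S.toGlob2 ∧ t ≫ d₁.toHom = e.toHom ≫ s

structure IsQuot (d₀ d₁ : R ⟶ S) (e : S ⟶ Y) : Prop where
  w : d₀ ≫ e = d₁ ≫ e
  refl : ∃ r : S ⟶ R, r ≫ d₀ = 𝟙 S ∧ r ≫ d₁ = 𝟙 S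
  bij : Function.Bijective e⁰
  surj : Function.Surjective e¹
  desc : ∀ {Z : TwoCat.{u}} (k : S ⟶ Z), d₀ ≫ k = d₁ ≫ k → ∃ k' : Y ⟶ Z, e ≫ k' = k
  epi : ∀ {Z : TwoCat.{u}} (k k' : Y ⟶ Z), e ≫ k = e ≫ k' → k = k'

lemma Hom.congr_f0 {A B : TwoCat.{u}} {F G : A ⟶ B} (h : F = G) (x) : F⁰ x = G⁰ x := by rw [h]

lemma Hom.congr_f1 {A B : TwoCat.{u}} {F G : A ⟶ B} (h : F = G) (x) : F¹ x = G¹ x := by rw [h]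

lemma Hom.congr_f2 {A B : TwoCat.{u}} {F G : A ⟶ B} (h : F = G) (x) : F² x = G² x := by rw [h]

variable {d₀ d₁ : R ⟶ S} {e : S ⟶ Y}

namespace IsSplit

variable (h : IsSplit d₀ d₁ e)

include h

lemma surj1 : Function.Surjective e¹ := fun y => by
  obtain ⟨s, t, h1, -⟩ := h.split
  exact ⟨s.f1 y, congrArg (fun k => k.f1 y) h1⟩

lemma surj2 : Function.Surjective e² := fun y => by
  obtain ⟨s, t, h1, -⟩ := h.split
  exact ⟨s.f2 y, congrArg (fun k => k.f2 y) h1⟩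

lemma key1 {T : Type*} (φ : S.C1 → T) (hφ : ∀ z, φ (d₀¹ z) = φ (d₁¹ z)) {x x' : S.C1}
    (hx : e¹ x = e¹ x') : φ x = φ x' := by
  obtain ⟨s, t, -, h2, h3⟩ := h.split
  have key : ∀ x, φ x = φ (s.f1 (e¹ x)) := fun x =>
    (congrArg (fun k => φ (k.f1 x)) h2).symm.trans ((hφ _).trans (congrArg (fun k => φ (k.f1 x)) h3))
  rw [key x, key x', hx]

lemma key2 {T : Type*} (φ : S.C2 → T) (hφ : ∀ z, φ (d₀² z) = φ (d₁² z)) {x x' : S.C2}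
    (hx : e² x = e² x') : φ x = φ x' := by
  obtain ⟨s, t, -, h2, h3⟩ := h.split
  have key : ∀ x, φ x = φ (s.f2 (e² x)) := fun x =>
    (congrArg (fun k => φ (k.f2 x)) h2).symm.trans ((hφ _).trans (congrArg (fun k => φ (k.f2 x)) h3))
  rw [key x, key x', hx]

lemma desc {Z : TwoCat.{u}} (k : S ⟶ Z) (hk : d₀ ≫ k = d₁ ≫ k) : ∃ k' : Y ⟶ Z, e ≫ k' = k := by
  have k1 : ∀ {x x'}, e¹ x = e¹ x' → k¹ x = k¹ x' := h.key1 k¹ (fun z => Hom.congr_f1 hk z)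
  have k2 : ∀ {x x'}, e² x = e² x' → k² x = k² x' := h.key2 k² (fun z => Hom.congr_f2 hk z)
  obtain ⟨s, t, h1, h2, h3⟩ := h.split
  have hs0 : ∀ y, e⁰ (s.f0 y) = y := fun y => congrArg (fun k => k.f0 y) h1
  have hs1 : ∀ y, e¹ (s.f1 y) = y := fun y => congrArg (fun k => k.f1 y) h1
  have hs2 : ∀ y, e² (s.f2 y) = y := fun y => congrArg (fun k => k.f2 y) h1
  have e0 : ∀ x, s.f0 (e⁰ x) = x := fun x => h.bij.1 (hs0 _)
  refine ⟨⟨s ≫ k.toHom, fun a => ?_, fun f g h₁ h₂ => ?_, fun f => ?_, fun f g h₁ h₂ => ?_,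
    fun f g h₁ h₂ => ?_⟩, hom_ext (fun a => congrArg k⁰ (e0 a)) (fun f => k1 (hs1 _))
    (fun α => k2 (hs2 _))⟩
  · refine Eq.trans ?_ (Hom.map_i0 k (s.f0 a))
    exact k1 (by rw [hs1, Hom.map_i0, hs0])
  · have hh : S.t0 (s.f1 f) = S.s0 (s.f1 g) := by rw [s.s0, s.t0, h₁]
    rw [← c1_eq h₁, ← c1_eq h₂]
    refine Eq.trans ?_ (Hom.map_c1 k hh)
    exact k1 (by rw [hs1, Hom.map_c1 _ hh, hs1, hs1])
  · refine Eq.trans ?_ (Hom.map_i1 k (s.f1 f))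
    exact k2 (by rw [hs2, Hom.map_i1, hs1])
  · have hh : S.t1 (s.f2 f) = S.s1 (s.f2 g) := by rw [s.s1, s.t1, h₁]
    rw [← vc_eq h₁, ← vc_eq h₂]
    refine Eq.trans ?_ (Hom.map_vc k hh)
    exact k2 (by rw [hs2, Hom.map_vc _ hh, hs2, hs2])
  · have hh : S.t0 (S.s1 (s.f2 f)) = S.s0 (S.s1 (s.f2 g)) := by rw [s.s1, s.s1, s.s0, s.t0, h₁]
    rw [← hc_eq h₁, ← hc_eq h₂]
    refine Eq.trans ?_ (Hom.map_hc k hh)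
    exact k2 (by rw [hs2, Hom.map_hc _ hh, hs2, hs2])

lemma epi {Z : TwoCat.{u}} (k k' : Y ⟶ Z) (hk : e ≫ k = e ≫ k') : k = k' := by
  refine hom_ext (fun a => ?_) (fun f => ?_) fun α => ?_
  · obtain ⟨a, rfl⟩ := h.bij.2 a; exact Hom.congr_f0 hk a
  · obtain ⟨a, rfl⟩ := h.surj1 f; exact Hom.congr_f1 hk a
  · obtain ⟨a, rfl⟩ := h.surj2 α; exact Hom.congr_f2 hk a

end IsSplit

end TwoCat

open TwoCat

lemma Cubical.desc_left {R S Y B C : TwoCat.{u}} {d₀ d₁ : R ⟶ S} {e : S ⟶ Y}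
    (h : IsSplit d₀ d₁ e) (F : Cubical S B C) (hl : ∀ b, d₀ ≫ F.left b = d₁ ≫ F.left b)
    (hγ : ∀ z g, F.γ (d₀¹ z) g = F.γ (d₁¹ z) g) :
    ∃ F' : Cubical Y B C, (∀ b, e ≫ F'.left b = F.left b) ∧
      (∀ a, F'.right (e⁰ a) = F.right a) ∧ ∀ f g, F'.γ (e¹ f) g = F.γ f g := by
  choose l hl' using fun b => h.desc (F.left b) (hl b)
  obtain ⟨s0, hs0⟩ := h.bij.2.hasRightInverse
  obtain ⟨s1, hs1⟩ := h.surj1.hasRightInverse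
  have e0 : ∀ x, s0 (e⁰ x) = x := fun x => h.bij.1 (hs0 _)
  have k : ∀ f g, F.γ (s1 (e¹ f)) g = F.γ f g := fun f g =>
    h.key1 (fun x => F.γ x g) (fun z => hγ z g) (hs1 _)
  have l1 : ∀ b f, (l b)¹ (e¹ f) = (F.left b)¹ f := fun b f => Hom.congr_f1 (hl' b) f
  refine ⟨Cubical.ofTotal l (fun a => F.right (s0 a)) (fun a b => ?_) (fun f g => F.γ (s1 f) g)
    (fun f g => ?_) (fun f g => ?_) (fun f g => ⟨_, F.isInv _ _⟩) (fun a g => ?_) (fun f b => ?_)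
    (fun f f' g h₁ => ?_) (fun f g g' h₁ => ?_) (fun α g => ?_) (fun f β => ?_), hl', fun a => ?_, k⟩
  · obtain ⟨a, rfl⟩ := h.bij.2 a
    rw [e0, ← F.agree, ← hl']; rfl
  · obtain ⟨f, rfl⟩ := h.surj1 f
    rw [k, l1, Hom.t0, e0, F.s1γ]
  · obtain ⟨f, rfl⟩ := h.surj1 f
    rw [k, l1, Hom.s0, e0, F.t1γ]
  · obtain ⟨a, rfl⟩ := h.bij.2 a
    rw [← Hom.map_i0, k, e0, F.γ_id_left]
  · obtain ⟨f, rfl⟩ := h.surj1 f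
    rw [k, l1, F.γ_id_right]
  · obtain ⟨f, rfl⟩ := h.surj1 f
    obtain ⟨f', rfl⟩ := h.surj1 f'
    have h₂ : S.t0 f = S.s0 f' := h.bij.1 (by rw [← Hom.t0, ← Hom.s0, h₁])
    rw [← Hom.map_c1 _ h₂, k, k, k, l1, l1, F.γ_c1_left _ h₂]
  · obtain ⟨f, rfl⟩ := h.surj1 f
    rw [k, k, k, Hom.t0, e0, Hom.s0, e0, F.γ_c1_right _ h₁]
  · obtain ⟨α, rfl⟩ := h.surj2 α
    have l2 : ∀ b, (l b)² (e² α) = (F.left b)² α := fun b => Hom.congr_f2 (hl' b) α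
    rw [l2, l2, Hom.s1, Hom.t1, Hom.t0, Hom.s0, e0, e0, k, k, F.γ_nat_left]
  · obtain ⟨f, rfl⟩ := h.surj1 f
    rw [k, k, l1, l1, Hom.t0, e0, Hom.s0, e0, F.γ_nat_right]
  · exact congrArg F.right (e0 a)

def TwoCat.cylSrc (Z : TwoCat.{u}) : Z.cyl ⟶ Z where
  toHom := ⟨Z.s0, Sq.p, Sq.Cell.α, fun x => x.h3, fun x => x.h4, fun x => x.sα, fun x => x.tα⟩
  map_id _ := rfl
  map_comp _ _ _ _ := c1_eq _
  map_vid _ := rfl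
  map_vcomp _ _ _ _ := vc_eq _
  map_hcomp _ _ _ _ := hc_eq _

def TwoCat.cylTgt (Z : TwoCat.{u}) : Z.cyl ⟶ Z where
  toHom := ⟨Z.t0, Sq.q, Sq.Cell.β, fun x => x.h1.symm, fun x => x.h2, fun x => x.sβ, fun x => x.tβ⟩
  map_id _ := rfl
  map_comp _ _ _ _ := c1_eq _
  map_vid _ := rfl
  map_vcomp _ _ _ _ := vc_eq _
  map_hcomp _ _ _ _ := hc_eq _

lemma Cubical.desc_right {R S Y A C : TwoCat.{u}} {d₀ d₁ : R ⟶ S} {e : S ⟶ Y}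
    (h : IsQuot d₀ d₁ e) (F : Cubical A S C) (hr : ∀ a, d₀ ≫ F.right a = d₁ ≫ F.right a)
    (hγ : ∀ f z, F.γ f (d₀¹ z) = F.γ f (d₁¹ z)) :
    ∃ F' : Cubical A Y C, (∀ b, F'.left (e⁰ b) = F.left b) ∧
      (∀ a, e ≫ F'.right a = F.right a) ∧ ∀ f g, F'.γ f (e¹ g) = F.γ f g := by
  have hd0 : ∀ z, d₀⁰ z = d₁⁰ z := fun z => h.bij.1 (Hom.congr_f0 h.w z)
  choose r hr' using fun a => h.desc (F.right a) (hr a)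
  have hsq : ∀ f z, F.sq f (d₀¹ z) = F.sq f (d₁¹ z) := fun f z =>
    Sq.ext (congrArg (fun b => (F.left b)¹ f) (by rw [Hom.s0, Hom.s0, hd0]))
      (congrArg (fun b => (F.left b)¹ f) (by rw [Hom.t0, Hom.t0, hd0]))
      (Hom.congr_f1 (hr _) z) (Hom.congr_f1 (hr _) z) (hγ f z)
  choose K hK using fun f => h.desc (F.cyl f) (hom_ext
    (fun z => congrArg (fun b => (F.left b)¹ f) (hd0 z)) (fun z => hsq f z)
    (fun z => Sq.Cell.ext ((congrArg (F.sq f) (Hom.s1 d₀ z)).trans ((hsq f _).trans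
      (congrArg (F.sq f) (Hom.s1 d₁ z)).symm)) ((congrArg (F.sq f) (Hom.t1 d₀ z)).trans ((hsq f _).trans
      (congrArg (F.sq f) (Hom.t1 d₁ z)).symm)) (Hom.congr_f2 (hr _) z) (Hom.congr_f2 (hr _) z)))
  have hKs : ∀ f, K f ≫ C.cylSrc = r (A.s0 f) := fun f => h.epi _ _ (by
    rw [← Category.assoc, hK, hr']
    exact hom_ext (fun b => by rw [← F.agree]; exact Hom.s0 _ _) (fun _ => rfl) (fun _ => rfl))
  have hKt : ∀ f, K f ≫ C.cylTgt = r (A.t0 f) := fun f => h.epi _ _ (by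
    rw [← Category.assoc, hK, hr']
    exact hom_ext (fun b => by rw [← F.agree]; exact Hom.t0 _ _) (fun _ => rfl) (fun _ => rfl))
  obtain ⟨s0, hs0⟩ := h.bij.2.hasRightInverse
  have e0 : ∀ x, s0 (e⁰ x) = x := fun x => h.bij.1 (hs0 _)
  have k : ∀ f g, (K f)¹ (e¹ g) = F.sq f g := fun f g => Hom.congr_f1 (hK f) g
  have kγ : ∀ f g, ((K f)¹ (e¹ g)).x = F.γ f g := fun f g => congrArg Sq.x (k f g)
  have r1 : ∀ a f, (r a)¹ (e¹ f) = (F.right a)¹ f := fun b f => Hom.congr_f1 (hr' b) f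
  refine ⟨Cubical.ofTotal (fun b => F.left (s0 b)) r (fun a b => ?_) (fun f g => ((K f)¹ g).x)
    (fun f g => ?_) (fun f g => ?_) (fun f g => ?_) (fun a g => ?_) (fun f b => ?_)
    (fun f f' g h₁ => ?_) (fun f g g' h₁ => ?_) (fun α g => ?_) (fun f β => ?_), fun a => ?_, hr', kγ⟩
  · obtain ⟨b, rfl⟩ := h.bij.2 b
    rw [e0, F.agree, ← hr']; rfl
  · obtain ⟨g, rfl⟩ := h.surj g
    rw [kγ, r1, Hom.s0, e0, F.s1γ]
  · obtain ⟨g, rfl⟩ := h.surj g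
    rw [kγ, r1, Hom.t0, e0, F.t1γ]
  · obtain ⟨g, rfl⟩ := h.surj g
    exact ⟨_, kγ f g ▸ F.isInv f g⟩
  · obtain ⟨g, rfl⟩ := h.surj g
    rw [kγ, r1, F.γ_id_left]
  · obtain ⟨b, rfl⟩ := h.bij.2 b
    rw [← Hom.map_i0, kγ, e0, F.γ_id_right]
  · obtain ⟨g, rfl⟩ := h.surj g
    rw [kγ, kγ, kγ, Hom.t0, e0, Hom.s0, e0, F.γ_c1_left _ h₁]
  · obtain ⟨g, rfl⟩ := h.surj g
    obtain ⟨g', rfl⟩ := h.surj g'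
    have h₂ : S.t0 g = S.s0 g' := h.bij.1 (by rw [← Hom.t0, ← Hom.s0, h₁])
    rw [← Hom.map_c1 _ h₂, kγ, kγ, kγ, r1, r1, F.γ_c1_right _ h₂]
  · obtain ⟨g, rfl⟩ := h.surj g
    rw [kγ, kγ, r1, r1, Hom.t0, e0, Hom.s0, e0, F.γ_nat_left]
  · have n := ((K f)² β).nat
    have n1 : ((K f)² β).α = (r (A.s0 f))² β := Hom.congr_f2 (hKs f) β
    have n2 : ((K f)² β).β = (r (A.t0 f))² β := Hom.congr_f2 (hKt f) β
    have n3 : ((K f)² β).a = (K f)¹ (Y.s1 β) := (K f).toHom.s1 β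
    have n4 : ((K f)² β).b = (K f)¹ (Y.t1 β) := (K f).toHom.t1 β
    have n5 : ∀ b, (F.left (s0 b))¹ f = (K f)⁰ b := fun b => by
      obtain ⟨b, rfl⟩ := h.bij.2 b
      rw [e0]
      exact (Hom.congr_f0 (hK f) b).symm
    have n6 : ((K f)¹ (Y.s1 β)).u = (K f)⁰ (Y.s0 (Y.s1 β)) := (K f).toHom.s0 _
    have n7 : ((K f)¹ (Y.s1 β)).u' = (K f)⁰ (Y.t0 (Y.s1 β)) := (K f).toHom.t0 _
    rwa [n1, n2, n3, n4, n6, n7, ← n5, ← n5] at n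
  · exact congrArg F.left (e0 a)

lemma TwoCat.IsSplit.isQuot_hMap₂ {R S Y R' S' Y' : TwoCat.{u}} {d₀ d₁ : R ⟶ S} {e : S ⟶ Y}
    (h : IsSplit d₀ d₁ e) {d₀' d₁' : R' ⟶ S'} {e' : S' ⟶ Y'} (h' : IsQuot d₀' d₁' e') :
    IsQuot (hMap₂ d₀ d₀') (hMap₂ d₁ d₁') (hMap₂ e e') := by
  obtain ⟨r, hr0, hr1⟩ := h.refl
  obtain ⟨r', hr0', hr1'⟩ := h'.refl
  refine ⟨?_, ⟨hMap₂ r r', ?_, ?_⟩, hMap₂_bijective h.bij h'.bij,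
    hMap₂_surjective h.bij h'.bij h.surj1 h'.surj, fun {Z} k hk => ?_, fun {Z} k k' hk => ?_⟩
  · rw [← hMap₂_comp, ← hMap₂_comp, h.w, h'.w]
  · rw [← hMap₂_comp, hr0, hr0']; exact grayH.E.map_id _
  · rw [← hMap₂_comp, hr1, hr1']; exact grayH.E.map_id _
  · have h1 : hMap₂ d₀ (𝟙 S') ≫ k = hMap₂ d₁ (𝟙 S') ≫ k := by
      have := congrArg (hMap₂ (𝟙 R) r' ≫ ·) hk
      simpa only [← Category.assoc, ← hMap₂_comp, Category.id_comp, hr0', hr1'] using this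
    have h2 : hMap₂ (𝟙 S) d₀' ≫ k = hMap₂ (𝟙 S) d₁' ≫ k := by
      have := congrArg (hMap₂ r (𝟙 R') ≫ ·) hk
      simpa only [← Category.assoc, ← hMap₂_comp, Category.id_comp, hr0, hr1] using this
    obtain ⟨F, f1, f2, f3⟩ := Cubical.desc_left h ((cubH S S').map k) (fun b => by
        have := congrArg ((cubH R S').left b ≫ ·) h1
        simp only [← Category.assoc, left_hMap₂] at this
        exact this)
      (fun z g => by
        have := Hom.congr_f2 h1 ((cubH R S').γ z g)
        exact (congrArg k² (γ_hMap₂ d₀ (𝟙 S') z g)).symm.trans (this.trans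
          (congrArg k² (γ_hMap₂ d₁ (𝟙 S') z g))))
    obtain ⟨K, k1, k2, k3⟩ := Cubical.desc_right h' F (fun a => by
        obtain ⟨a, rfl⟩ := h.bij.2 a
        rw [f2]
        have := congrArg ((cubH S R').right a ≫ ·) h2
        simp only [← Category.assoc, right_hMap₂] at this
        exact this)
      (fun f z => by
        obtain ⟨f, rfl⟩ := h.surj1 f
        rw [f3, f3]
        have := Hom.congr_f2 h2 ((cubH S R').γ f z)
        exact (congrArg k² (γ_hMap₂ (𝟙 S) d₀' f z)).symm.trans (this.trans
          (congrArg k² (γ_hMap₂ (𝟙 S) d₁' f z))))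
    refine ⟨hDesc K, cubH_hom_ext (fun b => ?_) (fun a => ?_) (fun f g => ?_)⟩
    · rw [← Category.assoc, left_hMap₂, Category.assoc, left_hDesc, k1, f1]; rfl
    · rw [← Category.assoc, right_hMap₂, Category.assoc, right_hDesc, k2, f2]; rfl
    · refine (congrArg (hDesc K)² (γ_hMap₂ e e' f g)).trans ?_
      rw [γ_hDesc, k3, f3]; rfl
  · refine cubH_hom_ext (fun b => ?_) (fun a => ?_) (fun f g => ?_)
    · obtain ⟨b, rfl⟩ := h'.bij.2 b
      refine h.epi _ _ ?_
      rw [← Category.assoc, ← Category.assoc, ← left_hMap₂, Category.assoc, Category.assoc, hk]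
    · obtain ⟨a, rfl⟩ := h.bij.2 a
      refine h'.epi _ _ ?_
      rw [← Category.assoc, ← Category.assoc, ← right_hMap₂, Category.assoc, Category.assoc, hk]
    · obtain ⟨f, rfl⟩ := h.surj1 f
      obtain ⟨g, rfl⟩ := h'.surj g
      rw [← γ_hMap₂]
      exact Hom.congr_f2 hk _

inductive IsSplitSeq : ∀ {R S Y : List TwoCat.{u}}, (R ⟶ S) → (R ⟶ S) → (S ⟶ Y) → Prop
  | nil : IsSplitSeq (𝟙 []) (𝟙 []) (𝟙 [])
  | cons {R S Y : TwoCat.{u}} {R' S' Y' : List TwoCat.{u}} {d₀ d₁ : R ⟶ S} {e : S ⟶ Y}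
      {d₀' d₁' : R' ⟶ S'} {e' : S' ⟶ Y'} (h : IsSplit d₀ d₁ e) (h' : IsSplitSeq d₀' d₁' e') :
      IsSplitSeq (consHom d₀ d₀') (consHom d₁ d₁') (consHom e e')

lemma TwoCat.IsQuot.of_iso {R S Y R' S' Y' : TwoCat.{u}} {d₀ d₁ : R ⟶ S} {e : S ⟶ Y}
    (h : IsQuot d₀ d₁ e) {d₀' d₁' : R' ⟶ S'} {e' : S' ⟶ Y'} (i : R ⟶ R') (j : S ⟶ S') (l : Y ⟶ Y')
    [IsIso i] [IsIso j] [IsIso l] (h0 : d₀ ≫ j = i ≫ d₀') (h1 : d₁ ≫ j = i ≫ d₁')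
    (he : e ≫ l = j ≫ e') : IsQuot d₀' d₁' e' := by
  obtain ⟨r, hr0, hr1⟩ := h.refl
  have e0 : d₀' = inv i ≫ d₀ ≫ j := by rw [h0, IsIso.inv_hom_id_assoc]
  have e1 : d₁' = inv i ≫ d₁ ≫ j := by rw [h1, IsIso.inv_hom_id_assoc]
  have e2 : e' = inv j ≫ e ≫ l := by rw [he, IsIso.inv_hom_id_assoc]
  have bij : ∀ {A B : TwoCat.{u}} (f : A ⟶ B) [IsIso f], Function.Bijective f⁰ ∧
      Function.Bijective f¹ := fun f _ =>
    ⟨⟨Function.LeftInverse.injective (g := (inv f)⁰) fun x =>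
      Hom.congr_f0 (IsIso.hom_inv_id f) x, fun x => ⟨_, Hom.congr_f0 (IsIso.inv_hom_id f) x⟩⟩,
      ⟨Function.LeftInverse.injective (g := (inv f)¹) fun x =>
      Hom.congr_f1 (IsIso.hom_inv_id f) x, fun x => ⟨_, Hom.congr_f1 (IsIso.inv_hom_id f) x⟩⟩⟩
  subst e0 e1 e2
  refine ⟨by simp [reassoc_of% h.w], ⟨inv j ≫ r ≫ i, by simp [reassoc_of% hr0],
    by simp [reassoc_of% hr1]⟩, (bij l).1.comp (h.bij.comp (bij (inv j)).1),
    (bij l).2.2.comp (h.surj.comp (bij (inv j)).2.2), fun {Z} k hk => ?_, fun {Z} k k' hk => ?_⟩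
  · obtain ⟨k', hk'⟩ := h.desc (j ≫ k) (by simpa using hk)
    exact ⟨inv l ≫ k', by simp [hk']⟩
  · exact (cancel_epi l).1 (h.epi (l ≫ k) (l ≫ k') (by simpa using hk))

lemma IsSplitSeq.isQuot {R S Y : List TwoCat.{u}} {d₀ d₁ : R ⟶ S} {e : S ⟶ Y}
    (h : IsSplitSeq d₀ d₁ e) : IsQuot (grayH.E.map d₀) (grayH.E.map d₁) (grayH.E.map e) := by
  induction h with
  | nil =>
    have : grayH.E.map (𝟙 ([] : List TwoCat.{u})) = 𝟙 _ := grayH.E.map_id _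
    rw [this]
    exact ⟨rfl, ⟨𝟙 _, rfl, rfl⟩, Function.bijective_id, Function.surjective_id,
      fun k _ => ⟨k, Category.id_comp k⟩, fun k k' hk => by simpa using hk⟩
  | cons h h' ih =>
    exact (h.isQuot_hMap₂ ih).of_iso (grayH.cn _ _) (grayH.cn _ _) (grayH.cn _ _)
      (grayH.cn_natural _ _) (grayH.cn_natural _ _) (grayH.cn_natural _ _)

end

section

universe v₁ u₁ v₂ u₂

def transportHom {V : Type u} [Category.{v} V] {W : Type u'} [Category.{v'} W] (F : V ⥤ W)
    (E : List V ⥤ V) (H : List W ⥤ W) (r : ∀ L : List V, F.obj (E.obj L) ⟶ H.obj (L.map F.obj)) :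
    ∀ LL : List (List V), (LL.map E.obj).map F.obj ⟶ (LL.map (List.map F.obj)).map H.obj
  | [] => 𝟙 []
  | L :: LL => consHom (r L) (transportHom F E H r LL)

structure Transport {V : Type u} [Category.{v} V] {W : Type u'} [Category.{v'} W] {F : V ⥤ W}
    {U : W ⥤ V} (adj : F ⊣ U) (E : Multitensor V) (H : Multitensor W) where
  e : ∀ L : List V, E.E.obj L ≅ U.obj (H.E.obj (L.map F.obj))
  natural : ∀ {L M : List V} (f : L ⟶ M), E.E.map f ≫ (e M).hom = (e L).hom ≫ U.map (H.E.map (mapMHom F f))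
  unit : ∀ X, E.η X ≫ (e [X]).hom = adj.unit.app X ≫ U.map (H.η (F.obj X))
  subst : ∀ (LL : List (List V)) (L : List V) (h : LL.flatten = L)
    (h' : (LL.map (List.map F.obj)).flatten = L.map F.obj),
    E.σ LL L h ≫ (e L).hom = (e (LL.map E.E.obj)).hom ≫
      U.map (H.E.map (transportHom F E.E H.E (fun L => F.map (e L).hom ≫ adj.counit.app _) LL) ≫
        H.σ (LL.map (List.map F.obj)) (L.map F.obj) h')

namespace OfAdjunction

open MonoidalCategory Functor.LaxMonoidal Functor.OplaxMonoidal

variable {V : Type u} [Category.{v} V] {W : Type u'} [Category.{v'} W] {D : Type u₁}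
  [Category.{v₁} D] [MonoidalCategory D] {C : Type u₂} [Category.{v₂} C] [MonoidalCategory C]
  {F : V ⥤ W} {U : W ⥤ V} (adj : F ⊣ U) {d : V ⥤ D} {Ψ : D ⥤ V} (adjD : d ⊣ Ψ) {d' : W ⥤ C}
  {Ψ' : C ⥤ W} (adjC : d' ⊣ Ψ') (P : D ⥤ C) [P.Monoidal] (κ : F ⋙ d' ≅ d ⋙ P)

lemma tensor_μ_map {A A' B B' Z : D} {X Y : C} (k : X ⟶ P.obj A) (t : Y ⟶ P.obj B) (f : A ⟶ A')
    (g : B ⟶ B') (m : A' ⊗ B' ⟶ Z) : ((k ⊗ₘ t) ≫ μ P A B) ≫ P.map ((f ⊗ₘ g) ≫ m) =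
      (k ≫ P.map f ⊗ₘ t ≫ P.map g) ≫ μ P A' B' ≫ P.map m := by
  rw [P.map_comp, ← tensorHom_comp_tensorHom, Category.assoc, Category.assoc]
  exact congrArg _ (Functor.LaxMonoidal.μ_natural_assoc P _ _ _).symm

lemma rightUnitor_inv_comp {A : D} {X : C} (k : X ⟶ P.obj A) (t : X ⊗ 𝟙_ C ≅ P.obj (A ⊗ 𝟙_ D))
    (ht : t.hom = (k ⊗ₘ ε P) ≫ μ P A (𝟙_ D)) : k ≫ P.map (ρ_ A).inv ≫ t.inv = (ρ_ X).inv := by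
  have h : μ P A _ = μ P A _ ≫ P.map (ρ_ A).hom ≫ P.map (ρ_ A).inv := by
    rw [← P.map_comp, Iso.hom_inv_id, P.map_id, Category.comp_id]
  rw [← Category.assoc, Iso.comp_inv_eq, Iso.eq_inv_comp, ht, h, MonoidalCategory.tensorHom_def,
    ← rightUnitor_naturality_assoc, Functor.LaxMonoidal.right_unitality]
  simp only [Category.assoc]

lemma map_eps_comp {A B : W} {Y Y' : C} (g : B ⟶ Ψ'.obj Y) (c : A ⟶ B) (t : Y ≅ Y') :
    d'.map (c ≫ g ≫ Ψ'.map t.hom) ≫ adjC.counit.app Y' ≫ t.inv = d'.map (c ≫ g) ≫ adjC.counit.app Y := by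
  simp

def Tcomp : ∀ L : List V, T d' (L.map F.obj) ≅ P.obj (T d L)
  | [] => Functor.Monoidal.εIso P
  | X :: L => (κ.app X ⊗ᵢ Tcomp L) ≪≫ Functor.Monoidal.μIso P _ _

lemma Tcomp_nil : (Tcomp P κ []).hom = ε P := rfl

lemma Tcomp_cons (X : V) (L : List V) : (Tcomp P κ (X :: L)).hom =
    (κ.hom.app X ⊗ₘ (Tcomp P κ L).hom) ≫ μ P _ _ := rfl

lemma Tcomp_natural : ∀ {L M : List V} (f : L ⟶ M),
    TMap d' (mapMHom F f) ≫ (Tcomp P κ M).hom = (Tcomp P κ L).hom ≫ P.map (TMap d f)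
  | [], [], _ => by
    refine (Category.id_comp _).trans ?_
    exact ((congrArg _ (P.map_id _)).trans (Category.comp_id _)).symm
  | [], _ :: _, f => PEmpty.elim f
  | _ :: _, [], f => PEmpty.elim f
  | X :: L, Y :: M, f => by
    obtain ⟨f₁, f₂⟩ := f
    have ih := Tcomp_natural f₂
    have hk : d'.map _ ≫ κ.hom.app Y = κ.hom.app X ≫ P.map _ := κ.hom.naturality f₁
    change (d'.map (F.map f₁) ⊗ₘ TMap d' (mapMHom F f₂)) ≫ (κ.hom.app Y ⊗ₘ (Tcomp P κ M).hom) ≫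
      μ P _ _ = (_ ≫ μ P _ _) ≫ P.map _
    rw [tensorHom_comp_tensorHom_assoc, hk, ih, ← tensorHom_comp_tensorHom_assoc, Category.assoc]
    exact congrArg _ (Functor.LaxMonoidal.μ_natural P _ _)

lemma tc_Tcomp {L M : List V} (h : L = M) :
    tc d' (congrArg (List.map F.obj) h) ≫ (Tcomp P κ M).hom = (Tcomp P κ L).hom ≫ P.map (tc d h) := by
  subst h
  rw [tc_rfl, tc_rfl, P.map_id, Category.id_comp, Category.comp_id]

lemma mu_Tcomp : ∀ L M : List V, ((Tcomp P κ L).hom ⊗ₘ (Tcomp P κ M).hom) ≫ μ P _ _ ≫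
    P.map (mu d L M) = mu d' (L.map F.obj) (M.map F.obj) ≫ tc d' List.map_append.symm ≫
      (Tcomp P κ (L ++ M)).hom
  | [], M => by
    change (ε P ⊗ₘ (Tcomp P κ M).hom) ≫ μ P _ _ ≫ P.map (λ_ _).hom = (λ_ _).hom ≫ 𝟙 _ ≫ (Tcomp P κ M).hom
    rw [Category.id_comp, ← leftUnitor_naturality, Functor.LaxMonoidal.left_unitality, tensorHom_def']
    simp
  | X :: L, M => by
    have ih := mu_Tcomp L M
    have e : tc d' (List.map_append (l₁ := X :: L) (l₂ := M)).symm =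
      d'.obj (F.obj X) ◁ tc d' List.map_append.symm := (tc_cons d' _ _).symm
    rw [e, Tcomp_cons]
    change _ ≫ μ P _ _ ≫ P.map ((α_ _ _ _).hom ≫ _) = _ ≫ _ ≫ _ ≫ μ P _ _
    have h₂ : ((α_ _ _ _).hom ≫ (_ ◁ mu d' _ _)) ≫ (_ ◁ tc d' List.map_append.symm) ≫
        (κ.hom.app X ⊗ₘ (Tcomp P κ _).hom) ≫ μ P _ _ =
        (α_ _ _ _).hom ≫ (κ.hom.app X ⊗ₘ (((Tcomp P κ L).hom ⊗ₘ (Tcomp P κ M).hom) ≫ μ P _ _ ≫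
          P.map (mu d L M))) ≫ μ P _ _ := by
      rw [ih]
      simp [tensorHom_def']
    refine Eq.trans ?_ h₂.symm
    have h₃ : ((κ.hom.app X ⊗ₘ (Tcomp P κ L).hom) ≫ μ P _ _ ⊗ₘ (Tcomp P κ M).hom) =
      ((κ.hom.app X ⊗ₘ (Tcomp P κ L).hom) ⊗ₘ (Tcomp P κ M).hom) ≫ (μ P _ _ ▷ _) := by
      rw [← tensorHom_id, tensorHom_comp_tensorHom, Category.comp_id]
    have h₄ : (κ.hom.app X ⊗ₘ (((Tcomp P κ L).hom ⊗ₘ (Tcomp P κ M).hom) ≫ μ P _ _ ≫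
          P.map (mu d L M))) = (κ.hom.app X ⊗ₘ ((Tcomp P κ L).hom ⊗ₘ (Tcomp P κ M).hom)) ≫
        (_ ◁ μ P _ _) ≫ (_ ◁ P.map (mu d L M)) := by
      rw [← id_tensorHom, ← id_tensorHom, tensorHom_comp_tensorHom, tensorHom_comp_tensorHom,
        Category.comp_id, Category.comp_id]
    rw [h₄, P.map_comp]
    refine (congrArg (· ≫ _) h₃).trans ?_
    simp only [Category.assoc]
    rw [Functor.LaxMonoidal.associativity_assoc]
    refine (associator_naturality_assoc _ _ _ _).trans (congrArg (fun k => _ ≫ _ ≫ _ ≫ k) ?_)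
    exact (Functor.LaxMonoidal.μ_natural_right P _ _).symm

structure Mate where
  ω : Ψ ≅ P ⋙ Ψ' ⋙ U
  counit : ∀ Y : D, κ.hom.app (Ψ.obj Y) ≫ P.map (adjD.counit.app Y) =
    d'.map (F.map (ω.hom.app Y) ≫ adj.counit.app _) ≫ adjC.counit.app (P.obj Y)
  unit : ∀ X : V, adjD.unit.app X ≫ ω.hom.app (d.obj X) =
    adj.unit.app X ≫ U.map (adjC.unit.app (F.obj X) ≫ Ψ'.map (κ.hom.app X))

variable {adj adjD adjC P κ} (m : Mate adj adjD adjC P κ)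

namespace Mate

def iso (L : List V) : Ψ.obj (T d L) ≅ U.obj (Ψ'.obj (T d' (L.map F.obj))) :=
  m.ω.app (T d L) ≪≫ (Ψ' ⋙ U).mapIso (Tcomp P κ L).symm

lemma iso_hom (L : List V) : (m.iso L).hom = m.ω.hom.app (T d L) ≫ U.map (Ψ'.map (Tcomp P κ L).inv) := rfl

def r (L : List V) : F.obj ((E adjD).obj L) ⟶ (E adjC).obj (L.map F.obj) :=
  F.map (m.iso L).hom ≫ adj.counit.app _

lemma r_eps (L : List V) : d'.map (m.r L) ≫ eps adjC (L.map F.obj) ≫ (Tcomp P κ L).hom =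
    κ.hom.app (Ψ.obj (T d L)) ≫ P.map (eps adjD L) := by
  have h : m.r L = F.map (m.ω.hom.app _) ≫ adj.counit.app _ ≫ Ψ'.map (Tcomp P κ L).inv := by
    refine (congrArg (· ≫ _) (F.map_comp _ _)).trans ((Category.assoc _ _ _).trans ?_)
    exact congrArg _ (adj.counit_naturality _)
  refine Eq.trans ?_ (m.counit _).symm
  rw [h]
  exact map_eps_comp adjC _ _ (Tcomp P κ L).symm

lemma flat_Tcomp : ∀ LL : List (List V), (Tcomp P κ (LL.map (E adjD).obj)).hom ≫ P.map (flat adjD LL) =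
      TMap d' (transportHom F (E adjD) (E adjC) m.r LL) ≫ flat adjC (LL.map (List.map F.obj)) ≫
        tc d' (List.map_flatten).symm ≫ (Tcomp P κ LL.flatten).hom
  | [] => by
    change ε P ≫ P.map (𝟙 _) = 𝟙 _ ≫ 𝟙 _ ≫ 𝟙 _ ≫ ε P
    simp
  | L :: LL => by
    have ih := flat_Tcomp LL
    have hm := mu_Tcomp P κ L LL.flatten
    have ht : tc d' (List.map_flatten (L := L :: LL)).symm =
      tc d' (congrArg _ (List.map_flatten (f := F.obj)).symm) ≫
        tc d' List.map_append.symm := (tc_tc d' _ _).symm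
    have hmt := mu_tc d' (rfl : L.map F.obj = L.map F.obj) (List.map_flatten (f := F.obj) (L := LL)).symm
    rw [tc_rfl] at hmt
    change _ ≫ P.map _ = _ ≫ _ ≫ tc d' (List.map_flatten (L := L :: LL)).symm ≫ _
    rw [ht]
    have hm' : mu d' _ (LL.map _).flatten ≫ (tc d' (congrArg _ (List.map_flatten).symm) ≫
        tc d' List.map_append.symm) ≫ (Tcomp P κ _).hom =
      ((Tcomp P κ L).hom ⊗ₘ (tc d' (List.map_flatten).symm ≫ (Tcomp P κ _).hom)) ≫
        μ P _ _ ≫ P.map (mu d L _) := by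
      have e : ((Tcomp P κ L).hom ⊗ₘ (tc d' (List.map_flatten).symm ≫ (Tcomp P κ LL.flatten).hom)) =
        (𝟙 _ ⊗ₘ tc d' (List.map_flatten).symm) ≫ ((Tcomp P κ L).hom ⊗ₘ (Tcomp P κ _).hom) := by
        rw [tensorHom_comp_tensorHom, Category.id_comp]
      refine (congrArg _ (Category.assoc _ _ _)).trans ((Category.assoc _ _ _).symm.trans
        ((congrArg (· ≫ _) hmt.symm).trans ((Category.assoc _ _ _).trans ?_)))
      refine (congrArg _ hm.symm).trans ?_
      rw [e, Category.assoc]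
    refine Eq.trans ?_ (congrArg _ ((Category.assoc _ _ _).trans (congrArg _ hm'))).symm
    have e1 := m.r_eps L
    refine Eq.trans ?_ (tensorHom_comp_tensorHom_assoc _ _ _ _ _).symm
    refine Eq.trans ?_ (tensorHom_comp_tensorHom_assoc _ _ _ _ _).symm
    refine Eq.trans ?_ (congrArg₂ (fun a b => _ ≫ μ P _ _ ≫ P.map _)
      ((Category.assoc _ _ _).trans e1) ((Category.assoc _ _ _).trans ih.symm)).symm
    exact tensor_μ_map P _ _ _ _ _

def transport : Transport adj (Multitensor.ofAdjunction adjD) (Multitensor.ofAdjunction adjC) where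
  e := m.iso
  natural {L M} f := by
    change Ψ.map (TMap d f) ≫ m.ω.hom.app (T d M) ≫ U.map (Ψ'.map (Tcomp P κ M).inv) =
      (m.ω.hom.app (T d L) ≫ U.map (Ψ'.map (Tcomp P κ L).inv)) ≫ U.map (Ψ'.map (TMap d' (mapMHom F f)))
    have h : (Tcomp P κ L).inv ≫ TMap d' (mapMHom F f) = P.map (TMap d f) ≫ (Tcomp P κ M).inv := by
      rw [Iso.inv_comp_eq, ← Category.assoc, ← Tcomp_natural, Category.assoc, Iso.hom_inv_id,
        Category.comp_id]
    rw [Category.assoc, ← U.map_comp, ← Ψ'.map_comp, h, Ψ'.map_comp, U.map_comp]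
    exact (m.ω.hom.naturality_assoc (TMap d f) _)
  unit X := by
    change (adjD.unit.app X ≫ Ψ.map (ρ_ (d.obj X)).inv) ≫ m.ω.hom.app (d.obj X ⊗ 𝟙_ D) ≫
      U.map (Ψ'.map (Tcomp P κ [X]).inv) =
      adj.unit.app X ≫ U.map (adjC.unit.app (F.obj X) ≫ Ψ'.map (ρ_ (d'.obj (F.obj X))).inv)
    have h : κ.hom.app X ≫ P.map (ρ_ (d.obj X)).inv ≫ (Tcomp P κ [X]).inv = (ρ_ (d'.obj (F.obj X))).inv :=
      rightUnitor_inv_comp P (κ.hom.app X) (Tcomp P κ [X]) rfl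
    have hn : Ψ.map (ρ_ (d.obj X)).inv ≫ m.ω.hom.app (d.obj X ⊗ 𝟙_ D) =
      m.ω.hom.app (d.obj X) ≫ U.map (Ψ'.map (P.map (ρ_ (d.obj X)).inv)) := m.ω.hom.naturality _
    rw [Category.assoc, reassoc_of% hn, reassoc_of% m.unit X, ← h]
    have h₃ : ∀ {X₀ X₁ X₂ X₃ : C} (f : X₀ ⟶ X₁) (g : X₁ ⟶ X₂) (h : X₂ ⟶ X₃),
        U.map (Ψ'.map f) ≫ U.map (Ψ'.map g) ≫ U.map (Ψ'.map h) = U.map (Ψ'.map (f ≫ g ≫ h)) := by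
      simp
    rw [U.map_comp, U.map_comp, Category.assoc]
    exact congrArg (fun k => adj.unit.app X ≫ U.map (adjC.unit.app (F.obj X)) ≫ k) (h₃ _ _ _)
  subst LL L h h' := by
    subst h
    change Ψ.map (flat adjD LL ≫ tc d rfl) ≫ m.ω.hom.app (T d LL.flatten) ≫
      U.map (Ψ'.map (Tcomp P κ LL.flatten).inv) =
      (m.ω.hom.app (T d (LL.map (E adjD).obj)) ≫ U.map (Ψ'.map (Tcomp P κ (LL.map (E adjD).obj)).inv)) ≫
        U.map (Ψ'.map (TMap d' (transportHom F (E adjD) (E adjC) m.r LL)) ≫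
          Ψ'.map (flat adjC (LL.map (List.map F.obj)) ≫ tc d' h'))
    have h : P.map (flat adjD LL) ≫ (Tcomp P κ LL.flatten).inv =
      (Tcomp P κ (LL.map (E adjD).obj)).inv ≫ TMap d' (transportHom F (E adjD) (E adjC) m.r LL) ≫
        flat adjC (LL.map (List.map F.obj)) ≫ tc d' h' := by
      rw [Iso.eq_inv_comp, ← Category.assoc, Iso.comp_inv_eq, m.flat_Tcomp]
      simp only [Category.assoc]
    have hn : Ψ.map (flat adjD LL) ≫ m.ω.hom.app (T d LL.flatten) =
      m.ω.hom.app (T d (LL.map (E adjD).obj)) ≫ U.map (Ψ'.map (P.map (flat adjD LL))) :=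
      m.ω.hom.naturality _
    rw [tc_rfl, Category.comp_id, reassoc_of% hn, ← U.map_comp, ← Ψ'.map_comp, h, Category.assoc,
      ← Ψ'.map_comp, ← U.map_comp, ← Ψ'.map_comp]

end Mate

end OfAdjunction

end

section

@[reducible] def Ct.free (G : Gph.{u}) : Ct.{u} := ⟨G.V, Walk G, Walk.src, Walk.tgt, Walk.catOn G⟩

lemma Ct.free_hom_ext {G : Gph.{u}} {Z : Ct.{u}} {F K : Ct.free G ⟶ Z} (h0 : ∀ x, F.f0 x = K.f0 x)
    (h1 : ∀ e, F.f1 (Walk.single e) = K.f1 (Walk.single e)) : F = K := by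
  refine Ct.hom_ext h0 fun p => ?_
  induction p using Walk.induction with
  | hnil a => exact (F.map_id a).trans ((congrArg Z.cat.id (h0 a)).trans (K.map_id a).symm)
  | hcons e p h ih =>
    have hF : Z.t (F.f1 (Walk.single e)) = Z.s (F.f1 p) := by
      rw [F.t, F.s]; exact congrArg F.f0 h
    have hK : Z.t (K.f1 (Walk.single e)) = Z.s (K.f1 p) := by
      rw [K.t, K.s]; exact congrArg K.f0 h
    exact (F.map_comp (Walk.single e) p h hF).trans
      ((Z.cat.comp_congr (h1 e) ih _ _).trans (K.map_comp (Walk.single e) p h hK).symm)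

def Ct.freeLift {G : Gph.{u}} {Z : Ct.{u}} (f : G.V → Z.O) (g : G.E → Z.M)
    (hs : ∀ e, Z.s (g e) = f (G.s e)) (ht : ∀ e, Z.t (g e) = f (G.t e)) : Ct.free G ⟶ Z where
  f0 := f
  f1 := Z.cat.eval f g hs ht
  s := Z.cat.s_eval f g hs ht
  t := Z.cat.t_eval f g hs ht
  map_id _ := rfl
  map_comp p q h h' := Z.cat.eval_append f g hs ht p q h h'

@[simp] lemma Ct.freeLift_single {G : Gph.{u}} {Z : Ct.{u}} (f : G.V → Z.O) (g : G.E → Z.M)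
    (hs : ∀ e, Z.s (g e) = f (G.s e)) (ht : ∀ e, Z.t (g e) = f (G.t e)) (e : G.E) :
    (Ct.freeLift f g hs ht).f1 (Walk.single e) = g e := Z.cat.eval_single _ _ _ _ e

namespace GData

def Hom.ct {D D' : GData.{u}} (F : D ⟶ D') : Ct.free D.G ⟶ Ct.free D'.G where
  f0 := F.f0
  f1 := F.walk
  s _ := rfl
  t _ := rfl
  map_id _ := rfl
  map_comp _ _ _ _ := Walk.ext rfl rfl List.flatMap_append

lemma Hom.ct_single {D D' : GData.{u}} (F : D ⟶ D') (e : D.G.E) :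
    (Hom.ct F).f1 (Walk.single e) = F.f1 e := Walk.bind_single F.f0 F.f1 F.src F.tgt e

@[reducible] def toCData : GData.{u} ⥤ CData.{u} where
  obj D := ⟨Ct.free D.G, D.A, Ct.freeLift (Z := D.A.ct) D.φ0 D.φ1 D.hs D.ht⟩
  map F := ⟨Hom.ct F, F.H, Ct.hom_ext (fun x => (F.h0 x).symm) (fun p => (F.eval_walk p).symm)⟩
  map_id D := CData.hom_ext (Ct.free_hom_ext (fun _ => rfl) fun e => Hom.ct_single (𝟙 D) e) rfl
  map_comp F K := CData.hom_ext (Ct.free_hom_ext (fun _ => rfl) fun e =>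
    (Hom.ct_single (F ≫ K) e).trans (congrArg K.walk (Hom.ct_single F e).symm)) rfl

variable (D D' : GData.{u})

def inlCt (w : D'.G.V) : Ct.free D.G ⟶ Ct.free (D.box D').G where
  f0 v := (v, w)
  f1 := inl w
  s _ := rfl
  t _ := rfl
  map_id _ := rfl
  map_comp _ _ _ _ := Walk.ext rfl rfl List.map_append

def inrCt (v : D.G.V) : Ct.free D'.G ⟶ Ct.free (D.box D').G where
  f0 w := (v, w)
  f1 := inr v
  s _ := rfl
  t _ := rfl
  map_id _ := rfl
  map_comp _ _ _ _ := Walk.ext rfl rfl List.map_append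

def boxLift : Ct.funny (Ct.free D.G) (Ct.free D'.G) ⟶ Ct.free (D.box D').G :=
  Ct.lift ⟨inlCt D D', inrCt D D', fun _ _ => rfl⟩

@[simp] lemma boxLift_f0 (x) : (boxLift D D').f0 x = x := rfl

@[simp] lemma boxLift_inl (w : D'.G.V) (p : Walk D.G) :
    (boxLift D D').f1 ((Ct.inl (Ct.free D.G) (D := Ct.free D'.G) w).f1 p) = inl w p := Ct.lift_inl _ _ _

@[simp] lemma boxLift_inr (v : D.G.V) (p : Walk D'.G) :
    (boxLift D D').f1 ((Ct.inr (C := Ct.free D.G) (Ct.free D'.G) v).f1 p) = inr v p := Ct.lift_inr _ _ _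

def boxUnlift : Ct.free (D.box D').G ⟶ Ct.funny (Ct.free D.G) (Ct.free D'.G) :=
  Ct.freeLift (Z := Ct.funny (Ct.free D.G) (Ct.free D'.G)) (fun v => v)
    (Sum.elim (fun e => (Ct.inl (Ct.free D.G) (D := Ct.free D'.G) e.2).f1 (Walk.single e.1))
      (fun e => (Ct.inr (C := Ct.free D.G) (Ct.free D'.G) e.1).f1 (Walk.single e.2)))
    (by rintro (e | e) <;> rfl) (by rintro (e | e) <;> rfl)

lemma boxUnlift_single_inl (e : D.G.E) (w : D'.G.V) :
    (boxUnlift D D').f1 (Walk.single (G := (D.box D').G) (Sum.inl (e, w))) =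
      (Ct.inl (Ct.free D.G) (D := Ct.free D'.G) w).f1 (Walk.single e) := Ct.freeLift_single _ _ _ _ _

lemma boxUnlift_single_inr (v : D.G.V) (e : D'.G.E) :
    (boxUnlift D D').f1 (Walk.single (G := (D.box D').G) (Sum.inr (v, e))) =
      (Ct.inr (C := Ct.free D.G) (Ct.free D'.G) v).f1 (Walk.single e) := Ct.freeLift_single _ _ _ _ _

def boxLiftIso : Ct.funny (Ct.free D.G) (Ct.free D'.G) ≅ Ct.free (D.box D').G where
  hom := boxLift D D'
  inv := boxUnlift D D'
  hom_inv_id := Ct.funny_hom_ext (fun w => Ct.free_hom_ext (fun _ => rfl) fun e =>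
      (congrArg (boxUnlift D D').f1 (boxLift_inl D D' w (Walk.single e))).trans
        (boxUnlift_single_inl D D' e w))
    (fun v => Ct.free_hom_ext (fun _ => rfl) fun e =>
      (congrArg (boxUnlift D D').f1 (boxLift_inr D D' v (Walk.single e))).trans
        (boxUnlift_single_inr D D' v e))
  inv_hom_id := Ct.free_hom_ext (fun _ => rfl) (by
    rintro (⟨e, w⟩ | ⟨v, e⟩)
    · exact (congrArg (boxLift D D').f1 (boxUnlift_single_inl D D' e w)).trans (boxLift_inl D D' w _)
    · exact (congrArg (boxLift D D').f1 (boxUnlift_single_inr D D' v e)).trans (boxLift_inr D D' v _))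

open MonoidalCategory

lemma boxLift_comm : (CData.tensor (toCData.obj D) (toCData.obj D')).φ ≫
      TwoCat.Hom.ct (𝟙 (D.A.prod D'.A)) = boxLift D D' ≫ (toCData.obj (D.box D')).φ := by
  refine Ct.funny_hom_ext' (fun _ => rfl) (fun w p => ?_) (fun v p => ?_)
  · refine Eq.trans ?_ (congrArg (D.box D').eval (boxLift_inl D D' w p)).symm
    refine Eq.trans ?_ (eval_inl w p).symm
    exact Prod.ext (congrArg D.eval (Ct.fst_inl _ _)) (congrArg (toCData.obj D').φ.f1 (Ct.snd_inl _ _))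
  · refine Eq.trans ?_ (congrArg (D.box D').eval (boxLift_inr D D' v p)).symm
    refine Eq.trans ?_ (eval_inr v p).symm
    exact Prod.ext (congrArg (toCData.obj D).φ.f1 (Ct.fst_inr _ _)) (congrArg D'.eval (Ct.snd_inr _ _))

def _root_.GrayLift.CData.isoMk {K K' : CData.{u}} (F : K ⟶ K') (f : K'.C ⟶ K.C) (H : K'.A ⟶ K.A)
    (h₁ : F.f ≫ f = 𝟙 _) (h₂ : f ≫ F.f = 𝟙 _) (h₃ : F.H ≫ H = 𝟙 _) (h₄ : H ≫ F.H = 𝟙 _) : K ≅ K' where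
  hom := F
  inv := ⟨f, H, by
    have h : TwoCat.Hom.ct F.H ≫ TwoCat.Hom.ct H = 𝟙 _ := congrArg TwoCat.Hom.ct h₃
    have e := congrArg (fun k => f ≫ k ≫ TwoCat.Hom.ct H) F.comm
    simp only [Category.assoc] at e
    rw [h, Category.comp_id, ← Category.assoc f, h₂, Category.id_comp] at e
    exact e.symm⟩
  hom_inv_id := CData.hom_ext h₁ h₃
  inv_hom_id := CData.hom_ext h₂ h₄

def muIso : CData.tensor (toCData.obj D) (toCData.obj D') ≅ toCData.obj (D.box D') :=
  CData.isoMk ⟨boxLift D D', 𝟙 (D.A.prod D'.A), boxLift_comm D D'⟩ (boxUnlift D D') (𝟙 (D.A.prod D'.A))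
    (boxLiftIso D D').hom_inv_id (boxLiftIso D D').inv_hom_id rfl rfl

def epsIso : CData.one ≅ toCData.obj one :=
  CData.isoMk ⟨Ct.const _ (D := Ct.free one.G) ⟨⟩, 𝟙 TwoCat.one, rfl⟩ (Ct.const _ (D := Ct.one) ⟨⟩)
    (𝟙 TwoCat.one) rfl (Ct.free_hom_ext (fun _ => rfl) (fun e => e.elim)) rfl rfl

variable {D D'}

lemma boxLift_natural {K K' : GData.{u}} (F : D ⟶ K) (F' : D' ⟶ K') :
    Ct.funnyMap (Hom.ct F) (Hom.ct F') ≫ boxLift K K' = boxLift D D' ≫ Hom.ct (boxHom F F') := by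
  refine Ct.funny_hom_ext' (fun _ => rfl) (fun w p => ?_) (fun v p => ?_)
  · refine (congrArg (boxLift K K').f1 (Ct.funnyMap_inl _ _ _ _)).trans ((boxLift_inl _ _ _ _).trans ?_)
    exact (walk_inl F F' w p).symm.trans (congrArg (boxHom F F').walk (boxLift_inl _ _ _ _)).symm
  · refine (congrArg (boxLift K K').f1 (Ct.funnyMap_inr _ _ _ _)).trans ((boxLift_inr _ _ _ _).trans ?_)
    exact (walk_inr F F' v p).symm.trans (congrArg (boxHom F F').walk (boxLift_inr _ _ _ _)).symm

lemma muIso_natural {K K' : GData.{u}} (F : D ⟶ K) (F' : D' ⟶ K') :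
    (toCData.map F ⊗ₘ toCData.map F') ≫ (muIso K K').hom = (muIso D D').hom ≫ toCData.map (F ⊗ₘ F') :=
  CData.hom_ext (boxLift_natural F F') rfl

lemma inl_single (w : D'.G.V) (e : D.G.E) :
    inl w (Walk.single e) = Walk.single (G := (D.box D').G) (Sum.inl (e, w)) := rfl

lemma inr_single (v : D.G.V) (e : D'.G.E) :
    inr v (Walk.single e) = Walk.single (G := (D.box D').G) (Sum.inr (v, e)) := rfl

lemma boxLift_assoc (D'' : GData.{u}) :
    Ct.funnyMap (boxLift D D') (𝟙 (Ct.free D''.G)) ≫ boxLift (D.box D') D'' ≫ Hom.ct (boxAssoc D D' D'').hom =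
      Ct.assocHom _ _ _ ≫ Ct.funnyMap (𝟙 (Ct.free D.G)) (boxLift D' D'') ≫ boxLift D (D'.box D'') := by
  refine Ct.funny_hom_ext (fun w => Ct.funny_hom_ext (fun w' => Ct.free_hom_ext (fun _ => rfl) fun e => ?_)
    (fun v => Ct.free_hom_ext (fun _ => rfl) fun e => ?_)) (fun v => Ct.free_hom_ext (fun _ => rfl) fun e => ?_)
  · simp only [Ct.comp_f1, Ct.funnyMap_inl, boxLift_inl, inl_single, Ct.assocHom_inl_inl, Ct.id_f1]
    exact Hom.ct_single (boxAssoc D D' D'').hom (Sum.inl (Sum.inl (e, w'), w))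
  · simp only [Ct.comp_f1, Ct.funnyMap_inl, Ct.funnyMap_inr, boxLift_inl, boxLift_inr, inl_single, inr_single, Ct.assocHom_inl_inr, Ct.id_f1]
    exact Hom.ct_single (boxAssoc D D' D'').hom (Sum.inl (Sum.inr (v, e), w))
  · simp only [Ct.comp_f1, Ct.funnyMap_inr, boxLift_inr, inr_single, Ct.assocHom_inr, Ct.id_f1]
    exact Hom.ct_single _ _

lemma boxLift_left : Ct.snd Ct.one (Ct.free D.G) =
    Ct.funnyMap (Ct.const _ (D := Ct.free one.G) ⟨⟩) (𝟙 (Ct.free D.G)) ≫ boxLift one D ≫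
      Hom.ct (boxLeft D).hom := by
  refine Ct.funny_hom_ext (fun w => Ct.hom_ext (fun _ => rfl) fun e => ?_)
    (fun v => Ct.free_hom_ext (fun _ => rfl) fun e => ?_)
  · simp only [Ct.comp_f1, Ct.snd_inl, Ct.funnyMap_inl, boxLift_inl]
    rfl
  · simp only [Ct.comp_f1, Ct.snd_inr, Ct.funnyMap_inr, boxLift_inr, inr_single, Ct.id_f1]
    exact (Hom.ct_single (boxLeft D).hom (Sum.inr (v, e))).symm

lemma boxLift_right : Ct.fst (Ct.free D.G) Ct.one =
    Ct.funnyMap (𝟙 (Ct.free D.G)) (Ct.const _ (D := Ct.free one.G) ⟨⟩) ≫ boxLift D one ≫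
      Hom.ct (boxRight D).hom := by
  refine Ct.funny_hom_ext (fun v => Ct.free_hom_ext (fun _ => rfl) fun e => ?_)
    (fun w => Ct.hom_ext (fun _ => rfl) fun e => ?_)
  · simp only [Ct.comp_f1, Ct.fst_inl, Ct.funnyMap_inl, boxLift_inl, inl_single, Ct.id_f1]
    exact (Hom.ct_single (boxRight D).hom (Sum.inl (e, v))).symm
  · simp only [Ct.comp_f1, Ct.fst_inr, Ct.funnyMap_inr, boxLift_inr]
    rfl

def coreMonoidal : Functor.CoreMonoidal toCData.{u} where
  εIso := epsIso
  μIso := muIso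
  μIso_hom_natural_left {X Y} f X' := by
    have h := muIso_natural f (𝟙 X')
    rw [toCData.map_id] at h
    exact h
  μIso_hom_natural_right {X Y} X' f := by
    have h := muIso_natural (𝟙 X') f
    rw [toCData.map_id] at h
    exact h
  associativity X Y Z := CData.hom_ext (boxLift_assoc Z) rfl
  left_unitality X := CData.hom_ext boxLift_left rfl
  right_unitality X := CData.hom_ext boxLift_right rfl

instance : toCData.{u}.Monoidal := coreMonoidal.toMonoidal

lemma freeLift_single_eq (X : Glob2.{u}) : Ct.freeLift (Z := X.free.ct) (fun a => a)
    (fun e => Walk.single (G := X.trunc) e) (fun _ => rfl) (fun _ => rfl) = 𝟙 _ :=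
  Ct.free_hom_ext (G := X.trunc) (fun _ => rfl) fun e => Ct.freeLift_single _ _ _ _ e

def genIso : TwoCat.freeFunctor.{u} ⋙ CData.gen ≅ gen ⋙ toCData :=
  NatIso.ofComponents (fun X => CData.isoMk (K := CData.gen.obj X.free) (K' := toCData.obj (gen.obj X))
    ⟨𝟙 X.free.ct, 𝟙 X.free, (freeLift_single_eq X).symm⟩ (𝟙 X.free.ct) (𝟙 X.free) rfl rfl rfl rfl)
    (fun {X Y} f => CData.hom_ext (Ct.free_hom_ext (G := X.trunc) (Z := Y.free.ct) (fun _ => rfl) fun e =>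
      ((gen.map f).h1 e).symm.trans (((Walk.catOn Y.trunc).eval_single _ _ _ _ _).trans
        (Hom.ct_single (gen.map f) e).symm)) rfl)

def cellsIso : cells.{u} ≅ toCData ⋙ CData.cells ⋙ TwoCat.forget := NatIso.ofComponents (fun D =>
    { hom := ⟨fun x => x, fun x => x, fun x => ⟨x.src, x.tgt, x.cell, x.src_src, x.tgt_tgt, x.hs, x.ht⟩,
        fun _ => rfl, fun _ => rfl, fun _ => rfl, fun _ => rfl⟩
      inv := ⟨fun x => x, fun x => x, fun x => ⟨x.src, x.tgt, x.cell, x.ss, x.tt, x.hs, x.ht⟩,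
        fun _ => rfl, fun _ => rfl, fun _ => rfl, fun _ => rfl⟩
      hom_inv_id := rfl
      inv_hom_id := rfl }) (fun _ => rfl)

open OfAdjunction

def mate : Mate TwoCat.freeAdj.{u} GData.adj CData.adj toCData genIso where
  ω := cellsIso
  counit Y := CData.hom_ext (Ct.free_hom_ext (G := (cells.obj Y).trunc) (fun _ => rfl) fun e => by
      change (Hom.ct (GData.adj.counit.app Y)).f1 (Walk.single e) = (TwoCat.Hom.ct
        (Glob2.lift (A := CData.cellsObj (toCData.obj Y)) (cellsIso.hom.app Y))).f1 (Walk.single e)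
      refine (Hom.ct_single (GData.adj.counit.app Y) e).trans ?_
      exact (congrFun (congrArg Glob2.Hom.f1 (Glob2.unit_lift (A := CData.cellsObj (toCData.obj Y))
        (cellsIso.hom.app Y))) e).symm) (by
      have h : TwoCat.freeFunctor.map (cellsIso.hom.app Y) ≫
          TwoCat.freeAdj.counit.app (CData.cells.obj (toCData.obj Y)) =
          Glob2.lift (A := CData.cellsObj (toCData.obj Y)) (cellsIso.hom.app Y) :=
        Glob2.freeMap_lift (A := CData.cellsObj (toCData.obj Y)) (cellsIso.hom.app Y) (𝟙 _)
      change Glob2.lift (𝟙 _ ≫ Y.proj) = (TwoCat.freeFunctor.map (cellsIso.hom.app Y) ≫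
          TwoCat.freeAdj.counit.app (CData.cells.obj (toCData.obj Y))) ≫ CData.proj (toCData.obj Y)
      rw [h]
      exact (Glob2.lift_comp (A := CData.cellsObj (toCData.obj Y)) (cellsIso.hom.app Y)
        (CData.proj (toCData.obj Y))).symm)
  unit X := by
    refine Glob2.Hom.ext rfl rfl (funext fun x => ?_)
    exact CData.Cell.ext (X.unit.s1 x).symm (X.unit.t1 x).symm rfl

end GData

def grayTransport : Transport TwoCat.freeAdj.{u} grayE grayH := GData.mate.transport

end

section

section Image

variable {O M O' M' : Type u} {s t : M → O} {s' t' : M' → O'} (c : CatOn s t) (p0 : O → O')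
  (p1 : M → M') (i0 : O' → O) (i1 : M' → M)

@[reducible] def CatOn.image (ps : ∀ m, s' (p1 m) = p0 (s m)) (pt : ∀ m, t' (p1 m) = p0 (t m))
    (is : ∀ m, s (i1 m) = i0 (s' m)) (it : ∀ m, t (i1 m) = i0 (t' m)) (pi0 : ∀ a, p0 (i0 a) = a)
    (pi1 : ∀ m, p1 (i1 m) = m) (hid : ∀ a, p1 (c.id a) = p1 (c.id (i0 (p0 a))))
    (hcomp : ∀ f g h h', p1 (c.comp f g h) = p1 (c.comp (i1 (p1 f)) (i1 (p1 g)) h')) :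
    CatOn s' t' where
  id a := p1 (c.id (i0 a))
  comp f g h := p1 (c.comp (i1 f) (i1 g) (by rw [is, it, h]))
  s_id a := by rw [ps, c.s_id, pi0]
  t_id a := by rw [pt, c.t_id, pi0]
  s_comp f g h := by rw [ps, c.s_comp, is, pi0]
  t_comp f g h := by rw [pt, c.t_comp, it, pi0]
  id_comp f h := by
    have h₀ : t (c.id (s (i1 f))) = s (i1 f) := c.t_id _
    refine Eq.trans ?_ (pi1 f)
    refine Eq.trans ?_ (congrArg p1 (c.id_comp (i1 f) h₀))
    have h₁ : t (i1 (p1 (c.id (s (i1 f))))) = s (i1 (p1 (i1 f))) := by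
      rw [pi1, it, pt, c.t_id, is, pi0]
    refine Eq.trans ?_ (hcomp _ _ h₀ h₁).symm
    refine congrArg p1 (c.comp_congr (congrArg i1 ?_) (congrArg i1 (pi1 f).symm) _ _)
    exact congrArg (fun a => p1 (c.id a)) (is f).symm
  comp_id f h := by
    have h₀ : t (i1 f) = s (c.id (t (i1 f))) := (c.s_id _).symm
    refine Eq.trans ?_ (pi1 f)
    refine Eq.trans ?_ (congrArg p1 (c.comp_id (i1 f) h₀))
    have h₁ : t (i1 (p1 (i1 f))) = s (i1 (p1 (c.id (t (i1 f))))) := by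
      rw [pi1, it, is, ps, c.s_id, pi0]
    refine Eq.trans ?_ (hcomp _ _ h₀ h₁).symm
    refine congrArg p1 (c.comp_congr (congrArg i1 (pi1 f).symm) (congrArg i1 ?_) _ _)
    exact congrArg (fun a => p1 (c.id a)) (it f).symm
  assoc f g k h₁ h₂ h₃ h₄ := by
    have k₁ : t (i1 f) = s (i1 g) := by rw [it, is, h₁]
    have k₃ : t (i1 g) = s (i1 k) := by rw [it, is, h₃]
    have k₂ : t (c.comp (i1 f) (i1 g) k₁) = s (i1 k) := by rw [c.t_comp, k₃]
    have k₄ : t (i1 f) = s (c.comp (i1 g) (i1 k) k₃) := by rw [c.s_comp, k₁]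
    have l₂ : t (i1 (p1 (c.comp (i1 f) (i1 g) k₁))) = s (i1 (p1 (i1 k))) := by
      rw [it, is, pt, ps, k₂]
    have l₄ : t (i1 (p1 (i1 f))) = s (i1 (p1 (c.comp (i1 g) (i1 k) k₃))) := by
      rw [it, is, pt, ps, k₄]
    refine Eq.trans (congrArg p1 (c.comp_congr rfl (congrArg i1 (pi1 k).symm) _ l₂)) ?_
    refine (hcomp _ _ k₂ l₂).symm.trans ((congrArg p1 (c.assoc _ _ _ k₁ k₂ k₃ k₄)).trans ?_)
    refine (hcomp _ _ k₄ l₄).trans ?_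
    exact congrArg p1 (c.comp_congr (congrArg i1 (pi1 f)) rfl l₄ _)

end Image

namespace TwoCat

structure USplit {R S : TwoCat.{u}} (d₀ d₁ : R ⟶ S) {X : Glob2.{u}} (p : S.toGlob2 ⟶ X) where
  i : X ⟶ S.toGlob2
  t : S.toGlob2 ⟶ R.toGlob2
  w : d₀.toHom ≫ p = d₁.toHom ≫ p
  ip : i ≫ p = 𝟙 X
  td₀ : t ≫ d₀.toHom = 𝟙 S.toGlob2
  td₁ : t ≫ d₁.toHom = p ≫ i

variable {R S : TwoCat.{u}} {d₀ d₁ : R ⟶ S} {X : Glob2.{u}} {p : S.toGlob2 ⟶ X} (h : USplit d₀ d₁ p)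

namespace USplit

lemma ip0 (x) : p.f0 (h.i.f0 x) = x := congrArg (fun k => k.f0 x) h.ip
lemma ip1 (x) : p.f1 (h.i.f1 x) = x := congrArg (fun k => k.f1 x) h.ip
lemma ip2 (x) : p.f2 (h.i.f2 x) = x := congrArg (fun k => k.f2 x) h.ip

include h

lemma pid (a) : p.f1 (S♭ a) = p.f1 (S♭ (h.i.f0 (p.f0 a))) := by
  have e0 : d₀⁰ (h.t.f0 a) = a := congrArg (fun k => k.f0 a) h.td₀
  have e1 : d₁⁰ (h.t.f0 a) = h.i.f0 (p.f0 a) := congrArg (fun k => k.f0 a) h.td₁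
  have hw := congrArg (fun k => k.f1 (R♭ (h.t.f0 a))) h.w
  rw [← e1, ← d₁.map_id]
  exact (congrArg p.f1 ((congrArg S♭ e0.symm).trans (d₀.map_id _).symm)).trans hw

lemma pvid (a) : p.f2 (S♯ a) = p.f2 (S♯ (h.i.f1 (p.f1 a))) := by
  have e0 : d₀¹ (h.t.f1 a) = a := congrArg (fun k => k.f1 a) h.td₀
  have e1 : d₁¹ (h.t.f1 a) = h.i.f1 (p.f1 a) := congrArg (fun k => k.f1 a) h.td₁
  have hw := congrArg (fun k => k.f2 (R♯ (h.t.f1 a))) h.w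
  rw [← e1, ← d₁.map_vid]
  exact (congrArg p.f2 ((congrArg S♯ e0.symm).trans (d₀.map_vid _).symm)).trans hw

lemma pcomp (f g k k') : p.f1 (S.cat1.comp f g k) =
    p.f1 (S.cat1.comp (h.i.f1 (p.f1 f)) (h.i.f1 (p.f1 g)) k') := by
  have e0 : ∀ a, d₀¹ (h.t.f1 a) = a := fun a => congrArg (fun k => k.f1 a) h.td₀
  have e1 : ∀ a, d₁¹ (h.t.f1 a) = h.i.f1 (p.f1 a) := fun a => congrArg (fun k => k.f1 a) h.td₁
  have hc : R.t0 (h.t.f1 f) = R.s0 (h.t.f1 g) := by rw [h.t.t0, h.t.s0, k]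
  have hw := congrArg (fun k => k.f1 (R.cat1.comp _ _ hc)) h.w
  refine Eq.trans (congrArg p.f1 ?_) (hw.trans (congrArg p.f1 ?_))
  · refine Eq.trans ?_ (d₀.map_comp _ _ hc (by rw [e0, e0, k])).symm
    exact S.cat1.comp_congr (e0 f).symm (e0 g).symm _ _
  · refine (d₁.map_comp _ _ hc (by rw [e1, e1, k'])).trans ?_
    exact S.cat1.comp_congr (e1 f) (e1 g) _ _

lemma pvcomp (f g k k') : p.f2 (S.catV.comp f g k) =
    p.f2 (S.catV.comp (h.i.f2 (p.f2 f)) (h.i.f2 (p.f2 g)) k') := by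
  have e0 : ∀ a, d₀² (h.t.f2 a) = a := fun a => congrArg (fun k => k.f2 a) h.td₀
  have e1 : ∀ a, d₁² (h.t.f2 a) = h.i.f2 (p.f2 a) := fun a => congrArg (fun k => k.f2 a) h.td₁
  have hc : R.t1 (h.t.f2 f) = R.s1 (h.t.f2 g) := by rw [h.t.t1, h.t.s1, k]
  have hw := congrArg (fun k => k.f2 (R.catV.comp _ _ hc)) h.w
  refine Eq.trans (congrArg p.f2 ?_) (hw.trans (congrArg p.f2 ?_))
  · refine Eq.trans ?_ (d₀.map_vcomp _ _ hc (by rw [e0, e0, k])).symm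
    exact S.catV.comp_congr (e0 f).symm (e0 g).symm _ _
  · refine (d₁.map_vcomp _ _ hc (by rw [e1, e1, k'])).trans ?_
    exact S.catV.comp_congr (e1 f) (e1 g) _ _

lemma phcomp (f g k k') : p.f2 (S.catH.comp f g k) =
    p.f2 (S.catH.comp (h.i.f2 (p.f2 f)) (h.i.f2 (p.f2 g)) k') := by
  have e0 : ∀ a, d₀² (h.t.f2 a) = a := fun a => congrArg (fun k => k.f2 a) h.td₀
  have e1 : ∀ a, d₁² (h.t.f2 a) = h.i.f2 (p.f2 a) := fun a => congrArg (fun k => k.f2 a) h.td₁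
  have hc : R.t0 (R.s1 (h.t.f2 f)) = R.s0 (R.s1 (h.t.f2 g)) := by
    rw [h.t.s1, h.t.s1, h.t.t0, h.t.s0, k]
  have hw := congrArg (fun k => k.f2 (R.catH.comp _ _ hc)) h.w
  refine Eq.trans (congrArg p.f2 ?_) (hw.trans (congrArg p.f2 ?_))
  · refine Eq.trans ?_ (d₀.map_hcomp _ _ hc (by rw [e0, e0, k])).symm
    exact S.catH.comp_congr (e0 f).symm (e0 g).symm _ _
  · refine (d₁.map_hcomp _ _ hc (by rw [e1, e1, k'])).trans ?_
    exact S.catH.comp_congr (e1 f) (e1 g) _ _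

@[reducible] def twoCat : TwoCat.{u} where
  toGlob2 := X
  cat1 := S.cat1.image p.f0 p.f1 h.i.f0 h.i.f1 p.s0 p.t0 h.i.s0 h.i.t0 h.ip0 h.ip1 h.pid h.pcomp
  catV := S.catV.image p.f1 p.f2 h.i.f1 h.i.f2 p.s1 p.t1 h.i.s1 h.i.t1 h.ip1 h.ip2 h.pvid h.pvcomp
  catH := S.catH.image p.f0 p.f2 h.i.f0 h.i.f2 (fun _ => by rw [p.s1, p.s0])
    (fun _ => by rw [p.s1, p.t0]) (fun _ => by rw [h.i.s1, h.i.s0]) (fun _ => by rw [h.i.s1, h.i.t0])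
    h.ip0 h.ip2 (fun a => by
      rw [S.catH_id, S.catH_id, h.pvid, h.pid, ← h.pvid]) h.phcomp
  catH_id a := (congrArg p.f2 (S.catH_id _)).trans (h.pvid _)
  s1_hcomp x y k := by
    refine (p.s1 _).trans ((congrArg p.f1 (S.s1_hcomp _ _ _)).trans (congrArg p.f1 ?_))
    exact S.cat1.comp_congr (h.i.s1 _) (h.i.s1 _) _ _
  t1_hcomp x y k k' := by
    have hk : S.t0 (S.t1 (h.i.f2 x)) = S.s0 (S.t1 (h.i.f2 y)) := by
      rw [h.i.t1, h.i.t1, h.i.t0, h.i.s0, k']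
    refine (p.t1 _).trans ((congrArg p.f1 (S.t1_hcomp _ _ _ hk)).trans (congrArg p.f1 ?_))
    exact S.cat1.comp_congr (h.i.t1 _) (h.i.t1 _) _ _
  hcomp_id f g k k' := by
    have hk : S.t0 (h.i.f1 f) = S.s0 (h.i.f1 g) := by rw [h.i.t0, h.i.s0, k]
    have hk' : S.t0 (S.s1 (S♯ (h.i.f1 f))) = S.s0 (S.s1 (S♯ (h.i.f1 g))) := by
      rw [S.catV.s_id, S.catV.s_id, hk]
    refine (h.phcomp _ _ hk' _).symm.trans ((congrArg p.f2 (S.hcomp_id _ _ hk hk')).trans (h.pvid _))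
  interchange x x' y y' hx hy k k₁ k₂ k' := by
    have jx : S.t1 (h.i.f2 x) = S.s1 (h.i.f2 x') := by rw [h.i.t1, h.i.s1, hx]
    have jy : S.t1 (h.i.f2 y) = S.s1 (h.i.f2 y') := by rw [h.i.t1, h.i.s1, hy]
    have j₁ : S.t0 (S.s1 (h.i.f2 x)) = S.s0 (S.s1 (h.i.f2 y)) := by
      rw [h.i.s1, h.i.s1, h.i.t0, h.i.s0, k₁]
    have j₂ : S.t0 (S.s1 (h.i.f2 x')) = S.s0 (S.s1 (h.i.f2 y')) := by
      rw [h.i.s1, h.i.s1, h.i.t0, h.i.s0, k₂]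
    have j : S.t0 (S.s1 (S.catV.comp _ _ jx)) = S.s0 (S.s1 (S.catV.comp _ _ jy)) := by
      rw [S.catV.s_comp, S.catV.s_comp, j₁]
    have j' : S.t1 (S.catH.comp _ _ j₁) = S.s1 (S.catH.comp _ _ j₂) := by
      have j₃ : S.t0 (S.t1 (h.i.f2 x)) = S.s0 (S.t1 (h.i.f2 y)) := by rw [jx, jy, j₂]
      refine (S.t1_hcomp _ _ j₁ j₃).trans (Eq.trans ?_ (S.s1_hcomp _ _ j₂).symm)
      exact S.cat1.comp_congr jx jy _ _
    refine (h.phcomp _ _ j _).symm.trans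
      ((congrArg p.f2 (S.interchange _ _ _ _ jx jy j j₁ j₂ j')).trans (h.pvcomp _ _ j' _))

def proj : S ⟶ h.twoCat where
  toHom := p
  map_id := h.pid
  map_comp _ _ _ _ := h.pcomp _ _ _ _
  map_vid := h.pvid
  map_vcomp _ _ _ _ := h.pvcomp _ _ _ _
  map_hcomp _ _ _ _ := h.phcomp _ _ _ _

end USplit

instance : forget.{u}.Faithful where
  map_injective h := TwoCat.Hom.ext' h

lemma eq_of_toHom_eq {A B : TwoCat.{u}} (F : A ⟶ B) (h : A.toGlob2 = B.toGlob2)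
    (hF : F.toHom = eqToHom h) : A = B := by
  obtain ⟨A, a1, aV, aH, _, _, _, _, _⟩ := A
  obtain ⟨B, b1, bV, bH, _, _, _, _, _⟩ := B
  dsimp only at h
  subst h
  obtain ⟨f, h1, h2, h3, h4, h5⟩ := F
  dsimp only at hF
  subst hF
  obtain rfl : a1 = b1 := CatOn.ext (funext h1) (funext fun f => funext fun g => funext fun h => h2 f g h h)
  obtain rfl : aV = bV := CatOn.ext (funext h3) (funext fun f => funext fun g => funext fun h => h4 f g h h)
  obtain rfl : aH = bH := by
    refine CatOn.ext (funext fun a => ?_) (funext fun f => funext fun g => funext fun h => h5 f g h h)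
    simp_all
  rfl

end TwoCat

section IsoOver

variable {A : Type*} [Category A] {B : Type*} [Category B] {C : Type*} [Category C]

def Amnestic (U : A ⥤ C) : Prop :=
  ∀ (a a' : A) (f : a ⟶ a') (h : U.obj a = U.obj a'), U.map f = eqToHom h → a = a'

variable {U : A ⥤ C} {U' : B ⥤ C}

def IsoOver.ofFF (Φ : A ⥤ B) (hΦ : Φ ⋙ U' = U) [Φ.Full] [Φ.Faithful]
    (surj : Function.Surjective Φ.obj) (hU : Amnestic U) : IsoOver U U' := by
  have inj : Function.Injective Φ.obj := fun a a' h => by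
    have hm : U.map (Φ.preimage (eqToHom h)) = eqToHom (by rw [← hΦ]; exact congrArg U'.obj h) := by
      subst hΦ
      change U'.map (Φ.map _) = _
      rw [Φ.map_preimage, eqToHom_map]
    exact hU a a' _ _ hm
  choose g hg using surj
  refine
    { functor := Φ
      inverse :=
        { obj := g
          map := fun {X Y} f => Φ.preimage (eqToHom (hg X) ≫ f ≫ eqToHom (hg Y).symm)
          map_id := fun X => Φ.map_injective (by simp)
          map_comp := fun f f' => Φ.map_injective (by simp) }
      functor_inverse := ?_
      inverse_functor := ?_
      comp_forget := hΦ }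
  · refine CategoryTheory.Functor.ext (fun a => inj (hg _)) fun X Y f => Φ.map_injective ?_
    simp [eqToHom_map]
  · exact CategoryTheory.Functor.ext hg fun X Y f => by simp

def IsoOver.symm (I : IsoOver U U') : IsoOver U' U where
  functor := I.inverse
  inverse := I.functor
  functor_inverse := I.inverse_functor
  inverse_functor := I.functor_inverse
  comp_forget := by
    have h : I.inverse ⋙ U = I.inverse ⋙ (I.functor ⋙ U') := congrArg (I.inverse ⋙ ·) I.comp_forget.symm
    rw [h, ← Functor.assoc, I.inverse_functor]
    rfl

def IsoOver.trans {D : Type*} [Category D] {U'' : D ⥤ C} (I : IsoOver U U') (J : IsoOver U' U'') :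
    IsoOver U U'' where
  functor := I.functor ⋙ J.functor
  inverse := J.inverse ⋙ I.inverse
  functor_inverse := by
    rw [Functor.assoc, ← Functor.assoc J.functor, J.functor_inverse]
    exact I.functor_inverse
  inverse_functor := by
    rw [Functor.assoc, ← Functor.assoc I.inverse, I.inverse_functor]
    exact J.inverse_functor
  comp_forget := by
    rw [Functor.assoc, J.comp_forget, I.comp_forget]

def IsoOver.comp {D : Type*} [Category D] (I : IsoOver U U') (K : C ⥤ D) : IsoOver (U ⋙ K) (U' ⋙ K) :=
  { I with comp_forget := by rw [← Functor.assoc, I.comp_forget] }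

end IsoOver

end

section

namespace Transport

section Abstract

variable {V : Type u} [Category.{v} V] {W : Type u'} [Category.{v'} W] {F : V ⥤ W} {U : W ⥤ V}
  {adj : F ⊣ U} {E : Multitensor V} {H : Multitensor W} (T : Transport adj E H)
  [hη : ∀ X, IsIso (H.η X)]

lemma inv_η_natural {X Y : W} (f : X ⟶ Y) : H.E.map (consHom f (𝟙 [])) ≫ inv (H.η Y) = inv (H.η X) ≫ f := by
  rw [IsIso.comp_inv_eq, Category.assoc, IsIso.eq_inv_comp, H.η_natural]

def m (X : V) : E.E.obj [X] ⟶ U.obj (F.obj X) := (T.e [X]).hom ≫ U.map (inv (H.η (F.obj X)))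

instance (X : V) : IsIso (T.m X) := by
  unfold m; infer_instance

lemma m_natural {X Y : V} (f : X ⟶ Y) : E.E.map (consHom f (𝟙 [])) ≫ T.m Y = T.m X ≫ U.map (F.map f) := by
  have h := T.natural (L := [X]) (M := [Y]) (consHom f (𝟙 []))
  have h₂ : H.E.map (consHom (F.map f) (𝟙 [])) ≫ inv (H.η (F.obj Y)) = inv (H.η (F.obj X)) ≫ F.map f :=
    inv_η_natural _
  rw [m, m, Category.assoc, ← U.map_comp, ← h₂, U.map_comp, ← Category.assoc, h]
  exact Category.assoc _ _ _

lemma η_m (X : V) : E.η X ≫ T.m X = adj.unit.app X := by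
  rw [m, ← Category.assoc, T.unit, Category.assoc, ← U.map_comp, IsIso.hom_inv_id, U.map_id]
  exact Category.comp_id _

def q (A : W) : E.E.obj [U.obj A] ⟶ U.obj A := T.m (U.obj A) ≫ U.map (adj.counit.app A)

lemma η_q (A : W) : E.η (U.obj A) ≫ T.q A = 𝟙 _ := by
  rw [q, ← Category.assoc, η_m, adj.right_triangle_components]

lemma q_natural {A B : W} (k : A ⟶ B) : E.E.map (consHom (U.map k) (𝟙 [])) ≫ T.q B = T.q A ≫ U.map k := by
  rw [q, q, ← Category.assoc, m_natural, Category.assoc, Category.assoc, ← U.map_comp, ← U.map_comp,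
    adj.counit_naturality]

lemma σ_e (L : List V) (h : [L].flatten = L) : E.σ [L] L h ≫ (T.e L).hom =
    E.E.map (consHom (T.e L).hom (𝟙 [])) ≫ T.q (H.E.obj (L.map F.obj)) := by
  have h' : ([L].map (List.map F.obj)).flatten = L.map F.obj := by simp
  have hr : H.E.map (transportHom F E.E H.E (fun L => F.map (T.e L).hom ≫ adj.counit.app _) [L]) ≫
      H.σ [L.map F.obj] (L.map F.obj) h' = inv (H.η _) ≫ F.map (T.e L).hom ≫ adj.counit.app _ := by
    rw [IsIso.eq_inv_comp, ← Category.assoc]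
    have := H.η_natural (F.map (T.e L).hom ≫ adj.counit.app (H.E.obj (L.map F.obj)))
    refine (congrArg (· ≫ _) this).trans ?_
    refine (Category.assoc _ _ _).trans ((congrArg (_ ≫ ·) (H.unit_left (L.map F.obj) h')).trans ?_)
    exact Category.comp_id _
  refine (T.subst [L] L h h').trans ((congrArg (fun k => (T.e [E.E.obj L]).hom ≫ U.map k) hr).trans ?_)
  refine Eq.trans ?_ ((Category.assoc _ _ _).symm.trans (congrArg (· ≫ _) (T.m_natural (T.e L).hom))).symm
  rw [m, U.map_comp, U.map_comp]
  simp only [Category.assoc]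

lemma σ_comp (L : List V) (h : [L].flatten = L) {Z : W} (k : H.E.obj (L.map F.obj) ⟶ Z) :
    E.σ [L] L h ≫ (T.e L).hom ≫ U.map k = E.E.map (consHom ((T.e L).hom ≫ U.map k) (𝟙 [])) ≫ T.q Z := by
  have h₁ : consHom ((T.e L).hom ≫ U.map k) (𝟙 []) = consHom (T.e L).hom (𝟙 []) ≫ consHom (U.map k) (𝟙 []) :=
    (consHom_comp _ _ _ _).symm.trans (congrArg (consHom _) (Category.id_comp _)) |>.symm
  refine (Category.assoc _ _ _).symm.trans ((congrArg (· ≫ U.map k) (T.σ_e L h)).trans ?_)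
  refine (Category.assoc _ _ _).trans ((congrArg (_ ≫ ·) (T.q_natural k).symm).trans ?_)
  refine (Category.assoc _ _ _).symm.trans (congrArg (· ≫ T.q Z) ?_)
  exact (E.E.map_comp _ _).symm.trans (congrArg E.E.map h₁.symm)

lemma q_assoc (A : W) : E.σ [[U.obj A]] [U.obj A] rfl ≫ T.q A = E.E.map (consHom (T.q A) (𝟙 [])) ≫ T.q A := by
  have h := T.σ_comp [U.obj A] rfl (inv (H.η (F.obj (U.obj A))) ≫ adj.counit.app A)
  have hq : T.q A = (T.e [U.obj A]).hom ≫ U.map (inv (H.η (F.obj (U.obj A))) ≫ adj.counit.app A) := by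
    rw [q, m, Category.assoc, ← U.map_comp]
  refine (congrArg (_ ≫ ·) hq).trans (h.trans ?_)
  exact congrArg (fun k => E.E.map (consHom k (𝟙 [])) ≫ T.q A) hq.symm

lemma σ_m (X : V) : E.σ [[X]] [X] rfl ≫ T.m X =
    E.E.map (consHom (T.m X) (𝟙 [])) ≫ T.m (U.obj (F.obj X)) ≫ U.map (adj.counit.app (F.obj X)) :=
  T.σ_comp [X] rfl (inv (H.η (F.obj X)))

def toAlg : W ⥤ E.unary.Algebra where
  obj A := ⟨U.obj A, T.q A, T.η_q A, T.q_assoc A⟩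
  map k := ⟨U.map k, T.q_natural k⟩
  map_id A := Monad.Algebra.Hom.ext (U.map_id A)
  map_comp f g := Monad.Algebra.Hom.ext (U.map_comp f g)

instance [U.Faithful] : T.toAlg.Faithful where
  map_injective h := U.map_injective (congrArg Monad.Algebra.Hom.f h)

lemma alg_hom {A B : W} (g : U.obj A ⟶ U.obj B) (hg : E.E.map (consHom g (𝟙 [])) ≫ T.q B = T.q A ≫ g) :
    U.map (F.map g ≫ adj.counit.app B) = U.map (adj.counit.app A) ≫ g := by
  have h : E.E.map (consHom g (𝟙 [])) ≫ T.q B = T.m (U.obj A) ≫ U.map (F.map g ≫ adj.counit.app B) := by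
    rw [q, ← Category.assoc, m_natural, Category.assoc, U.map_comp]
  rw [h, q, Category.assoc] at hg
  exact (cancel_epi (T.m (U.obj A))).1 hg

end Abstract

open TwoCat

lemma _root_.GrayLift.TwoCat.isSplit_counit (A : TwoCat.{u}) : IsSplit
    (freeAdj.counit.app (freeFunctor.obj (forget.obj A)))
    (freeFunctor.map (forget.map (freeAdj.counit.app A))) (freeAdj.counit.app A) where
  w := (freeAdj.counit_naturality (freeAdj.counit.app A)).symm
  refl := ⟨freeFunctor.map (freeAdj.unit.app (forget.obj A)), freeAdj.left_triangle_components _, by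
    rw [← freeFunctor.map_comp, freeAdj.right_triangle_components, freeFunctor.map_id]; rfl⟩
  bij := Function.bijective_id
  split := ⟨freeAdj.unit.app (forget.obj A), freeAdj.unit.app _, freeAdj.right_triangle_components A,
    freeAdj.right_triangle_components (freeFunctor.obj (forget.obj A)),
    (freeAdj.unit_naturality (forget.map (freeAdj.counit.app A)))⟩

lemma exists_of_alg_hom {A B : TwoCat.{u}} (g : forget.obj A ⟶ forget.obj B)
    (hg : forget.map (freeFunctor.map g ≫ freeAdj.counit.app B) = forget.map (freeAdj.counit.app A) ≫ g) :
    ∃ G : A ⟶ B, forget.map G = g := by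
  obtain ⟨G, hG⟩ := (isSplit_counit A).desc (freeFunctor.map g ≫ freeAdj.counit.app B) (by
    refine Eq.trans ?_ (Category.assoc _ _ _)
    rw [← freeFunctor.map_comp, ← hg]
    exact (freeAdj.counit_naturality (freeFunctor.map g ≫ freeAdj.counit.app B)).symm)
  refine ⟨G, ?_⟩
  have h : freeAdj.unit.app (forget.obj A) ≫ forget.map (freeAdj.counit.app A) ≫ forget.map G =
      freeAdj.unit.app (forget.obj A) ≫ forget.map (freeAdj.counit.app A) ≫ g := by
    rw [← hg, ← forget.map_comp, hG]
  exact ((congrArg (· ≫ _) (freeAdj.right_triangle_components A)).symm.trans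
    (Category.assoc _ _ _)).trans (h.trans ((Category.assoc _ _ _).symm.trans
      (congrArg (· ≫ _) (freeAdj.right_triangle_components A))))

variable {E : Multitensor Glob2.{u}} {H : Multitensor TwoCat.{u}} (T : Transport freeAdj E H)
  [hη : ∀ X, IsIso (H.η X)]

instance : T.toAlg.Full where
  map_surjective {A B} f := by
    obtain ⟨G, hG⟩ := exists_of_alg_hom f.f (T.alg_hom f.f f.h)
    exact ⟨G, Monad.Algebra.Hom.ext hG⟩

lemma exists_twoCat (X : Glob2.{u}) (a : E.E.obj [X] ⟶ X) (h₁ : E.η X ≫ a = 𝟙 X)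
    (h₂ : E.σ [[X]] [X] rfl ≫ a = E.E.map (consHom a (𝟙 [])) ≫ a) :
    ∃ (A : TwoCat.{u}) (h : A.toGlob2 = X), HEq (T.q A) a := by
  let p : forget.obj (freeFunctor.obj X) ⟶ X := inv (T.m X) ≫ a
  have hp : T.m X ≫ p = a := IsIso.hom_inv_id_assoc _ _
  let S : USplit (freeAdj.counit.app (freeFunctor.obj X)) (freeFunctor.map p) p :=
    { i := freeAdj.unit.app X
      t := freeAdj.unit.app _
      w := by
        have h := congrArg (· ≫ p) (T.σ_m X)
        have hm := T.m_natural p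
        have e1 : E.σ [[X]] [X] rfl ≫ T.m X ≫ p = E.E.map (consHom (T.m X) (𝟙 [])) ≫
            T.m (forget.obj (freeFunctor.obj X)) ≫ forget.map (freeFunctor.map p) ≫ p := by
          have h₃ : consHom a (𝟙 []) = consHom (T.m X) (𝟙 []) ≫ consHom p (𝟙 []) := by
            rw [← consHom_comp, hp, Category.comp_id]
          rw [hp, h₂, h₃, ← reassoc_of% hm, hp]
          exact (congrArg (· ≫ a) (E.E.map_comp _ _)).trans (Category.assoc _ _ _)
        have e2 := h.symm.trans ((Category.assoc _ _ _).trans e1)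
        simp only [Category.assoc] at e2
        have hi : IsIso (E.E.map (consHom (T.m X) (𝟙 []))) := by
          have : IsIso (consHom (T.m X) (𝟙 [])) := inferInstance
          infer_instance
        exact (cancel_epi (T.m _)).1 ((cancel_epi _).1 e2)
      ip := by
        change freeAdj.unit.app X ≫ p = _
        rw [← T.η_m X, Category.assoc, hp, h₁]
      td₀ := freeAdj.right_triangle_components (freeFunctor.obj X)
      td₁ := freeAdj.unit_naturality p }
  refine ⟨S.twoCat, rfl, heq_of_eq ?_⟩
  have he : freeAdj.counit.app S.twoCat = S.proj := (freeAdj.homEquiv X S.twoCat).injective (by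
    refine (freeAdj.homEquiv_unit _ _ _).trans (Eq.trans ?_ (freeAdj.homEquiv_unit _ _ _).symm)
    exact (freeAdj.right_triangle_components S.twoCat).trans S.ip.symm)
  refine (congrArg (fun k => T.m X ≫ forget.map k) he).trans hp

lemma toAlg_surjective : Function.Surjective T.toAlg.obj := by
  rintro ⟨X, a, h₁, h₂⟩
  obtain ⟨A, rfl, h⟩ := T.exists_twoCat X a h₁ h₂
  refine ⟨A, ?_⟩
  cases h
  rfl

lemma _root_.GrayLift.TwoCat.amnestic_forget : Amnestic forget.{u} :=
  fun _ _ F h hF => TwoCat.eq_of_toHom_eq F h hF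

def isoOver : IsoOver E.unary.forget forget.{u} :=
  (IsoOver.ofFF T.toAlg (U' := E.unary.forget) rfl T.toAlg_surjective amnestic_forget).symm

end Transport

end

section

section Lists

variable {V : Type u} [Category.{v} V]

lemma appendHom_heq {L L' M M' N N' : List V} (f : L ⟶ L') {g : M ⟶ M'} {g' : N ⟶ N'}
    (h : M = N) (h' : M' = N') (hg : HEq g g') : HEq (appendHom f g) (appendHom f g') := by
  subst h h'; cases hg; rfl

end Lists

namespace ECat

variable {V : Type u} [Category.{v} V] {G : Multitensor V} (Y : ECat.{w} G)

lemma append_nil {S : Type w} : ∀ {a b : S} (p : Chain S a b), p.append (.nil b) = p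
  | _, _, .nil _ => rfl
  | _, _, .cons a p => congrArg (Chain.cons a) (append_nil p)

lemma assoc' {a b : Y.graph.obj} (P : Chain₂ Y.graph.obj a b) {q r : Chain Y.graph.obj a b}
    (hq : P.outer = q) (hr : P.flatten = r) {M : List (List V)} (hM : Y.graph.homs₂ P = M)
    (c : M.map G.E.obj ⟶ Y.graph.homs q) (hc : HEq (compHom G.E Y.graph Y.κ P) c)
    (h : M.flatten = Y.graph.homs r) : G.E.map c ≫ Y.κ q = G.σ M (Y.graph.homs r) h ≫ Y.κ r := by
  subst hq hr hM; cases hc; exact Y.assoc P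

lemma assoc_single {a b : Y.graph.obj} (p : Chain Y.graph.obj a b)
    (h : [Y.graph.homs p].flatten = Y.graph.homs p) :
    G.E.map (consHom (Y.κ p) (𝟙 [])) ≫ Y.κ (.single a b) = G.σ [Y.graph.homs p] _ h ≫ Y.κ p :=
  Y.assoc' (.cons p (.nil b)) rfl (append_nil p) rfl (consHom (Y.κ p) (𝟙 [])) HEq.rfl h

def _root_.GrayLift.Chain.singles {S : Type w} : ∀ {a b : S}, Chain S a b → Chain₂ S a b
  | _, _, .nil a => .nil a
  | _, _, .cons a (b := b) p => .cons (.single a b) p.singles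

def singComp : ∀ {a b : Y.graph.obj} (p : Chain Y.graph.obj a b),
    ((Y.graph.homs p).map fun X => [X]).map G.E.obj ⟶ Y.graph.homs p
  | _, _, .nil _ => 𝟙 []
  | _, _, .cons a (b := b) p => consHom (Y.κ (.single a b)) (singComp p)

lemma singles_spec : ∀ {a b : Y.graph.obj} (p : Chain Y.graph.obj a b), p.singles.outer = p ∧
    p.singles.flatten = p ∧ Y.graph.homs₂ p.singles = (Y.graph.homs p).map (fun X => [X]) ∧
    HEq (compHom G.E Y.graph Y.κ p.singles) (Y.singComp p)
  | _, _, .nil _ => ⟨rfl, rfl, rfl, HEq.rfl⟩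
  | _, _, .cons a (b := b) p => by
    obtain ⟨h1, h2, h3, h4⟩ := singles_spec p
    exact ⟨congrArg (Chain.cons a) h1, congrArg (Chain.cons a) h2, congrArg (List.cons _) h3,
      consHom_heq _ (congrArg (List.map G.E.obj) h3) (congrArg Y.graph.homs h1) h4⟩

lemma assoc_singles {a b : Y.graph.obj} (p : Chain Y.graph.obj a b) (h) :
    G.E.map (Y.singComp p) ≫ Y.κ p = G.σ ((Y.graph.homs p).map fun X => [X]) (Y.graph.homs p) h ≫ Y.κ p := by
  obtain ⟨h1, h2, h3, h4⟩ := Y.singles_spec p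
  exact Y.assoc' p.singles h1 h2 h3 _ h4 h

end ECat

namespace Transport

section Abstract

variable {V : Type u} [Category.{v} V] {W : Type u'} [Category.{v'} W] {F : V ⥤ W} {U : W ⥤ V}
  (adj : F ⊣ U) {E : Multitensor V} {H : Multitensor W}

abbrev gU (U : W ⥤ V) (X : EGraph.{w} W) : EGraph.{w} V := ⟨X.obj, fun a b => U.obj (X.hom a b)⟩

abbrev gUMap (U : W ⥤ V) {X Y : EGraph.{w} W} (f : X ⟶ Y) : gU U X ⟶ gU U Y :=
  EGraph.Hom.mk (X := gU U X) (Y := gU U Y) f.obj (fun a b => U.map (f.hom a b))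

def cH (X : EGraph.{w} W) : ∀ {a b : X.obj} (p : Chain X.obj a b), ((gU U X).homs p).map F.obj ⟶ X.homs p
  | _, _, .nil _ => 𝟙 []
  | _, _, .cons a (b := b) p => consHom (adj.counit.app (X.hom a b)) (cH X p)

lemma cH_natural {X Y : EGraph.{w} W} (f : X ⟶ Y) : ∀ {a b : X.obj} (p : Chain X.obj a b),
    mapMHom F (EGraph.homsMap (gUMap U f) p) ≫ cH adj Y (p.map f.obj) = cH adj X p ≫ EGraph.homsMap f p
  | _, _, .nil _ => rfl
  | _, _, .cons _ p => Prod.ext (adj.counit_naturality (f.hom _ _)) (cH_natural f p)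

lemma cH_append (X : EGraph.{w} W) : ∀ {a b c : X.obj} (p : Chain X.obj a b) (q : Chain X.obj b c),
    HEq (appendHom (cH adj X p) (cH adj X q)) (cH adj X (p.append q))
  | _, _, _, .nil _, q => HEq.rfl
  | _, _, _, .cons a p, q => consHom_heq _ (by rw [EGraph.homs_append, List.map_append]; rfl)
      (X.homs_append p q).symm (cH_append X p q)

def cH₂ (X : EGraph.{w} W) : ∀ {a b : X.obj} (P : Chain₂ X.obj a b),
    ((gU U X).homs₂ P).map (List.map F.obj) ⟶ X.homs₂ P
  | _, _, .nil _ => 𝟙 []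
  | _, _, .cons p P => consHom (cH adj X p) (cH₂ X P)

lemma flattenHom_cH₂ (X : EGraph.{w} W) : ∀ {a b : X.obj} (P : Chain₂ X.obj a b),
    HEq (flattenHom (cH₂ adj X P)) (cH adj X P.flatten)
  | _, _, .nil _ => HEq.rfl
  | _, _, .cons p P => (appendHom_heq (cH adj X p)
      (by rw [← List.map_flatten, EGraph.flatten_homs₂]) (X.flatten_homs₂ P)
      (flattenHom_cH₂ X P)).trans (cH_append adj X p P.flatten)

variable {adj} (T : Transport adj E H)

def r (L : List V) : F.obj (E.E.obj L) ⟶ H.E.obj (L.map F.obj) :=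
  F.map (T.e L).hom ≫ adj.counit.app (H.E.obj (L.map F.obj))

variable {X : EGraph.{w} W}

def κE (κ : ∀ {a b : X.obj} (p : Chain X.obj a b), H.E.obj (X.homs p) ⟶ X.hom a b) {a b : X.obj}
    (p : Chain X.obj a b) : E.E.obj ((gU U X).homs p) ⟶ U.obj (X.hom a b) :=
  (T.e _).hom ≫ U.map (H.E.map (cH adj X p) ≫ κ p)

variable (κ : ∀ {a b : X.obj} (p : Chain X.obj a b), H.E.obj (X.homs p) ⟶ X.hom a b)

lemma κE_single (a b : X.obj) : T.κE κ (.single a b) = (T.e [U.obj (X.hom a b)]).hom ≫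
    U.map (H.E.map (consHom (adj.counit.app (X.hom a b)) (𝟙 [])) ≫ κ (.single a b)) := rfl

lemma η_κE (a b : X.obj) : E.η (U.obj (X.hom a b)) ≫ T.κE κ (.single a b) =
    U.map (H.η (X.hom a b) ≫ κ (.single a b)) := by
  have h := H.η_natural (adj.counit.app (X.hom a b))
  rw [κE_single, ← Category.assoc, T.unit, Category.assoc, ← U.map_comp]
  refine (congrArg (fun k => _ ≫ U.map k) ((Category.assoc _ _ _).symm.trans
    ((congrArg (· ≫ κ (.single a b)) h).trans (Category.assoc _ _ _)))).trans ?_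
  rw [U.map_comp]
  exact ((Category.assoc _ _ _).symm.trans (congrArg (· ≫ _)
    (adj.right_triangle_components (X.hom a b)))).trans (Category.id_comp _)

def rP : ∀ {a b : X.obj} (P : Chain₂ X.obj a b),
    (((gU U X).homs₂ P).map E.E.obj).map F.obj ⟶ (X.homs₂ P).map H.E.obj
  | _, _, .nil _ => 𝟙 []
  | _, _, .cons p P => consHom (T.r _ ≫ H.E.map (cH adj X p)) (rP P)

lemma rP_eq : ∀ {a b : X.obj} (P : Chain₂ X.obj a b),
    T.rP P = transportHom F E.E H.E T.r _ ≫ mapMHom H.E (cH₂ adj X P)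
  | _, _, .nil _ => rfl
  | _, _, .cons p P => Prod.ext rfl (rP_eq P)

lemma rP_compHom : ∀ {a b : X.obj} (P : Chain₂ X.obj a b),
    mapMHom F (compHom E.E (gU U X) (T.κE κ) P) ≫ cH adj X P.outer = T.rP P ≫ compHom H.E X κ P
  | _, _, .nil _ => rfl
  | _, _, .cons (a := a) (b := b) p P => by
    refine Prod.ext ?_ (rP_compHom P)
    change F.map (T.κE κ p) ≫ adj.counit.app (X.hom a b) =
      ((F.map (T.e _).hom ≫ adj.counit.app _) ≫ H.E.map (cH adj X p)) ≫ κ p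
    have h := adj.counit_naturality (H.E.map (cH adj X p) ≫ κ p)
    refine (congrArg (· ≫ _) (F.map_comp _ _)).trans ((Category.assoc _ _ _).trans ?_)
    refine (congrArg (_ ≫ ·) h).trans ?_
    simp only [Category.assoc]

lemma compHom_κE {a b : X.obj} (P : Chain₂ X.obj a b) :
    E.E.map (compHom E.E (gU U X) (T.κE κ) P) ≫ T.κE κ P.outer =
      (T.e _).hom ≫ U.map (H.E.map (T.rP P) ≫ H.E.map (compHom H.E X κ P) ≫ κ P.outer) := by
  refine (Category.assoc _ _ _).symm.trans ((congrArg (· ≫ _) (T.natural _)).trans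
    ((Category.assoc _ _ _).trans (congrArg (_ ≫ ·) ?_)))
  rw [← U.map_comp, ← Category.assoc, ← H.E.map_comp, rP_compHom, H.E.map_comp, Category.assoc]

lemma σ_κE {a b : X.obj} (P : Chain₂ X.obj a b) :
    E.σ ((gU U X).homs₂ P) ((gU U X).homs P.flatten) ((gU U X).flatten_homs₂ P) ≫ T.κE κ P.flatten =
      (T.e _).hom ≫ U.map (H.E.map (T.rP P) ≫
        H.σ (X.homs₂ P) (X.homs P.flatten) (X.flatten_homs₂ P) ≫ κ P.flatten) := by
  have h' : (((gU U X).homs₂ P).map (List.map F.obj)).flatten = ((gU U X).homs P.flatten).map F.obj := by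
    rw [← List.map_flatten, EGraph.flatten_homs₂]
  have hs := T.subst ((gU U X).homs₂ P) ((gU U X).homs P.flatten) ((gU U X).flatten_homs₂ P) h'
  have hn := H.σ_natural' (cH₂ adj X P) h' (X.flatten_homs₂ P) (cH adj X P.flatten) (flattenHom_cH₂ adj X P)
  refine (Category.assoc _ _ _).symm.trans ((congrArg (· ≫ _) hs).trans
    ((Category.assoc _ _ _).trans (congrArg (_ ≫ ·) ?_)))
  rw [← U.map_comp, rP_eq, H.E.map_comp]
  refine congrArg U.map ?_
  have hn' : H.E.map (mapMHom H.E (cH₂ adj X P)) ≫ H.σ (X.homs₂ P) (X.homs P.flatten)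
      (X.flatten_homs₂ P) ≫ κ P.flatten = H.σ _ _ h' ≫ H.E.map (cH adj X P.flatten) ≫ κ P.flatten :=
    (Category.assoc _ _ _).symm.trans ((congrArg (· ≫ κ P.flatten) hn).trans (Category.assoc _ _ _))
  exact (Category.assoc _ _ _).trans ((congrArg (H.E.map (transportHom F E.E H.E T.r _) ≫ ·)
    hn'.symm).trans (Category.assoc _ _ _).symm)

def ecatObj (X : ECat.{w} H) : ECat.{w} E where
  graph := gU U X.graph
  κ := T.κE X.κ
  unit a b := (T.η_κE X.κ a b).trans ((congrArg U.map (X.unit a b)).trans (U.map_id _))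
  assoc P := (T.compHom_κE X.κ P).trans (Eq.trans (by rw [X.assoc P]) (T.σ_κE X.κ P).symm)

lemma map_κE {X Y : ECat.{w} H} (f : X.graph ⟶ Y.graph) {a b : X.graph.obj}
    (p : Chain X.graph.obj a b) : E.E.map (EGraph.homsMap (gUMap U f) p) ≫ T.κE Y.κ (p.map f.obj) =
      (T.e _).hom ≫ U.map (H.E.map (cH adj X.graph p) ≫ H.E.map (EGraph.homsMap f p) ≫ Y.κ (p.map f.obj)) := by
  refine (Category.assoc _ _ _).symm.trans ((congrArg (· ≫ _) (T.natural _)).trans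
    ((Category.assoc _ _ _).trans (congrArg (_ ≫ ·) ?_)))
  rw [← U.map_comp, ← Category.assoc, ← H.E.map_comp, cH_natural, H.E.map_comp, Category.assoc]

lemma κE_comp {X Y : ECat.{w} H} (f : X.graph ⟶ Y.graph) {a b : X.graph.obj}
    (p : Chain X.graph.obj a b) : T.κE X.κ p ≫ U.map (f.hom a b) =
      (T.e _).hom ≫ U.map (H.E.map (cH adj X.graph p) ≫ X.κ p ≫ f.hom a b) := by
  rw [κE, Category.assoc, ← U.map_comp, Category.assoc]

def ecat : ECat.{w} H ⥤ ECat.{w} E where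
  obj := T.ecatObj
  map {X Y} f := ⟨gUMap U f.map, fun p => (T.map_κE f.map p).trans (Eq.trans (by rw [f.map_κ p])
    (T.κE_comp f.map p).symm)⟩
  map_id X := ECat.Hom.ext (EGraph.Hom.ext rfl (heq_of_eq (funext fun _ => funext fun _ => U.map_id _)))
  map_comp f g := ECat.Hom.ext (EGraph.Hom.ext rfl
    (heq_of_eq (funext fun _ => funext fun _ => U.map_comp _ _)))

lemma _root_.GrayLift.EGraph.Hom.eq_mk {V : Type u} [Category.{v} V] {X Y : EGraph.{w} V} {o : X.obj → Y.obj}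
    {h h' : ∀ a b, X.hom a b ⟶ Y.hom (o a) (o b)} (e : (⟨o, h⟩ : EGraph.Hom X Y) = ⟨o, h'⟩) (a b) :
    h a b = h' a b := by
  cases e; rfl

instance [U.Faithful] : T.ecat.Faithful where
  map_injective {X Y f g} h := by
    obtain ⟨⟨o, f⟩, hf⟩ := f
    obtain ⟨⟨o', g⟩, hg⟩ := g
    have h' := congrArg ECat.Hom.map h
    obtain rfl : o = o' := congrArg EGraph.Hom.obj h'
    refine ECat.Hom.ext (EGraph.Hom.ext rfl (heq_of_eq (funext fun a => funext fun b => ?_)))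
    exact U.map_injective (EGraph.Hom.eq_mk h' a b)

end Abstract

end Transport

end

section

def unitHomMap {V : Type u} [Category.{v} V] {W : Type u'} [Category.{v'} W] (F : V ⥤ W)
    (H : Multitensor W) : ∀ L : List V, L.map F.obj ⟶ ((L.map fun X => [X]).map (List.map F.obj)).map H.E.obj
  | [] => 𝟙 []
  | X :: L => consHom (H.η (F.obj X)) (unitHomMap F H L)

namespace Transport

section Abstract

variable {V : Type u} [Category.{v} V] {W : Type u'} [Category.{v'} W] {F : V ⥤ W} {U : W ⥤ V}
  {adj : F ⊣ U} {E : Multitensor V} {H : Multitensor W} (T : Transport adj E H)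

lemma unitHomMap_σ (L : List V) (h : ((L.map fun X => [X]).map (List.map F.obj)).flatten = L.map F.obj) :
    H.E.map (unitHomMap F H L) ≫ H.σ _ _ h = 𝟙 _ := by
  have key : ∀ L : List V, (L.map fun X => [X]).map (List.map F.obj) = (L.map F.obj).map (fun X => [X]) ∧
      HEq (unitHomMap F H L) (unitHom H.E H.η (L.map F.obj)) := by
    intro L
    induction L with
    | nil => exact ⟨rfl, HEq.rfl⟩
    | cons X L ih => exact ⟨congrArg _ ih.1, consHom_heq _ rfl (congrArg _ ih.1) ih.2⟩
  obtain ⟨h1, h2⟩ := key L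
  have gen : ∀ (M : List _) (k : L.map F.obj ⟶ M.map _) (hM : M = (L.map F.obj).map (fun X => [X]))
      (hk : HEq k (unitHom H.E H.η (L.map F.obj))) (h : _ = L.map F.obj),
      H.E.map k ≫ H.σ M _ h = 𝟙 _ := by
    rintro M k rfl hk h
    cases hk
    exact H.unit_right _ h
  exact gen _ _ h1 h2 h

variable [hη : ∀ X, IsIso (H.η X)]

def mSeq : ∀ L : List V, (L.map fun X => [X]).map E.E.obj ⟶ (L.map F.obj).map U.obj
  | [] => 𝟙 []
  | X :: L => consHom (T.m X) (mSeq L)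

instance : ∀ L : List V, IsIso (T.mSeq L)
  | [] => inferInstanceAs (IsIso (𝟙 []))
  | X :: L => by
    have := instIsIsoListMSeq L
    unfold mSeq; infer_instance

def _root_.GrayLift.counitFree (adj : F ⊣ U) : ∀ L : List V, ((L.map F.obj).map U.obj).map F.obj ⟶ L.map F.obj
  | [] => 𝟙 []
  | X :: L => consHom (adj.counit.app (F.obj X)) (counitFree adj L)

lemma mSeq_counitFree : ∀ L : List V, mapMHom F (T.mSeq L) ≫ counitFree adj L ≫ unitHomMap F H L =
    transportHom F E.E H.E T.r (L.map fun X => [X])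
  | [] => rfl
  | X :: L => by
    refine Prod.ext ?_ (mSeq_counitFree L)
    change F.map ((T.e [X]).hom ≫ U.map _) ≫ adj.counit.app _ ≫ H.η (F.obj X) =
      F.map (T.e [X]).hom ≫ adj.counit.app (H.E.obj [F.obj X])
    have h := adj.counit_naturality (inv (H.η (F.obj X)))
    rw [F.map_comp, Category.assoc, reassoc_of% h, IsIso.inv_hom_id, Category.comp_id]

lemma mSeq_e (L : List V) (h : (L.map fun X => [X]).flatten = L) :
    E.E.map (T.mSeq L) ≫ (T.e _).hom ≫ U.map (H.E.map (counitFree adj L)) = E.σ _ L h ≫ (T.e L).hom := by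
  have h' : ((L.map fun X => [X]).map (List.map F.obj)).flatten = L.map F.obj := by
    rw [← List.map_flatten, h]
  have e1 : H.E.map (mapMHom F (T.mSeq L)) ≫ H.E.map (counitFree adj L) =
      H.E.map (transportHom F E.E H.E T.r _) ≫ H.σ _ _ h' := by
    rw [← mSeq_counitFree, H.E.map_comp, H.E.map_comp, Category.assoc, Category.assoc,
      unitHomMap_σ, Category.comp_id]
  refine Eq.trans ?_ (T.subst _ L h h').symm
  refine (Category.assoc _ _ _).symm.trans ((congrArg (· ≫ _) (T.natural _)).trans
    ((Category.assoc _ _ _).trans (congrArg _ ?_)))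
  rw [← U.map_comp]
  exact congrArg U.map e1

def uc (adj : F ⊣ U) (X : EGraph.{w} W) : ∀ {a b : X.obj} (p : Chain X.obj a b),
    (((gU U X).homs p).map F.obj).map U.obj ⟶ (gU U X).homs p
  | _, _, .nil _ => 𝟙 []
  | _, _, .cons a (b := b) p => consHom (U.map (adj.counit.app (X.hom a b))) (uc adj X p)

lemma mSeq_uc {X : EGraph.{w} W} {κ : ∀ {a b : X.obj} (p : Chain X.obj a b),
      E.E.obj ((gU U X).homs p) ⟶ U.obj (X.hom a b)} {h₁ h₂}
    (hq : ∀ a b, T.q (X.hom a b) = κ (.single a b)) : ∀ {a b : X.obj} (p : Chain X.obj a b),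
    T.mSeq ((gU U X).homs p) ≫ uc adj X p = (ECat.mk (F := E) (gU U X) κ h₁ h₂).singComp p
  | _, _, .nil _ => rfl
  | _, _, .cons a (b := b) p => Prod.ext (hq a b) (mSeq_uc hq p)

end Abstract

open TwoCat

lemma _root_.GrayLift.TwoCat.IsSplit.precomp {R S Y S' : TwoCat.{u}} {d₀ d₁ : R ⟶ S} {e : S ⟶ Y}
    (h : IsSplit d₀ d₁ e) (i : S' ⟶ S) [IsIso i] : IsSplit (d₀ ≫ inv i) (d₁ ≫ inv i) (i ≫ e) where
  w := by simpa using h.w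
  refl := by
    obtain ⟨r, h0, h1⟩ := h.refl
    exact ⟨i ≫ r, by rw [Category.assoc, reassoc_of% h0, IsIso.hom_inv_id],
      by rw [Category.assoc, reassoc_of% h1, IsIso.hom_inv_id]⟩
  bij := h.bij.comp ⟨Function.LeftInverse.injective (g := _⁰) fun x =>
      Hom.congr_f0 (IsIso.hom_inv_id i) x, fun x => ⟨_, Hom.congr_f0 (IsIso.inv_hom_id i) x⟩⟩
  split := by
    obtain ⟨s, t, h1, h2, h3⟩ := h.split
    have k1 : (inv i).toHom ≫ i.toHom = 𝟙 _ := congrArg Hom.toHom (IsIso.inv_hom_id i)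
    have k2 : i.toHom ≫ (inv i).toHom = 𝟙 _ := congrArg Hom.toHom (IsIso.hom_inv_id i)
    refine ⟨s ≫ (inv i).toHom, i.toHom ≫ t, ?_, ?_, ?_⟩
    · change (s ≫ (inv i).toHom) ≫ i.toHom ≫ e.toHom = _
      rw [Category.assoc, reassoc_of% k1, h1]
    · change (i.toHom ≫ t) ≫ d₀.toHom ≫ (inv i).toHom = _
      rw [Category.assoc, reassoc_of% h2, k2]
    · change (i.toHom ≫ t) ≫ d₁.toHom ≫ (inv i).toHom = (i.toHom ≫ e.toHom) ≫ s ≫ (inv i).toHom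
      rw [Category.assoc, reassoc_of% h3, Category.assoc]

variable {E : Multitensor Glob2.{u}} {H : Multitensor TwoCat.{u}} (T : Transport freeAdj E H)

lemma isSplitSeq_cH (X : EGraph.{w} TwoCat.{u}) : ∀ {a b : X.obj} (p : Chain X.obj a b),
    IsSplitSeq (counitFree freeAdj ((gU forget X).homs p)) (mapMHom freeFunctor (uc freeAdj X p)) (cH freeAdj X p)
  | _, _, .nil _ => .nil
  | _, _, .cons a (b := b) p => .cons (isSplit_counit _) (isSplitSeq_cH X p)

lemma exists_isSplitSeq_transportHom : ∀ LL : List (List Glob2.{u}),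
    ∃ (R : List TwoCat.{u}) (d₀ d₁ : R ⟶ _), IsSplitSeq d₀ d₁ (transportHom freeFunctor E.E H.E T.r LL)
  | [] => ⟨_, _, _, .nil⟩
  | L :: LL => by
    obtain ⟨R, d₀, d₁, h⟩ := exists_isSplitSeq_transportHom LL
    exact ⟨_, _, _, .cons ((isSplit_counit _).precomp _) h⟩

variable [hη : ∀ X, IsIso (H.η X)] [hσ : ∀ LL L h, IsIso (H.σ LL L h)]
  (hq : ∀ {R S Y : List TwoCat.{u}} {d₀ d₁ : R ⟶ S} {e : S ⟶ Y}, IsSplitSeq d₀ d₁ e →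
    IsQuot (H.E.map d₀) (H.E.map d₁) (H.E.map e))

include hq

lemma epi_cH (X : EGraph.{w} TwoCat.{u}) {a b : X.obj} (p : Chain X.obj a b) :
    Epi (H.E.map (cH freeAdj X p)) :=
  ⟨fun _ _ h => (hq (isSplitSeq_cH X p)).epi _ _ h⟩

lemma epi_rP (X : EGraph.{w} TwoCat.{u}) {a b : X.obj} (P : Chain₂ X.obj a b) :
    Epi (H.E.map (T.rP (X := X) P)) := by
  obtain ⟨R, d₀, d₁, h⟩ := T.exists_isSplitSeq_transportHom ((gU forget X).homs₂ P)
  have h₁ : Epi _ := ⟨fun _ _ k => (hq h).epi _ _ k⟩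
  have h' : (((gU forget X).homs₂ P).map (List.map freeFunctor.obj)).flatten =
      ((gU forget X).homs P.flatten).map freeFunctor.obj := by
    rw [← List.map_flatten, EGraph.flatten_homs₂]
  have hn := H.σ_natural' (cH₂ freeAdj X P) h' (X.flatten_homs₂ P) _ (flattenHom_cH₂ _ X P)
  have h₂ : Epi (H.E.map (mapMHom H.E (cH₂ freeAdj X P))) := by
    have e : H.E.map (mapMHom H.E (cH₂ freeAdj X P)) = H.σ _ _ h' ≫ H.E.map (cH freeAdj X _) ≫
        inv (H.σ _ _ (X.flatten_homs₂ P)) := by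
      rw [← Category.assoc, IsIso.eq_comp_inv]
      exact hn
    have := epi_cH hq X P.flatten
    rw [e]
    infer_instance
  rw [rP_eq, H.E.map_comp]
  exact epi_comp _ _

lemma full_ecat : (T.ecat : ECat.{w} H ⥤ ECat.{w} E).Full where
  map_surjective {X Y} f := by
    obtain ⟨⟨o, f⟩, hf⟩ := f
    have hsingle : ∀ (Z : ECat.{w} H) (a b : _), T.κE Z.κ (.single a b) = T.q _ := by
      intro Z a b
      have h1 := (IsIso.inv_eq_of_hom_inv_id (Z.unit a b)).symm
      have h2 := inv_η_natural (H := H) (freeAdj.counit.app (Z.graph.hom a b))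
      rw [κE_single, h1]
      refine (congrArg (fun k => _ ≫ forget.map k) h2).trans ?_
      rw [q, m, Category.assoc, ← forget.map_comp]
      rfl
    have hG := fun a b => by
      have := hf (Chain.single a b)
      change E.E.map _ ≫ T.κE Y.κ (.single (o a) (o b)) = T.κE X.κ (.single a b) ≫ f a b at this
      exact exists_of_alg_hom _ (T.alg_hom _ ((congrArg _ (hsingle Y (o a) (o b)).symm).trans
        (this.trans (congrArg (· ≫ f a b) (hsingle X a b)))))
    choose G hG using hG
    obtain rfl : f = fun a b => forget.map _ := funext fun a => funext fun b => (hG a b).symm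
    let g : _ ⟶ Y.graph := EGraph.Hom.mk o G
    refine ⟨⟨g, fun p => ?_⟩, rfl⟩
    have e := epi_cH hq _ p
    have h := (T.map_κE g p).symm.trans ((hf p).trans (T.κE_comp g p))
    have h' := forget.map_injective ((cancel_epi (T.e _).hom).1 h)
    exact (cancel_epi _).1 h'

lemma exists_ecat_of_graph (X : EGraph.{w} TwoCat.{u})
    (κ : ∀ {a b : X.obj} (p : Chain X.obj a b), E.E.obj ((gU forget X).homs p) ⟶ forget.obj (X.hom a b))
    (h₁ h₂) (hκ : ∀ a b, T.q (X.hom a b) = κ (.single a b)) :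
    ∃ Z : ECat.{w} H, T.ecat.obj Z = ECat.mk (F := E) (gU forget X) κ h₁ h₂ := by
  let Y : ECat.{w} E := ECat.mk (gU forget X) κ h₁ h₂
  have hG : ∀ {a b : X.obj} (p : Chain X.obj a b), ∃ G : H.E.obj _ ⟶
      X.hom a b, (T.e _).hom ≫ forget.map G = κ p := by
    intro a b p
    have h : [(gU forget X).homs p].flatten = (gU forget X).homs p := by simp
    have e1 := (congrArg _ (hκ a b)).trans (Y.assoc_single p h)
    have e2 := T.σ_e _ h
    have e3 : consHom (κ p) (𝟙 []) = consHom (T.e _).hom (𝟙 []) ≫ consHom ((T.e _).inv ≫ κ p) (𝟙 []) := by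
      rw [← consHom_comp, Iso.hom_inv_id_assoc, Category.comp_id]
    obtain ⟨G, hG⟩ := exists_of_alg_hom _ (T.alg_hom _ (by
      refine (cancel_epi (E.E.map (consHom (T.e ((gU forget X).homs p)).hom (𝟙 [])))).1 ?_
      refine (Category.assoc _ _ _).symm.trans (Eq.trans (congrArg (· ≫ _) ((E.E.map_comp _ _).symm.trans
        (congrArg _ e3.symm))) (e1.trans ?_))
      refine Eq.trans ?_ (Category.assoc _ _ _)
      refine Eq.trans ?_ (congrArg (· ≫ _) e2)
      refine Eq.trans ?_ (Category.assoc _ _ _).symm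
      rw [Iso.hom_inv_id_assoc]))
    exact ⟨G, by rw [hG, Iso.hom_inv_id_assoc]⟩
  choose G hG using @hG
  have hK : ∀ {a b : X.obj} (p : Chain X.obj a b), ∃ k : H.E.obj _ ⟶ X.hom a b,
      H.E.map (cH freeAdj X p) ≫ k = G p := by
    intro a b p
    refine (hq (isSplitSeq_cH X p)).desc (G p) (forget.map_injective ?_)
    have hf : (((gU forget X).homs p).map fun X => [X]).flatten = (gU forget X).homs p := by
      induction (gU forget X).homs p with
      | nil => rfl
      | cons Y L ih => exact congrArg _ ih
    refine (cancel_epi (T.e _).hom).1 ((cancel_epi (E.E.map (T.mSeq _))).1 ?_)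
    have e1 := T.mSeq_e _ hf
    have e2 := T.natural (uc freeAdj X p)
    rw [forget.map_comp, forget.map_comp]
    refine Eq.trans (b := E.σ _ _ hf ≫ κ p) ?_ ?_
    · grind
    · refine (Y.assoc_singles p hf).symm.trans ?_
      refine (congrArg (fun k => E.E.map k ≫ κ p) (T.mSeq_uc hκ p).symm).trans ?_
      rw [E.E.map_comp, Category.assoc, ← hG]
      refine congrArg _ ?_
      refine (Category.assoc _ _ _).symm.trans ((congrArg (· ≫ _) e2).trans (Category.assoc _ _ _))
  choose k hk using @hK
  have hkE : ∀ {a b : X.obj} (p : Chain X.obj a b), T.κE k p = κ p := fun p => by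
    rw [κE, hk, hG]
  obtain rfl : _ = @κ := by
    funext a b p
    exact hkE p
  refine ⟨⟨X, k, fun a b => forget.map_injective ?_, fun P => ?_⟩, rfl⟩
  · rw [← T.η_κE k a b]
    exact (h₁ a b).trans (forget.map_id _).symm
  · have := T.epi_rP hq X P
    have h := (T.compHom_κE k P).symm.trans ((h₂ P).trans (T.σ_κE k P))
    exact (cancel_epi _).1 (forget.map_injective ((cancel_epi (T.e _).hom).1 h))

lemma ecat_surjective : Function.Surjective (T.ecat : ECat.{w} H ⥤ ECat.{w} E).obj := by
  intro Y
  have hZ := fun a b => T.exists_twoCat _ _ (Y.unit a b) (Y.assoc_single (.single a b) rfl).symm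
  obtain ⟨⟨o, hom⟩, κ, h₁, h₂⟩ := Y
  have hZ' : ∃ Z : o → o → TwoCat.{u}, (fun a b => forget.obj (Z a b)) = hom ∧
      ∀ a b, HEq (T.q (Z a b)) (κ (.single a b)) := by
    choose Z hZ hh using hZ
    exact ⟨Z, funext fun a => funext fun b => hZ a b, hh⟩
  obtain ⟨Z, rfl, hh⟩ := hZ'
  exact T.exists_ecat_of_graph hq ⟨o, Z⟩ κ h₁ h₂ (fun a b => eq_of_heq (hh a b))

end Transport

lemma Amnestic.comp {A : Type*} [Category A] {B : Type*} [Category B] {C : Type*} [Category C]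
    {F : A ⥤ B} {G : B ⥤ C} [G.Faithful] (hF : Amnestic F) (hG : Amnestic G) : Amnestic (F ⋙ G) := by
  intro a a' f h hf
  have h' := hG _ _ _ h hf
  refine hF a a' f h' (G.map_injective (hf.trans ?_))
  rw [eqToHom_map]

lemma ECat.amnestic_forget {V : Type u} [Category.{v} V] (H : Multitensor V) :
    Amnestic (ECat.forget.{w} H) := by
  rintro ⟨X, κ, h₁, h₂⟩ ⟨X', κ', h₁', h₂'⟩ ⟨f, hf⟩ h e
  obtain rfl : X = X' := h
  obtain rfl : f = 𝟙 X := e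
  obtain rfl : @κ = @κ' := by
    funext a b p
    have h := congrArg (fun s : _ => H.E.map s.2 ≫ κ' s.1) (X.homsMap_id p)
    have h3 : H.E.map _ ≫ κ' p = κ p ≫ 𝟙 _ := h.symm.trans (hf p)
    rw [H.E.map_id, Category.id_comp, Category.comp_id] at h3
    exact h3.symm
  rfl

lemma EGraph.eq_eqToHom {V : Type u} [Category.{v} V] {o : Type w} {A B : o → o → V}
    (h : (⟨o, A⟩ : EGraph.{w} V) = ⟨o, B⟩) : ∃ h' : ∀ a b, A a b = B a b,
      eqToHom h = EGraph.Hom.mk (X := ⟨o, A⟩) (Y := ⟨o, B⟩) (fun a => a) (fun a b => eqToHom (h' a b)) := by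
  cases h
  exact ⟨fun _ _ => rfl, rfl⟩

lemma EGraph.amnestic_mapFunctor {V : Type u} [Category.{v} V] {W : Type u'} [Category.{v'} W] {U : W ⥤ V}
    (hU : Amnestic U) : Amnestic (EGraph.mapFunctor.{w} U) := by
  rintro ⟨o, X⟩ ⟨o', X'⟩ ⟨f, g⟩ h hf
  obtain rfl : o = o' := congrArg EGraph.obj h
  obtain ⟨h', e⟩ := EGraph.eq_eqToHom h
  have hf' := hf.trans e
  obtain rfl : f = fun a => a := congrArg EGraph.Hom.obj hf'
  exact congrArg _ (funext fun a => funext fun b => hU _ _ _ _ (EGraph.Hom.eq_mk hf' a b))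

instance EGraph.faithful_mapFunctor {V : Type u} [Category.{v} V] {W : Type u'} [Category.{v'} W]
    {U : W ⥤ V} [U.Faithful] : (EGraph.mapFunctor.{w} U).Faithful where
  map_injective {X Y f g} h := by
    obtain ⟨o, f⟩ := f
    obtain ⟨o', g⟩ := g
    obtain rfl : o = o' := congrArg EGraph.Hom.obj h
    exact EGraph.Hom.ext rfl (heq_of_eq (funext fun a => funext fun b =>
      U.map_injective (EGraph.Hom.eq_mk h a b)))

def Transport.ecatIso {E : Multitensor Glob2.{u}} {H : Multitensor TwoCat.{u}}
    (T : Transport TwoCat.freeAdj E H) [hη : ∀ X, IsIso (H.η X)] [hσ : ∀ LL L h, IsIso (H.σ LL L h)]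
    (hq : ∀ {R S Y : List TwoCat.{u}} {d₀ d₁ : R ⟶ S} {e : S ⟶ Y}, IsSplitSeq d₀ d₁ e →
      TwoCat.IsQuot (H.E.map d₀) (H.E.map d₁) (H.E.map e)) :
    IsoOver (ECat.forget.{w} H ⋙ EGraph.mapFunctor.{w} TwoCat.forget) (ECat.forget.{w} E) := by
  have := T.full_ecat.{w} hq
  exact IsoOver.ofFF T.ecat rfl (T.ecat_surjective hq)
    ((ECat.amnestic_forget H).comp (EGraph.amnestic_mapFunctor TwoCat.amnestic_forget))

def grayEcatIso :
    IsoOver (ECat.forget.{w} grayH.{u} ⋙ EGraph.mapFunctor.{w} TwoCat.forget) (ECat.forget.{w} grayE) :=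
  have := grayH_isIso_η.{u}
  have := grayH_isIso_σ.{u}
  grayTransport.ecatIso IsSplitSeq.isQuot

end

section

section Distributive

variable {V : Type u} [Category.{v} V] {W : Type u'} [Category.{v'} W]

def Dist (Φ : List V ⥤ W) : Prop := ∀ (L₁ L₂ : List V) (J : Type w),
  Nonempty (PreservesColimitsOfShape (Discrete J) (insertAt L₁ L₂ ⋙ Φ))

def consF (X : V) : List V ⥤ List V where
  obj L := X :: L
  map f := consHom (𝟙 X) f
  map_comp f g := Prod.ext (Category.comp_id (𝟙 X)).symm rfl

lemma Dist.cons {Φ : List V ⥤ W} (h : Dist.{w} Φ) (X : V) : Dist.{w} (consF X ⋙ Φ) :=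
  fun L₁ L₂ J => h (X :: L₁) L₂ J

variable [HasCoproducts.{w} V]

def Dist.isColimit {Φ : List V ⥤ W} (h : Dist.{w} Φ) {J : Type w} (Z : J → V) (L : List V) :
    IsColimit (Cofan.mk (Φ.obj ((∐ Z) :: L)) fun j => Φ.map (consHom (Sigma.ι Z j) (𝟙 L))) :=
  have := (h [] L J).some
  isColimitCofanMkObjOfIsColimit (insertAt [] L ⋙ Φ) Z (Sigma.ι Z) (coproductIsCoproduct Z)

end Distributive

section Refinements

variable {S : Type w}

def Ref : ∀ {a b : S}, Chain S a b → Type w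
  | _, _, .nil _ => PUnit
  | _, _, .cons a (b := b) q => Chain S a b × Ref q

namespace Ref

def cat : ∀ {a b : S} {q : Chain S a b}, Ref q → Chain S a b
  | _, _, .nil a, _ => .nil a
  | _, _, .cons _ _, r => r.1.append (cat r.2)

def map {S' : Type w} (f : S → S') : ∀ {a b : S} {q : Chain S a b}, Ref q → Ref (q.map f)
  | _, _, .nil _, _ => PUnit.unit
  | _, _, .cons _ _, r => (r.1.map f, map f r.2)

def append : ∀ {a b c : S} {q : Chain S a b} {q' : Chain S b c}, Ref q → Ref q' → Ref (q.append q')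
  | _, _, _, .nil _, _, _, r' => r'
  | _, _, _, .cons _ _, _, r, r' => (r.1, append r.2 r')

lemma _root_.GrayLift.Chain.append_assoc : ∀ {a b c d : S} (p : Chain S a b) (q : Chain S b c) (r : Chain S c d),
    (p.append q).append r = p.append (q.append r)
  | _, _, _, _, .nil _, _, _ => rfl
  | _, _, _, _, .cons a p, q, r => congrArg (Chain.cons a) (append_assoc p q r)

lemma _root_.GrayLift.Chain.map_append {S' : Type w} (f : S → S') : ∀ {a b c : S} (p : Chain S a b) (q : Chain S b c),
    (p.append q).map f = (p.map f).append (q.map f)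
  | _, _, _, .nil _, _ => rfl
  | _, _, _, .cons a p, q => congrArg (Chain.cons (f a)) (map_append f p q)

lemma cat_append : ∀ {a b c : S} {q : Chain S a b} {q' : Chain S b c} (r : Ref q) (r' : Ref q'),
    (append r r').cat = r.cat.append r'.cat
  | _, _, _, .nil _, _, _, _ => rfl
  | _, _, _, .cons _ _, _, r, r' => (congrArg r.1.append (cat_append r.2 r')).trans
      (Chain.append_assoc _ _ _).symm

lemma cat_map {S' : Type w} (f : S → S') : ∀ {a b : S} {q : Chain S a b} (r : Ref q),
    (r.map f).cat = r.cat.map f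
  | _, _, .nil _, _ => rfl
  | _, _, .cons _ _, r => (congrArg (Chain.append _) (cat_map f r.2)).trans (Chain.map_append f _ _).symm

def ofChain₂ : ∀ {a b : S} (P : Chain₂ S a b), Ref P.outer
  | _, _, .nil _ => PUnit.unit
  | _, _, .cons p P => (p, ofChain₂ P)

def toChain₂ : ∀ {a b : S} {q : Chain S a b}, Ref q → Chain₂ S a b
  | _, _, .nil a, _ => .nil a
  | _, _, .cons _ _, r => .cons r.1 (toChain₂ r.2)

variable {V : Type u} [Category.{v} V] (F : List V ⥤ V) {X : S → S → V} {Y : S → S → V}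

abbrev _root_.GrayLift.hs (X : S → S → V) {a b : S} (p : Chain S a b) : List V := EGraph.homs ⟨S, X⟩ p

def sel (X : S → S → V) : ∀ {a b : S} {q : Chain S a b}, Ref q → List (List V)
  | _, _, .nil _, _ => []
  | _, _, .cons _ _, r => hs X r.1 :: sel X r.2

lemma flatten_sel : ∀ {a b : S} {q : Chain S a b} (r : Ref q), (r.sel X).flatten = hs X r.cat
  | _, _, .nil _, _ => rfl
  | _, _, .cons _ _, r => (congrArg (hs X r.1 ++ ·) (flatten_sel r.2)).trans (EGraph.homs_append _ _ _).symm

lemma sel_append : ∀ {a b c : S} {q : Chain S a b} {q' : Chain S b c} (r : Ref q) (r' : Ref q'),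
    (append r r').sel X = r.sel X ++ r'.sel X
  | _, _, _, .nil _, _, _, _ => rfl
  | _, _, _, .cons _ _, _, r, r' => congrArg (List.cons _) (sel_append r.2 r')

def hom (κ : ∀ {a b : S} (p : Chain S a b), F.obj (hs X p) ⟶ Y a b) :
    ∀ {a b : S} {q : Chain S a b} (r : Ref q), (r.sel X).map F.obj ⟶ hs Y q
  | _, _, .nil _, _ => 𝟙 []
  | _, _, .cons _ _, r => consHom (κ r.1) (hom κ r.2)

variable (κ : ∀ {a b : S} (p : Chain S a b), F.obj (hs X p) ⟶ Y a b)

lemma hom_append : ∀ {a b c : S} {q : Chain S a b} {q' : Chain S b c} (r : Ref q) (r' : Ref q'),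
    HEq (appendHom (r.hom F κ) (r'.hom F κ)) ((append r r').hom F κ)
  | _, _, _, .nil _, _, _, _ => HEq.rfl
  | _, _, _, .cons _ _, _, r, r' => consHom_heq _
      (List.map_append.symm.trans (congrArg (List.map F.obj) (sel_append r.2 r').symm)) (EGraph.homs_append _ _ _).symm (hom_append r.2 r')

lemma ofChain₂_sel : ∀ {a b : S} (P : Chain₂ S a b), (ofChain₂ P).sel X = EGraph.homs₂ ⟨S, X⟩ P
  | _, _, .nil _ => rfl
  | _, _, .cons _ P => congrArg (List.cons _) (ofChain₂_sel P)

lemma ofChain₂_cat : ∀ {a b : S} (P : Chain₂ S a b), (ofChain₂ P).cat = P.flatten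
  | _, _, .nil _ => rfl
  | _, _, .cons p P => congrArg p.append (ofChain₂_cat P)

lemma ofChain₂_hom (κ : ∀ {a b : S} (p : Chain S a b), F.obj (hs X p) ⟶ X a b) :
    ∀ {a b : S} (P : Chain₂ S a b), HEq ((ofChain₂ P).hom F κ) (compHom F ⟨S, X⟩ κ P)
  | _, _, .nil _ => HEq.rfl
  | _, _, .cons _ P => consHom_heq _ (congrArg (List.map F.obj) (ofChain₂_sel P)) rfl (ofChain₂_hom κ P)

lemma toChain₂_spec (κ : ∀ {a b : S} (p : Chain S a b), F.obj (hs X p) ⟶ X a b) :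
    ∀ {a b : S} {q : Chain S a b} (r : Ref q), r.toChain₂.outer = q ∧ r.toChain₂.flatten = r.cat ∧
      EGraph.homs₂ ⟨S, X⟩ r.toChain₂ = r.sel X ∧ HEq (compHom F ⟨S, X⟩ κ r.toChain₂) (r.hom F κ)
  | _, _, .nil _, _ => ⟨rfl, rfl, rfl, HEq.rfl⟩
  | _, _, .cons a q, r => by
    obtain ⟨h1, h2, h3, h4⟩ := toChain₂_spec κ r.2
    exact ⟨congrArg (Chain.cons a) h1, congrArg r.1.append h2, congrArg (List.cons _) h3,
      consHom_heq _ (congrArg (List.map F.obj) h3) (congrArg (hs X) h1) h4⟩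

end Ref

end Refinements

namespace ECat

variable {V : Type u} [Category.{v} V] {F : Multitensor V}

lemma assoc_ref (Z : ECat.{w} F) {a b : Z.graph.obj} {q : Chain Z.graph.obj a b} (r : Ref q) :
    F.E.map (r.hom F.E Z.κ) ≫ Z.κ q = F.σ (r.sel Z.graph.hom) _ r.flatten_sel ≫ Z.κ r.cat := by
  obtain ⟨h1, h2, h3, h4⟩ := r.toChain₂_spec F.E Z.κ
  exact Z.assoc' _ h1 h2 h3 _ h4 _

def ofRef {S : Type w} (X : S → S → V) (κ : ∀ {a b : S} (p : Chain S a b), F.E.obj (hs X p) ⟶ X a b)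
    (unit : ∀ a b, F.η (X a b) ≫ κ (.single a b) = 𝟙 _)
    (assoc : ∀ {a b : S} {q : Chain S a b} (r : Ref q),
      F.E.map (r.hom F.E κ) ≫ κ q = F.σ (r.sel X) _ r.flatten_sel ≫ κ r.cat) : ECat.{w} F where
  graph := ⟨S, X⟩
  κ := κ
  unit := unit
  assoc {a b} P := by
    have gen : ∀ {M M' : List (List V)} {r r' : Chain S a b} (q : Chain S a b) (c : M.map F.E.obj ⟶ hs X q)
        (c' : M'.map F.E.obj ⟶ hs X q) (h : M.flatten = hs X r) (h' : M'.flatten = hs X r')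
        (_ : M = M') (_ : r = r') (_ : HEq c c'), F.E.map c ≫ κ q = F.σ M _ h ≫ κ r →
        F.E.map c' ≫ κ q = F.σ M' _ h' ≫ κ r' := by
      rintro M _ r _ q c c' h h' rfl rfl hc e
      cases hc
      exact e
    exact gen _ _ _ _ _ (Ref.ofChain₂_sel P) (Ref.ofChain₂_cat P) (Ref.ofChain₂_hom F.E κ P) (assoc (Ref.ofChain₂ P))

end ECat

end

section

section

lemma cancel_id {C : Type u} [Category.{v} C] {A B : C} {i : A ⟶ A} (hi : i = 𝟙 A) {f g : A ⟶ B}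
    (h : i ≫ f = i ≫ g) : f = g := by
  subst hi; simpa using h

lemma cancel_comp {C : Type u} [Category.{v} C] {A B D E : C} {k : A ⟶ D} {i : A ⟶ B} {j : B ⟶ D}
    (hk : k = i ≫ j) {f g : D ⟶ E} (h : k ≫ f = k ≫ g) : i ≫ j ≫ f = i ≫ j ≫ g := by
  subst hk; simpa using h

lemma paste {C : Type u} [Category.{v} C] {A B D D' E E' Z : C} {m : A ⟶ B} {c : B ⟶ D} {k : D ⟶ Z}
    {s : B ⟶ D'} {k' : D' ⟶ Z} {t : A ⟶ E} {i : E ⟶ D} {t' : A ⟶ E'} {i' : E' ⟶ D'} {l : E ⟶ Z} {l' : E' ⟶ Z}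
    (h₁ : m ≫ c = t ≫ i) (h₂ : i ≫ k = l) (h₃ : m ≫ s = t' ≫ i') (h₄ : i' ≫ k' = l') (h : t ≫ l = t' ≫ l') :
    m ≫ c ≫ k = m ≫ s ≫ k' := by
  rw [reassoc_of% h₁, reassoc_of% h₃, h₂, h₄, h]

variable {V : Type u} [Category.{v} V] (F : Multitensor V) {S : Type w} (X : S → S → V) [HasCoproducts.{w} V]

def Γ (a b : S) : V := ∐ fun p : Chain S a b => F.E.obj (hs X p)

def Γι {a b : S} (p : Chain S a b) : F.E.obj (hs X p) ⟶ Γ F X a b :=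
  Sigma.ι (fun p : Chain S a b => F.E.obj (hs X p)) p

variable {F X}

lemma Γ_ext {a b : S} {Z : V} {f g : Γ F X a b ⟶ Z} (h : ∀ p, Γι F X p ≫ f = Γι F X p ≫ g) : f = g :=
  Sigma.hom_ext _ _ h

lemma Γ_desc {a b : S} {Z : V} (f : ∀ p : Chain S a b, F.E.obj (hs X p) ⟶ Z) :
    ∃ g : Γ F X a b ⟶ Z, ∀ p, Γι F X p ≫ g = f p := ⟨Sigma.desc f, Sigma.ι_desc f⟩

variable {W : Type u'} [Category.{v'} W]

lemma Dist.ext_Γ {Φ : List V ⥤ W} (h : Dist.{w} Φ) {a b : S} {L : List V} {Z : W}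
    {f g : Φ.obj (Γ F X a b :: L) ⟶ Z}
    (e : ∀ p, Φ.map (consHom (Γι F X p) (𝟙 L)) ≫ f = Φ.map (consHom (Γι F X p) (𝟙 L)) ≫ g) : f = g :=
  Cofan.IsColimit.hom_ext (h.isColimit (fun p : Chain S a b => F.E.obj (hs X p)) L) _ _ e

lemma map_cons {Φ : List V ⥤ W} {A B : V} {L M : List V} (f : A ⟶ B) (g : L ⟶ M) :
    Φ.map (consHom f g) = (consF A ⋙ Φ).map g ≫ Φ.map (consHom f (𝟙 M)) :=
  (congrArg Φ.map (Prod.ext (Category.id_comp f).symm (Category.comp_id g).symm)).trans (Φ.map_comp _ _)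

lemma Dist.ext_hom {a b : S} {q : Chain S a b} {Z : W} : ∀ {Φ : List V ⥤ W} (_ : Dist.{w} Φ)
    {f g : Φ.obj (hs (Γ F X) q) ⟶ Z}
    (_ : ∀ r : Ref q, Φ.map (r.hom F.E (Γι F X)) ≫ f = Φ.map (r.hom F.E (Γι F X)) ≫ g), f = g := by
  induction q with
  | nil a =>
    intro Φ _ f g e
    have := e PUnit.unit
    change Φ.map (𝟙 []) ≫ f = Φ.map (𝟙 []) ≫ g at this
    exact cancel_id (Φ.map_id []) this
  | cons a q ih =>
    intro Φ h f g e
    refine h.ext_Γ fun p => ih (h.cons _) fun r => ?_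
    have := e (p, r)
    change Φ.map (consHom (Γι F X p) (r.hom F.E (Γι F X))) ≫ f = Φ.map (consHom (Γι F X p) (r.hom F.E (Γι F X))) ≫ g at this
    exact cancel_comp (map_cons _ _) this

lemma Dist.desc_hom {a b : S} {q : Chain S a b} {Z : W} : ∀ {Φ : List V ⥤ W} (_ : Dist.{w} Φ)
    (f : ∀ r : Ref q, Φ.obj ((r.sel X).map F.E.obj) ⟶ Z),
    ∃ g : Φ.obj (hs (Γ F X) q) ⟶ Z, ∀ r, Φ.map (r.hom F.E (Γι F X)) ≫ g = f r := by
  induction q with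
  | nil a =>
    intro Φ _ f
    exact ⟨f PUnit.unit, fun r => (congrArg (· ≫ _) (Φ.map_id [])).trans (Category.id_comp _)⟩
  | cons a q ih =>
    intro Φ h f
    choose g hg using fun p => ih (h.cons (F.E.obj (hs X p))) (fun r => f (p, r))
    refine ⟨Cofan.IsColimit.desc (h.isColimit _ _) g, fun r => ?_⟩
    refine (congrArg (· ≫ _) (map_cons (Γι F X r.1) _)).trans ((Category.assoc _ _ _).trans ?_)
    exact (congrArg (_ ≫ ·) (Cofan.IsColimit.fac (h.isColimit _ _) g r.1)).trans (hg r.1 r.2)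

def Ref₂ : ∀ {a b : S} {q : Chain S a b}, Ref q → Type w
  | _, _, .nil _, _ => PUnit
  | _, _, .cons _ _, r => Ref r.1 × Ref₂ r.2

namespace Ref₂

def inner : ∀ {a b : S} {q : Chain S a b} {r : Ref q}, Ref₂ r → Ref q
  | _, _, .nil _, _, _ => PUnit.unit
  | _, _, .cons _ _, _, R => (R.1.cat, inner R.2)

def concat : ∀ {a b : S} {q : Chain S a b} {r : Ref q}, Ref₂ r → Ref r.cat
  | _, _, .nil _, _, _ => PUnit.unit
  | _, _, .cons _ _, _, R => R.1.append (concat R.2)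

lemma cat_concat : ∀ {a b : S} {q : Chain S a b} {r : Ref q} (R : Ref₂ r), (concat R).cat = (inner R).cat
  | _, _, .nil _, _, _ => rfl
  | _, _, .cons _ _, _, R => (Ref.cat_append _ _).trans (congrArg R.1.cat.append (cat_concat R.2))

def sel (X : S → S → V) : ∀ {a b : S} {q : Chain S a b} {r : Ref q}, Ref₂ r → List (List (List V))
  | _, _, .nil _, _, _ => []
  | _, _, .cons _ _, _, R => R.1.sel X :: sel X R.2

lemma sel_inner : ∀ {a b : S} {q : Chain S a b} {r : Ref q} (R : Ref₂ r),
    (R.sel X).map List.flatten = R.inner.sel X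
  | _, _, .nil _, _, _ => rfl
  | _, _, .cons _ _, _, R => congrArg₂ List.cons R.1.flatten_sel (sel_inner R.2)

lemma sel_concat : ∀ {a b : S} {q : Chain S a b} {r : Ref q} (R : Ref₂ r), (R.sel X).flatten = R.concat.sel X
  | _, _, .nil _, _, _ => rfl
  | _, _, .cons _ _, _, R => (congrArg (R.1.sel X ++ ·) (sel_concat R.2)).trans (Ref.sel_append _ _).symm

def inj : ∀ {a b : S} {q : Chain S a b} {r : Ref q} (R : Ref₂ r),
    (R.sel X).map (List.map F.E.obj) ⟶ r.sel (Γ F X)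
  | _, _, .nil _, _, _ => 𝟙 []
  | _, _, .cons _ _, _, R => consHom (R.1.hom F.E (Γι F X)) (inj R.2)

lemma map_sel_concat {a b : S} {q : Chain S a b} {r : Ref q} (R : Ref₂ r) :
    ((R.sel X).map (List.map F.E.obj)).flatten = (R.concat.sel X).map F.E.obj := by
  rw [← List.map_flatten, sel_concat]

lemma flattenHom_inj : ∀ {a b : S} {q : Chain S a b} {r : Ref q} (R : Ref₂ r),
    HEq (flattenHom (inj (F := F) (X := X) R)) (R.concat.hom F.E (Γι F X))
  | _, _, .nil _, _, _ => HEq.rfl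
  | _, _, .cons _ _, r, R => (appendHom_heq _ R.2.map_sel_concat r.2.flatten_sel
      (flattenHom_inj R.2)).trans (Ref.hom_append _ _ _ _)

def subst (F : Multitensor V) (X : S → S → V) : ∀ {a b : S} {q : Chain S a b} {r : Ref q} (R : Ref₂ r),
    ((R.sel X).map (List.map F.E.obj)).map F.E.obj ⟶ (R.inner.sel X).map F.E.obj
  | _, _, .nil _, _, _ => 𝟙 []
  | _, _, .cons _ _, _, R => consHom (F.σ (R.1.sel X) _ R.1.flatten_sel) (subst F X R.2)

lemma σ_heq (F : Multitensor V) (LL : List (List V)) {L L' : List V} (h : LL.flatten = L) (h' : LL.flatten = L') :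
    HEq (F.σ LL L h) (F.σ LL L' h') := by
  subst h h'; rfl

lemma subst_heq : ∀ {a b : S} {q : Chain S a b} {r : Ref q} (R : Ref₂ r),
    HEq (subst F X R) (substHom F.E F.σ (R.sel X))
  | _, _, .nil _, _, _ => HEq.rfl
  | _, _, .cons _ _, _, R => by
    have gen : ∀ {A B B' : V} {L M M' : List V} {f : A ⟶ B} {f' : A ⟶ B'} {g : L ⟶ M} {g' : L ⟶ M'},
        B = B' → M = M' → HEq f f' → HEq g g' → HEq (consHom f g) (consHom f' g') := by
      rintro A B _ L M _ f f' g g' rfl rfl hf hg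
      cases hf; cases hg; rfl
    exact gen (congrArg F.E.obj R.1.flatten_sel.symm) (congrArg (List.map F.E.obj) (sel_inner R.2).symm)
      (σ_heq F _ _ _) (subst_heq R.2)

lemma assoc {a b : S} {q : Chain S a b} {r : Ref q} (R : Ref₂ r) :
    F.E.map (subst F X R) ≫ F.σ (R.inner.sel X) _ R.inner.flatten_sel =
      F.σ _ _ R.map_sel_concat ≫ F.σ (R.concat.sel X) (hs X R.inner.cat)
        (R.concat.flatten_sel.trans (congrArg (hs X) R.cat_concat)) := by
  have gen : ∀ {LLL : List (List (List V))} {M N : List (List V)} {L : List V} (hM : LLL.map List.flatten = M)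
      (hN : LLL.flatten = N) (c : (LLL.map (List.map F.E.obj)).map F.E.obj ⟶ M.map F.E.obj)
      (_ : HEq c (substHom F.E F.σ LLL)) (h₁ : M.flatten = L) (h₂ : N.flatten = L)
      (h₃ : (LLL.map (List.map F.E.obj)).flatten = N.map F.E.obj),
      F.E.map c ≫ F.σ M L h₁ = F.σ _ _ h₃ ≫ F.σ N L h₂ := by
    rintro LLL _ _ L rfl rfl c hc h₁ h₂ h₃
    cases hc
    exact F.assoc LLL L h₁ h₂ h₃
  exact gen R.sel_inner R.sel_concat _ R.subst_heq _ _ _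

lemma mapMHom_inj (κ : ∀ {a b : S} (q : Chain S a b), F.E.obj (hs (Γ F X) q) ⟶ Γ F X a b)
    (hκ : ∀ {a b : S} {q : Chain S a b} (r : Ref q), F.E.map (r.hom F.E (Γι F X)) ≫ κ q =
      F.σ (r.sel X) _ r.flatten_sel ≫ Γι F X r.cat) :
    ∀ {a b : S} {q : Chain S a b} {r : Ref q} (R : Ref₂ r),
    mapMHom F.E (inj R) ≫ r.hom F.E κ = subst F X R ≫ R.inner.hom F.E (Γι F X)
  | _, _, .nil _, _, _ => rfl
  | _, _, .cons _ _, _, R => Prod.ext (hκ R.1) (mapMHom_inj κ hκ R.2)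

end Ref₂

lemma Dist.tensor {Φ : List V ⥤ W} (h : Dist.{w} Φ) (hF : Dist.{w} F.E) (L : List V) :
    Dist.{w} (F.E ⋙ insertAt [] L ⋙ Φ) := fun L₁ L₂ J => by
  have := (hF L₁ L₂ J).some
  have := (h [] L J).some
  exact ⟨inferInstanceAs (PreservesColimitsOfShape (Discrete J) ((insertAt L₁ L₂ ⋙ F.E) ⋙ insertAt [] L ⋙ Φ))⟩

lemma Dist.ext_inj (hF : Dist.{w} F.E) {a b : S} {q : Chain S a b} {r : Ref q} {Z : W} :
    ∀ {Φ : List V ⥤ W} (_ : Dist.{w} Φ) {f g : Φ.obj ((r.sel (Γ F X)).map F.E.obj) ⟶ Z}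
    (_ : ∀ R : Ref₂ r, Φ.map (mapMHom F.E R.inj) ≫ f = Φ.map (mapMHom F.E R.inj) ≫ g), f = g := by
  induction q with
  | nil a =>
    intro Φ _ f g e
    have := e PUnit.unit
    change Φ.map (𝟙 []) ≫ f = Φ.map (𝟙 []) ≫ g at this
    exact cancel_id (Φ.map_id []) this
  | cons a q ih =>
    intro Φ h f g e
    refine Dist.ext_hom (q := r.1) (h.tensor hF ((r.2.sel (Γ F X)).map F.E.obj)) fun s => ih (h.cons _) fun R => ?_
    have := e (s, R)
    change Φ.map (consHom (F.E.map (s.hom F.E (Γι F X))) (mapMHom F.E R.inj)) ≫ f =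
      Φ.map (consHom (F.E.map (s.hom F.E (Γι F X))) (mapMHom F.E R.inj)) ≫ g at this
    exact cancel_comp (map_cons _ _) this

def Γκ (hF : Dist.{w} F.E) {a b : S} (q : Chain S a b) : F.E.obj (hs (Γ F X) q) ⟶ Γ F X a b :=
  (Dist.desc_hom (Φ := F.E) (q := q) (X := X) hF fun r => F.σ (r.sel X) _ r.flatten_sel ≫ Γι F X r.cat).choose

lemma hom_Γκ (hF : Dist.{w} F.E) {a b : S} {q : Chain S a b} (r : Ref q) :
    F.E.map (r.hom F.E (Γι F X)) ≫ Γκ hF q = F.σ (r.sel X) _ r.flatten_sel ≫ Γι F X r.cat :=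
  (Dist.desc_hom (Φ := F.E) (q := q) (X := X) hF _).choose_spec r

lemma Γι_congr {a b : S} {p p' : Chain S a b} (h : p = p') (LL : List (List V)) (hp hp') :
    F.σ LL _ hp ≫ Γι F X p = F.σ LL _ hp' ≫ Γι F X p' := by
  subst h; rfl

variable (X)

def freeCat (hF : Dist.{w} F.E) : ECat.{w} F := ECat.ofRef (Γ F X) (Γκ hF) (fun a b => Γ_ext fun p => by
      have h := (hom_Γκ (X := X) hF (q := .single a b) (p, PUnit.unit)).trans
        (Γι_congr (ECat.append_nil p) [hs X p] _ (by simp))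
      refine (Category.assoc _ _ _).symm.trans ((congrArg (· ≫ _) (F.η_natural (Γι F X p)).symm).trans
        ((Category.assoc _ _ _).trans ((congrArg (F.η _ ≫ ·) h).trans ?_)))
      rw [← Category.assoc, F.unit_left, Category.id_comp, Category.comp_id])
    (fun {a b q} r => Dist.ext_inj hF (Φ := F.E) hF fun R => by
      refine paste ((F.E.map_comp _ _).symm.trans ((congrArg F.E.map (R.mapMHom_inj _ (hom_Γκ hF))).trans (F.E.map_comp _ _)))
        (hom_Γκ hF _) (F.σ_natural' R.inj R.map_sel_concat r.flatten_sel _ R.flattenHom_inj) (hom_Γκ hF _) ?_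
      refine (Category.assoc _ _ _).symm.trans ((congrArg (· ≫ _) R.assoc).trans ((Category.assoc _ _ _).trans ?_))
      exact congrArg (_ ≫ ·) (Γι_congr R.cat_concat.symm _ _ _))

end

end

section

section

variable {V : Type u} [Category.{v} V] {F : Multitensor V} {X Y : EGraph.{w} V}

lemma EGraph.homsMap_append (f : X ⟶ Y) : ∀ {a b c : X.obj} (p : Chain X.obj a b) (q : Chain X.obj b c),
    HEq (appendHom (homsMap f p) (homsMap f q)) (homsMap f (p.append q))
  | _, _, _, .nil _, _ => HEq.rfl
  | _, _, _, .cons a p, q => consHom_heq _ (X.homs_append p q).symm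
      ((Y.homs_append _ _).symm.trans (congrArg _ (Chain.map_append f.obj p q).symm)) (homsMap_append f p q)

namespace Ref

def selMap (k : X ⟶ Y) : ∀ {a b : X.obj} {q : Chain X.obj a b} (r : Ref q),
    r.sel X.hom ⟶ (r.map k.obj).sel Y.hom
  | _, _, .nil _, _ => 𝟙 []
  | _, _, .cons _ _, r => consHom (EGraph.homsMap k r.1) (selMap k r.2)

lemma flattenHom_selMap (k : X ⟶ Y) : ∀ {a b : X.obj} {q : Chain X.obj a b} (r : Ref q),
    HEq (flattenHom (selMap k r)) (EGraph.homsMap k r.cat)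
  | _, _, .nil _, _ => HEq.rfl
  | _, _, .cons _ _, r => (appendHom_heq _ r.2.flatten_sel ((r.2.map k.obj).flatten_sel.trans
      (congrArg (hs Y.hom) (cat_map k.obj r.2))) (flattenHom_selMap k r.2)).trans (EGraph.homsMap_append k _ _)

end Ref

namespace ECat

variable {Z Z' : ECat.{w} F}

def ev (Z : ECat.{w} F) (k : X ⟶ Z.graph) {a b : X.obj} (p : Chain X.obj a b) :
    F.E.obj (X.homs p) ⟶ Z.graph.hom (k.obj a) (k.obj b) :=
  F.E.map (EGraph.homsMap k p) ≫ Z.κ (p.map k.obj)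

lemma ev_congr {k k' : X ⟶ Z.graph} (e : k = k') {a b : X.obj} (p : Chain X.obj a b) (h) :
    Z.ev k p ≫ eqToHom h = Z.ev k' p := by
  subst e; exact Category.comp_id _

lemma ev_comp (k : X ⟶ Z.graph) (g : Z ⟶ Z') {a b : X.obj} (p : Chain X.obj a b) :
    Z.ev k p ≫ g.map.hom _ _ = Z'.ev (k ≫ g.map) p := by
  have h := congrArg (fun s : (Σ q : Chain Z'.graph.obj (g.map.obj (k.obj a)) (g.map.obj (k.obj b)),
    X.homs p ⟶ Z'.graph.homs q) => F.E.map s.2 ≫ Z'.κ s.1) (EGraph.homsMap_comp k g.map p)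
  refine Eq.trans ?_ h.symm
  change _ = F.E.map (_ ≫ _) ≫ _
  rw [F.E.map_comp, Category.assoc, g.map_κ, ev, Category.assoc]

lemma map_ev (f : X ⟶ Y) (k : Y ⟶ Z.graph) {a b : X.obj} (p : Chain X.obj a b) :
    F.E.map (EGraph.homsMap f p) ≫ Z.ev k (p.map f.obj) = Z.ev (f ≫ k) p := by
  have h := congrArg (fun s : (Σ q : Chain Z.graph.obj (k.obj (f.obj a)) (k.obj (f.obj b)),
    X.homs p ⟶ Z.graph.homs q) => F.E.map s.2 ≫ Z.κ s.1) (EGraph.homsMap_comp f k p)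
  refine Eq.trans ?_ h.symm
  change _ = F.E.map (_ ≫ _) ≫ _
  rw [F.E.map_comp, Category.assoc, ev]

lemma ev_id {a b : Z.graph.obj} (p : Chain Z.graph.obj a b) : Z.ev (𝟙 _) p = Z.κ p := by
  have h := congrArg (fun s : (Σ q : Chain Z.graph.obj a b, Z.graph.homs p ⟶ Z.graph.homs q) =>
    F.E.map s.2 ≫ Z.κ s.1) (EGraph.homsMap_id Z.graph p)
  refine h.trans ?_
  change F.E.map (𝟙 _) ≫ Z.κ p = Z.κ p
  rw [F.E.map_id, Category.id_comp]

lemma η_ev (k : X ⟶ Z.graph) (a b : X.obj) : F.η (X.hom a b) ≫ Z.ev k (.single a b) = k.hom a b := by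
  refine (Category.assoc _ _ _).symm.trans ((congrArg (· ≫ _) (F.η_natural (k.hom a b))).trans ?_)
  exact (Category.assoc _ _ _).trans ((congrArg (_ ≫ ·) (Z.unit _ _)).trans (Category.comp_id _))

def evHom (Z : ECat.{w} F) (k : X ⟶ Z.graph) : ∀ {a b : X.obj} {q : Chain X.obj a b} (r : Ref q),
    (r.sel X.hom).map F.E.obj ⟶ Z.graph.homs (q.map k.obj)
  | _, _, .nil _, _ => 𝟙 []
  | _, _, .cons _ _, r => consHom (Z.ev k r.1) (evHom Z k r.2)

lemma evHom_eq (k : X ⟶ Z.graph) : ∀ {a b : X.obj} {q : Chain X.obj a b} (r : Ref q),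
    Z.evHom k r = mapMHom F.E (r.selMap k) ≫ (r.map k.obj).hom F.E Z.κ
  | _, _, .nil _, _ => rfl
  | _, _, .cons _ _, r => Prod.ext rfl (evHom_eq k r.2)

lemma ev_ref (k : X ⟶ Z.graph) {a b : X.obj} {q : Chain X.obj a b} (r : Ref q) :
    F.E.map (Z.evHom k r) ≫ Z.κ (q.map k.obj) = F.σ (r.sel X.hom) _ r.flatten_sel ≫ Z.ev k r.cat := by
  have h := F.σ_natural' (r.selMap k) r.flatten_sel ((r.map k.obj).flatten_sel.trans
      (congrArg (hs Z.graph.hom) (Ref.cat_map k.obj r))) _ (r.flattenHom_selMap k)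
  have gen : ∀ {p p' : Chain Z.graph.obj (k.obj a) (k.obj b)} (_ : p = p') (LL : List (List V)) (hp hp'),
      F.σ LL _ hp ≫ Z.κ p = F.σ LL _ hp' ≫ Z.κ p' := by
    rintro p _ rfl LL hp hp'
    rfl
  refine (congrArg (fun k => F.E.map k ≫ _) (evHom_eq k r)).trans ((congrArg (· ≫ _) (F.E.map_comp _ _)).trans
    ((Category.assoc _ _ _).trans ((congrArg (_ ≫ ·) (Z.assoc_ref (r.map k.obj))).trans ?_)))
  refine (congrArg (_ ≫ ·) (gen (Ref.cat_map k.obj r) _ _ ((r.map k.obj).flatten_sel.trans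
      (congrArg (hs Z.graph.hom) (Ref.cat_map k.obj r))))).trans ?_
  exact (Category.assoc _ _ _).symm.trans ((congrArg (· ≫ _) h).trans (Category.assoc _ _ _))

variable [HasCoproducts.{w} V] (X) (hF : Dist.{w} F.E)

def freeUnit : X ⟶ (freeCat X.hom hF).graph :=
  EGraph.Hom.mk (X := X) (Y := (freeCat X.hom hF).graph) (fun a => a)
    (fun a b => F.η (X.hom a b) ≫ Γι F X.hom (.single a b))

lemma exists_free_desc (k : X ⟶ Z.graph) : ∃ g : freeCat X.hom hF ⟶ Z, freeUnit X hF ≫ g.map = k := by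
  choose g hg using fun a b => Γ_desc (F := F) (X := X.hom) (a := a) (b := b) (fun p => Z.ev k p)
  let m : (freeCat X.hom hF).graph ⟶ Z.graph := EGraph.Hom.mk (X := (freeCat X.hom hF).graph) k.obj g
  have key : ∀ {a b : X.obj} {q : Chain X.obj a b} (r : Ref q),
      r.hom F.E (Γι F X.hom) ≫ EGraph.homsMap m q = Z.evHom k r := by
    intro a b q
    induction q with
    | nil => exact fun _ => rfl
    | cons a q ih => exact fun r => Prod.ext (hg _ _ r.1) (ih r.2)
  refine ⟨⟨m, fun {a b} q => Dist.ext_hom (Φ := F.E) hF fun r => ?_⟩,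
    EGraph.Hom.ext rfl (heq_of_eq (funext fun a => funext fun b => ?_))⟩
  · refine (Category.assoc _ _ _).symm.trans (Eq.trans (congrArg (· ≫ _) ((F.E.map_comp _ _).symm.trans
      (congrArg F.E.map (key r)))) ((ev_ref k r).trans ?_))
    refine Eq.trans ?_ (Category.assoc _ _ _)
    refine Eq.trans ?_ (congrArg (· ≫ _) (hom_Γκ hF r).symm)
    exact (congrArg (_ ≫ ·) (hg a b r.cat).symm).trans (Category.assoc _ _ _).symm
  · exact (Category.assoc _ _ _).trans ((congrArg (_ ≫ ·) (hg a b (.single a b))).trans (η_ev k a b))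

def _root_.GrayLift.Ref.ones {S : Type w} : ∀ {a b : S} (q : Chain S a b), Ref q
  | _, _, .nil _ => PUnit.unit
  | _, _, .cons a (b := b) q => (.single a b, ones q)

lemma ι_comp (g : freeCat X.hom hF ⟶ Z) {a b : X.obj} (p : Chain X.obj a b) :
    Γι F X.hom p ≫ g.map.hom a b = Z.ev (freeUnit X hF ≫ g.map) p := by
  have spec : ∀ {a b : X.obj} (p : Chain X.obj a b), (Ref.ones p).cat = p ∧
      (Ref.ones p).sel X.hom = (X.homs p).map (fun A => [A]) ∧
      ∃ c : X.homs p ⟶ ((Ref.ones p).sel X.hom).map F.E.obj, HEq c (unitHom F.E F.η (X.homs p)) ∧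
      c ≫ (Ref.ones p).hom F.E (Γι F X.hom) ≫ EGraph.homsMap g.map p = EGraph.homsMap (freeUnit X hF ≫ g.map) p := by
    intro a b p
    induction p with
    | nil => exact ⟨rfl, rfl, 𝟙 [], HEq.rfl, rfl⟩
    | cons a p ih =>
      obtain ⟨h1, h2, c, hc, h⟩ := ih
      exact ⟨congrArg (Chain.cons a) h1, congrArg (List.cons _) h2, consHom (F.η _) c,
        consHom_heq _ rfl (congrArg (List.map F.E.obj) h2) hc, Prod.ext (Category.assoc _ _ _).symm h⟩
  obtain ⟨h1, h2, c, hc, h⟩ := spec p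
  have gen : ∀ {M : List (List V)} {q : Chain X.obj a b} (_ : q = p) (_ : M = (X.homs p).map (fun A => [A]))
      (c : X.homs p ⟶ M.map F.E.obj) (_ : HEq c (unitHom F.E F.η (X.homs p))) (hM : M.flatten = X.homs q),
      F.E.map c ≫ F.σ M _ hM ≫ Γι F X.hom q = Γι F X.hom p := by
    rintro M q rfl rfl c hc hM
    cases hc
    rw [← Category.assoc, F.unit_right, Category.id_comp]
  have e := gen h1 h2 c hc (Ref.ones p).flatten_sel
  have hg := g.map_κ p
  refine (congrArg (· ≫ g.map.hom a b) (e.symm.trans (congrArg (F.E.map c ≫ ·) (hom_Γκ hF (Ref.ones p)).symm))).trans ?_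
  refine Eq.trans ?_ (congrArg (fun k => F.E.map k ≫ Z.κ (p.map g.map.obj)) h)
  refine (Category.assoc _ _ _).trans (Eq.trans (congrArg (_ ≫ ·) ((Category.assoc _ _ _).trans
    (congrArg (_ ≫ ·) hg.symm))) ?_)
  refine Eq.trans ?_ (congrArg (· ≫ _) ((F.E.map_comp _ _).trans (congrArg (_ ≫ ·) (F.E.map_comp _ _))).symm)
  exact (congrArg (_ ≫ ·) (Category.assoc _ _ _).symm).trans (Category.assoc _ _ _).symm

lemma free_hom_ext {g g' : freeCat X.hom hF ⟶ Z} (h : freeUnit X hF ≫ g.map = freeUnit X hF ≫ g'.map) :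
    g = g' := by
  have h1 := fun {a b} => ι_comp X hF g (a := a) (b := b)
  have h2 := fun {a b} => ι_comp X hF g' (a := a) (b := b)
  obtain ⟨⟨o, m⟩, hg⟩ := g
  obtain ⟨⟨o', m'⟩, hg'⟩ := g'
  obtain rfl : o = o' := congrArg EGraph.Hom.obj h
  refine ECat.Hom.ext (EGraph.Hom.ext rfl (heq_of_eq (funext fun a => funext fun b => Γ_ext fun p => ?_)))
  refine (h1 p).trans (Eq.trans ?_ (h2 p).symm)
  exact ((Category.comp_id _).symm.trans (ev_congr h p rfl))

end ECat

end

end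

section

section

variable {V : Type u} [Category.{v} V] {F : Multitensor V}

structure EStr (F : Multitensor V) (X : EGraph.{w} V) where
  κ : ∀ {a b : X.obj} (p : Chain X.obj a b), F.E.obj (X.homs p) ⟶ X.hom a b
  unit : ∀ a b : X.obj, F.η (X.hom a b) ≫ κ (Chain.single a b) = 𝟙 _
  assoc : ∀ {a b : X.obj} (P : Chain₂ X.obj a b), F.E.map (compHom F.E X κ P) ≫ κ P.outer =
    F.σ (X.homs₂ P) (X.homs P.flatten) (X.flatten_homs₂ P) ≫ κ P.flatten

abbrev EStr.cat {X : EGraph.{w} V} (s : EStr F X) : ECat.{w} F := ⟨X, s.κ, s.unit, s.assoc⟩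

lemma IsoOver.exists_str {A : Type*} [Category A] {U : A ⥤ EGraph.{w} V}
    (I : IsoOver U (ECat.forget.{w} F)) : ∃ s : ∀ A, EStr F (U.obj A),
      (∀ {A B} (f : U.obj A ⟶ U.obj B), (∃ g : (s A).cat ⟶ (s B).cat, g.map = f) ↔ ∃ φ : A ⟶ B, U.map φ = f) ∧
      ∀ Z : ECat.{w} F, ∃ A, (s A).cat = Z := by
  obtain ⟨Φ, Ψ, h1, h2, rfl⟩ := I
  refine ⟨fun A => ⟨(Φ.obj A).κ, (Φ.obj A).unit, (Φ.obj A).assoc⟩, fun {A B} f => ?_,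
    fun Z => ⟨Ψ.obj Z, Functor.congr_obj h2 Z⟩⟩
  have : Φ.Full := (CategoryTheory.Equivalence.mk Φ Ψ (eqToIso h1.symm) (eqToIso h2)).full_functor
  constructor
  · rintro ⟨g, rfl⟩
    exact ⟨Φ.preimage g, congrArg ECat.Hom.map (Φ.map_preimage (X := A) (Y := B) g)⟩
  · rintro ⟨φ, rfl⟩
    exact ⟨Φ.map φ, rfl⟩

lemma EGraph.bijective_obj {X Y : EGraph.{w} V} (f : X ⟶ Y) (g : Y ⟶ X) (h : f ≫ g = 𝟙 _) (h' : g ≫ f = 𝟙 _) :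
    Function.Bijective f.obj :=
  ⟨Function.LeftInverse.injective (g := g.obj) fun a => congrFun (congrArg EGraph.Hom.obj h) a,
    fun b => ⟨g.obj b, congrFun (congrArg EGraph.Hom.obj h') b⟩⟩

lemma EGraph.isIso_hom {X Y : EGraph.{w} V} (f : X ⟶ Y) (g : Y ⟶ X) (h : f ≫ g = 𝟙 _) (h' : g ≫ f = 𝟙 _)
    (a b : X.obj) : IsIso (f.hom a b) := by
  have gen : ∀ {X : EGraph.{w} V} (t : X ⟶ X) (a b : X.obj), t = 𝟙 X → IsIso (t.hom a b) := by
    rintro _ _ a b rfl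
    exact inferInstanceAs (IsIso (𝟙 _))
  have six : ∀ {A B C D : V} (x : A ⟶ B) (y : B ⟶ C) (z : C ⟶ D), IsIso (x ≫ y) → IsIso (y ≫ z) → IsIso x := by
    intro A B C D x y z h1 h2
    have : Epi y := epi_of_epi x y
    have : IsSplitMono y := ⟨⟨⟨z ≫ inv (y ≫ z), by rw [← Category.assoc, IsIso.hom_inv_id]⟩⟩⟩
    have := isIso_of_epi_of_isSplitMono y
    exact IsIso.of_isIso_comp_right x y
  exact six _ _ _ (gen _ a b h) (gen _ (f.obj a) (f.obj b) h')

variable [HasCoproducts.{w} V] (hF : Dist.{w} F.E)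

lemma EStr.exists_free {A : Type*} [Category A] {U : A ⥤ EGraph.{w} V} {s : ∀ A, EStr F (U.obj A)}
    (hs : ∀ {A B} (f : U.obj A ⟶ U.obj B), (∃ g : (s A).cat ⟶ (s B).cat, g.map = f) ↔ ∃ φ : A ⟶ B, U.map φ = f)
    (hs' : ∀ Z : ECat.{w} F, ∃ A, (s A).cat = Z) {X : EGraph.{w} V} {L : A} (η : X ⟶ U.obj L)
    (h₁ : ∀ B (k : X ⟶ U.obj B), ∃ φ : L ⟶ B, η ≫ U.map φ = k)
    (h₂ : ∀ B (φ ψ : L ⟶ B), η ≫ U.map φ = η ≫ U.map ψ → φ = ψ) :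
    ∃ g : freeCat X.hom hF ⟶ (s L).cat, ECat.freeUnit X hF ≫ g.map = η ∧ Function.Bijective g.map.obj ∧
      ∀ a b, IsIso (g.map.hom a b) := by
  obtain ⟨g, hg⟩ := ECat.exists_free_desc (Z := (s L).cat) X hF η
  have e₁ : ∀ (Z : ECat.{w} F) (k : X ⟶ Z.graph), ∃ h : (s L).cat ⟶ Z, η ≫ h.map = k := by
    intro Z k
    obtain ⟨B, rfl⟩ := hs' Z
    obtain ⟨φ, hφ⟩ := h₁ B k
    obtain ⟨h, hh⟩ := (hs _).2 ⟨φ, rfl⟩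
    exact ⟨h, (congrArg (η ≫ ·) hh).trans hφ⟩
  have e₂ : ∀ (Z : ECat.{w} F) (h h' : (s L).cat ⟶ Z), η ≫ h.map = η ≫ h'.map → h = h' := by
    intro Z h h' e
    obtain ⟨B, rfl⟩ := hs' Z
    obtain ⟨φ, hφ⟩ := (hs h.map).1 ⟨h, rfl⟩
    obtain ⟨ψ, hψ⟩ := (hs h'.map).1 ⟨h', rfl⟩
    refine ECat.Hom.ext (hφ.symm.trans (Eq.trans (congrArg U.map (h₂ B φ ψ ?_)) hψ))
    exact (congrArg (η ≫ ·) hφ).trans (e.trans (congrArg (η ≫ ·) hψ.symm))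
  obtain ⟨h, hh⟩ := e₁ _ (ECat.freeUnit X hF)
  have i₁ : g ≫ h = 𝟙 _ := ECat.free_hom_ext X hF ((Category.assoc _ _ _).symm.trans
    ((congrArg (· ≫ h.map) hg).trans (hh.trans (Category.comp_id _).symm)))
  have i₂ : h ≫ g = 𝟙 _ := e₂ _ _ _ ((Category.assoc _ _ _).symm.trans
    ((congrArg (· ≫ g.map) hh).trans (hg.trans (Category.comp_id _).symm)))
  have i₁' := congrArg ECat.Hom.map i₁
  have i₂' := congrArg ECat.Hom.map i₂
  exact ⟨g, hg, EGraph.bijective_obj _ _ i₁' i₂', EGraph.isIso_hom _ _ i₁' i₂'⟩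

include hF in
lemma gammaPresentation (A : Monad (EGraph.{w} V)) (I : IsoOver A.forget (ECat.forget.{w} F)) :
    Nonempty (GammaPresentation F A) := by
  obtain ⟨s, hs, hs'⟩ := I.exists_str
  let Z (X : EGraph.{w} V) : ECat.{w} F := (s (A.free.obj X)).cat
  have free : ∀ X, ∃ g : freeCat X.hom hF ⟶ Z X, ECat.freeUnit X hF ≫ g.map = A.η.app X ∧
      Function.Bijective g.map.obj ∧ ∀ a b, IsIso (g.map.hom a b) := fun X => by
    have hu : ∀ B φ, A.adj.homEquiv X B φ = A.η.app X ≫ A.forget.map φ := fun B φ =>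
      (A.adj.homEquiv_unit _ _ _).trans (by rw [A.adj_unit]; rfl)
    exact EStr.exists_free hF hs hs' (L := A.free.obj X) (A.η.app X) (fun B k => ⟨(A.adj.homEquiv X B).symm k,
      (hu _ _).symm.trans ((A.adj.homEquiv X B).apply_symm_apply k)⟩) (fun B φ ψ h =>
      (A.adj.homEquiv X B).injective ((hu _ _).trans (h.trans (hu _ _).symm)))
  have hmap : ∀ {X Y : EGraph.{w} V} (f : X ⟶ Y), ∃ g : Z X ⟶ Z Y, g.map = A.map f := fun f =>
    (hs (A := A.free.obj _) (B := A.free.obj _) (A.map f)).2 ⟨A.free.map f, rfl⟩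
  have hμ : ∀ X : EGraph.{w} V, ∃ g : Z (A.obj X) ⟶ Z X, g.map = A.μ.app X := fun X =>
    (hs (A := A.free.obj (A.obj X)) (B := A.free.obj X) (A.μ.app X)).2 ⟨A.adj.counit.app (A.free.obj X), by rw [A.adj_counit]; rfl⟩
  refine ⟨
    { bijective := fun X => ?_
      ι := fun X {a b} p => (Z X).ev (A.η.app X) p
      isColimit := fun X a b => ?_
      natural := fun {X Y} f {a b} p h => ?_
      unit := fun X a b => (Z X).η_ev (A.η.app X) a b
      mult := fun X {a b} P h => ?_ }⟩
  · obtain ⟨g, hg, hb, -⟩ := free X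
    rw [← hg]
    exact hb
  · obtain ⟨g, hg, -, hi⟩ := free X
    have e := fun p => ECat.ι_comp X hF g (a := a) (b := b) p
    have gen : ∀ η (_ : ECat.freeUnit X hF ≫ g.map = η), Nonempty (IsColimit (Cofan.mk _
        fun p : Chain X.obj a b => (Z X).ev η p)) := by
      rintro _ rfl
      exact ⟨IsColimit.ofIsoColimit (coproductIsCoproduct (fun p : Chain X.obj a b => F.E.obj (X.homs p)))
        (Cofan.ext (@asIso _ _ _ _ (g.map.hom a b) (hi a b)) fun p => e p)⟩
    exact gen _ hg
  · obtain ⟨g, hg⟩ := hmap f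
    have e1 := ECat.ev_comp (A.η.app X) g p
    have e2 := ECat.map_ev f (A.η.app Y) (Z := Z Y) p
    have gen : ∀ {t : A.obj X ⟶ A.obj Y} {k : X ⟶ A.obj Y} (_ : g.map = t) (_ : A.η.app X ≫ t = k) (h),
        (Z X).ev (A.η.app X) p ≫ t.hom _ _ ≫ eqToHom h = (Z Y).ev k p := by
      rintro _ _ rfl rfl h
      exact (congrArg (_ ≫ ·) (Category.comp_id _)).trans e1
    exact e2.trans (gen hg (A.η.naturality f).symm h).symm
  · obtain ⟨g, hg⟩ := hμ X
    have e1 := ECat.ev_comp (A.η.app (A.obj X)) g (P.outer.map (A.η.app X).obj)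
    have gen : ∀ {t : A.obj (A.obj X) ⟶ A.obj X} {k : A.obj X ⟶ A.obj X} (_ : g.map = t)
        (_ : A.η.app (A.obj X) ≫ t = k) (h),
        (Z (A.obj X)).ev (A.η.app (A.obj X)) (P.outer.map (A.η.app X).obj) ≫ t.hom _ _ ≫ eqToHom h =
          (Z X).ev k (P.outer.map (A.η.app X).obj) := by
      rintro _ _ rfl rfl h
      exact (congrArg (_ ≫ ·) (Category.comp_id _)).trans e1
    refine (congrArg (_ ≫ ·) ((gen hg (A.left_unit X) h).trans (ECat.ev_id _))).trans ?_
    have spec : ∀ {a b : X.obj} (P : Chain₂ X.obj a b), HEq ((Z X).evHom (A.η.app X) (Ref.ofChain₂ P))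
        (injHom F.E (A.η.app X).obj (fun p => (Z X).ev (A.η.app X) p) P) := by
      intro a b P
      induction P with
      | nil => rfl
      | cons p P ih => exact consHom_heq _ (congrArg (List.map F.E.obj) (Ref.ofChain₂_sel P)) rfl ih
    have fin : ∀ {M M' : List (List V)} {r r' : Chain X.obj a b} (c : M.map F.E.obj ⟶
        (A.obj X).homs (P.outer.map (A.η.app X).obj)) (c' : M'.map F.E.obj ⟶ (A.obj X).homs (P.outer.map (A.η.app X).obj)) (h : M.flatten = X.homs r)
        (h' : M'.flatten = X.homs r') (_ : M = M') (_ : r = r') (_ : HEq c c'),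
        F.E.map c ≫ (Z X).κ (P.outer.map (A.η.app X).obj) = F.σ M _ h ≫ (Z X).ev (A.η.app X) r →
        F.E.map c' ≫ (Z X).κ (P.outer.map (A.η.app X).obj) = F.σ M' _ h' ≫ (Z X).ev (A.η.app X) r' := by
      rintro M _ r _ c c' h h' rfl rfl hc e
      cases hc
      exact e
    exact fin _ _ _ _ (Ref.ofChain₂_sel P) (Ref.ofChain₂_cat P) (spec P)
      (ECat.ev_ref (Z := Z X) (A.η.app X) (Ref.ofChain₂ P))

def freeEquiv (X : EGraph.{w} V) (Z : ECat.{w} F) : (freeCat X.hom hF ⟶ Z) ≃ (X ⟶ (ECat.forget F).obj Z) :=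
  Equiv.ofBijective (fun g => ECat.freeUnit X hF ≫ g.map)
    ⟨fun _ _ h => ECat.free_hom_ext X hF h, fun k => ECat.exists_free_desc X hF k⟩

def freeCatAdj : Adjunction (Adjunction.leftAdjointOfEquiv (freeEquiv hF)
    fun X Z Z' g h => (Category.assoc (ECat.freeUnit X hF) h.map g.map).symm) (ECat.forget.{w} F) :=
  Adjunction.adjunctionOfEquivLeft _ _

lemma freeCatAdj_unit (X : EGraph.{w} V) : (freeCatAdj hF).unit.app X = ECat.freeUnit X hF :=
  (rfl : _ = ECat.freeUnit X hF ≫ 𝟙 _).trans (Category.comp_id _)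

lemma freeUnit_counit (Z : ECat.{w} F) : ECat.freeUnit Z.graph hF ≫ ((freeCatAdj hF).counit.app Z).map = 𝟙 _ :=
  (congrArg (· ≫ _) (freeCatAdj_unit hF _).symm).trans ((freeCatAdj hF).right_triangle_components Z)

instance : (ECat.forget.{w} F).Faithful := ⟨fun h => ECat.Hom.ext h⟩

lemma map_κ_of_free {Z Z' : ECat.{w} F} (c : freeCat Z.graph.hom hF ⟶ Z) (hc : ECat.freeUnit Z.graph hF ≫ c.map = 𝟙 _)
    (f : Z.graph ⟶ Z'.graph) (g : freeCat Z.graph.hom hF ⟶ Z') (hg : g.map = c.map ≫ f) {a b : Z.graph.obj}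
    (p : Chain Z.graph.obj a b) : F.E.map (EGraph.homsMap f p) ≫ Z'.κ (p.map f.obj) = Z.κ p ≫ f.hom a b := by
  have e1 := ECat.ι_comp _ hF g p
  have e2 := ECat.ι_comp _ hF c p
  obtain ⟨⟨o, m⟩, hcκ⟩ := c
  obtain ⟨gm, hgκ⟩ := g
  obtain rfl : o = fun a => a := congrArg EGraph.Hom.obj hc
  subst hg
  have hcf := (Category.assoc _ _ _).symm.trans ((congrArg (· ≫ f) hc).trans (Category.id_comp f))
  have e3 := (ECat.ev_congr (Z := Z) hc p rfl).trans (ECat.ev_id p)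
  have e4 := ECat.ev_congr (Z := Z') hcf p rfl
  refine e4.symm.trans ((Category.comp_id _).trans (e1.symm.trans ?_))
  exact (Category.assoc _ _ _).symm.trans (congrArg (· ≫ f.hom a b) (e2.trans ((Category.comp_id _).symm.trans e3)))

lemma exists_str_of_free {X : EGraph.{w} V} (α : (freeCat X.hom hF).graph ⟶ X) (hα : ECat.freeUnit X hF ≫ α = 𝟙 X)
    (c : freeCat (Γ F X.hom) hF ⟶ freeCat X.hom hF) (hc : ECat.freeUnit (freeCat X.hom hF).graph hF ≫ c.map = 𝟙 _)
    (l : freeCat (Γ F X.hom) hF ⟶ freeCat X.hom hF)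
    (hl : ECat.freeUnit (freeCat X.hom hF).graph hF ≫ l.map = α ≫ ECat.freeUnit X hF) (h : c.map ≫ α = l.map ≫ α) :
    ∃ (s : EStr F X) (t : freeCat X.hom hF ⟶ s.cat), t.map = α := by
  have e1 := fun {a b : X.obj} (q : Chain X.obj a b) => ECat.ι_comp (freeCat X.hom hF).graph hF c q
  have e2 := fun {a b : X.obj} (q : Chain X.obj a b) => ECat.ι_comp (freeCat X.hom hF).graph hF l q
  have e3 := fun {a b : X.obj} (q : Chain X.obj a b) => ECat.ι_comp X hF (𝟙 (freeCat X.hom hF)) q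
  obtain ⟨o, m⟩ := α
  obtain rfl : o = fun a => a := congrArg EGraph.Hom.obj hα
  obtain ⟨⟨oc, mc⟩, hcκ⟩ := c
  obtain rfl : oc = fun a => a := congrArg EGraph.Hom.obj hc
  obtain ⟨⟨ol, ml⟩, hlκ⟩ := l
  obtain rfl : ol = fun a => a := congrArg EGraph.Hom.obj hl
  let A : (freeCat X.hom hF).graph ⟶ X := EGraph.Hom.mk (X := (freeCat X.hom hF).graph) (fun a => a) m
  have star : ∀ {a b : X.obj} (q : Chain X.obj a b), Γκ hF q ≫ m a b =
      F.E.map (EGraph.homsMap A q) ≫ Γι F X.hom (q.map fun a => a) ≫ m a b := by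
    intro a b q
    have i1 : Γι F (Γ F X.hom) q ≫ mc a b = Γκ hF q :=
      (e1 q).trans ((Category.comp_id _).symm.trans ((ECat.ev_congr (Z := freeCat X.hom hF) hc q rfl).trans
        (ECat.ev_id (Z := freeCat X.hom hF) q)))
    have i2 : Γι F (Γ F X.hom) q ≫ ml a b = F.E.map (EGraph.homsMap A q) ≫ Γι F X.hom (q.map fun a => a) := by
      refine (e2 q).trans ((Category.comp_id _).symm.trans ((ECat.ev_congr (Z := freeCat X.hom hF) hl q rfl).trans ?_))
      refine (ECat.map_ev A (ECat.freeUnit X hF) (Z := freeCat X.hom hF) q).symm.trans (congrArg (_ ≫ ·) ?_)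
      exact ((ECat.ev_congr (Z := freeCat X.hom hF) (Category.comp_id _).symm _ rfl).symm.trans (Category.comp_id _)).symm.trans
        ((e3 _).symm.trans (Category.comp_id _))
    have i3 : mc a b ≫ m a b = ml a b ≫ m a b := EGraph.Hom.eq_mk h a b
    refine (congrArg (· ≫ m a b) i1.symm).trans ((Category.assoc _ _ _).trans ((congrArg (_ ≫ ·) i3).trans ?_))
    exact (Category.assoc _ _ _).symm.trans ((congrArg (· ≫ m a b) i2).trans (Category.assoc _ _ _))
  have push : ∀ {a b : X.obj} {q : Chain X.obj a b} (r : Ref q),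
      (⟨q.map (fun a => a), r.hom F.E (Γι F X.hom) ≫ EGraph.homsMap A q⟩ :
        Σ q' : Chain X.obj a b, (r.sel X.hom).map F.E.obj ⟶ X.homs q') =
      ⟨q, r.hom F.E fun p => Γι F X.hom p ≫ m _ _⟩ := by
    intro a b q
    induction q with
    | nil => exact fun _ => rfl
    | @cons a b c q ih => exact fun r => congrArg (fun s : (Σ q' : Chain X.obj b c, (r.2.sel X.hom).map F.E.obj ⟶ X.homs q') =>
        (⟨Chain.cons a s.1, consHom (Γι F X.hom r.1 ≫ m a b) s.2⟩ :
          Σ q' : Chain X.obj a c, (Ref.sel (q := .cons a q) X.hom r).map F.E.obj ⟶ X.homs q')) (ih r.2)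
  let Z : ECat.{w} F := ECat.ofRef X.hom (fun p => Γι F X.hom p ≫ m _ _)
    (fun a b => (Category.assoc _ _ _).symm.trans (EGraph.Hom.eq_mk hα a b)) fun {a b q} r => by
      have h1 := congrArg (fun s : (Σ q' : Chain X.obj a b, (r.sel X.hom).map F.E.obj ⟶ X.homs q') =>
        F.E.map s.2 ≫ Γι F X.hom s.1 ≫ m a b) (push r)
      refine h1.symm.trans ?_
      refine (congrArg (· ≫ _) (F.E.map_comp _ _)).trans ((Category.assoc _ _ _).trans ?_)
      refine (congrArg (_ ≫ ·) (star q).symm).trans ?_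
      exact (Category.assoc _ _ _).symm.trans ((congrArg (· ≫ m a b) (hom_Γκ hF r)).trans (Category.assoc _ _ _))
  exact ⟨⟨Z.κ, Z.unit, Z.assoc⟩, ⟨A, fun q => (star q).symm⟩, rfl⟩

lemma full_comparison : (Monad.comparison (freeCatAdj hF)).Full where
  map_surjective {Z Z'} f := ⟨⟨f.f, map_κ_of_free hF ((freeCatAdj hF).counit.app Z) (freeUnit_counit hF Z) f.f
    ((Adjunction.leftAdjointOfEquiv (freeEquiv hF) _).map (X := Z.graph) (Y := Z'.graph) f.f ≫ (freeCatAdj hF).counit.app Z') f.h⟩, rfl⟩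

lemma comparison_surjective : Function.Surjective (Monad.comparison (freeCatAdj hF)).obj := by
  rintro ⟨X, α, hα, h⟩
  have hα' : ECat.freeUnit X hF ≫ α = 𝟙 X := (congrArg (· ≫ α) (freeCatAdj_unit hF X).symm).trans hα
  obtain ⟨s, t, ht⟩ := exists_str_of_free hF α hα' ((freeCatAdj hF).counit.app (freeCat X.hom hF))
    (freeUnit_counit hF _) ((Adjunction.leftAdjointOfEquiv (freeEquiv hF) _).map (X := (freeCat X.hom hF).graph) (Y := X) α)
      (((freeEquiv hF _ _).apply_symm_apply _).trans (congrArg (α ≫ ·) (Category.comp_id (ECat.freeUnit X hF)))) h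
  refine ⟨s.cat, ?_⟩
  have e : ((freeCatAdj hF).counit.app s.cat).map = α := by
    rw [← ht]
    refine congrArg ECat.Hom.map (ECat.free_hom_ext X hF ((freeUnit_counit hF s.cat).trans ?_))
    exact hα'.symm.trans (congrArg (_ ≫ ·) ht.symm)
  have gen : ∀ {β : (freeCat X.hom hF).graph ⟶ X} (_ : β = α) (h₁ h₂),
      (⟨X, β, h₁, h₂⟩ : (freeCatAdj hF).toMonad.Algebra) = ⟨X, α, hα, h⟩ := by
    rintro _ rfl _ _
    rfl
  exact gen e _ _

def ECat.isoAlgebra : IsoOver (freeCatAdj hF).toMonad.forget (ECat.forget.{w} F) := have := full_comparison hF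
  have : (Monad.comparison (freeCatAdj hF)).Faithful := ⟨fun h => ECat.Hom.ext (congrArg Monad.Algebra.Hom.f h)⟩
  (IsoOver.ofFF (Monad.comparison (freeCatAdj hF)) (U' := (freeCatAdj hF).toMonad.forget) rfl
    (comparison_surjective hF) (ECat.amnestic_forget F)).symm

end

end

section

structure MIso {V : Type u} [Category.{v} V] (E F : Multitensor V) where
  θ : ∀ L : List V, E.E.obj L ⟶ F.E.obj L
  iso : ∀ L, IsIso (θ L)
  natural : ∀ {L M : List V} (f : L ⟶ M), E.E.map f ≫ θ M = θ L ≫ F.E.map f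
  unit : ∀ X, E.η X ≫ θ [X] = F.η X
  subst : ∀ (LL : List (List V)) (L : List V) (h : LL.flatten = L),
    E.σ LL L h ≫ θ L = θ (LL.map E.E.obj) ≫ F.E.map (betweenHom E.E F.E θ LL) ≫ F.σ LL L h

section

inductive Pos : Type w
  | zero
  | succ (n : Pos)

variable {V : Type u} [Category.{v} V] {F : Multitensor V}

lemma Ref.exists_split (X : EGraph.{w} V) : ∀ (L M : List V) {a b : X.obj} (p : Chain X.obj a b)
    (f : L ++ M ⟶ X.homs p), ∃ (c : X.obj) (p₁ : Chain X.obj a c) (p₂ : Chain X.obj c b)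
      (f₁ : L ⟶ X.homs p₁) (f₂ : M ⟶ X.homs p₂), p₁.append p₂ = p ∧ HEq (appendHom f₁ f₂) f
  | [], _, _, _, p, f => ⟨_, .nil _, p, 𝟙 [], f, rfl, HEq.rfl⟩
  | _ :: _, _, _, _, .nil _, f => PEmpty.elim f
  | X₀ :: L, M, _, _, .cons a p, f => by
    obtain ⟨c, p₁, p₂, f₁, f₂, rfl, h⟩ := exists_split X L M p f.2
    exact ⟨c, .cons a p₁, p₂, consHom f.1 f₁, f₂, rfl, consHom_heq f.1 rfl (X.homs_append _ _).symm h⟩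

lemma Ref.exists_ref (X : EGraph.{w} V) : ∀ (LL : List (List V)) {a b : X.obj} (p : Chain X.obj a b)
    (f : LL.flatten ⟶ X.homs p), ∃ (q : Chain X.obj a b) (r : Ref q) (g : LL ⟶ r.sel X.hom),
      r.cat = p ∧ HEq (flattenHom g) f
  | [], _, _, .nil _, f => ⟨.nil _, PUnit.unit, 𝟙 [], rfl, HEq.rfl⟩
  | [], _, _, .cons _ _, f => PEmpty.elim f
  | L :: LL, _, _, p, f => by
    obtain ⟨c, p₁, p₂, f₁, f₂, rfl, h⟩ := exists_split X L _ p f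
    obtain ⟨q, r, g, rfl, h'⟩ := exists_ref X LL p₂ f₂
    exact ⟨.cons _ q, (p₁, r), consHom f₁ g, rfl, (appendHom_heq f₁ rfl r.flatten_sel h').trans h⟩

variable [HasCoproducts.{w} V] [HasInitial V]

namespace Pos

def len : List V → Pos.{w}
  | [] => zero
  | _ :: L => succ (len L)

def path : List V → Pos.{w} → Pos.{w} → V
  | [], _, _ => ⊥_ V
  | _ :: _, zero, zero => ⊥_ V
  | X :: _, zero, succ zero => X
  | _ :: _, zero, succ (succ _) => ⊥_ V
  | _ :: _, succ _, zero => ⊥_ V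
  | _ :: L, succ i, succ j => path L i j

abbrev gph (L : List V) : EGraph.{w} V := ⟨Pos.{w}, path L⟩

def chain : ∀ L : List V, Chain Pos.{w} zero (len L)
  | [] => .nil zero
  | _ :: L => .cons zero ((chain L).map succ)

def shift (X : V) (L : List V) : gph.{w} L ⟶ gph (X :: L) :=
  EGraph.Hom.mk (X := gph L) (Y := gph (X :: L)) succ (fun i j => 𝟙 (path L i j))

def j : ∀ L : List V, L ⟶ (gph.{w} L).homs (chain L)
  | [] => 𝟙 []
  | X :: L => consHom (Y := path.{w} (X :: L) zero (succ zero)) (𝟙 X) (j L ≫ EGraph.homsMap (shift X L) (chain L))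

lemma exists_hom (A : EGraph.{w} V) : ∀ {a b : A.obj} (p : Chain A.obj a b) (L : List V) (f : L ⟶ A.homs p),
    ∃ φ : gph L ⟶ A, (⟨_, _, _, j L ≫ EGraph.homsMap φ (chain L)⟩ : Σ a b, Σ q : Chain A.obj a b, L ⟶ A.homs q) =
      ⟨a, b, p, f⟩
  | _, _, .nil a, [], f => ⟨EGraph.Hom.mk (X := gph []) (fun _ => a) (fun _ _ => initial.to _), rfl⟩
  | _, _, .nil _, _ :: _, f => PEmpty.elim f
  | _, _, .cons _ _, [], f => PEmpty.elim f
  | _, _, .cons a p, X :: L, f => by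
    obtain ⟨φ, e⟩ := exists_hom A p L f.2
    obtain ⟨f₁, f₂⟩ : (X ⟶ A.hom a _) × (L ⟶ A.homs p) := f
    cases e
    let ψ : gph (X :: L) ⟶ A := EGraph.Hom.mk (X := gph (X :: L)) (fun i => match i with
      | zero => a
      | succ i => φ.obj i) (fun i k => match i, k with
      | zero, zero => initial.to _
      | zero, succ zero => f₁
      | zero, succ (succ _) => initial.to _
      | succ _, zero => initial.to _
      | succ i, succ k => φ.hom i k)
    have hψ := congrArg (fun h : ∀ i k, path L i k ⟶ A.hom (φ.obj i) (φ.obj k) =>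
      (⟨(chain L).map φ.obj, EGraph.homsMap (EGraph.Hom.mk (X := gph L) φ.obj h) (chain L)⟩ :
        Σ q : Chain A.obj (φ.obj zero) (φ.obj (len L)), (gph L).homs (chain L) ⟶ A.homs q))
      (funext fun i => funext fun k => Category.id_comp (φ.hom i k))
    have h := hψ.symm.trans (EGraph.homsMap_comp (shift X L) ψ (chain L))
    have h' := congrArg (fun s : (Σ q : Chain A.obj (φ.obj zero) (φ.obj (len L)), (gph L).homs (chain L) ⟶ A.homs q) =>
      (⟨a, φ.obj (len L), .cons a s.1, consHom f₁ (j L ≫ s.2)⟩ :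
        Σ a b, Σ q : Chain A.obj a b, (X :: L) ⟶ A.homs q)) h
    refine ⟨ψ, Eq.trans ?_ h'.symm⟩
    exact congrArg (fun k => (⟨a, φ.obj (len L), .cons a (((chain L).map succ).map ψ.obj), k⟩ :
      Σ a b, Σ q : Chain A.obj a b, (X :: L) ⟶ A.homs q)) (Prod.ext (Category.id_comp _)
        (show (j L ≫ EGraph.homsMap (shift X L) (chain L)) ≫ EGraph.homsMap ψ ((chain L).map (shift X L).obj) = _ from
          Category.assoc _ _ _))

def Up : ∀ {i k : Pos.{w}}, Chain Pos.{w} i k → Prop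
  | _, _, .nil _ => True
  | _, _, .cons i (b := k) p => k = succ i ∧ Up p

def nat : Pos.{w} → ℕ
  | zero => 0
  | succ i => nat i + 1

lemma Up.le {i k : Pos.{w}} {p : Chain Pos.{w} i k} (h : Up p) : nat i ≤ nat k := by
  induction p with
  | nil => exact le_rfl
  | cons i p ih =>
    obtain ⟨rfl, h⟩ := h
    exact (Nat.le_succ _).trans (ih h)

lemma Up.eq {i k : Pos.{w}} {p q : Chain Pos.{w} i k} (h : Up p) (h' : Up q) : p = q := by
  induction p with
  | nil =>
    cases q with
    | nil => rfl
    | cons _ q =>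
      obtain ⟨rfl, h'⟩ := h'
      exact (Nat.not_succ_le_self _ h'.le).elim
  | cons i p ih =>
    cases q with
    | nil =>
      obtain ⟨rfl, h⟩ := h
      exact (Nat.not_succ_le_self _ h.le).elim
    | cons _ q =>
      obtain ⟨rfl, h⟩ := h
      obtain ⟨rfl, h'⟩ := h'
      exact congrArg (Chain.cons i) (ih h h')

lemma Up.map : ∀ {i k : Pos.{w}} {p : Chain Pos.{w} i k}, Up p → Up (p.map succ)
  | _, _, .nil _, _ => trivial
  | _, _, .cons _ _, h => ⟨congrArg succ h.1, h.2.map⟩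

lemma up_chain : ∀ L : List V, Up (chain L)
  | [] => trivial
  | _ :: L => ⟨by cases L <;> rfl, (up_chain L).map⟩

lemma path_eq : ∀ (L : List V) {i k : Pos.{w}}, k ≠ succ i → path L i k = ⊥_ V
  | [], _, _, _ => rfl
  | _ :: _, zero, zero, _ => rfl
  | _ :: _, zero, succ zero, h => (h rfl).elim
  | _ :: _, zero, succ (succ _), _ => rfl
  | _ :: _, succ _, zero, _ => rfl
  | _ :: L, succ i, succ k, h => path_eq L fun e => h (congrArg succ e)

lemma isInitial (L : List V) {i k : Pos.{w}} (q : Chain Pos.{w} i k) (h : ¬Up q) :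
    ∀ {Φ : List V ⥤ V} (_ : Dist.{w} Φ), Nonempty (IsInitial (Φ.obj ((gph L).homs q))) := by
  induction q with
  | nil => exact (h trivial).elim
  | @cons i k l q ih =>
    intro Φ hΦ
    by_cases e : k = succ i
    · exact ih (fun h' => h ⟨e, h'⟩) (hΦ.cons _)
    · have e' := path_eq L e
      have := (hΦ [] ((gph L).homs q) PEmpty).some
      have := preservesColimitsOfShape_of_equiv (Discrete.equivalence (Equiv.equivOfIsEmpty _ _) : Discrete PEmpty.{w+1} ≌ Discrete PEmpty.{1}) (insertAt [] ((gph L).homs q) ⋙ Φ)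
      have h0 : IsInitial (path L i k) := e' ▸ initialIsInitial
      exact ⟨h0.isInitialObj (insertAt [] ((gph L).homs q) ⋙ Φ) _⟩

lemma isIso_Γι (hF : Dist.{w} F.E) (L : List V) : IsIso (Γι F (gph.{w} L).hom (chain L)) := by
  classical
  obtain ⟨g, hg⟩ := Γ_desc (F := F) (X := (gph.{w} L).hom) (Z := F.E.obj ((gph L).homs (chain L)))
    (fun q => if h : q = chain L then eqToHom (by rw [h]) else
      (isInitial L q (fun h' => h (h'.eq (up_chain L))) hF).some.to _)
  have h0 : Γι F (gph.{w} L).hom (chain L) ≫ g = 𝟙 _ := by rw [hg, dif_pos rfl]; rfl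
  refine ⟨g, h0, Γ_ext fun q => ?_⟩
  by_cases h : q = chain L
  · subst h
    rw [reassoc_of% h0, Category.comp_id]
  · exact (isInitial L q (fun h' => h (h'.eq (up_chain L))) hF).some.hom_ext _ _

end Pos

end

end

section

section

variable {V : Type u} [Category.{v} V] {F F' : Multitensor V}

lemma ECat.σ_map_κ (Z : ECat.{w} F) {LL : List (List V)} {a b : Z.graph.obj} {p q : Chain Z.graph.obj a b}
    (f : LL.flatten ⟶ Z.graph.homs p) (r : Ref q) (g : LL ⟶ r.sel Z.graph.hom) (hr : r.cat = p)
    (hg : HEq (flattenHom g) f) : F.σ LL _ rfl ≫ F.E.map f ≫ Z.κ p =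
      F.E.map (mapMHom F.E g ≫ r.hom F.E Z.κ) ≫ Z.κ q := by
  subst hr
  have h := F.σ_natural' g rfl r.flatten_sel f hg
  rw [F.E.map_comp, Category.assoc, Z.assoc_ref r]
  exact (Category.assoc _ _ _).symm.trans ((congrArg (· ≫ _) h.symm).trans (Category.assoc _ _ _))

lemma EGraph.isIso_homsMap {X Y : EGraph.{w} V} (f : X ⟶ Y) (hf : ∀ a b, IsIso (f.hom a b)) :
    ∀ {a b : X.obj} (p : Chain X.obj a b), IsIso (homsMap f p)
  | _, _, .nil _ => inferInstanceAs (IsIso (𝟙 []))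
  | _, _, .cons _ p => by
    have := isIso_homsMap f hf p
    have := hf
    exact isIso_consHom _ _

lemma ECat.η_κ (Z : ECat.{w} F) {X : V} {a b : Z.graph.obj} (f : X ⟶ Z.graph.hom a b) :
    F.η X ≫ F.E.map (consHom f (𝟙 [])) ≫ Z.κ (.single a b) = f := by
  exact (Category.assoc _ _ _).symm.trans ((congrArg (· ≫ _) (F.η_natural f)).trans ((Category.assoc _ _ _).trans
    ((congrArg (_ ≫ ·) (Z.unit _ _)).trans (Category.comp_id _))))

variable [HasCoproducts.{w} V] [HasInitial V]

open Pos

lemma Pos.isIso_j : ∀ L : List V, IsIso (j.{w} L)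
  | [] => inferInstanceAs (IsIso (𝟙 []))
  | X :: L => by
    have := isIso_j L
    have := EGraph.isIso_homsMap (shift X L) (fun i k => inferInstanceAs (IsIso (𝟙 (path L i k)))) (chain L)
    exact @isIso_consHom _ _ _ _ _ _ _ _ (inferInstanceAs (IsIso (𝟙 X))) (@IsIso.comp_isIso _ _ _ _ _ _ _ ‹_› ‹_›)

lemma Pos.ev_comp {Z Z' : ECat.{w} F} {L : List V} (k : gph.{w} L ⟶ Z.graph) (g : Z ⟶ Z') :
    F.E.map (j L ≫ EGraph.homsMap (k ≫ g.map) (chain L)) ≫ Z'.κ ((chain L).map (k ≫ g.map).obj) =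
      (F.E.map (j L ≫ EGraph.homsMap k (chain L)) ≫ Z.κ ((chain L).map k.obj)) ≫ g.map.hom _ _ := by
  have := ECat.ev_comp k g (chain L)
  rw [F.E.map_comp, F.E.map_comp, Category.assoc, Category.assoc, Category.assoc]
  exact congrArg (_ ≫ ·) (this.symm.trans (Category.assoc _ _ _))

lemma Ref.hom_compat {X : EGraph.{w} V} {κ : ∀ {a b : X.obj} (p : Chain X.obj a b), F.E.obj (X.homs p) ⟶ X.hom a b}
    {κ' : ∀ {a b : X.obj} (p : Chain X.obj a b), F'.E.obj (X.homs p) ⟶ X.hom a b}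
    {θ : ∀ L, F.E.obj L ⟶ F'.E.obj L}
    (h : ∀ {a b : X.obj} (p : Chain X.obj a b) {L : List V} (f : L ⟶ X.homs p), F.E.map f ≫ κ p =
      θ L ≫ F'.E.map f ≫ κ' p) : ∀ {a b : X.obj} {q : Chain X.obj a b} (r : Ref q) (LL : List (List V))
    (g : LL ⟶ r.sel X.hom), mapMHom F.E g ≫ r.hom F.E κ =
      betweenHom F.E F'.E θ LL ≫ mapMHom F'.E g ≫ r.hom F'.E κ'
  | _, _, .nil _, _, [], _ => rfl
  | _, _, .nil _, _, _ :: _, g => PEmpty.elim g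
  | _, _, .cons _ _, _, [], g => PEmpty.elim g
  | _, _, .cons _ _, r, L :: LL, g => Prod.ext (h r.1 g.1) (hom_compat h r.2 LL g.2)

lemma exists_mIso (hF : Dist.{w} F.E) (hF' : Dist.{w} F'.E)
    (I : IsoOver (ECat.forget.{w} F') (ECat.forget.{w} F)) : Nonempty (MIso F F') := by
  obtain ⟨s, hs, hs'⟩ := I.exists_str
  let A (L : List V) : ECat.{w} F' := freeCat (gph.{w} L).hom hF'
  let u (L : List V) : gph.{w} L ⟶ (A L).graph := ECat.freeUnit (gph L) hF'
  let p (L : List V) := (chain.{w} L).map (u L).obj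
  let m (L : List V) : L ⟶ (A L).graph.homs (p L) := j L ≫ EGraph.homsMap (u L) (chain L)
  have hι : ∀ {F : Multitensor V} (hF : Dist.{w} F.E) {Z : ECat.{w} F} (L : List V) (k : gph.{w} L ⟶ Z.graph)
      (g : freeCat (gph.{w} L).hom hF ⟶ Z) (_ : ECat.freeUnit (gph L) hF ≫ g.map = k)
      (_ : ∀ a b, IsIso (g.map.hom a b)),
      IsIso (F.E.map (j L ≫ EGraph.homsMap k (chain L)) ≫ Z.κ ((chain L).map k.obj)) := by
    rintro F hF Z L _ g rfl hi
    have h1 := isIso_Γι hF L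
    have h2 := isIso_j.{w} L
    have h4 : IsIso (Z.ev (ECat.freeUnit (gph L) hF ≫ g.map) (chain L)) := by
      rw [← ECat.ι_comp]
      exact @IsIso.comp_isIso _ _ _ _ _ _ _ h1 (hi zero (len L))
    rw [F.E.map_comp, Category.assoc]
    exact @IsIso.comp_isIso _ _ _ _ _ _ _ (inferInstanceAs (IsIso (F.E.map (j L)))) h4
  have he : ∀ L, IsIso (F.E.map (m L) ≫ (s (A L)).κ (p L)) := fun L => by
    obtain ⟨g, hg, -, hi⟩ := EStr.exists_free hF hs hs' (L := A L) (u L)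
      (fun B k => ECat.exists_free_desc (gph L) hF' k) (fun B φ ψ h => ECat.free_hom_ext (gph L) hF' h)
    exact hι hF (Z := (s (A L)).cat) L (u L) g hg hi
  have he' : ∀ L, IsIso (F'.E.map (m L) ≫ (A L).κ (p L)) := fun L =>
    hι hF' L (u L) (𝟙 (A L)) (Category.comp_id _) fun a b => inferInstanceAs (IsIso (𝟙 _))
  obtain ⟨e, hee⟩ : ∃ e : ∀ L, F.E.obj L ⟶ (A L).graph.hom (u L |>.obj zero) ((u L).obj (len L)),
    ∀ L, e L = F.E.map (m L) ≫ (s (A L)).κ (p L) := ⟨_, fun _ => rfl⟩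
  obtain ⟨d, hd⟩ : ∃ d : ∀ L, (A L).graph.hom ((u L).obj zero) ((u L).obj (len L)) ⟶ F'.E.obj L,
    ∀ L, IsIso (d L) ∧ d L ≫ F'.E.map (m L) ≫ (A L).κ (p L) = 𝟙 _ :=
      ⟨fun L => inv _, fun L => ⟨inferInstance, IsIso.inv_hom_id _⟩⟩
  have key : ∀ (B : ECat.{w} F') {a b : B.graph.obj} (p : Chain B.graph.obj a b) {L : List V} (f : L ⟶ B.graph.homs p),
      F.E.map f ≫ (s B).κ p = (e L ≫ d L) ≫ F'.E.map f ≫ B.κ p := by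
    intro B a b p' L f
    obtain ⟨φ, hφ⟩ := exists_hom B.graph p' L f
    obtain ⟨h, rfl⟩ := ECat.exists_free_desc (gph L) hF' φ
    obtain ⟨h', hh⟩ := (hs (A := A L) (B := B) h.map).2 ⟨h, rfl⟩
    have e2 := Pos.ev_comp (Z := (s (A L)).cat) (Z' := (s B).cat) (u L) h'
    have e3 := Pos.ev_comp (Z := A L) (u L) h
    replace e2 : _ ≫ (s B).κ ((chain L).map (u L ≫ h.map).obj) = (_ ≫ (s (A L)).κ _) ≫ h.map.hom _ _ := hh ▸ e2
    cases hφ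
    refine e2.trans (Eq.trans ?_ (congrArg (_ ≫ ·) e3.symm))
    have := congrArg (fun k => e L ≫ k ≫ h.map.hom _ _) (hd L).2
    refine (congrArg (· ≫ _) (hee L).symm).trans ?_
    refine (congrArg (_ ≫ ·) (Category.id_comp _).symm).trans (this.symm.trans ?_)
    simp only [Category.assoc]
    exact (Category.assoc _ _ _).symm
  have hcan : ∀ (L : List V) {Y : V} {f g : Y ⟶ F'.E.obj L}, f ≫ F'.E.map (m L) ≫ (A L).κ (p L) =
      g ≫ F'.E.map (m L) ≫ (A L).κ (p L) → f = g := fun L Y f g h => by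
    have := he' L
    exact (cancel_mono _).1 h
  have nat : ∀ {L M : List V} (f : L ⟶ M), F.E.map f ≫ e M = (e L ≫ d L) ≫ F'.E.map f ≫
      F'.E.map (m M) ≫ (A M).κ (p M) := fun {L M} f => by
    have := key (A M) (p M) (f ≫ m M)
    rw [F.E.map_comp, F'.E.map_comp, Category.assoc, Category.assoc] at this
    rw [hee]
    exact (Category.assoc _ _ _).symm.trans (this.trans (Category.assoc _ _ _).symm)
  have hθ : ∀ L, (e L ≫ d L) ≫ F'.E.map (m L) ≫ (A L).κ (p L) = e L := fun L => by
    rw [Category.assoc, (hd L).2, Category.comp_id]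
  refine ⟨⟨fun L => e L ≫ d L, fun L => ?_, fun {L M} f => hcan M ?_, fun X => hcan [X] ?_, fun LL L h => hcan L ?_⟩⟩
  · rw [hee]
    exact @IsIso.comp_isIso _ _ _ _ _ _ _ (he L) (hd L).1
  · rw [Category.assoc, hθ, nat, Category.assoc _ (F'.E.map f)]
  · rw [Category.assoc, hθ, hee]
    exact ((s (A [X])).cat.η_κ (m [X]).1).trans ((A [X]).η_κ (m [X]).1).symm
  · subst h
    obtain ⟨q, r, g, hr, hg⟩ := Ref.exists_ref (A LL.flatten).graph LL (p _) (m _)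
    have h1 := (s (A LL.flatten)).cat.σ_map_κ (m _) r g hr hg
    have h2 := (A LL.flatten).σ_map_κ (m _) r g hr hg
    have h3 := Ref.hom_compat (key (A LL.flatten)) r LL g
    rw [Category.assoc, hθ, hee]
    refine h1.trans ((key _ q _).trans ?_)
    refine (congrArg (fun k => (e _ ≫ d _) ≫ F'.E.map k ≫ _) h3).trans ?_
    rw [F'.E.map_comp]
    have h4 := congrArg (fun k => (e (LL.map F.E.obj) ≫ d (LL.map F.E.obj)) ≫
      F'.E.map (betweenHom F.E F'.E (fun L => e L ≫ d L) LL) ≫ k) h2.symm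
    simp only [Category.assoc] at h4 ⊢
    exact h4

end

end

section

namespace Multitensor

variable {V : Type u} [Category.{v} V] (G : Multitensor V)

def mu (L M : List V) : G.E.obj [G.E.obj L, G.E.obj M] ⟶ G.E.obj (L ++ M) := G.σ [L, M] (L ++ M) (by simp)

lemma map₂_id (X Y : V) : G.map₂ (𝟙 X) (𝟙 Y) = 𝟙 _ := G.E.map_id [X, Y]

lemma σ_nil (h) : G.σ [] [] h = 𝟙 _ :=
  (Category.id_comp _).symm.trans ((congrArg (· ≫ _) (G.E.map_id _).symm).trans (G.unit_right [] h))

lemma σ₂ (LL₁ LL₂ : List (List V)) {L₁ L₂ L : List V} {LL : List (List V)} (h₁ : LL₁.flatten = L₁)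
    (h₂ : LL₂.flatten = L₂) (hL : [L₁, L₂].flatten = L) (hLL : [LL₁, LL₂].flatten = LL) (b c) :
    G.map₂ (G.σ LL₁ L₁ h₁) (G.σ LL₂ L₂ h₂) ≫ G.σ [L₁, L₂] L hL =
      G.σ [LL₁.map G.E.obj, LL₂.map G.E.obj] (LL.map G.E.obj) b ≫ G.σ LL L c := by
  subst h₁ h₂ hLL hL
  exact G.assoc [LL₁, LL₂] _ rfl c b

lemma map₂_map₂_assoc {X Y X' Y' X'' Y'' Z : V} (f : X ⟶ X') (g : Y ⟶ Y') (f' : X' ⟶ X'')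
    (g' : Y' ⟶ Y'') (k : G.E.obj [X'', Y''] ⟶ Z) :
    G.map₂ f g ≫ G.map₂ f' g' ≫ k = G.map₂ (f ≫ f') (g ≫ g') ≫ k := by
  rw [map₂_comp, Category.assoc]

lemma σ_cons (L : List V) (LL : List (List V)) : G.cn (G.E.obj L) (LL.map G.E.obj) ≫
    G.σ (L :: LL) (L ++ LL.flatten) rfl = G.map₂ (𝟙 _) (G.σ LL LL.flatten rfl) ≫ G.mu L LL.flatten := by
  have h := G.σ₂ [L] LL (L₁ := L) (by simp) rfl (L := L ++ LL.flatten) (LL := L :: LL) (by simp) (by simp) (by simp) rfl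
  refine (Category.assoc _ _ _).trans ((congrArg (_ ≫ ·) h.symm).trans ((G.map₂_map₂_assoc _ _ _ _ _).trans ?_))
  rw [G.unit_left, Category.id_comp]
  rfl

lemma unitLeft_σ (M : List V) (h) : G.unitLeft (G.E.obj M) ≫ G.σ [M] M h = G.mu [] M := by
  have := G.σ₂ [] [M] (L₁ := []) (L₂ := M) (L := M) (LL := [M]) rfl h (by simp) (by simp) (by simp) h
  refine (Category.assoc _ _ _).trans ((congrArg (_ ≫ ·) this.symm).trans ((G.map₂_map₂_assoc _ _ _ _ _).trans ?_))
  rw [G.unit_left, σ_nil, Category.id_comp]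
  exact (congrArg (· ≫ _) (G.map₂_id _ _)).trans (Category.id_comp _)

def cn₂ (X : V) (L M : List V) : G.E.obj [X, G.E.obj L, G.E.obj M] ⟶ G.E.obj (X :: L ++ M) :=
  G.E.map (consHom (G.η X) (𝟙 [G.E.obj L, G.E.obj M])) ≫ G.σ [[X], L, M] (X :: L ++ M) (by simp)

lemma assocLeft_cn₂ (X : V) (L M : List V) : G.assocLeft X (G.E.obj L) (G.E.obj M) ≫ G.cn₂ X L M =
    G.map₂ (G.cn X L) (𝟙 _) ≫ G.mu (X :: L) M := by
  have h1 := G.σ_natural' (LL := [[X, G.E.obj L], [G.E.obj M]]) (MM := [[G.E.obj [X], G.E.obj L], [G.E.obj M]])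
    (consHom (consHom (G.η X) (𝟙 _)) (𝟙 _)) rfl rfl (consHom (G.η X) (𝟙 [G.E.obj L, G.E.obj M])) HEq.rfl
  have h2 := G.σ₂ [[X], L] [M] (L₁ := X :: L) (L₂ := M) (L := X :: L ++ M) (LL := [[X], L, M])
    (by simp) (by simp) (by simp) rfl rfl (by simp)
  have h3 := congrArg (· ≫ G.σ [[X], L, M] (X :: L ++ M) (by simp)) h1
  refine (Category.assoc _ _ _).trans ((congrArg (_ ≫ ·) ((Category.assoc _ _ _).symm.trans
    (h3.symm.trans ((Category.assoc _ _ _).trans (congrArg (_ ≫ ·) h2.symm))))).trans ?_)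
  refine (congrArg (_ ≫ ·) (G.map₂_map₂_assoc _ (G.E.map (𝟙 _)) _ _ _)).trans ((G.map₂_map₂_assoc _ _ _ _ _).trans ?_)
  rw [G.E.map_id, Category.id_comp, Category.id_comp, G.unit_left]
  rfl

lemma assocRight_cn₂ (X : V) (L M : List V) : G.assocRight X (G.E.obj L) (G.E.obj M) ≫ G.cn₂ X L M =
    G.map₂ (𝟙 _) (G.mu L M) ≫ G.cn X (L ++ M) := by
  have h1 := G.σ_natural' (LL := [[X], [G.E.obj L, G.E.obj M]]) (MM := [[G.E.obj [X]], [G.E.obj L, G.E.obj M]])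
    (consHom (consHom (G.η X) (𝟙 _)) (𝟙 _)) rfl rfl (consHom (G.η X) (𝟙 [G.E.obj L, G.E.obj M])) HEq.rfl
  have h2 := G.σ₂ [[X]] [L, M] (L₁ := [X]) (L₂ := L ++ M) (L := X :: L ++ M) (LL := [[X], L, M])
    (by simp) (by simp) (by simp) rfl rfl (by simp)
  have h3 := congrArg (· ≫ G.σ [[X], L, M] (X :: L ++ M) (by simp)) h1
  refine (Category.assoc _ _ _).trans ((congrArg (_ ≫ ·) ((Category.assoc _ _ _).symm.trans
    (h3.symm.trans ((Category.assoc _ _ _).trans (congrArg (_ ≫ ·) h2.symm))))).trans ?_)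
  refine (congrArg (_ ≫ ·) (G.map₂_map₂_assoc _ (G.E.map (𝟙 _)) _ _ _)).trans ((G.map₂_map₂_assoc _ _ _ _ _).trans ?_)
  have h4 : G.E.map (consHom (G.η X) (𝟙 [])) ≫ G.σ [[X]] [X] rfl = 𝟙 _ := G.unit_right [X] rfl
  rw [G.E.map_id, Category.id_comp, Category.id_comp]
  refine (congrArg (fun k => G.map₂ (_ ≫ k) _ ≫ _) h4).trans (Eq.trans ?_ (G.map₂_map₂_assoc _ _ _ _ _).symm)
  rw [Category.comp_id, Category.id_comp, Category.comp_id]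
  rfl

lemma assocLeft_natural {X Y Z X' Y' Z' : V} (f : X ⟶ X') (g : Y ⟶ Y') (k : Z ⟶ Z') :
    G.map₂ (G.map₂ f g) k ≫ G.assocLeft X' Y' Z' =
      G.assocLeft X Y Z ≫ G.E.map (consHom f (consHom g (consHom k (𝟙 [])))) := by
  have h := G.σ_natural' (LL := [[X, Y], [Z]]) (MM := [[X', Y'], [Z']])
    (consHom (consHom f (consHom g (𝟙 []))) (consHom (consHom k (𝟙 [])) (𝟙 []))) rfl rfl
    (consHom f (consHom g (consHom k (𝟙 [])))) HEq.rfl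
  refine (Category.assoc _ _ _).symm.trans (Eq.trans (Eq.trans (congrArg (· ≫ _) ?_)
    (Category.assoc _ _ _)) ((congrArg (_ ≫ ·) h).trans (Category.assoc _ _ _).symm))
  refine (G.map₂_comp _ _ _ _).symm.trans (Eq.trans (congrArg₂ G.map₂ ?_ (G.η_natural k).symm) (G.map₂_comp _ _ _ _))
  exact (Category.comp_id _).trans (Category.id_comp _).symm

lemma assocRight_natural {X Y Z X' Y' Z' : V} (f : X ⟶ X') (g : Y ⟶ Y') (k : Z ⟶ Z') :
    G.map₂ f (G.map₂ g k) ≫ G.assocRight X' Y' Z' =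
      G.assocRight X Y Z ≫ G.E.map (consHom f (consHom g (consHom k (𝟙 [])))) := by
  have h := G.σ_natural' (LL := [[X], [Y, Z]]) (MM := [[X'], [Y', Z']])
    (consHom (consHom f (𝟙 [])) (consHom (consHom g (consHom k (𝟙 []))) (𝟙 []))) rfl rfl
    (consHom f (consHom g (consHom k (𝟙 [])))) HEq.rfl
  refine (Category.assoc _ _ _).symm.trans (Eq.trans (Eq.trans (congrArg (· ≫ _) ?_)
    (Category.assoc _ _ _)) ((congrArg (_ ≫ ·) h).trans (Category.assoc _ _ _).symm))
  refine (G.map₂_comp _ _ _ _).symm.trans (Eq.trans (congrArg₂ G.map₂ (G.η_natural f).symm ?_) (G.map₂_comp _ _ _ _))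
  exact (Category.comp_id _).trans (Category.id_comp _).symm

lemma assoc_natural {X Y Z X' Y' Z' : V} (f : X ⟶ X') (g : Y ⟶ Y') (k : Z ⟶ Z') {α α'}
    (h : α ≫ G.assocRight X Y Z = G.assocLeft X Y Z) (h' : α' ≫ G.assocRight X' Y' Z' = G.assocLeft X' Y' Z')
    [Mono (G.assocRight X' Y' Z')] : α ≫ G.map₂ f (G.map₂ g k) = G.map₂ (G.map₂ f g) k ≫ α' := by
  rw [← cancel_mono (G.assocRight X' Y' Z'), Category.assoc, Category.assoc, h', assocLeft_natural,
    assocRight_natural, ← h, Category.assoc]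

lemma assoc_mu (X : V) (L M : List V) {α}
    (h : α ≫ G.assocRight X (G.E.obj L) (G.E.obj M) = G.assocLeft X (G.E.obj L) (G.E.obj M)) :
    G.map₂ (G.cn X L) (𝟙 _) ≫ G.mu (X :: L) M = α ≫ G.map₂ (𝟙 _) (G.mu L M) ≫ G.cn X (L ++ M) := by
  rw [← assocLeft_cn₂, ← assocRight_cn₂, ← h, Category.assoc]

end Multitensor

namespace GrayTensor

variable {G : Multitensor TwoCat.{u}} (g : GrayTensor G)
include g

lemma isIso_assocLeft (A B C) : IsIso (G.assocLeft A B C) := by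
  have := g.isIso_η C
  have := g.isIso_σ [[A, B], [C]] [A, B, C] rfl
  have : IsIso (consHom (𝟙 (G.E.obj [A, B])) (consHom (G.η C) (𝟙 []))) := inferInstance
  exact IsIso.comp_isIso

lemma isIso_assocRight (A B C) : IsIso (G.assocRight A B C) := by
  have := g.isIso_η A
  have := g.isIso_σ [[A], [B, C]] [A, B, C] rfl
  have : IsIso (consHom (G.η A) (consHom (𝟙 (G.E.obj [B, C])) (𝟙 []))) := inferInstance
  exact IsIso.comp_isIso

lemma exists_assoc (A B C) : ∃ α : G.E.obj [G.E.obj [A, B], C] ⟶ G.E.obj [A, G.E.obj [B, C]],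
    α ≫ G.assocRight A B C = G.assocLeft A B C := by
  have := g.isIso_assocRight A B C
  exact ⟨G.assocLeft A B C ≫ inv (G.assocRight A B C), by simp⟩

lemma hom_ext {A B C} {H K : G.E.obj [A, B] ⟶ C} (hl : ∀ b, (g.cub A B).left b ≫ H = (g.cub A B).left b ≫ K)
    (hr : ∀ a, (g.cub A B).right a ≫ H = (g.cub A B).right a ≫ K)
    (hγ : ∀ x y, H² ((g.cub A B).γ x y) = K² ((g.cub A B).γ x y)) : H = K :=
  (g.universal ((g.cub A B).map K)).unique ⟨hl, hr, hγ⟩ ⟨fun _ => rfl, fun _ => rfl, fun _ _ => rfl⟩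

lemma isIso_cn (X L) : IsIso (G.cn X L) := G.isIso_cn g.isIso_η g.isIso_σ X L

section

variable {A B C : TwoCat.{u}} {α : G.E.obj [G.E.obj [A, B], C] ⟶ G.E.obj [A, G.E.obj [B, C]]}
  (hα : α ≫ G.assocRight A B C = G.assocLeft A B C)
include hα

lemma α_left (b c) : (g.cub A B).left b ≫ (g.cub _ C).left c ≫ α =
    (g.cub A _).left (((g.cub B C).left c)⁰ b) := by
  have := g.isIso_assocRight A B C
  rw [← cancel_mono (G.assocRight A B C), ← g.assoc_left, Category.assoc, Category.assoc, hα]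

lemma α_middle (a c) : (g.cub A B).right a ≫ (g.cub _ C).left c ≫ α =
    (g.cub B C).left c ≫ (g.cub A _).right a := by
  have := g.isIso_assocRight A B C
  rw [← cancel_mono (G.assocRight A B C), Category.assoc, Category.assoc, Category.assoc, ← g.assoc_middle, hα]

lemma α_right (a b) : (g.cub _ C).right (((g.cub A B).left b)⁰ a) ≫ α =
    (g.cub B C).right b ≫ (g.cub A _).right a := by
  have := g.isIso_assocRight A B C
  rw [← cancel_mono (G.assocRight A B C), Category.assoc, Category.assoc, ← g.assoc_right, hα]

lemma α_cancel {x y} (h : (G.assocLeft A B C)² x = (G.assocRight A B C)² y) : α² x = y := by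
  have := g.isIso_assocRight A B C
  have k : ∀ z, (inv (G.assocRight A B C))² ((G.assocRight A B C)² z) = z := fun z =>
    congrArg (fun F => F² z) (IsIso.hom_inv_id (G.assocRight A B C))
  rw [← hα] at h
  exact (k _).symm.trans ((congrArg _ h).trans (k _))

end

end GrayTensor

lemma cubH_ext_γ {A B C D : TwoCat.{u}} {H K : grayH.E.obj [grayH.E.obj [A, B], C] ⟶ D}
    (h1 : ∀ b c, (cubH A B).left b ≫ (cubH _ C).left c ≫ H = (cubH A B).left b ≫ (cubH _ C).left c ≫ K)
    (h2 : ∀ a c, (cubH A B).right a ≫ (cubH _ C).left c ≫ H = (cubH A B).right a ≫ (cubH _ C).left c ≫ K)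
    (h3 : ∀ a b, (cubH _ C).right (((cubH A B).left b)⁰ a) ≫ H =
      (cubH _ C).right (((cubH A B).left b)⁰ a) ≫ K)
    (h4 : ∀ x y c, H² (((cubH _ C).left c)² ((cubH A B).γ x y)) =
      K² (((cubH _ C).left c)² ((cubH A B).γ x y)))
    (h5 : ∀ x b z, H² ((cubH _ C).γ (((cubH A B).left b)¹ x) z) =
      K² ((cubH _ C).γ (((cubH A B).left b)¹ x) z))
    (h6 : ∀ a y z, H² ((cubH _ C).γ (((cubH A B).right a)¹ y) z) =
      K² ((cubH _ C).γ (((cubH A B).right a)¹ y) z)) : H = K := by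
  have hl : ∀ c, (cubH (grayH.E.obj [A, B]) C).left c ≫ H = (cubH _ C).left c ≫ K := fun c =>
    cubH_hom_ext (h1 · c) (h2 · c) (h4 · · c)
  have hr : ∀ e, (cubH (grayH.E.obj [A, B]) C).right e ≫ H = (cubH _ C).right e ≫ K := fun e => by
    obtain ⟨⟨a, b⟩, rfl⟩ := cubH_bijective.2 e
    exact h3 a b
  refine cubH_hom_ext hl hr fun f z => ?_
  have hc : ∀ {f f' : (grayH.E.obj [A, B]).C1} (_ : (grayH.E.obj [A, B]).t0 f = (grayH.E.obj [A, B]).s0 f')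
    (_ : H² ((cubH _ C).γ f z) = K² ((cubH _ C).γ f z))
    (_ : H² ((cubH _ C).γ f' z) = K² ((cubH _ C).γ f' z)),
      H² ((cubH _ C).γ (TwoCat.c1 _ f f') z) = K² ((cubH _ C).γ (TwoCat.c1 _ f f') z) := by
    intro f f' h e e'
    have k := ((cubH _ C).map H).γ_c1_left z h
    have k' := ((cubH _ C).map K).γ_c1_left z h
    refine k.trans (Eq.trans ?_ k'.symm)
    change D.vc (D.hc (D♯ (((cubH _ C).left _ ≫ H)¹ f)) (H² _))
      (D.hc (H² _) (D♯ (((cubH _ C).left _ ≫ H)¹ f'))) = _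
    rw [hl, hl, e, e']
    rfl
  induction f using cubH_induction with
  | hid a =>
    rw [(cubH _ C).γ_id_left, TwoCat.Hom.map_i1, TwoCat.Hom.map_i1]
    exact congrArg (fun k => D♯ (k¹ z)) (hr a)
  | hl b f c h ih => exact hc h (h5 _ _ _) ih
  | hr a f c h ih => exact hc h (h6 _ _ _) ih

end

section

section

variable {G : Multitensor TwoCat.{u}} (g : GrayTensor G)

abbrev grayβ (A B : TwoCat.{u}) : grayH.E.obj [A, B] ⟶ G.E.obj [A, B] := hDesc (g.cub A B)

lemma isIso_grayβ (A B : TwoCat.{u}) : IsIso (grayβ g A B) := by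
  obtain ⟨k, ⟨kl, kr, kγ⟩, -⟩ := g.universal (cubH A B)
  refine ⟨k, cubH_hom_ext (fun b => ?_) (fun a => ?_) fun x y => ?_,
    g.hom_ext (fun b => ?_) (fun a => ?_) fun x y => ?_⟩
  · rw [← Category.assoc, left_hDesc, kl, Category.comp_id]
  · rw [← Category.assoc, right_hDesc, kr, Category.comp_id]
  · exact (congrArg k² (γ_hDesc _ x y)).trans (kγ x y)
  · rw [← Category.assoc, kl, left_hDesc, Category.comp_id]
  · rw [← Category.assoc, kr, right_hDesc, Category.comp_id]
  · exact (congrArg (grayβ g A B)² (kγ x y)).trans (γ_hDesc _ x y)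

lemma grayβ_natural {A B A' B' : TwoCat.{u}} (f : A ⟶ A') (k : B ⟶ B') :
    hMap₂ f k ≫ grayβ g A' B' = grayβ g A B ≫ G.map₂ f k := by
  refine cubH_hom_ext (fun b => ?_) (fun a => ?_) fun x y => ?_
  · rw [← Category.assoc, left_hMap₂, Category.assoc, left_hDesc, ← Category.assoc, left_hDesc, g.natural_left]
  · rw [← Category.assoc, right_hMap₂, Category.assoc, right_hDesc, ← Category.assoc, right_hDesc, g.natural_right]
  · refine (congrArg (grayβ g A' B')² (γ_hMap₂ f k x y)).trans ((γ_hDesc _ _ _).trans ?_)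
    exact (g.natural_γ f k x y).symm.trans (congrArg (G.map₂ f k)² (γ_hDesc _ _ _).symm)

lemma grayβ_assoc {A B C : TwoCat.{u}} {α : grayH.E.obj [grayH.E.obj [A, B], C] ⟶ grayH.E.obj [A, grayH.E.obj [B, C]]}
    (hα : α ≫ grayH.assocRight A B C = grayH.assocLeft A B C)
    {α' : G.E.obj [G.E.obj [A, B], C] ⟶ G.E.obj [A, G.E.obj [B, C]]}
    (hα' : α' ≫ G.assocRight A B C = G.assocLeft A B C) :
    α ≫ hMap₂ (𝟙 A) (grayβ g B C) ≫ grayβ g A _ = hMap₂ (grayβ g A B) (𝟙 C) ≫ grayβ g _ C ≫ α' := by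
  have l := fun {A B} b => left_hDesc (g.cub A B) b
  have r := fun {A B} a => right_hDesc (g.cub A B) a
  have c := fun {A B} x y => γ_hDesc (g.cub A B) x y
  have l0 := fun {A B} b x => congrArg (fun k => k⁰ x) (l (A := A) (B := B) b)
  have l1 := fun {A B} b x => congrArg (fun k => k¹ x) (l (A := A) (B := B) b)
  have l2 := fun {A B} b x => congrArg (fun k => k² x) (l (A := A) (B := B) b)
  have r1 := fun {A B} b x => congrArg (fun k => k¹ x) (r (A := A) (B := B) b)
  have r2 := fun {A B} b x => congrArg (fun k => k² x) (r (A := A) (B := B) b)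
  have ml := fun {A B A' B'} (f : A ⟶ A') (k : B ⟶ B') b x => congrArg (fun k => k² x) (left_hMap₂ f k b)
  have mr := fun {A B A' B'} (f : A ⟶ A') (k : B ⟶ B') b x => congrArg (fun k => k² x) (right_hMap₂ f k b)
  let K := hMap₂ (𝟙 A) (grayβ g B C) ≫ grayβ g A _
  refine cubH_ext_γ (fun b z => ?_) (fun a z => ?_) (fun a b => ?_) (fun x y z => ?_) (fun x b z => ?_) fun a y z => ?_
  · have h : (cubH A B).left b ≫ (cubH _ C).left z ≫ α = (cubH A _).left (((cubH B C).left z)⁰ b) :=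
      grayTensorH.α_left hα b z
    have hm := left_hMap₂ (grayβ g A B) (𝟙 C) z
    have hm' := left_hMap₂ (𝟙 A) (grayβ g B C) (((cubH B C).left z)⁰ b)
    rw [reassoc_of% h, reassoc_of% hm', l, reassoc_of% hm, reassoc_of% (l (A := A) b)]
    refine Eq.trans ?_ (congrArg (fun k => _ ≫ k ≫ α') (l (A := G.E.obj [A, B]) z).symm)
    exact (congrArg (g.cub A _).left (l0 z b)).trans (g.α_left hα' b z).symm
  · have h : (cubH A B).right a ≫ (cubH _ C).left z ≫ α = (cubH B C).left z ≫ (cubH A _).right a :=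
      grayTensorH.α_middle hα a z
    have hm := left_hMap₂ (grayβ g A B) (𝟙 C) z
    have hm' := right_hMap₂ (𝟙 A) (grayβ g B C) a
    rw [reassoc_of% h, reassoc_of% hm', reassoc_of% (l (A := B) z), reassoc_of% hm, reassoc_of% (r (A := A) a)]
    exact (congrArg (_ ≫ ·) (r a)).trans ((g.α_middle hα' a z).symm.trans (congrArg (fun k => _ ≫ k ≫ α') (l z).symm))
  · have h : (cubH _ C).right (((cubH A B).left b)⁰ a) ≫ α = (cubH B C).right b ≫ (cubH A _).right a :=
      grayTensorH.α_right hα a b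
    have hm := right_hMap₂ (grayβ g A B) (𝟙 C) (((cubH A B).left b)⁰ a)
    have hm' := right_hMap₂ (𝟙 A) (grayβ g B C) a
    rw [reassoc_of% h, reassoc_of% hm', reassoc_of% (r (A := B) b), reassoc_of% hm]
    refine (congrArg (_ ≫ ·) (r a)).trans ((g.α_right hα' a b).symm.trans ?_)
    refine Eq.trans ?_ ((congrArg (· ≫ α') (r (A := G.E.obj [A, B]) _)).symm.trans (Category.assoc _ _ _))
    exact congrArg (fun k => (g.cub _ C).right k ≫ α') (l0 b a).symm
  · refine (congrArg K² (grayTensorH.α_cancel hα (grayTensorH.assoc_γ_left_middle A B C x y z))).trans ?_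
    refine Eq.trans ?_ (congrArg (grayβ g _ C ≫ α')² (ml (grayβ g A B) (𝟙 C) z ((cubH A B).γ x y))).symm
    refine Eq.trans ?_ (congrArg α'² ((l2 _ _).trans (congrArg _ (c x y)))).symm
    refine Eq.trans ?_ (g.α_cancel hα' (g.assoc_γ_left_middle A B C x y z)).symm
    refine (congrArg (grayβ g A _)² (γ_hMap₂ _ _ _ _)).trans ((c _ _).trans ?_)
    exact congrArg ((g.cub A _).γ x) (l1 _ _)
  · refine (congrArg K² (grayTensorH.α_cancel hα (grayTensorH.assoc_γ_left_right A B C x b z))).trans ?_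
    refine Eq.trans ?_ (congrArg (grayβ g _ C ≫ α')² (γ_hMap₂ (grayβ g A B) (𝟙 C) _ z)).symm
    refine Eq.trans ?_ (congrArg α'² ((c _ _).trans (congrArg (fun k => (g.cub _ C).γ k z) (l1 b x)))).symm
    refine Eq.trans ?_ (g.α_cancel hα' (g.assoc_γ_left_right A B C x b z)).symm
    refine (congrArg (grayβ g A _)² (γ_hMap₂ _ _ _ _)).trans ((c _ _).trans ?_)
    exact congrArg ((g.cub A _).γ x) (r1 _ _)
  · refine (congrArg K² (grayTensorH.α_cancel hα (grayTensorH.assoc_γ_middle_right A B C a y z))).trans ?_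
    refine Eq.trans ?_ (congrArg (grayβ g _ C ≫ α')² (γ_hMap₂ (grayβ g A B) (𝟙 C) _ z)).symm
    refine Eq.trans ?_ (congrArg α'² ((c _ _).trans (congrArg (fun k => (g.cub _ C).γ k z) (r1 a y)))).symm
    refine Eq.trans ?_ (g.α_cancel hα' (g.assoc_γ_middle_right A B C a y z)).symm
    refine (congrArg (grayβ g A _)² (mr _ _ _ _)).trans ((r2 _ _).trans ?_)
    exact congrArg ((g.cub A _).right a)² (c _ _)

def grayθ : ∀ L : List TwoCat.{u}, grayH.E.obj L ⟶ G.E.obj L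
  | [] => g.isTerminal.some.from _
  | X :: L => inv (grayH.cn X L) ≫ hMap₂ (𝟙 X) (grayθ L) ≫ grayβ g X _ ≫ G.cn X L

lemma cn_grayθ (X : TwoCat.{u}) (L) : grayH.cn X L ≫ grayθ g (X :: L) =
    hMap₂ (𝟙 X) (grayθ g L) ≫ grayβ g X _ ≫ G.cn X L := IsIso.hom_inv_id_assoc _ _

lemma isIso_grayθ : ∀ L, IsIso (grayθ g L)
  | [] => by
    have h := grayH_isTerminal.{u}.some
    exact ⟨h.from _, h.hom_ext _ _, g.isTerminal.some.hom_ext _ _⟩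
  | X :: L => by
    have := isIso_grayθ L
    have := isIso_grayβ g X (G.E.obj L)
    have := g.isIso_cn X L
    have : IsIso (hMap₂ (𝟙 X) (grayθ g L)) := inferInstanceAs (IsIso (grayH.E.map _))
    exact inferInstanceAs (IsIso (inv (grayH.cn X L) ≫ hMap₂ (𝟙 X) (grayθ g L) ≫ grayβ g X _ ≫ G.cn X L))

lemma grayθ_natural : ∀ {L M : List TwoCat.{u}} (f : L ⟶ M), grayH.E.map f ≫ grayθ g M = grayθ g L ≫ G.E.map f
  | [], [], _ => g.isTerminal.some.hom_ext _ _
  | [], _ :: _, f => PEmpty.elim f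
  | _ :: _, [], f => PEmpty.elim f
  | X :: L, Y :: M, f => by
    obtain ⟨f, k⟩ : (X ⟶ Y) × (L ⟶ M) := f
    have h1 := grayH.cn_natural f k
    have h2 := G.cn_natural f k
    have ih := grayθ_natural k
    rw [← cancel_epi (grayH.cn X L)]
    refine (Category.assoc _ _ _).symm.trans ((congrArg (· ≫ _) h1.symm).trans ((Category.assoc _ _ _).trans
      ((congrArg (_ ≫ ·) (cn_grayθ g Y M)).trans ?_)))
    refine Eq.trans ?_ ((congrArg (· ≫ _) (cn_grayθ g X L).symm).trans (Category.assoc _ _ _))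
    refine (grayH.map₂_map₂_assoc _ _ _ _ _).trans ?_
    rw [ih, Category.comp_id, ← Category.id_comp f]
    refine (congrArg (· ≫ _) (hMap₂_comp _ _ _ _)).trans ?_
    have h3 := grayβ_natural g f (G.E.map k)
    rw [Category.id_comp, Category.assoc, reassoc_of% h3, Category.assoc, Category.assoc]
    exact congrArg (fun k => _ ≫ _ ≫ k) h2

lemma grayθ_unit (X : TwoCat.{u}) : grayH.η X ≫ grayθ g [X] = G.η X := by
  obtain ⟨e⟩ : Nonempty (grayH.E.obj []).C0 := ⟨(grayH_isTerminal.{u}.some.from (TwoCat.one))⁰ ⟨⟩⟩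
  have h1 : (cubH X _).left e ≫ grayH.cn X [] = grayH.η X := grayTensorH.unit_right X e
  have h2 := cn_grayθ g X []
  have h3 := left_hMap₂ (𝟙 X) (grayθ g []) e
  rw [← h1, Category.assoc, h2, reassoc_of% h3, ← Category.assoc, left_hDesc]
  exact g.unit_right X _

lemma GrayTensor.right_mu (M : List TwoCat.{u}) (e) : (g.cub _ _).right e ≫ G.mu [] M = 𝟙 _ := by
  rw [← G.unitLeft_σ M (by simp), ← Category.assoc]
  exact (congrArg (· ≫ _) (g.unit_left _ e)).trans (G.unit_left M _)

lemma grayθ_mu : ∀ L M : List TwoCat.{u}, grayH.mu L M ≫ grayθ g (L ++ M) =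
    hMap₂ (grayθ g L) (grayθ g M) ≫ grayβ g _ _ ≫ G.mu L M
  | [], M => by
    obtain ⟨e⟩ : Nonempty (grayH.E.obj []).C0 := ⟨(grayH_isTerminal.{u}.some.from (TwoCat.one))⁰ ⟨⟩⟩
    have h1 : (cubH _ _).right e ≫ grayH.mu [] M = 𝟙 _ := grayTensorH.right_mu M e
    have h2 := right_hMap₂ (grayθ g []) (grayθ g M) e
    have : IsIso (grayH.mu [] M) := grayH_isIso_σ _ _ _
    have : IsIso ((cubH (grayH.E.obj []) (grayH.E.obj M)).right e) := by
      rw [← IsIso.eq_comp_inv] at h1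
      rw [h1]
      infer_instance
    rw [← cancel_epi ((cubH (grayH.E.obj []) (grayH.E.obj M)).right e), reassoc_of% h1, reassoc_of% h2]
    refine Eq.trans ?_ (congrArg (_ ≫ ·) ((Category.assoc _ _ _).symm.trans (congrArg (· ≫ _) (right_hDesc (g.cub _ _) _)))).symm
    exact ((congrArg (_ ≫ ·) (g.right_mu M _)).trans (Category.comp_id _)).symm
  | X :: L, M => by
    obtain ⟨α, hα⟩ := grayTensorH.exists_assoc X (grayH.E.obj L) (grayH.E.obj M)
    obtain ⟨α', hα'⟩ := g.exists_assoc X (G.E.obj L) (G.E.obj M)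
    have := g.isIso_cn X L
    have h1 := grayH.assoc_mu X L M hα
    have h2 := G.assoc_mu X L M hα'
    obtain ⟨α'', hα''⟩ := grayTensorH.exists_assoc X (G.E.obj L) (G.E.obj M)
    have := grayTensorH.isIso_assocRight X (G.E.obj L) (G.E.obj M)
    have h3 := grayH.assoc_natural (𝟙 X) (grayθ g L) (grayθ g M) hα hα''
    have h4 := grayβ_assoc g hα'' hα'
    have h5 := grayβ_natural g (G.cn X L) (𝟙 (G.E.obj M))
    have h6 := grayβ_natural g (𝟙 X) (G.mu L M)
    have h7 := cn_grayθ g X (L ++ M)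
    have ih := grayθ_mu L M
    have : IsIso (grayH.map₂ (grayH.cn X L) (𝟙 (grayH.E.obj M))) := inferInstanceAs (IsIso (grayH.E.map _))
    rw [← cancel_epi (grayH.map₂ (grayH.cn X L) (𝟙 (grayH.E.obj M))), reassoc_of% h1]
    refine (congrArg (fun k => α ≫ _ ≫ k) h7).trans ?_
    refine (congrArg (α ≫ ·) (grayH.map₂_map₂_assoc _ _ _ _ _)).trans (Eq.trans ?_ (grayH.map₂_map₂_assoc _ _ _ _ _).symm)
    rw [ih, Category.id_comp, cn_grayθ]
    have e1 : hMap₂ (𝟙 X) (hMap₂ (grayθ g L) (grayθ g M) ≫ grayβ g _ _ ≫ G.mu L M) =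
      hMap₂ (𝟙 X) (hMap₂ (grayθ g L) (grayθ g M)) ≫ hMap₂ (𝟙 X) (grayβ g _ _) ≫ hMap₂ (𝟙 X) (G.mu L M) := by
      rw [← hMap₂_comp, ← hMap₂_comp, Category.id_comp, Category.id_comp]
    have e2 : hMap₂ (hMap₂ (𝟙 X) (grayθ g L) ≫ grayβ g _ _ ≫ G.cn X L) (𝟙 (grayH.E.obj M) ≫ grayθ g M) =
      hMap₂ (hMap₂ (𝟙 X) (grayθ g L)) (grayθ g M) ≫ hMap₂ (grayβ g _ _) (𝟙 _) ≫ hMap₂ (G.cn X L) (𝟙 _) := by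
      rw [← hMap₂_comp, ← hMap₂_comp, Category.id_comp, Category.comp_id, Category.comp_id]
    refine (congrArg (fun k => α ≫ k ≫ _) e1).trans (Eq.trans ?_ (congrArg (· ≫ _) e2).symm)
    simp only [Category.assoc]
    refine Eq.trans ?_ (congrArg (fun k => _ ≫ _ ≫ k) ((Category.assoc _ _ _).symm.trans
      ((congrArg (· ≫ _) h5).trans ((Category.assoc _ _ _).trans (congrArg (_ ≫ ·) h2))))).symm
    rw [reassoc_of% h3, reassoc_of% h6, reassoc_of% h4]

lemma paste₂ {V : Type u} [Category.{v} V] {A B C D X Y Z W T T' : V} {c : A ⟶ B} {s : B ⟶ C} {t : C ⟶ D} {a : A ⟶ X}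
    {b : X ⟶ C} {e : X ⟶ Y} {f : Y ⟶ Z} {p : Z ⟶ D} {k : B ⟶ W} {l : A ⟶ T} {m : T ⟶ T'} {n : T' ⟶ W}
    {q : W ⟶ D} {n' : T' ⟶ Z} (h₁ : c ≫ s = a ≫ b) (h₂ : b ≫ t = e ≫ f ≫ p) (h₃ : c ≫ k = l ≫ m ≫ n)
    (h₄ : n ≫ q = n' ≫ p) (h : a ≫ e ≫ f = l ≫ m ≫ n') : c ≫ s ≫ t = c ≫ k ≫ q := by
  rw [reassoc_of% h₁, h₂, reassoc_of% h₃, h₄, reassoc_of% h]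

lemma grayθ_subst : ∀ (LL : List (List TwoCat.{u})) (L) (h : LL.flatten = L), grayH.σ LL L h ≫ grayθ g L =
    grayθ g (LL.map grayH.E.obj) ≫ G.E.map (betweenHom grayH.E G.E (grayθ g) LL) ≫ G.σ LL L h
  | [], _, rfl => g.isTerminal.some.hom_ext _ _
  | L :: LL, _, rfl => by
    have ih := grayθ_subst LL _ rfl
    have h1 := grayH.σ_cons L LL
    have h2 := G.σ_cons L LL
    have h3 := grayθ_mu g L LL.flatten
    have h4 := cn_grayθ g (grayH.E.obj L) (LL.map grayH.E.obj)
    have h5 := G.cn_natural (grayθ g L) (betweenHom grayH.E G.E (grayθ g) LL)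
    have h6 := grayβ_natural g (grayθ g L) (G.E.map (betweenHom grayH.E G.E (grayθ g) LL))
    have h7 := grayβ_natural g (𝟙 (G.E.obj L)) (G.σ LL LL.flatten rfl)
    rw [← cancel_epi (grayH.cn (grayH.E.obj L) (LL.map grayH.E.obj))]
    have h8 := (Category.assoc _ _ _).symm.trans ((congrArg (· ≫ G.σ (L :: LL) (L ++ LL.flatten) rfl) h5.symm).trans
      (((Category.assoc _ _ _).trans (congrArg (_ ≫ ·) h2)).trans (Category.assoc _ _ _).symm))
    refine paste₂ h1 h3 h4 h8 ?_
    have h9 := (Category.assoc _ _ _).symm.trans ((congrArg (· ≫ _) h6.symm).trans ((Category.assoc _ _ _).trans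
      ((congrArg (_ ≫ ·) h7.symm).trans (grayH.map₂_map₂_assoc _ _ _ _ _))))
    refine (grayH.map₂_map₂_assoc _ _ _ _ _).trans (Eq.trans ?_ ((congrArg (_ ≫ ·)
      h9).trans (grayH.map₂_map₂_assoc _ _ _ _ _)).symm)
    rw [ih]
    simp only [Category.id_comp, Category.comp_id]

def grayMIso : MIso grayH G := ⟨grayθ g, isIso_grayθ g, grayθ_natural g, grayθ_unit g, grayθ_subst g⟩

end

end

section

section

variable {V : Type u} [Category.{v} V] {E F : Multitensor V}

lemma isIso_betweenHom {E F : List V ⥤ V} {θ : ∀ L, E.obj L ⟶ F.obj L} (h : ∀ L, IsIso (θ L)) :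
    ∀ LL, IsIso (betweenHom E F θ LL)
  | [] => inferInstanceAs (IsIso (𝟙 []))
  | L :: LL => by
    have := isIso_betweenHom h LL
    have := h L
    exact isIso_consHom _ _

namespace MIso

variable (m : MIso E F)

lemma compHom_eq (X : EGraph.{w} V) (κ : ∀ {a b : X.obj} (p : Chain X.obj a b), F.E.obj (X.homs p) ⟶ X.hom a b) :
    ∀ {a b : X.obj} (P : Chain₂ X.obj a b), compHom E.E X (fun p => m.θ _ ≫ κ p) P =
      betweenHom E.E F.E m.θ (X.homs₂ P) ≫ compHom F.E X κ P
  | _, _, .nil _ => rfl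
  | _, _, .cons _ P => Prod.ext rfl (compHom_eq X κ P)

lemma assoc_iff (X : EGraph.{w} V) (κ : ∀ {a b : X.obj} (p : Chain X.obj a b), F.E.obj (X.homs p) ⟶ X.hom a b)
    {a b : X.obj} (P : Chain₂ X.obj a b) : (F.E.map (compHom F.E X κ P) ≫ κ P.outer =
      F.σ (X.homs₂ P) (X.homs P.flatten) (X.flatten_homs₂ P) ≫ κ P.flatten) ↔
    E.E.map (compHom E.E X (fun p => m.θ _ ≫ κ p) P) ≫ m.θ _ ≫ κ P.outer =
      E.σ (X.homs₂ P) (X.homs P.flatten) (X.flatten_homs₂ P) ≫ m.θ _ ≫ κ P.flatten := by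
  have := m.iso ((X.homs₂ P).map E.E.obj)
  have := isIso_betweenHom m.iso (X.homs₂ P)
  have h1 := m.natural (compHom E.E X (fun p => m.θ _ ≫ κ p) P)
  have h2 := m.subst _ _ (X.flatten_homs₂ P)
  rw [reassoc_of% h1, reassoc_of% h2, compHom_eq, F.E.map_comp, Category.assoc, cancel_epi, cancel_epi]

def ecatFunctor : ECat.{w} F ⥤ ECat.{w} E where
  obj Z := ⟨Z.graph, fun p => m.θ _ ≫ Z.κ p, fun a b => by
    refine (Category.assoc _ _ _).symm.trans ((congrArg (· ≫ _) (m.unit _)).trans (Z.unit a b)),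
    fun P => (m.assoc_iff Z.graph Z.κ P).1 (Z.assoc P)⟩
  map f := ⟨f.map, fun p => by
    have h := m.natural (EGraph.homsMap f.map p)
    rw [reassoc_of% h, f.map_κ, Category.assoc]⟩

lemma exists_ecatIso (m : MIso E F) : Nonempty (IsoOver (ECat.forget.{w} F) (ECat.forget.{w} E)) := by
  have : (ecatFunctor.{w} m).Faithful := ⟨fun h => ECat.Hom.ext (congrArg (fun k : ECat.Hom _ _ => k.map) h :)⟩
  have : (ecatFunctor.{w} m).Full := ⟨fun {Z Z'} f => ⟨⟨f.map, fun p => by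
    have := m.iso (Z.graph.homs p)
    have h := m.natural (EGraph.homsMap f.map p)
    exact (cancel_epi (m.θ _)).1 ((Category.assoc _ _ _).symm.trans ((congrArg (· ≫ _) h.symm).trans
      ((Category.assoc _ _ _).trans ((f.map_κ p).trans (Category.assoc _ _ _)))))⟩, rfl⟩⟩
  refine ⟨IsoOver.ofFF m.ecatFunctor rfl (fun Z => ?_) (ECat.amnestic_forget _)⟩
  have := m.iso
  have e : ∀ {a b} (p : Chain Z.graph.obj a b), m.θ (Z.graph.homs p) ≫ inv (m.θ _) ≫ Z.κ p = Z.κ p := fun p => by simp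
  obtain ⟨X, κ, h1, h2⟩ := Z
  refine ⟨⟨X, fun p => inv (m.θ _) ≫ κ p, fun a b => ?_, fun P => (m.assoc_iff X _ P).2 ?_⟩, ?_⟩
  · refine (congrArg (· ≫ _) (m.unit _).symm).trans ((Category.assoc _ _ _).trans ((congrArg (_ ≫ ·) (e (.single a b))).trans (h1 a b)))
  · simp only [e]
    exact h2 P
  · simp only [ecatFunctor, e]

end MIso

end

end

section

section

variable {J : Type u}

@[reducible] def CatOn.sigma {O M : J → Type u} {s t : ∀ j, M j → O j} (c : ∀ j, CatOn (s j) (t j)) :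
    CatOn (O := Σ j, O j) (M := Σ j, M j) (fun x => ⟨x.1, s _ x.2⟩) (fun x => ⟨x.1, t _ x.2⟩) where
  id a := ⟨a.1, (c a.1).id a.2⟩
  comp f g h := ⟨f.1, (c f.1).comp f.2 ((congrArg Sigma.fst h).symm ▸ g.2) (by
    obtain ⟨j, f⟩ := f
    obtain ⟨k, g⟩ := g
    obtain rfl : j = k := congrArg Sigma.fst h
    exact eq_of_heq (Sigma.mk.inj h).2)⟩
  s_id a := congrArg (Sigma.mk a.1) ((c a.1).s_id a.2)
  t_id a := congrArg (Sigma.mk a.1) ((c a.1).t_id a.2)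
  s_comp f g h := congrArg (Sigma.mk f.1) ((c f.1).s_comp _ _ _)
  t_comp := by
    rintro ⟨j, f⟩ ⟨k, g⟩ h
    obtain rfl : j = k := congrArg Sigma.fst h
    exact congrArg (Sigma.mk j) ((c j).t_comp _ _ _)
  id_comp f h := congrArg (Sigma.mk f.1) ((c f.1).id_comp _ _)
  comp_id f h := congrArg (Sigma.mk f.1) ((c f.1).comp_id _ _)
  assoc := by
    rintro ⟨j, f⟩ ⟨k, g⟩ ⟨l, e⟩ h h' h₁ h₂
    obtain rfl : j = k := congrArg Sigma.fst h
    obtain rfl : j = l := congrArg Sigma.fst h'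
    exact congrArg (Sigma.mk j) ((c j).assoc _ _ _ _ _ _ _)

@[reducible] def Glob2.sigma (A : J → Glob2.{u}) : Glob2.{u} where
  C0 := Σ j, (A j).C0
  C1 := Σ j, (A j).C1
  C2 := Σ j, (A j).C2
  s0 x := ⟨x.1, (A _).s0 x.2⟩
  t0 x := ⟨x.1, (A _).t0 x.2⟩
  s1 x := ⟨x.1, (A _).s1 x.2⟩
  t1 x := ⟨x.1, (A _).t1 x.2⟩
  ss x := congrArg (Sigma.mk x.1) ((A _).ss x.2)
  tt x := congrArg (Sigma.mk x.1) ((A _).tt x.2)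

def Glob2.inj (A : J → Glob2.{u}) (j : J) : A j ⟶ sigma A where
  f0 x := ⟨j, x⟩
  f1 x := ⟨j, x⟩
  f2 x := ⟨j, x⟩
  s0 _ := rfl
  t0 _ := rfl
  s1 _ := rfl
  t1 _ := rfl

def Glob2.sigmaDesc {A : J → Glob2.{u}} {B : Glob2.{u}} (f : ∀ j, A j ⟶ B) : sigma A ⟶ B :=
  ⟨fun x => (f x.1).f0 x.2, fun x => (f x.1).f1 x.2, fun x => (f x.1).f2 x.2, fun x => (f x.1).s0 x.2,
    fun x => (f x.1).t0 x.2, fun x => (f x.1).s1 x.2, fun x => (f x.1).t1 x.2⟩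

lemma Glob2.sigma_hom_ext {A : J → Glob2.{u}} {B : Glob2.{u}} {f g : sigma A ⟶ B}
    (h : ∀ j, inj A j ≫ f = inj A j ≫ g) : f = g :=
  Glob2.Hom.ext (funext fun x => congrArg (fun k => k.f0 x.2) (h x.1))
    (funext fun x => congrArg (fun k => k.f1 x.2) (h x.1)) (funext fun x => congrArg (fun k => k.f2 x.2) (h x.1))

def Glob2.isColimitSigma (A : J → Glob2.{u}) : IsColimit (Cofan.mk (sigma A) (inj A)) :=
  mkCofanColimit _ (fun s => sigmaDesc s.inj) (fun _ _ => rfl) fun _ _ h => sigma_hom_ext h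

instance : HasCoproducts.{u} Glob2.{u} :=
  hasCoproducts_of_colimit_cofans (fun _ => Cofan.mk _ (Glob2.inj _)) fun _ => Glob2.isColimitSigma _

namespace TwoCat

@[reducible] def sigma (A : J → TwoCat.{u}) : TwoCat.{u} where
  toGlob2 := Glob2.sigma fun j => (A j).toGlob2
  cat1 := CatOn.sigma fun j => (A j).cat1
  catV := CatOn.sigma fun j => (A j).catV
  catH := CatOn.sigma fun j => (A j).catH
  catH_id a := congrArg (Sigma.mk a.1) ((A a.1).catH_id a.2)
  s1_hcomp := by
    rintro ⟨j, x⟩ ⟨k, y⟩ h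
    obtain rfl : j = k := congrArg Sigma.fst h
    exact congrArg (Sigma.mk j) ((A j).s1_hcomp _ _ _)
  t1_hcomp := by
    rintro ⟨j, x⟩ ⟨k, y⟩ h h'
    obtain rfl : j = k := congrArg Sigma.fst h
    exact congrArg (Sigma.mk j) ((A j).t1_hcomp _ _ _ _)
  hcomp_id := by
    rintro ⟨j, x⟩ ⟨k, y⟩ h h'
    obtain rfl : j = k := congrArg Sigma.fst h
    exact congrArg (Sigma.mk j) ((A j).hcomp_id _ _ _ _)
  interchange := by
    rintro ⟨j, x⟩ ⟨k, x'⟩ ⟨l, y⟩ ⟨m, y'⟩ hx hy h h₁ h₂ h'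
    obtain rfl : j = k := congrArg Sigma.fst hx
    obtain rfl : l = m := congrArg Sigma.fst hy
    obtain rfl : j = l := congrArg Sigma.fst h
    exact congrArg (Sigma.mk j) ((A j).interchange _ _ _ _ _ _ _ _ _ _)

def inj (A : J → TwoCat.{u}) (j : J) : A j ⟶ sigma A where
  toHom := Glob2.inj (fun j => (A j).toGlob2) j
  map_id _ := rfl
  map_comp _ _ _ _ := rfl
  map_vid _ := rfl
  map_vcomp _ _ _ _ := rfl
  map_hcomp _ _ _ _ := rfl

def sigmaDesc {A : J → TwoCat.{u}} {B : TwoCat.{u}} (f : ∀ j, A j ⟶ B) : sigma A ⟶ B where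
  toHom := Glob2.sigmaDesc fun j => (f j).toHom
  map_id a := (f a.1).map_id a.2
  map_comp := by
    rintro ⟨j, x⟩ ⟨k, y⟩ h h'
    obtain rfl : j = k := congrArg Sigma.fst h
    exact (f j).map_comp _ _ _ _
  map_vid a := (f a.1).map_vid a.2
  map_vcomp := by
    rintro ⟨j, x⟩ ⟨k, y⟩ h h'
    obtain rfl : j = k := congrArg Sigma.fst h
    exact (f j).map_vcomp _ _ _ _
  map_hcomp := by
    rintro ⟨j, x⟩ ⟨k, y⟩ h h'
    obtain rfl : j = k := congrArg Sigma.fst h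
    exact (f j).map_hcomp _ _ _ _

def isColimitSigma (A : J → TwoCat.{u}) : IsColimit (Cofan.mk (sigma A) (inj A)) :=
  mkCofanColimit _ (fun s => sigmaDesc s.inj) (fun _ _ => rfl) fun _ _ h =>
    TwoCat.Hom.ext' (Glob2.sigma_hom_ext fun j => congrArg TwoCat.Hom.toHom (h j))

instance : HasCoproducts.{u} TwoCat.{u} :=
  hasCoproducts_of_colimit_cofans (fun _ => Cofan.mk _ (inj _)) fun _ => isColimitSigma _

lemma preserves_of_sigma {C : Type*} [Category C] {T : TwoCat.{u} ⥤ C}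
    (h : ∀ A : J → TwoCat.{u}, Nonempty (IsColimit (Cofan.mk (T.obj (sigma A)) fun j => T.map (inj A j)))) :
    PreservesColimitsOfShape (Discrete J) T := by
  have : ∀ A : J → TwoCat.{u}, PreservesColimit (Discrete.functor A) T := fun A =>
    preservesColimit_of_preserves_colimit_cocone (isColimitSigma A) ((isColimitMapCoconeCofanMkEquiv T A _).symm (h A).some)
  exact preservesColimitsOfShape_of_discrete T

lemma preserves_forget : PreservesColimitsOfShape (Discrete J) forget.{u} :=
  preserves_of_sigma fun A => ⟨Glob2.isColimitSigma fun j => (A j).toGlob2⟩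

end TwoCat

open TwoCat

variable {X Y C : TwoCat.{u}} {A : J → TwoCat.{u}}

@[reducible] def Cubical.sigmaRight (F : ∀ j, Cubical X (A j) C) : Cubical X (sigma A) C where
  left b := (F b.1).left b.2
  right a := sigmaDesc fun j => (F j).right a
  agree a b := (F b.1).agree a b.2
  γ f g := (F g.1).γ f g.2
  s1_γ f g h := (F g.1).s1_γ f g.2 h
  t1_γ f g h := (F g.1).t1_γ f g.2 h
  invertible f g := (F g.1).invertible f g.2
  γ_id_left a g := (F g.1).γ_id_left a g.2
  γ_id_right f b := (F b.1).γ_id_right f b.2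
  γ_comp_left f f' g := (F g.1).γ_comp_left f f' g.2
  γ_comp_right := by
    rintro f ⟨j, x⟩ ⟨k, y⟩ h
    obtain rfl : j = k := congrArg Sigma.fst h
    exact (F j).γ_comp_right _ _ _ _
  γ_natural_left α g := (F g.1).γ_natural_left α g.2
  γ_natural_right f β := (F β.1).γ_natural_right f β.2

@[reducible] def Cubical.sigmaLeft (F : ∀ j, Cubical (A j) X C) : Cubical (sigma A) X C where
  left b := sigmaDesc fun j => (F j).left b
  right a := (F a.1).right a.2
  agree a b := (F a.1).agree a.2 b
  γ f g := (F f.1).γ f.2 g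
  s1_γ f g h := (F f.1).s1_γ f.2 g h
  t1_γ f g h := (F f.1).t1_γ f.2 g h
  invertible f g := (F f.1).invertible f.2 g
  γ_id_left a g := (F a.1).γ_id_left a.2 g
  γ_id_right f b := (F f.1).γ_id_right f.2 b
  γ_comp_right f g g' := (F f.1).γ_comp_right f.2 g g'
  γ_comp_left := by
    rintro ⟨j, x⟩ ⟨k, y⟩ g h
    obtain rfl : j = k := congrArg Sigma.fst h
    exact (F j).γ_comp_left _ _ _ _
  γ_natural_left α g := (F α.1).γ_natural_left α.2 g
  γ_natural_right f β := (F f.1).γ_natural_right f.2 β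

lemma isColimit_sigmaRight (X : TwoCat.{u}) (A : J → TwoCat.{u}) :
    Nonempty (IsColimit (Cofan.mk (grayH.E.obj [X, sigma A]) fun j => hMap₂ (𝟙 X) (inj A j))) := by
  refine ⟨mkCofanColimit _ (fun s => hDesc (.sigmaRight fun j => (cubH X (A j)).map (s.inj j))) (fun s j => ?_)
    fun s m h => ?_⟩
  · refine cubH_hom_ext (fun b => ?_) (fun a => ?_) fun x y => ?_
    · exact (Category.assoc _ _ _).symm.trans ((congrArg (· ≫ _) (left_hMap₂ (𝟙 X) (inj A j) b)).trans
        (left_hDesc _ _))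
    · exact (Category.assoc _ _ _).symm.trans ((congrArg (· ≫ _) (right_hMap₂ (𝟙 X) (inj A j) a)).trans
        ((Category.assoc _ _ _).trans (congrArg (inj A j ≫ ·) (right_hDesc _ _))))
    · exact (congrArg (hDesc _)² (γ_hMap₂ (𝟙 X) (inj A j) x y)).trans (γ_hDesc _ _ _)
  · refine cubH_hom_ext (fun b => ?_) (fun a => ?_) fun x y => ?_
    · refine Eq.trans ?_ (left_hDesc _ _).symm
      exact (congrArg (· ≫ m) (left_hMap₂ (𝟙 X) (inj A b.1) b.2).symm).trans ((Category.assoc _ _ _).trans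
        (congrArg (_ ≫ ·) (h b.1)))
    · refine Eq.trans ?_ (right_hDesc _ _).symm
      refine TwoCat.Hom.ext' (Glob2.sigma_hom_ext fun j => congrArg TwoCat.Hom.toHom (?_ : inj A j ≫ _ = inj A j ≫ _))
      exact (Category.assoc _ _ _).symm.trans ((congrArg (· ≫ m) (right_hMap₂ (𝟙 X) (inj A j) a).symm).trans
        ((Category.assoc _ _ _).trans (congrArg (_ ≫ ·) (h j))))
    · refine Eq.trans ?_ (γ_hDesc _ _ _).symm
      exact (congrArg m² (γ_hMap₂ (𝟙 X) (inj A y.1) x y.2).symm).trans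
        (congrArg (fun k => k² ((cubH X (A y.1)).γ x y.2)) (h y.1))

lemma isColimit_sigmaLeft (X : TwoCat.{u}) (A : J → TwoCat.{u}) :
    Nonempty (IsColimit (Cofan.mk (grayH.E.obj [sigma A, X]) fun j => hMap₂ (inj A j) (𝟙 X))) := by
  refine ⟨mkCofanColimit _ (fun s => hDesc (.sigmaLeft fun j => (cubH (A j) X).map (s.inj j))) (fun s j => ?_)
    fun s m h => ?_⟩
  · refine cubH_hom_ext (fun b => ?_) (fun a => ?_) fun x y => ?_
    · exact (Category.assoc _ _ _).symm.trans ((congrArg (· ≫ _) (left_hMap₂ (inj A j) (𝟙 X) b)).trans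
        ((Category.assoc _ _ _).trans (congrArg (inj A j ≫ ·) (left_hDesc _ _))))
    · exact (Category.assoc _ _ _).symm.trans ((congrArg (· ≫ _) (right_hMap₂ (inj A j) (𝟙 X) a)).trans
        (right_hDesc _ _))
    · exact (congrArg (hDesc _)² (γ_hMap₂ (inj A j) (𝟙 X) x y)).trans (γ_hDesc _ _ _)
  · refine cubH_hom_ext (fun b => ?_) (fun a => ?_) fun x y => ?_
    · refine Eq.trans ?_ (left_hDesc _ _).symm
      refine TwoCat.Hom.ext' (Glob2.sigma_hom_ext fun j => congrArg TwoCat.Hom.toHom (?_ : inj A j ≫ _ = inj A j ≫ _))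
      exact (Category.assoc _ _ _).symm.trans ((congrArg (· ≫ m) (left_hMap₂ (inj A j) (𝟙 X) b).symm).trans
        ((Category.assoc _ _ _).trans (congrArg (_ ≫ ·) (h j))))
    · refine Eq.trans ?_ (right_hDesc _ _).symm
      exact (congrArg (· ≫ m) (right_hMap₂ (inj A a.1) (𝟙 X) a.2).symm).trans ((Category.assoc _ _ _).trans
        (congrArg (_ ≫ ·) (h a.1)))
    · refine Eq.trans ?_ (γ_hDesc _ _ _).symm
      exact (congrArg m² (γ_hMap₂ (inj A x.1) (𝟙 X) x.2 y).symm).trans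
        (congrArg (fun k => k² ((cubH (A x.1) X).γ x.2 y)) (h x.1))

end

lemma grayH_dist : Dist.{u} grayH.{u}.E := fun L₁ L₂ J => ⟨by
  induction L₁ with
  | nil =>
    have := TwoCat.preserves_of_sigma (T := insertAt [] [grayH.E.obj L₂] ⋙ grayH.E) (isColimit_sigmaLeft (J := J) _)
    refine preservesColimitsOfShape_of_natIso (F := insertAt [] [grayH.E.obj L₂] ⋙ grayH.E)
      (NatIso.ofComponents (fun X => @asIso _ _ _ _ (grayH.cn X L₂) (grayH_isIso_cn X L₂)) fun {X Y} f => ?_)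
    have h := grayH.cn_natural f (𝟙 L₂)
    rw [grayH.E.map_id] at h
    exact h
  | cons X L₁ ih =>
    have := TwoCat.preserves_of_sigma (T := insertAt [X] [] ⋙ grayH.E) (isColimit_sigmaRight (J := J) _)
    refine preservesColimitsOfShape_of_natIso (F := (insertAt L₁ L₂ ⋙ grayH.E) ⋙ insertAt [X] [] ⋙ grayH.E)
      (NatIso.ofComponents (fun Y => @asIso _ _ _ _ (grayH.cn X (L₁ ++ Y :: L₂)) (grayH_isIso_cn X _)) fun {Y Z} f => ?_)
    exact grayH.cn_natural (𝟙 X) (insertHom L₁ f L₂)⟩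

end

section

lemma exists_insertAt_mapM {V : Type u} [Category.{v} V] {W : Type u'} [Category.{v'} W] (F : V ⥤ W) (L₂ : List V) :
    ∀ L₁ : List V, Nonempty (insertAt L₁ L₂ ⋙ mapM F ≅ F ⋙ insertAt (L₁.map F.obj) (L₂.map F.obj))
  | [] => ⟨NatIso.ofComponents (fun X => Iso.refl _) fun {X Y} f => by
    refine Eq.trans ?_ (Category.id_comp _).symm
    exact (Category.comp_id _).trans (congrArg _ (mapMHom_id F L₂))⟩
  | X :: L₁ => by
    obtain ⟨i⟩ := exists_insertAt_mapM F L₂ L₁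
    refine ⟨NatIso.ofComponents (fun Y => (consF _).mapIso (i.app Y)) fun f => Prod.ext ?_ (i.hom.naturality f)⟩
    exact (Category.comp_id _).trans ((F.map_id X).trans (Category.comp_id _).symm)

namespace Transport

variable {V : Type u} [Category.{v} V] {W : Type u'} [Category.{v'} W] {F : V ⥤ W} {U : W ⥤ V} {adj : F ⊣ U}
  {E : Multitensor V} {H : Multitensor W} (T : Transport adj E H)

include T in
lemma dist (hU : ∀ J : Type w, PreservesColimitsOfShape (Discrete J) U) (h : Dist.{w} H.E) : Dist.{w} E.E := by
  refine fun L₁ L₂ J => ⟨?_⟩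
  obtain ⟨i⟩ := exists_insertAt_mapM F L₂ L₁
  have := (h (L₁.map F.obj) (L₂.map F.obj) J).some
  have := hU J
  have : PreservesColimitsOfShape (Discrete J) F := adj.leftAdjoint_preservesColimits.preservesColimitsOfShape
  have j : F ⋙ (insertAt _ _ ⋙ H.E) ⋙ U ≅ insertAt L₁ L₂ ⋙ E.E :=
    Functor.isoWhiskerRight i.symm (H.E ⋙ U) ≪≫ (NatIso.ofComponents _ fun f => T.natural _).symm
  exact preservesColimitsOfShape_of_natIso j

include T in
lemma isFunctorOperad (h : H.IsFunctorOperad) [∀ X, IsIso (adj.unit.app X)] : E.IsFunctorOperad := fun X => by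
  have := h (F.obj X)
  have : IsIso (E.η X ≫ (T.e [X]).hom) := by rw [T.unit]; infer_instance
  exact IsIso.of_isIso_comp_right _ (T.e [X]).hom

section Equivalence

variable [U.Full] [U.Faithful]

lemma isIso_cH (X : EGraph.{w} W) : ∀ {a b : X.obj} (p : Chain X.obj a b), IsIso (cH adj X p)
  | _, _, .nil _ => inferInstanceAs (IsIso (𝟙 []))
  | _, _, .cons _ p => by
    have := isIso_cH X p
    exact isIso_consHom _ _

include T in
lemma cancel_e {X : EGraph.{w} W} {a b : X.obj} (p : Chain X.obj a b) {Z : W} {f g : H.E.obj (X.homs p) ⟶ Z}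
    (h : (T.e _).hom ≫ U.map (H.E.map (cH adj X p) ≫ f) = (T.e _).hom ≫ U.map (H.E.map (cH adj X p) ≫ g)) : f = g := by
  have := isIso_cH (adj := adj) X p
  exact (cancel_epi _).1 (U.map_injective ((cancel_epi (T.e _).hom).1 h))

instance full_ecat_of_full : (T.ecat : ECat.{w} H ⥤ _).Full := ⟨fun {X Y} f => by
  obtain ⟨⟨o, h⟩, hf⟩ := f
  have hh : ∀ a b, ∃ k : X.graph.hom a b ⟶ Y.graph.hom (o a) (o b), U.map k = h a b := fun a b => ⟨_, U.map_preimage _⟩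
  choose k hk using hh
  obtain rfl : (fun a b => U.map (k a b)) = h := funext fun a => funext fun b => hk a b
  let g : X.graph ⟶ Y.graph := EGraph.Hom.mk (X := X.graph) (Y := Y.graph) o k
  exact ⟨⟨g, fun p => T.cancel_e p ((T.map_κE g p).symm.trans ((hf p).trans (T.κE_comp g p)))⟩, rfl⟩⟩

lemma ecat_surjective_of_full (hU : Function.Surjective U.obj) :
    Function.Surjective (T.ecat : ECat.{w} H ⥤ ECat.{w} E).obj := by
  rintro ⟨⟨o, hom⟩, κ, h₁, h₂⟩
  have hZ := fun a b => hU (hom a b)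
  choose Z hZ using hZ
  obtain rfl : _ = hom := funext fun a => funext fun b => hZ a b
  let X : EGraph.{w} W := ⟨o, Z⟩
  have := fun {a b : o} (p : Chain o a b) => isIso_cH (adj := adj) X p
  have hk : ∀ {a b : X.obj} (p : Chain X.obj a b), ∃ k : H.E.obj _ ⟶ X.hom a b,
      (T.e _).hom ≫ U.map (H.E.map _ ≫ k) = κ p :=
    fun p => ⟨inv (H.E.map (cH adj X p)) ≫ U.preimage _, by
      rw [IsIso.hom_inv_id_assoc, U.map_preimage, Iso.hom_inv_id_assoc]⟩
  choose k hkE using @hk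
  obtain rfl : _ = @κ := by
    funext a b p
    exact hkE p
  refine ⟨⟨X, k, fun a b => U.map_injective ?_, fun P => ?_⟩, rfl⟩
  · rw [← T.η_κE k a b]
    exact (h₁ a b).trans (U.map_id _).symm
  · have hr : ∀ {a b : X.obj} (P : Chain₂ X.obj a b), IsIso (T.rP P) := by
      intro a b P
      induction P with
      | nil => exact inferInstanceAs (IsIso (𝟙 []))
      | cons p P ih =>
        have : IsIso (T.r ((gU U X).homs p)) := by unfold r; infer_instance
        have : IsIso (T.r _ ≫ H.E.map (cH adj X p)) := inferInstance
        exact isIso_consHom _ _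
    have := hr P
    have h := (T.compHom_κE k P).symm.trans ((h₂ P).trans (T.σ_κE k P))
    exact (cancel_epi _).1 (U.map_injective ((cancel_epi (T.e _).hom).1 h))

def ecatIsoOfFull (hU : Function.Surjective U.obj) (hU' : Amnestic U) :
    IsoOver (ECat.forget.{w} H ⋙ EGraph.mapFunctor.{w} U) (ECat.forget.{w} E) :=
  IsoOver.ofFF T.ecat rfl (T.ecat_surjective_of_full hU)
    ((ECat.amnestic_forget H).comp (EGraph.amnestic_mapFunctor hU'))

end Equivalence

end Transport

structure OverIso {V : Type u} [Category.{v} V] {W : Type u'} [Category.{v'} W] (K : V ⥤ W) (E : Multitensor V)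
    (F : Multitensor W) where
  ψ : ∀ L : List V, K.obj (E.E.obj L) ⟶ F.E.obj (L.map K.obj)
  iso : ∀ L, IsIso (ψ L)
  natural : ∀ {L M : List V} (f : L ⟶ M), K.map (E.E.map f) ≫ ψ M = ψ L ≫ F.E.map (mapMHom K f)
  unit : ∀ X : V, K.map (E.η X) ≫ ψ [X] = F.η (K.obj X)
  subst : ∀ (LL : List (List V)) (L : List V) (h : LL.flatten = L)
    (h' : (LL.map (List.map K.obj)).flatten = L.map K.obj), K.map (E.σ LL L h) ≫ ψ L =
      ψ (LL.map E.E.obj) ≫ F.E.map (transportHom K E.E F.E ψ LL) ≫ F.σ (LL.map (List.map K.obj)) (L.map K.obj) h'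

namespace OverIso

variable {V : Type u} [Category.{v} V] {W : Type u'} [Category.{v'} W] {K : V ⥤ W} {E E' : Multitensor V}
  {F F' : Multitensor W}

lemma along_transport {ψ : ∀ L : List V, K.obj (E.E.obj L) ⟶ F.E.obj (L.map K.obj)} [∀ L, IsIso (ψ L)] :
    ∀ LL, alongHom K E.E F.E (fun L => inv (ψ L)) LL ≫ transportHom K E.E F.E ψ LL = 𝟙 _
  | [] => rfl
  | L :: LL => Prod.ext (IsIso.inv_hom_id _) (along_transport LL)

def multitensorIsoOver (o : OverIso K E F) : MultitensorIsoOver K E F := have := o.iso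
  { θ L := (asIso (o.ψ L)).symm
    natural {L M} f := (@IsIso.comp_inv_eq _ _ _ _ _ (o.ψ M) (o.iso M) _ _).2 ((((Category.assoc _ _ _).trans (congrArg (inv (o.ψ L) ≫ ·) (o.natural f))).trans
      (IsIso.inv_hom_id_assoc (o.ψ L) _)).symm)
    unit X := (IsIso.comp_inv_eq _).2 (o.unit X).symm
    subst LL L h h' := by
      refine (IsIso.comp_inv_eq (o.ψ L)).2 ?_
      refine Eq.symm (((Category.assoc _ _ _).trans (congrArg (_ ≫ ·) (((Category.assoc _ _ _).trans
        (congrArg (inv (o.ψ _) ≫ ·) (o.subst LL L h h'))).trans (IsIso.inv_hom_id_assoc (o.ψ _) _)))).trans ?_)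
      refine (Category.assoc _ _ _).symm.trans ((congrArg (· ≫ _) ((F.E.map_comp _ _).symm.trans
        (congrArg F.E.map (along_transport LL)))).trans ?_)
      rw [F.E.map_id, Category.id_comp] }

lemma transport_betweenHom (ψ : ∀ L : List V, K.obj (E.E.obj L) ⟶ F.E.obj (L.map K.obj))
    (θ : ∀ L, F.E.obj L ⟶ F'.E.obj L) : ∀ LL, transportHom K E.E F'.E (fun L => ψ L ≫ θ _) LL =
      transportHom K E.E F.E ψ LL ≫ betweenHom F.E F'.E θ _
  | [] => rfl
  | _ :: LL => Prod.ext rfl (transport_betweenHom ψ θ LL)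

def post (o : OverIso K E F) (m : MIso F F') : OverIso K E F' where
  ψ L := o.ψ L ≫ m.θ _
  iso L := @IsIso.comp_isIso _ _ _ _ _ _ _ (o.iso L) (m.iso _)
  natural f := by rw [← Category.assoc, o.natural, Category.assoc, m.natural, Category.assoc]
  unit X := (Category.assoc _ _ _).symm.trans ((congrArg (· ≫ _) (o.unit X)).trans (m.unit _))
  subst LL L h h' := by
    have h1 := m.natural (transportHom K E.E F.E o.ψ LL)
    rw [transport_betweenHom, ← Category.assoc, o.subst LL L h h', F'.E.map_comp]
    simp only [Category.assoc]
    rw [← reassoc_of% h1, m.subst]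

lemma betweenHom_transport (ψ : ∀ L : List V, K.obj (E.E.obj L) ⟶ F.E.obj (L.map K.obj))
    (θ : ∀ L, E'.E.obj L ⟶ E.E.obj L) : ∀ LL, transportHom K E'.E F.E (fun L => K.map (θ L) ≫ ψ L) LL =
      mapMHom K (betweenHom E'.E E.E θ LL) ≫ transportHom K E.E F.E ψ LL
  | [] => rfl
  | _ :: LL => Prod.ext rfl (betweenHom_transport ψ θ LL)

def pre (m : MIso E' E) (o : OverIso K E F) : OverIso K E' F where
  ψ L := K.map (m.θ L) ≫ o.ψ L
  iso L := @IsIso.comp_isIso _ _ _ _ _ _ _ (@Functor.map_isIso _ _ _ _ _ _ K _ (m.iso L)) (o.iso _)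
  natural f := by rw [← Category.assoc, ← K.map_comp, m.natural, K.map_comp, Category.assoc, o.natural, Category.assoc]
  unit X := by rw [← Category.assoc, ← K.map_comp, m.unit, o.unit]
  subst LL L h h' := by
    have h1 := o.natural (betweenHom E'.E E.E m.θ LL)
    rw [betweenHom_transport, ← Category.assoc, ← K.map_comp, m.subst LL L h, K.map_comp, K.map_comp, F.E.map_comp]
    simp only [Category.assoc]
    rw [o.subst LL L h h', reassoc_of% h1]

def ofTransport {U : W ⥤ V} {adj : K ⊣ U} [U.Full] [U.Faithful] (T : Transport adj E F) : OverIso K E F where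
  ψ := T.r
  iso L := by unfold Transport.r; infer_instance
  natural f := by
    have h := adj.counit_naturality (F.E.map (mapMHom K f))
    rw [Transport.r, ← Category.assoc, ← K.map_comp, T.natural, K.map_comp, Category.assoc]
    exact (congrArg (_ ≫ ·) h).trans (Category.assoc _ _ _).symm
  unit X := by
    rw [Transport.r, ← Category.assoc, ← K.map_comp, T.unit, K.map_comp, Category.assoc]
    refine (congrArg (_ ≫ ·) (adj.counit_naturality (F.η (K.obj X)))).trans ?_
    exact adj.left_triangle_components_assoc X _
  subst LL L h h' := by
    rw [Transport.r, ← Category.assoc, ← K.map_comp, T.subst LL L h h', K.map_comp, Category.assoc]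
    exact (congrArg (_ ≫ ·) (adj.counit_naturality _)).trans (Category.assoc _ _ _).symm

end OverIso

def IsoOver.adj {A : Type*} [Category A] {B : Type*} [Category B] {C : Type*} [Category C] {U : A ⥤ C} {U' : B ⥤ C}
    (I : IsoOver U U') : I.functor ⊣ I.inverse :=
  (CategoryTheory.Equivalence.mk I.functor I.inverse (eqToIso I.functor_inverse.symm) (eqToIso I.inverse_functor)).toAdjunction

open MonoidalCategory in
def OfAdjunction.transportAdj {V : Type u} [Category.{v} V] {W : Type u'} [Category.{v'} W] {K : V ⥤ W} {U : W ⥤ V} (adj : K ⊣ U)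
    {D : Type*} [Category D] [MonoidalCategory D] {d : W ⥤ D} {Ψ : D ⥤ W} (adjC : d ⊣ Ψ) :
    Transport adj (Multitensor.ofAdjunction (adj.comp adjC)) (Multitensor.ofAdjunction adjC) :=
  Mate.transport (P := 𝟭 D) (κ := Iso.refl _)
    { ω := Iso.refl _
      counit := fun Y => by
        refine (Category.id_comp _).trans (Eq.symm ?_)
        refine (congrArg (fun k => d.map k ≫ _) ((congrArg (· ≫ _) (K.map_id _)).trans (Category.id_comp _))).trans ?_
        simp
      unit := fun X => by
        refine (Category.comp_id _).trans (Eq.symm ?_)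
        refine (congrArg (fun k => _ ≫ U.map (_ ≫ k)) (Ψ.map_id _)).trans ?_
        simp }

end

section

section

variable {A : Type*} [Category A] {B : Type*} [Category B] {C : Type*} [Category C] {U : A ⥤ C} {U' : B ⥤ C}
  (I : IsoOver U U')

instance : I.functor.IsEquivalence :=
  (CategoryTheory.Equivalence.mk I.functor I.inverse (eqToIso I.functor_inverse.symm) (eqToIso I.inverse_functor)).isEquivalence_functor

instance : I.inverse.IsEquivalence := inferInstanceAs I.symm.functor.IsEquivalence

def IsoOver.ofEq {U U' : A ⥤ C} (h : U = U') : IsoOver U U' := ⟨𝟭 A, 𝟭 A, rfl, rfl, h.symm⟩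

lemma IsoOver.surjective : Function.Surjective I.functor.obj :=
  fun b => ⟨I.inverse.obj b, congrArg (fun k : B ⥤ B => k.obj b) I.inverse_functor⟩

lemma IsoOver.amnestic : Amnestic I.functor := fun a a' _ h _ =>
  (congrArg (fun k : A ⥤ A => k.obj a) I.functor_inverse).symm.trans
    ((congrArg I.inverse.obj h).trans (congrArg (fun k : A ⥤ A => k.obj a') I.functor_inverse))

include I in
lemma IsoOver.hasCoproducts (h : HasCoproducts.{w} B) : HasCoproducts.{w} A := fun J =>
  have := h J
  Adjunction.hasColimitsOfShape_of_equivalence I.functor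

end

abbrev grayK : IsoOver grayE.{u}.unary.forget TwoCat.forget.{u} := have := grayH_isIso_η.{u}
  grayTransport.isoOver

def grayL : Multitensor grayE.{u}.unary.Algebra := Multitensor.ofAdjunction (grayK.adj.comp CData.adj)

def grayLTransport : Transport grayK.{u}.adj grayL grayH := OfAdjunction.transportAdj _ _

lemma grayL_dist : Dist.{u} grayL.{u}.E := grayLTransport.dist (fun _ => inferInstance) grayH_dist

lemma grayE_dist : Dist.{u} grayE.{u}.E := grayTransport.dist (fun _ => TwoCat.preserves_forget) grayH_dist

lemma grayL_isLift : IsLift.{u} grayE.{u} grayL where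
  functorOperad := have : ∀ X, IsIso (grayK.{u}.adj.unit.app X) := inferInstance
    grayLTransport.isFunctorOperad grayH_isIso_η
  distributive := grayL_dist
  iso := by
    have h : grayK.{u}.inverse ⋙ grayE.unary.forget = TwoCat.forget := grayK.symm.comp_forget
    have j := (grayLTransport.{u}.ecatIsoOfFull.{u} grayK.symm.surjective grayK.symm.amnestic).comp
      (EGraph.mapFunctor.{u} grayE.{u}.unary.forget)
    have h' := congrArg (fun k => ECat.forget.{u} grayH ⋙ EGraph.mapFunctor k) h
    exact ⟨j.symm.trans ((IsoOver.ofEq h').trans grayEcatIso)⟩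

instance : HasCoproducts.{u} grayE.{u}.unary.Algebra := grayK.hasCoproducts inferInstance

instance : HasInitial grayE.{u}.unary.Algebra :=
  have := hasFiniteCoproducts_of_hasCoproducts.{u} grayE.{u}.unary.Algebra
  inferInstance

end

section

lemma Gph.IsWalk.unique {G : Gph.{u}} (r : G.V → ℕ) (hr : ∀ e, r (G.t e) = r (G.s e) + 1)
    (hs : Function.Injective G.s) : ∀ {a b : G.V} {l m : List G.E}, G.IsWalk a l b → G.IsWalk a m b → l = m := by
  have hl : ∀ {a b : G.V} {l : List G.E}, G.IsWalk a l b → r b = r a + l.length := by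
    intro a b l
    induction l generalizing a with
    | nil => rintro rfl; rfl
    | cons e l ih => rintro ⟨rfl, h⟩; rw [ih h, hr, List.length_cons]; lia
  intro a b l
  induction l generalizing a with
  | nil => intro m h h'; exact (List.length_eq_zero_iff.1 (by have := hl h; have := hl h'; rw [List.length_nil] at *; lia)).symm
  | cons e l ih =>
    rintro (_ | ⟨e', m⟩) h h'
    · grind
    · obtain rfl := hs (h.1.trans h'.1.symm)
      rw [ih h.2 h'.2]

namespace Glob2

open Pos

def pathGlob : Glob2.{u} where
  C0 := Pos
  C1 := Pos
  C2 := PEmpty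
  s0 := fun a => a
  t0 := succ
  s1 := PEmpty.elim
  t1 := PEmpty.elim
  ss := nofun
  tt := nofun

def grid : Glob2.{u} where
  C0 := Pos
  C1 := Pos × Pos
  C2 := Pos × Pos
  s0 e := e.1
  t0 e := succ e.1
  s1 := fun e => e
  t1 e := (e.1, succ e.2)
  ss _ := rfl
  tt _ := rfl

variable {X : TwoCat.{u}}

def pathMap (x z : X.C1) (h : X.t0 x = X.s0 z) : pathGlob ⟶ X.toGlob2 where
  f0
    | zero => X.s0 x
    | succ zero => X.t0 x
    | succ (succ _) => X.t0 z
  f1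
    | zero => x
    | succ zero => z
    | succ (succ _) => X♭ (X.t0 z)
  f2 := PEmpty.elim
  s0 := by rintro (_ | _ | _); exacts [rfl, h.symm, X.cat1.s_id _]
  t0 := by rintro (_ | _ | _); exacts [rfl, rfl, X.cat1.t_id _]
  s1 := nofun
  t1 := nofun

def gridMap (x y z w : X.C2) (h : X.t1 x = X.s1 y) (h' : X.t1 z = X.s1 w) (h'' : X.t0 (X.s1 x) = X.s0 (X.s1 z)) :
    grid ⟶ X.toGlob2 where
  f0
    | zero => X.s0 (X.s1 x)
    | succ zero => X.t0 (X.s1 x)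
    | succ (succ _) => X.t0 (X.s1 z)
  f1
    | (zero, zero) => X.s1 x
    | (zero, succ zero) => X.t1 x
    | (zero, succ (succ _)) => X.t1 y
    | (succ zero, zero) => X.s1 z
    | (succ zero, succ zero) => X.t1 z
    | (succ zero, succ (succ _)) => X.t1 w
    | (succ (succ _), _) => X♭ (X.t0 (X.s1 z))
  f2
    | (zero, zero) => x
    | (zero, succ zero) => y
    | (zero, succ (succ _)) => X♯ (X.t1 y)
    | (succ zero, zero) => z
    | (succ zero, succ zero) => w
    | (succ zero, succ (succ _)) => X♯ (X.t1 w)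
    | (succ (succ _), _) => X♯ (X♭ (X.t0 (X.s1 z)))
  s0 := by
    rintro ⟨_ | _ | _, _ | _ | _⟩
    exacts [rfl, (X.ss _).symm, (X.ss y).symm.trans (h ▸ (X.ss x).symm), h''.symm, (X.ss z).symm.trans h''.symm,
      (X.ss w).symm.trans (h' ▸ (X.ss z).symm.trans h''.symm), X.cat1.s_id _, X.cat1.s_id _, X.cat1.s_id _]
  t0 := by
    rintro ⟨_ | _ | _, _ | _ | _⟩
    exacts [rfl, (X.tt _).symm, (X.tt y).symm.trans (h ▸ (X.tt x).symm), rfl, (X.tt z).symm,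
      (X.tt w).symm.trans (h' ▸ (X.tt z).symm), X.cat1.t_id _, X.cat1.t_id _, X.cat1.t_id _]
  s1 := by
    rintro ⟨_ | _ | _, _ | _ | _⟩
    exacts [rfl, h.symm, X.catV.s_id _, rfl, h'.symm, X.catV.s_id _, X.catV.s_id _, X.catV.s_id _, X.catV.s_id _]
  t1 := by
    rintro ⟨_ | _ | _, _ | _ | _⟩
    exacts [rfl, rfl, X.catV.t_id _, rfl, rfl, X.catV.t_id _, X.catV.t_id _, X.catV.t_id _, X.catV.t_id _]

lemma path_ext {w w' : pathGlob.{u}.free.C1} (hs : pathGlob.free.s0 w = pathGlob.free.s0 w')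
    (ht : pathGlob.free.t0 w = pathGlob.free.t0 w') : w = w' := by
  obtain ⟨a, b, l, h⟩ := w
  obtain ⟨a', b', m, h'⟩ := w'
  obtain rfl : a = a' := hs
  obtain rfl : b = b' := ht
  exact Walk.ext rfl rfl (h.unique nat (fun _ => rfl) (fun _ _ h => h) h')

lemma grid_ext {w w' : grid.{u}.free.C2} (hs : grid.free.s1 w = grid.free.s1 w')
    (ht : grid.free.t1 w = grid.free.t1 w') : w = w' := by
  refine Walk.ext (congrArg (Walk.src) hs :) (congrArg (Walk.tgt) hs :) ?_
  have h1 : w.edges.map _ = w'.edges.map _ := congrArg (Walk.edges) hs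
  have h2 : w.edges.map _ = w'.edges.map _ := congrArg (Walk.edges) ht
  generalize w.edges = l at h1 h2 ⊢
  generalize w'.edges = m at h1 h2 ⊢
  induction l generalizing m with
  | nil => cases m with
    | nil => rfl
    | cons _ _ => cases h1
  | cons c l ih => cases m with
    | nil => cases h1
    | cons c' m =>
      have e1 := List.cons.inj h1
      have e2 := List.cons.inj h2
      refine congrArg₂ _ ?_ (ih m e1.2 e2.2)
      obtain ⟨a, b, l, h⟩ := c
      obtain ⟨a', b', m, h'⟩ := c'
      obtain rfl : a = a' := e1.1
      obtain rfl : b = b' := e2.1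
      exact Walk.ext rfl rfl (h.unique (G := grid.vert) (fun e => nat e.2) (fun _ => rfl) (fun _ _ h => h) h')

structure Pres1 {A B : TwoCat.{u}} (i : A.toGlob2 ⟶ B.toGlob2) : Prop where
  id : ∀ a, i.f1 (A♭ a) = B♭ (i.f0 a)
  comp : ∀ f g h h', i.f1 (A.cat1.comp f g h) = B.cat1.comp (i.f1 f) (i.f1 g) h'

structure Pres2 {A B : TwoCat.{u}} (i : A.toGlob2 ⟶ B.toGlob2) : Prop where
  vid : ∀ f, i.f2 (A♯ f) = B♯ (i.f1 f)
  vcomp : ∀ x y h h', i.f2 (A.catV.comp x y h) = B.catV.comp (i.f2 x) (i.f2 y) h'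
  hcomp : ∀ x y h h', i.f2 (A.catH.comp x y h) = B.catH.comp (i.f2 x) (i.f2 y) h'

variable {R : TwoCat.{u}}

lemma pres1_path {j : pathGlob.{u}.free.toGlob2 ⟶ R.toGlob2} (hj : IsIso j) : Pres1 j := by
  have h0 : ∀ x, (inv j).f0 _ = x := fun x => congrArg (fun k => k.f0 x) (IsIso.hom_inv_id j)
  have h1 : ∀ x, j.f1 _ = x := fun x => congrArg (fun k => k.f1 x) (IsIso.inv_hom_id j)
  constructor
  · intro a
    rw [← h1 (R♭ _)]
    refine congrArg j.f1 (path_ext ?_ ?_)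
    · rw [(inv j).s0, R.cat1.s_id, h0]; rfl
    · rw [(inv j).t0, R.cat1.t_id, h0]; rfl
  · intro f g h h'
    rw [← h1 (R.cat1.comp _ _ _)]
    refine congrArg j.f1 (path_ext ?_ ?_)
    · rw [(inv j).s0, R.cat1.s_comp, j.s0, h0]; rfl
    · rw [(inv j).t0, R.cat1.t_comp, j.t0, h0]; rfl

lemma pres2_grid {j : grid.{u}.free.toGlob2 ⟶ R.toGlob2} (hj : IsIso j) (hp : Pres1 j) : Pres2 j := by
  have h1 : ∀ x, (inv j).f1 _ = x := fun x => congrArg (fun k => k.f1 x) (IsIso.hom_inv_id j)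
  have h2 : ∀ x, j.f2 _ = x := fun x => congrArg (fun k => k.f2 x) (IsIso.inv_hom_id j)
  constructor
  · intro a
    rw [← h2 (R♯ _)]
    refine congrArg j.f2 (grid_ext ?_ ?_)
    · rw [(inv j).s1, R.catV.s_id, h1, grid.free.catV.s_id]
    · rw [(inv j).t1, R.catV.t_id, h1, grid.free.catV.t_id]
  · intro f g h h'
    rw [← h2 (R.catV.comp _ _ _)]
    refine congrArg j.f2 (grid_ext ?_ ?_)
    · rw [(inv j).s1, R.catV.s_comp, j.s1, h1, grid.free.catV.s_comp]
    · rw [(inv j).t1, R.catV.t_comp, j.t1, h1, grid.free.catV.t_comp]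
  · intro f g h h'
    have k : grid.free.t0 (grid.free.t1 f) = grid.free.s0 (grid.free.t1 g) := by
      rw [← grid.free.tt, ← grid.free.ss, h]
    have k' : R.t0 (R.t1 (j.f2 f)) = R.s0 (R.t1 (j.f2 g)) := by rw [← R.tt, ← R.ss, h']
    rw [← h2 (R.catH.comp _ _ _)]
    refine congrArg j.f2 (grid_ext ?_ ?_)
    · rw [(inv j).s1, R.s1_hcomp, grid.free.s1_hcomp _ _ h, ← h1 (grid.free.cat1.comp _ _ _)]
      exact congrArg _ ((hp.comp _ _ _ (by rw [← j.s1, ← j.s1, h'])).trans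
        (R.cat1.comp_congr (j.s1 _).symm (j.s1 _).symm _ _))
    · rw [(inv j).t1, R.t1_hcomp _ _ _ k', grid.free.t1_hcomp _ _ h k, ← h1 (grid.free.cat1.comp _ _ _)]
      exact congrArg _ ((hp.comp _ _ _ (by rw [← j.t1, ← j.t1, k'])).trans
        (R.cat1.comp_congr (j.t1 _).symm (j.t1 _).symm _ _))

lemma exists_hom_of_closed {S : ∀ X Y : TwoCat.{u}, (X.toGlob2 ⟶ Y.toGlob2) → Prop}
    (hi : ∀ {X Y i}, S X Y i → IsIso i)
    (hS : ∀ {X Y i}, S X Y i → ∀ {D : Glob2.{u}} (f : D ⟶ X.toGlob2), ∃ (R : TwoCat.{u})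
      (j : D.free.toGlob2 ⟶ R.toGlob2) (g : R ⟶ Y), S D.free R j ∧ j ≫ g.toHom = (lift f).toHom ≫ i)
    {X Y : TwoCat.{u}} {i : X.toGlob2 ⟶ Y.toGlob2} (h : S X Y i) : ∃ k : X ⟶ Y, k.toHom = i := by
  have p1 : ∀ {X Y : TwoCat.{u}} {i : _ ⟶ Y.toGlob2}, S X Y i → Pres1 i := by
    intro X Y i h
    constructor
    · intro a
      obtain ⟨R, j, g, hj, e⟩ := hS h (pathMap _ (X♭ a) (by rw [X.cat1.s_id, X.cat1.t_id]))
      have hp := pres1_path (hi hj)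
      have e1 := congrArg (fun k => k.f1 (pathGlob.free♭ zero)) e
      have e0 := congrArg (fun k => k.f0 zero) e
      have ea := X.cat1.s_id a
      refine (congrArg (fun b => i.f1 _) ea).symm.trans (e1.symm.trans ?_)
      refine (congrArg g¹ (hp.id _)).trans ((g.map_id _).trans (congrArg _ ?_))
      exact e0.trans (congrArg i.f0 ea)
    · intro x z hx hy
      obtain ⟨R, j, g, hj, e⟩ := hS h _
      have hp := pres1_path (hi hj)
      have hu := fun a => congrArg (fun k => k.f1 a) (unit_lift (pathMap x z hx))
      have e1 := fun w => congrArg (fun k => k.f1 w) e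
      have k1 : pathGlob.free.t0 (pathGlob.unit.f1 zero) = pathGlob.free.s0 (pathGlob.unit.f1 _) := rfl
      have k2 := fun {A : TwoCat.{u}} (l : _ ⟶ A.toGlob2) =>
        (l.t0 _).trans ((congrArg l.f0 k1).trans (l.s0 _).symm)
      refine (congrArg i.f1 ((X.cat1.comp_congr (hu zero).symm (hu _).symm _ _).trans
        ((lift _).map_comp _ _ k1 (k2 (lift _).toHom)).symm)).trans ((e1 _).symm.trans ?_)
      refine (congrArg g¹ (hp.comp _ _ _ (k2 _))).trans ((g.map_comp _ _ _ (k2 (j ≫ g.toHom))).trans ?_)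
      exact Y.cat1.comp_congr ((e1 _).trans (congrArg i.f1 (hu zero))) ((e1 _).trans (congrArg i.f1 (hu _))) _ _
  have p2 : ∀ {R : TwoCat.{u}} {j : grid.{u}.free.toGlob2 ⟶ R.toGlob2}, S _ R j → Pres2 j :=
    fun hj => pres2_grid (hi hj) (p1 hj)
  refine ⟨⟨i, (p1 h).id, (p1 h).comp, fun f => ?_, fun x y hx hy => ?_, fun x z hx hy => ?_⟩, rfl⟩
  · have hv := (X.catV.t_id f).trans (X.catV.s_id f).symm
    let z := X♯ (X♭ (X.t0 f))
    have hz : X.t1 z = X.s1 z := (X.catV.t_id _).trans (X.catV.s_id _).symm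
    have hh : X.t0 (X.s1 (X♯ f)) = X.s0 (X.s1 z) := by rw [X.catV.s_id, X.catV.s_id, X.cat1.s_id]
    obtain ⟨R, j, g, hj, e⟩ := hS h _
    have hu := congrArg (fun k => k.f1 (zero, zero)) (unit_lift (gridMap _ _ _ _ hv hz hh))
    have hu' := hu.trans (X.catV.s_id f)
    have e1 := congrArg (fun k => k.f1 (grid.unit.f1 (zero, zero))) e
    have e2 := congrArg (fun k => k.f2 (grid.free♯ (grid.unit.f1 (zero, zero)))) e
    refine (congrArg i.f2 ((congrArg _ hu'.symm).trans ((lift _).map_vid _).symm)).trans (e2.symm.trans ?_)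
    exact (congrArg g² ((p2 hj).vid _)).trans ((g.map_vid _).trans
      (congrArg _ (e1.trans (congrArg i.f1 hu'))))
  · let z := X♯ (X♭ (X.t0 (X.s1 x)))
    have hz : X.t1 z = X.s1 z := (X.catV.t_id _).trans (X.catV.s_id _).symm
    have hh : X.t0 (X.s1 x) = X.s0 (X.s1 z) := by rw [X.catV.s_id, X.cat1.s_id]
    obtain ⟨R, j, g, hj, e⟩ := hS h (gridMap _ _ _ _ hx hz hh)
    have hu := fun a => congrArg (fun k => k.f2 a) (unit_lift (gridMap _ _ _ _ hx hz hh))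
    have e2 := fun w => congrArg (fun k => k.f2 w) e
    have k1 := (grid.unit.t1 (zero, zero)).trans (grid.unit.s1 _).symm
    have k2 := fun {A : TwoCat.{u}} (l : _ ⟶ A.toGlob2) =>
      (l.t1 _).trans ((congrArg l.f1 k1).trans (l.s1 _).symm)
    refine (congrArg i.f2 ((X.catV.comp_congr (hu _).symm (hu _).symm _ _).trans
      ((lift _).map_vcomp _ _ k1 (k2 (lift _).toHom)).symm)).trans ((e2 _).symm.trans ?_)
    refine (congrArg g² ((p2 hj).vcomp _ _ _ (k2 _))).trans ((g.map_vcomp _ _ _ (k2 (j ≫ g.toHom))).trans ?_)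
    exact Y.catV.comp_congr ((e2 _).trans (congrArg i.f2 (hu _))) ((e2 _).trans (congrArg i.f2 (hu _))) _ _
  · have hi' : ∀ x, X.t1 x = X.s1 _ := fun x => (X.catV.s_id _).symm
    obtain ⟨R, j, g, hj, e⟩ := hS h (gridMap _ _ _ _ _ _ hx)
    have hu := fun a => congrArg (fun k => k.f2 a) (unit_lift (gridMap _ _ _ _ (hi' x) (hi' z) hx))
    have e2 := fun w => congrArg (fun k => k.f2 w) e
    have k1 : grid.free.t0 (grid.free.s1 (grid.unit.f2 (zero, zero))) =
        grid.free.s0 (grid.free.s1 (grid.unit.f2 (succ zero, zero))) := rfl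
    have k2 := fun {A : TwoCat.{u}} (l : _ ⟶ A.toGlob2) =>
      ((congrArg A.t0 (l.s1 _)).trans (l.t0 _)).trans ((congrArg l.f0 k1).trans
        ((congrArg A.s0 (l.s1 _)).trans (l.s0 _)).symm)
    refine (congrArg i.f2 ((X.catH.comp_congr (hu (zero, zero)).symm (hu (succ zero, zero)).symm _ (k2 (lift _).toHom)).trans
      ((lift (gridMap _ _ _ _ (hi' x) (hi' z) hx)).map_hcomp _ _ k1 (k2 (lift _).toHom)).symm)).trans ((e2 _).symm.trans ?_)
    refine (congrArg g² ((p2 hj).hcomp _ _ _ (k2 _))).trans ((g.map_hcomp _ _ _ (k2 (j ≫ g.toHom))).trans ?_)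
    exact Y.catH.comp_congr ((e2 _).trans (congrArg i.f2 (hu _))) ((e2 _).trans (congrArg i.f2 (hu _))) _ _

end Glob2

end

section

namespace EGraph

variable {V : Type u} [Category.{v} V] {W : Type u'} [Category.{v'} W] {U : V ⥤ W}

lemma exists_of_map_eq {G Y : EGraph.{w} V} (h : (mapFunctor U).obj Y = (mapFunctor U).obj G) :
    ∃ X : G.obj → G.obj → V, Y = ⟨G.obj, X⟩ ∧ ∀ a b, U.obj (G.hom a b) = U.obj (X a b) := by
  obtain ⟨o, X⟩ := Y
  obtain ⟨o', Z⟩ := G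
  obtain rfl : o = o' := congrArg EGraph.obj h
  have h' := eq_of_heq (EGraph.mk.inj h).2
  exact ⟨X, rfl, fun a b => (congrFun (congrFun h' a) b).symm⟩

lemma exists_of_map_eqToHom {G G' Y Y' : EGraph.{w} V} (g : G ⟶ G') (φ : Y ⟶ Y') {X X'} (hY : Y = ⟨G.obj, X⟩)
    (hY' : Y' = ⟨G'.obj, X'⟩) (h : (mapFunctor U).obj Y = (mapFunctor U).obj G)
    (h' : (mapFunctor U).obj G' = (mapFunctor U).obj Y')
    (e : (mapFunctor U).map φ = eqToHom h ≫ (mapFunctor U).map g ≫ eqToHom h')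
    (hh : ∀ a b, U.obj (G.hom a b) = U.obj (X a b)) (hh' : ∀ a b, U.obj (G'.hom a b) = U.obj (X' a b)) (a b) :
    ∃ k : X a b ⟶ X' (g.obj a) (g.obj b),
      eqToHom (hh a b) ≫ U.map k = U.map (g.hom a b) ≫ eqToHom (hh' _ _) := by
  subst hY hY'
  obtain ⟨i, hi⟩ := EGraph.eq_eqToHom h
  obtain ⟨i', hi'⟩ := EGraph.eq_eqToHom h'
  have e' := e.trans (congrArg₂ (fun p q => p ≫ (mapFunctor U).map g ≫ q) hi hi')
  obtain ⟨o, k⟩ := φ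
  obtain rfl : o = g.obj := congrArg EGraph.Hom.obj e'
  refine ⟨k a b, ?_⟩
  have e'' : U.map (k a b) = eqToHom (i a b) ≫ U.map (g.hom a b) ≫ eqToHom (i' _ _) := EGraph.Hom.eq_mk e' a b
  rw [e'', eqToHom_trans_assoc, eqToHom_refl, Category.id_comp]

end EGraph

lemma eq_of_comp_faithful {A B C : Type*} [Category A] [Category B] [Category C] {P Q : A ⥤ B} {G : B ⥤ C}
    [G.Faithful] (h : P ⋙ G = Q ⋙ G) (hobj : ∀ a, P.obj a = Q.obj a) : P = Q :=
  CategoryTheory.Functor.ext hobj fun c d g => G.map_injective (by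
    rw [Functor.map_comp, Functor.map_comp, eqToHom_map, eqToHom_map]
    exact Functor.congr_hom h g)

open Pos in
lemma exists_ecatIso_of_glob {V : Type u'} [Category.{v'} V] [HasCoproducts.{u} V] [HasInitial V] {U : V ⥤ Glob2.{u}}
    (I : IsoOver U TwoCat.forget) {F F' : Multitensor V} (hF : Dist.{u} F.E) (hη : F.IsFunctorOperad)
    (J : IsoOver (ECat.forget.{u} F ⋙ EGraph.mapFunctor U) (ECat.forget.{u} F' ⋙ EGraph.mapFunctor U)) :
    Nonempty (IsoOver (ECat.forget.{u} F) (ECat.forget.{u} F')) := by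
  have hK : I.functor.IsEquivalence := inferInstance
  obtain ⟨K, K', h1, h2, rfl⟩ := I
  obtain ⟨Q, Q', q1, q2, hq⟩ := J
  change K.IsEquivalence at hK
  choose X hX hh using fun c => EGraph.exists_of_map_eq (Functor.congr_obj hq c)
  have hm := fun {c d : ECat.{u} F} (g : c ⟶ d) => EGraph.exists_of_map_eqToHom (U := K ⋙ TwoCat.forget) g.map (Q.map g).map
    (hX c) (hX d) (Functor.congr_obj hq c) (Functor.congr_obj hq d).symm (Functor.congr_hom hq g) (hh c) (hh d)
  let S (A B : TwoCat.{u}) (i : A.toGlob2 ⟶ B.toGlob2) : Prop :=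
    ∃ (c : ECat.{u} F) (a b : c.graph.obj) (v : A ⟶ K.obj (c.graph.hom a b)) (h : B = K.obj (X c a b)),
      IsIso v ∧ i = (TwoCat.forget.map v ≫ eqToHom (hh c a b)) ≫ eqToHom (congrArg TwoCat.forget.obj h.symm)
  have hi : ∀ {A B i}, S A B i → IsIso i := by
    rintro A B i ⟨c, a, b, v, rfl, hv, rfl⟩
    have h1 : IsIso (TwoCat.forget.map v) := inferInstance
    have h2 : IsIso (eqToHom (hh c a b)) := inferInstance
    exact @IsIso.comp_isIso _ _ _ _ _ _ _ (@IsIso.comp_isIso _ _ _ _ _ _ _ h1 h2) (IsIso.id (TwoCat.forget.obj (K.obj (X c a b))))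
  have hS : ∀ {A B i}, S A B i → ∀ {D : Glob2.{u}} (f : D ⟶ A.toGlob2), ∃ (R : TwoCat.{u})
      (j : D.free.toGlob2 ⟶ R.toGlob2) (g : R ⟶ B), S D.free R j ∧ j ≫ g.toHom = (Glob2.lift f).toHom ≫ i := by
    rintro A B i ⟨c, a, b, v, rfl, hv, rfl⟩ D f
    let Z := K'.obj D.free
    let w : D.free ⟶ K.obj Z := eqToHom (Functor.congr_obj h2 D.free).symm
    have hw : IsIso w := inferInstanceAs (IsIso (eqToHom _))
    let C := freeCat (gph.{u} [Z]).hom hF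
    let β : Z ⟶ C.graph.hom zero (succ zero) := (ECat.freeUnit (gph.{u} [Z]) hF).hom zero (succ zero)
    have hβ : IsIso β := by
      have := hη Z
      have := isIso_Γι.{u} hF [Z]
      exact @IsIso.comp_isIso _ _ _ _ _ _ _ (hη Z) (isIso_Γι.{u} hF [Z])
    let f' : Z ⟶ c.graph.hom a b := K.preimage (inv w ≫ Glob2.lift f ≫ v)
    let φ : gph.{u} [Z] ⟶ c.graph := EGraph.Hom.mk (X := gph [Z]) (fun i => match i with
      | zero => a
      | succ _ => b) (fun i k => match i, k with
      | zero, zero => initial.to _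
      | zero, succ zero => f'
      | zero, succ (succ _) => initial.to _
      | succ _, zero => initial.to _
      | succ _, succ _ => initial.to _)
    obtain ⟨g, hg⟩ := ECat.exists_free_desc (gph.{u} [Z]) hF (Z := c) φ
    have hg' := hm g
    obtain ⟨⟨o, h⟩, hκ⟩ := g
    obtain rfl : o = φ.obj := congrArg EGraph.Hom.obj hg
    have hβg : β ≫ h zero (succ zero) = f' := EGraph.Hom.eq_mk hg zero (succ zero)
    obtain ⟨g', e⟩ := hg' zero (succ zero)
    refine ⟨K.obj (X C zero (succ zero)), TwoCat.forget.map (w ≫ K.map β) ≫ eqToHom (hh C _ _), K.map g',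
      ⟨C, zero, succ zero, w ≫ K.map β, rfl, inferInstance, (Category.comp_id _).symm⟩, ?_⟩
    have hf : w ≫ K.map β ≫ K.map (h zero (succ zero)) = Glob2.lift f ≫ v := by
      rw [← K.map_comp, hβg, K.map_preimage, IsIso.hom_inv_id_assoc]
    refine (Category.assoc _ _ _).trans ((congrArg (_ ≫ ·) e).trans ?_)
    have hf' := congrArg (fun k => TwoCat.forget.map k ≫ eqToHom (hh c a b)) hf
    refine Eq.trans ?_ (hf'.trans ?_)
    · exact (Category.assoc _ _ _).symm
    · refine (Category.assoc (Glob2.lift f).toHom v.toHom (eqToHom (hh c a b))).trans ?_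
      exact congrArg ((Glob2.lift f).toHom ≫ ·) (Category.comp_id _).symm
  have hobj : ∀ c, (Q.obj c).graph = c.graph := fun c => (hX c).trans (congrArg (EGraph.mk c.graph.obj)
    (funext fun a => funext fun b => by
      obtain ⟨k, hk⟩ := Glob2.exists_hom_of_closed hi hS
        (⟨c, a, b, 𝟙 _, rfl, inferInstance, rfl⟩ : S (K.obj (c.graph.hom a b)) (K.obj (X c a b)) _)
      have hk' : TwoCat.forget.map k = eqToHom (hh c a b) := hk.trans ((Category.comp_id _).trans (Category.id_comp _))
      have e := congrArg K'.obj (TwoCat.amnestic_forget _ _ k (hh c a b) hk')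
      exact (Functor.congr_obj h1 (X c a b)).symm.trans (e.symm.trans (Functor.congr_obj h1 _))))
  exact ⟨⟨Q, Q', q1, q2, eq_of_comp_faithful (G := EGraph.mapFunctor.{u} (K ⋙ TwoCat.forget.{u})) hq hobj⟩⟩

end

section

lemma Walk.cases {G : Gph.{u}} (p : Walk G) : (∃ a, p = Walk.nil a) ∨
    ∃ (e : G.E) (q : Walk G) (h : G.t e = q.src), p = (Walk.single e).append q h := by
  induction p using Walk.induction with
  | hnil a => exact Or.inl ⟨a, rfl⟩
  | hcons e q h => exact Or.inr ⟨e, q, h, rfl⟩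

lemma CatOn.id_comp' {O M : Type u} {s t : M → O} (c : CatOn s t) {a : O} {f : M} (h : t (c.id a) = s f) :
    c.comp (c.id a) f h = f := by
  obtain rfl : a = s f := (c.t_id a).symm.trans h
  exact c.id_comp f h

namespace GData

variable {D K D' K' : GData.{u}}

structure Lifts (F : D ⟶ K) (g : D.G.E → K.G.E) : Prop where
  f1 : ∀ e, F.f1 e = Walk.single (g e)
  bij : Function.Bijective D.φ0
  inj : Function.Injective K.φ0
  id : ∀ a v, F.H¹ a = K.A♭ v → a = D.A♭ (D.A.s0 a)
  cons : ∀ a e c h, F.H¹ a = K.A.cat1.comp (K.φ1 e) c h →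
    ∃ e' c' h', g e' = e ∧ F.H¹ c' = c ∧ D.A.cat1.comp (D.φ1 e') c' h' = a
  uniq : ∀ e e' c c' h h', g e = g e' → D.A.cat1.comp (D.φ1 e) c h = D.A.cat1.comp (D.φ1 e') c' h' →
    e = e' ∧ c = c'

namespace Lifts

lemma box {F : D ⟶ K} {F' : D' ⟶ K'} {g : D.G.E → K.G.E} {g' : D'.G.E → K'.G.E} (l : Lifts F g) (l' : Lifts F' g') :
    Lifts (boxHom F F') (Sum.map (Prod.map g F'.f0) (Prod.map F.f0 g')) where
  f1 := by
    rintro (e | e)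
    · exact (congrArg (inl _) (l.f1 e.1)).trans (Walk.ext rfl rfl rfl)
    · exact (congrArg (inr _) (l'.f1 e.2)).trans (Walk.ext rfl rfl rfl)
  bij := l.bij.prodMap l'.bij
  inj := l.inj.prodMap l'.inj
  id a v h := Prod.ext (l.id _ _ (congrArg Prod.fst h)) (l'.id _ _ (congrArg Prod.snd h))
  cons := by
    rintro ⟨a, b⟩ (⟨e, w⟩ | ⟨v, e⟩) ⟨c, d⟩ h hab
    · obtain ⟨e', c', h', rfl, rfl, rfl⟩ := l.cons a e c (congrArg Prod.fst h) (congrArg Prod.fst hab)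
      have hd := congrArg Prod.snd h
      have hb : F'.H¹ b = d := (congrArg Prod.snd hab).trans (K'.A.cat1.id_comp' (congrArg Prod.snd h))
      obtain ⟨w', hw⟩ := l'.bij.2 (D'.A.s0 b)
      have hw' : F'.f0 w' = w := l'.inj ((F'.h0 w').trans ((congrArg F'.H⁰ hw).trans
        ((F'.H.toHom.s0 b).symm.trans ((congrArg K'.A.s0 hb).trans (hd.symm.trans (K'.A.cat1.t_id _))))))
      exact ⟨Sum.inl (e', w'), (c', b), Prod.ext h' ((D'.A.cat1.t_id _).trans hw),
        congrArg (fun w => Sum.inl (g e', w)) hw', Prod.ext rfl hb, Prod.ext rfl (D'.A.cat1.id_comp' _)⟩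
    · obtain ⟨e', c', h', rfl, rfl, rfl⟩ := l'.cons b e d (congrArg Prod.snd h) (congrArg Prod.snd hab)
      have hd := congrArg Prod.fst h
      have hb : F.H¹ a = c := (congrArg Prod.fst hab).trans (K.A.cat1.id_comp' (congrArg Prod.fst h))
      obtain ⟨w', hw⟩ := l.bij.2 (D.A.s0 a)
      have hw' : F.f0 w' = v := l.inj ((F.h0 w').trans ((congrArg F.H⁰ hw).trans
        ((F.H.toHom.s0 a).symm.trans ((congrArg K.A.s0 hb).trans (hd.symm.trans (K.A.cat1.t_id _))))))
      exact ⟨Sum.inr (w', e'), (a, c'), Prod.ext ((D.A.cat1.t_id _).trans hw) h',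
        congrArg (fun w => Sum.inr (w, g' e')) hw', Prod.ext hb rfl, Prod.ext (D.A.cat1.id_comp' _) rfl⟩
  uniq := by
    rintro (⟨e, w⟩ | ⟨v, e⟩) (⟨e', w'⟩ | ⟨v', e'⟩) ⟨c, d⟩ ⟨c', d'⟩ h h' hg hc
    · obtain ⟨rfl, rfl⟩ := l.uniq e e' c c' (congrArg Prod.fst h) (congrArg Prod.fst h')
        (congrArg Prod.fst (Sum.inl_injective hg)) (congrArg Prod.fst hc)
      obtain rfl : d = d' := (D'.A.cat1.id_comp' (congrArg Prod.snd h)).symm.trans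
        ((congrArg Prod.snd hc).trans (D'.A.cat1.id_comp' (congrArg Prod.snd h')))
      have hw : w = w' := l'.bij.1 ((D'.A.cat1.t_id _).symm.trans ((congrArg Prod.snd h).trans
        ((congrArg Prod.snd h').symm.trans (D'.A.cat1.t_id _))))
      exact ⟨congrArg (fun w => Sum.inl (e, w)) hw, rfl⟩
    · exact absurd hg (by simp)
    · exact absurd hg (by simp)
    · obtain ⟨rfl, rfl⟩ := l'.uniq e e' d d' (congrArg Prod.snd h) (congrArg Prod.snd h')
        (congrArg Prod.snd (Sum.inr_injective hg)) (congrArg Prod.snd hc)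
      obtain rfl : c = c' := (D.A.cat1.id_comp' (congrArg Prod.fst h)).symm.trans
        ((congrArg Prod.fst hc).trans (D.A.cat1.id_comp' (congrArg Prod.fst h')))
      have hw : v = v' := l.bij.1 ((D.A.cat1.t_id _).symm.trans ((congrArg Prod.fst h).trans
        ((congrArg Prod.fst h').symm.trans (D.A.cat1.t_id _))))
      exact ⟨congrArg (fun w => Sum.inr (w, e)) hw, rfl⟩

lemma one : Lifts (𝟙 GData.one.{u}) PEmpty.elim where
  f1 := nofun
  bij := Function.bijective_id
  inj := Function.injective_id
  id _ _ _ := rfl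
  cons _ := nofun
  uniq := nofun

lemma eval_gen {X : Glob2.{u}} (p : Walk X.trunc) : (gen.obj X).eval p = p :=
  ((Walk.catOn X.trunc).eval_unique _ _ _ _ (fun p => p) (fun _ => rfl) (fun _ _ _ _ => rfl) (fun _ => rfl)
    (fun _ => rfl) p).symm

lemma freeMap_f1 {X Y : Glob2.{u}} (f : X ⟶ Y) (p : Walk X.trunc) :
    (Glob2.freeMap f)¹ p = p.map (K := Y.trunc) f.f0 f.f1 f.s0 f.t0 := by
  have h : (GData.gen.obj Y).eval ((GData.gen.map f).walk p) = (Glob2.freeMap f)¹ ((GData.gen.obj X).eval p) :=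
    GData.Hom.eval_walk (GData.gen.map f) p
  refine (congrArg (Glob2.freeMap f)¹ (eval_gen p)).symm.trans (h.symm.trans ((eval_gen _).trans (Walk.ext rfl rfl ?_)))
  exact List.flatMap_pure_eq_map _ _

lemma gen {X Y : Glob2.{u}} (f : X ⟶ Y) : Lifts (gen.map f) f.f1 where
  f1 _ := rfl
  bij := Function.bijective_id
  inj := Function.injective_id
  id a v h := by
    obtain ⟨b, rfl⟩ | ⟨e, q, hq, rfl⟩ := Walk.cases (G := X.trunc) a
    · rfl
    · exact absurd ((congrArg Walk.edges (freeMap_f1 f _)).symm.trans (congrArg (Walk.edges (G := Y.trunc)) h)) nofun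
  cons a e c h ha := by
    have ha' := (freeMap_f1 f a).symm.trans ha
    obtain ⟨b, rfl⟩ | ⟨e', q, hq, rfl⟩ := Walk.cases (G := X.trunc) a
    · exact absurd (congrArg (Walk.edges (G := Y.trunc)) ha') nofun
    · have he := List.cons.inj (congrArg (Walk.edges (G := Y.trunc)) ha')
      refine ⟨e', q, hq, he.1, (freeMap_f1 f q).trans (Walk.ext ?_ (congrArg (Walk.tgt (G := Y.trunc)) ha' :) he.2), rfl⟩
      exact (congrArg f.f0 hq).symm.trans ((f.t0 e').symm.trans ((congrArg Y.t0 he.1).trans h))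
  uniq e e' c c' h h' _ hc := by
    have he := List.cons.inj (congrArg (Walk.edges (G := X.trunc)) hc)
    exact ⟨he.1, Walk.ext (h.symm.trans ((congrArg X.t0 he.1).trans h')) (congrArg (Walk.tgt (G := X.trunc)) hc :) he.2⟩

variable {F : D ⟶ K} {g : D.G.E → K.G.E} (l : Lifts F g)

include l

lemma edges_walk (p : Walk D.G) : (F.walk p).edges = p.edges.map g := by
  change p.edges.flatMap (fun e => (F.f1 e).edges) = _
  rw [← List.flatMap_pure_eq_map]
  exact congrArg (List.flatMap · p.edges) (funext fun e => congrArg Walk.edges (l.f1 e))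

lemma walk_injective {p p' : Walk D.G} (h : F.walk p = F.walk p') (h' : D.eval p = D.eval p') : p = p' := by
  have he := (l.edges_walk p).symm.trans ((congrArg Walk.edges h).trans (l.edges_walk p'))
  have hs : p.src = p'.src := l.bij.1 ((D.A.cat1.s_eval _ _ _ _ p).symm.trans
    ((congrArg D.A.s0 h').trans (D.A.cat1.s_eval _ _ _ _ p')))
  have ht : p.tgt = p'.tgt := l.bij.1 ((D.A.cat1.t_eval _ _ _ _ p).symm.trans
    ((congrArg D.A.t0 h').trans (D.A.cat1.t_eval _ _ _ _ p')))
  refine Walk.ext hs ht ?_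
  clear h hs ht
  induction p using Walk.induction generalizing p' with
  | hnil a => exact (List.map_eq_nil_iff.1 he.symm).symm
  | hcons e q hq ih =>
    obtain ⟨b, rfl⟩ | ⟨e', q', hq', rfl⟩ := p'.cases
    · exact absurd he nofun
    · have he' := List.cons.inj he
      have k : D.A.t0 (D.φ1 e) = D.A.s0 (D.eval q) :=
        (D.ht e).trans ((congrArg D.φ0 hq).trans (D.A.cat1.s_eval _ _ _ _ q).symm)
      have k' : D.A.t0 (D.φ1 e') = D.A.s0 (D.eval q') :=
        (D.ht e').trans ((congrArg D.φ0 hq').trans (D.A.cat1.s_eval _ _ _ _ q').symm)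
      obtain ⟨rfl, hc⟩ := l.uniq e e' _ _ k k' he'.1 ((D.A.cat1.eval_cons _ _ _ _ e q hq k).symm.trans
        (h'.trans (D.A.cat1.eval_cons _ _ _ _ e' q' hq' k')))
      exact congrArg (e :: ·) (ih hc he'.2)

lemma exists_walk (q : Walk K.G) (a : D.A.C1) (h : F.H¹ a = K.eval q) : ∃ p, F.walk p = q ∧ D.eval p = a := by
  induction q using Walk.induction generalizing a with
  | hnil v =>
    have ha := l.id a _ h
    obtain ⟨b, hb⟩ := l.bij.2 (D.A.s0 a)
    have hv : F.f0 b = v := l.inj ((F.h0 b).trans ((congrArg F.H⁰ hb).trans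
      ((F.H.toHom.s0 a).symm.trans ((congrArg K.A.s0 h).trans (K.A.cat1.s_id _)))))
    exact ⟨Walk.nil b, congrArg Walk.nil hv, (congrArg D.A♭ hb).trans ha.symm⟩
  | hcons e q hq ih =>
    have k : K.A.t0 (K.φ1 e) = K.A.s0 (K.eval q) :=
      (K.ht e).trans ((congrArg K.φ0 hq).trans (K.A.cat1.s_eval _ _ _ _ q).symm)
    obtain ⟨e', c, hc, rfl, hc', rfl⟩ := l.cons a e _ k (h.trans (K.A.cat1.eval_cons _ _ _ _ e q hq k))
    obtain ⟨p, rfl, rfl⟩ := ih c hc'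
    have hp : D.G.t e' = p.src := l.bij.1 ((D.ht e').symm.trans (hc.trans (D.A.cat1.s_eval _ _ _ _ p)))
    refine ⟨(Walk.single e').append p hp, Walk.ext ?_ rfl ?_, D.A.cat1.eval_cons _ _ _ _ e' p hp hc⟩
    · have hs := congrArg Walk.src (l.f1 e')
      exact (F.src e').symm.trans hs
    · rw [l.edges_walk]
      exact congrArg (g e' :: ·) (l.edges_walk p).symm

end Lifts

end GData

end

section

lemma Glob2.isPullback {P X Y Z : Glob2.{u}} {a : P ⟶ X} {b : P ⟶ Y} {c : X ⟶ Z} {d : Y ⟶ Z} (w : a ≫ c = b ≫ d)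
    (h0 : ∀ x y, c.f0 x = d.f0 y → ∃! p, a.f0 p = x ∧ b.f0 p = y)
    (h1 : ∀ x y, c.f1 x = d.f1 y → ∃! p, a.f1 p = x ∧ b.f1 p = y)
    (h2 : ∀ x y, c.f2 x = d.f2 y → ∃! p, a.f2 p = x ∧ b.f2 p = y) : IsPullback a b c d := by
  refine ⟨⟨w⟩, ⟨PullbackCone.isLimitAux' _ fun s => ?_⟩⟩
  have e0 : ∀ x, c.f0 (s.fst.f0 x) = d.f0 (s.snd.f0 x) := congrFun (congrArg Glob2.Hom.f0 s.condition)
  have e1 : ∀ x, c.f1 (s.fst.f1 x) = d.f1 (s.snd.f1 x) := congrFun (congrArg Glob2.Hom.f1 s.condition)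
  have e2 : ∀ x, c.f2 (s.fst.f2 x) = d.f2 (s.snd.f2 x) := congrFun (congrArg Glob2.Hom.f2 s.condition)
  choose l0 m0 u0 using fun x => h0 _ _ (e0 x)
  choose l1 m1 u1 using fun x => h1 _ _ (e1 x)
  choose l2 m2 u2 using fun x => h2 _ _ (e2 x)
  refine ⟨⟨l0, l1, l2, fun x => u0 _ _ ⟨?_, ?_⟩, fun x => u0 _ _ ⟨?_, ?_⟩, fun x => u1 _ _ ⟨?_, ?_⟩,
    fun x => u1 _ _ ⟨?_, ?_⟩⟩, Glob2.Hom.ext (funext fun x => (m0 x).1) (funext fun x => (m1 x).1)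
    (funext fun x => (m2 x).1), Glob2.Hom.ext (funext fun x => (m0 x).2) (funext fun x => (m1 x).2)
    (funext fun x => (m2 x).2), fun {m} ha hb => ?_⟩
  · exact (a.s0 _).symm.trans ((congrArg X.s0 (m1 x).1).trans (s.fst.s0 x))
  · exact (b.s0 _).symm.trans ((congrArg Y.s0 (m1 x).2).trans (s.snd.s0 x))
  · exact (a.t0 _).symm.trans ((congrArg X.t0 (m1 x).1).trans (s.fst.t0 x))
  · exact (b.t0 _).symm.trans ((congrArg Y.t0 (m1 x).2).trans (s.snd.t0 x))
  · exact (a.s1 _).symm.trans ((congrArg X.s1 (m2 x).1).trans (s.fst.s1 x))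
  · exact (b.s1 _).symm.trans ((congrArg Y.s1 (m2 x).2).trans (s.snd.s1 x))
  · exact (a.t1 _).symm.trans ((congrArg X.t1 (m2 x).1).trans (s.fst.t1 x))
  · exact (b.t1 _).symm.trans ((congrArg Y.t1 (m2 x).2).trans (s.snd.t1 x))
  · exact Glob2.Hom.ext
      (funext fun x => u0 x _ ⟨congrFun (congrArg Glob2.Hom.f0 ha) x, congrFun (congrArg Glob2.Hom.f0 hb) x⟩)
      (funext fun x => u1 x _ ⟨congrFun (congrArg Glob2.Hom.f1 ha) x, congrFun (congrArg Glob2.Hom.f1 hb) x⟩)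
      (funext fun x => u2 x _ ⟨congrFun (congrArg Glob2.Hom.f2 ha) x, congrFun (congrArg Glob2.Hom.f2 hb) x⟩)

namespace GData

lemma proj_natural {D K : GData.{u}} (F : D ⟶ K) : D.proj ≫ F.H.toHom = cells.map F ≫ K.proj :=
  Glob2.Hom.ext (funext fun v => (F.h0 v).symm) (funext fun p => (F.eval_walk p).symm) rfl

lemma Lifts.isPullback {D K : GData.{u}} {F : D ⟶ K} {g : D.G.E → K.G.E} (l : Lifts F g) :
    IsPullback D.proj (cells.map F) F.H.toHom K.proj := by
  refine Glob2.isPullback (proj_natural F) (fun x y h => ?_) (fun x y h => ?_) fun x y h => ?_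
  · obtain ⟨v, rfl⟩ := l.bij.2 x
    exact ⟨v, ⟨rfl, l.inj ((F.h0 v).trans h)⟩, fun w hw => l.bij.1 hw.1⟩
  · obtain ⟨p, rfl, rfl⟩ := l.exists_walk y x h
    exact ⟨p, ⟨rfl, rfl⟩, fun q hq => l.walk_injective hq.2 hq.1⟩
  · obtain ⟨p, hp, hp'⟩ := l.exists_walk y.src (D.A.s1 x)
      ((F.H.toHom.s1 x).symm.trans ((congrArg K.A.s1 h).trans y.hs))
    obtain ⟨q, hq, hq'⟩ := l.exists_walk y.tgt (D.A.t1 x)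
      ((F.H.toHom.t1 x).symm.trans ((congrArg K.A.t1 h).trans y.ht))
    have hs : p.src = q.src := l.bij.1 ((D.A.cat1.s_eval _ _ _ _ p).symm.trans
      ((congrArg D.A.s0 hp').trans ((D.A.ss x).trans
        ((congrArg D.A.s0 hq').symm.trans (D.A.cat1.s_eval _ _ _ _ q)))))
    have ht : p.tgt = q.tgt := l.bij.1 ((D.A.cat1.t_eval _ _ _ _ p).symm.trans
      ((congrArg D.A.t0 hp').trans ((D.A.tt x).trans
        ((congrArg D.A.t0 hq').symm.trans (D.A.cat1.t_eval _ _ _ _ q)))))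
    refine ⟨⟨p, q, x, hs, ht, hp'.symm, hq'.symm⟩, ⟨rfl, Cell.ext hp hq h⟩, fun z hz => ?_⟩
    obtain ⟨rfl, rfl⟩ := hz
    exact Cell.ext (l.walk_injective hp.symm (z.hs.symm.trans hp'.symm))
      (l.walk_injective hq.symm (z.ht.symm.trans hq'.symm)) rfl

open OfAdjunction MonoidalCategory

lemma exists_lifts : ∀ {L M : List Glob2.{u}} (f : L ⟶ M), ∃ g, Lifts (TMap gen f) g
  | [], [], _ => ⟨_, Lifts.one⟩
  | [], _ :: _, f => PEmpty.elim f
  | _ :: _, [], f => PEmpty.elim f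
  | _ :: _, _ :: _, f => ⟨_, (Lifts.gen f.1).box (exists_lifts f.2).choose_spec⟩

def tensorIso : ∀ L : List Glob2.{u}, (T gen L).A ≅ T TwoCat.freeFunctor L
  | [] => Iso.refl _
  | X :: L => whiskerLeftIso X.free (tensorIso L)

lemma tensorIso_natural : ∀ {L M : List Glob2.{u}} (f : L ⟶ M),
    (TMap gen f).H ≫ (tensorIso M).hom = (tensorIso L).hom ≫ TMap TwoCat.freeFunctor f
  | [], [], _ => rfl
  | [], _ :: _, f => PEmpty.elim f
  | _ :: _, [], f => PEmpty.elim f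
  | _ :: _, _ :: _, f => congrArg (TwoCat.prodMap (Glob2.freeMap f.1)) (tensorIso_natural f.2)

lemma mu_tensorIso : ∀ L M : List Glob2.{u}, (mu gen L M).H ≫ (tensorIso (L ++ M)).hom =
    TwoCat.prodMap (tensorIso L).hom (tensorIso M).hom ≫ mu TwoCat.freeFunctor L M
  | [], _ => rfl
  | X :: L, M => congrArg (fun h => TwoCat.assocHom X.free (T gen L).A (T gen M).A ≫ TwoCat.prodMap (𝟙 X.free) h)
    (mu_tensorIso L M)

def grayφ (L : List Glob2.{u}) : grayE.E.obj L ⟶ prodFree.E.obj L :=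
  (T gen L).proj ≫ TwoCat.forget.map (tensorIso L).hom

lemma flat_tensorIso : ∀ LL : List (List Glob2.{u}),
    (TMap gen (betweenHom grayE.E prodFree.E grayφ LL)).H ≫ (tensorIso (LL.map prodFree.E.obj)).hom ≫
      flat TwoCat.freeAdj LL = (flat adj LL).H ≫ (tensorIso LL.flatten).hom
  | [] => rfl
  | L :: LL => by
    have h : Glob2.freeMap (grayφ L) ≫ eps TwoCat.freeAdj L = (eps adj L).H ≫ (tensorIso L).hom :=
      (Glob2.freeMap_lift (grayφ L) _).trans (Glob2.lift_comp (T gen L).proj (tensorIso L).hom).symm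
    have k := congrArg₂ TwoCat.prodMap h (flat_tensorIso LL)
    exact (congrArg (· ≫ mu TwoCat.freeFunctor L LL.flatten) k).trans
      (congrArg (TwoCat.prodMap (eps adj L).H (flat adj LL).H ≫ ·) (mu_tensorIso L LL.flatten).symm)

end GData

open GData OfAdjunction

def grayCartesian : CartesianHom grayE.{u} prodFree where
  φ := grayφ
  cartesian {L M} f := (exists_lifts f).choose_spec.isPullback.paste_horiz
    (@IsPullback.of_horiz_isIso _ _ _ _ _ _ _ _ _ _ (TwoCat.forget.mapIso (tensorIso L)).isIso_hom
      (TwoCat.forget.mapIso (tensorIso M)).isIso_hom ⟨congrArg TwoCat.Hom.toHom (tensorIso_natural f).symm⟩)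
  unit X := (congrArg (adj.unit.app X ≫ ·) (proj_natural ((boxRight (gen.obj X)).inv)).symm).trans
    (congrArg (· ≫ X.free.prodOne.toHom) (transposeInv_proj (𝟙 (gen.obj X))))
  subst LL _ h := by
    subst h
    have e : (flat adj LL ≫ tc gen rfl) = flat adj LL := Category.comp_id _
    refine Eq.trans ?_ (congrArg (cells.map · ≫ grayφ LL.flatten) e).symm
    have h := congrArg (fun k => (T gen (LL.map grayE.E.obj)).proj ≫ TwoCat.Hom.toHom k) (flat_tensorIso LL)
    exact (congrArg (· ≫ ((tensorIso (LL.map prodFree.E.obj)).hom ≫ flat TwoCat.freeAdj LL).toHom)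
      (proj_natural (TMap gen (betweenHom grayE.E prodFree.E grayφ LL))).symm).trans
      (h.trans (congrArg (· ≫ (tensorIso LL.flatten).hom.toHom) (proj_natural (flat adj LL))))

end

section

lemma IsLift.exists_multitensorIsoOver {F : Multitensor grayE.{u}.unary.Algebra} (h : IsLift.{u} grayE.{u} F)
    {G : Multitensor TwoCat.{u}} (g : GrayTensor G) : Nonempty (MultitensorIsoOver grayK.{u}.functor F G) := by
  obtain ⟨i⟩ := h.iso
  obtain ⟨j⟩ := grayL_isLift.{u}.iso
  obtain ⟨k⟩ := exists_ecatIso_of_glob grayK.{u} h.distributive h.functorOperad (i.trans j.symm)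
  obtain ⟨m⟩ := exists_mIso h.distributive grayL_dist k.symm
  exact ⟨((OverIso.pre m (OverIso.ofTransport grayLTransport)).post (grayMIso g)).multitensorIsoOver⟩

lemma GrayTensor.exists_isoOver {G : Multitensor TwoCat.{u}} (g : GrayTensor G) :
    Nonempty (IsoOver (ECat.forget.{u} G ⋙ EGraph.mapFunctor.{u} TwoCat.forget.{u}) (ECat.forget.{u} grayE)) := by
  obtain ⟨i⟩ := (grayMIso g).exists_ecatIso
  exact ⟨(i.comp _).trans grayEcatIso⟩

end

end GrayLift

theorem mainTheorem3 :
    Nonempty (GrayLift.CartesianHom GrayLift.grayE.{u} GrayLift.prodFree.{u}) ∧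
    ∃ K : GrayLift.IsoOver GrayLift.grayE.{u}.unary.forget GrayLift.TwoCat.forget.{u},
      (∃ G : GrayLift.Multitensor GrayLift.TwoCat.{u}, Nonempty (GrayLift.GrayTensor G)) ∧
      (∃ E', GrayLift.IsLift.{u} GrayLift.grayE.{u} E') ∧
      ∀ G : GrayLift.Multitensor GrayLift.TwoCat.{u}, Nonempty (GrayLift.GrayTensor G) →
        (∃ A : CategoryTheory.Monad (GrayLift.EGraph.{u} GrayLift.Glob2.{u}),
          Nonempty (GrayLift.IsoOver A.forget (CategoryTheory.Functor.comp
            (GrayLift.ECat.forget.{u} G)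
            (GrayLift.EGraph.mapFunctor.{u} GrayLift.TwoCat.forget.{u})))) ∧
        (∀ A : CategoryTheory.Monad (GrayLift.EGraph.{u} GrayLift.Glob2.{u}),
          Nonempty (GrayLift.IsoOver A.forget (CategoryTheory.Functor.comp
            (GrayLift.ECat.forget.{u} G)
            (GrayLift.EGraph.mapFunctor.{u} GrayLift.TwoCat.forget.{u}))) →
          Nonempty (GrayLift.GammaPresentation GrayLift.grayE.{u} A)) ∧
        ∀ E', GrayLift.IsLift.{u} GrayLift.grayE.{u} E' →
          Nonempty (GrayLift.MultitensorIsoOver K.functor E' G) := by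
  refine ⟨⟨GrayLift.grayCartesian⟩, GrayLift.grayK, ⟨_, ⟨GrayLift.grayTensorH⟩⟩, ⟨_, GrayLift.grayL_isLift⟩, ?_⟩
  rintro G ⟨g⟩
  obtain ⟨i⟩ := g.exists_isoOver
  exact ⟨⟨_, ⟨(GrayLift.ECat.isoAlgebra GrayLift.grayE_dist.{u}).trans i.symm⟩⟩,
    fun A ⟨j⟩ => GrayLift.gammaPresentation GrayLift.grayE_dist.{u} A (j.trans i),
    fun E' h => h.exists_multitensorIsoOver g⟩
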